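/- **Proposition 2.2 (Estimate on life span).** Let $z_0\in\mathbb R$, $h>0$, $z_1=z_0+h$, $J=(z_0,z_1)$, $\Omega=\mathbb R^2\times J$. For a measurable $f$ on $\Omega$ put $\|f\|_{\infty,1}=\operatorname{ess\,sup}_{x\in\mathbb R^2}\int_J|f(x,z)|\,dz$, let $L^\infty(L^1)$ be the space of those $f$ with $\|f\|_{\infty,1}<\infty$, and let $\overline f(x)=\frac1h\int_J f(x,z)\,dz$. Let $L^\infty_\sigma(L^1)$ be the space of horizontal fields $v=(v_1,v_2)\in L^\infty(L^1)$ (real or complex) with $\operatorname{div}_H\overline v=0$ in the sense of distributions on $\mathbb R^2$, and $BUC_\sigma(L^1)=BUC(\mathbb R^2;L^1(J))\cap L^\infty_\sigma(L^1)$, where $BUC$ stands for bounded and uniformly continuous. Let $S(t)=e^{t\Delta_H}\otimes e^{t\Delta_N}$ be the hydrostatic Stokes semigroup, where $e^{t\Delta_H}$ is the heat semigroup on $\mathbb R^2$ and $e^{t\Delta_N}$ is the heat semigroup on $J$ with Neumann boundary conditions, and let $\mathbb P f=f+\nabla_H(-\Delta_H)^{-1}\operatorname{div}_H\overline f$ be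 the hydrostatic Helmholtz projection. A mild solution of the primitive equations on a time interval with end point $T$, with initial value $a$, is a field $v$ satisfying $$v(t)=S(t)a-\int_0^tS(t-s)\,\mathbb P\,\nabla\cdot\big(u(s)\otimes v(s)\big)\,ds,\qquad u=(v,w),\quad w(x,z)=\int_z^{z_1}\operatorname{div}_Hv(x,\zeta)\,d\zeta,$$ and such that $t^{1/2}\|\nabla v(t)\|_{\infty,1}$ is bounded and tends to $0$ as $t\downarrow0$. Here, for a matrix field $F\in L^\infty(L^1)$, $S(t)\mathbb P\nabla\cdot F$ is understood by moving the derivatives onto the kernel, where $e^{t\Delta_H}\partial_i\partial_j\partial_k(-\Delta_H)^{-1}$ has the kernel $\int_t^\infty\partial_i\partial_j\partial_kG_s\,ds$ and $G_s$ is the heat kernel of $\mathbb R^2$. For $\mu\in[0,1/2)$ let $$[a]_\mu=\sup_{0<t<1}t^\mu\|\nabla S(t)a\|_{\infty,1},\qquad |||a|||=[a]_\mu+\|a\|_{\infty,1}.$$ Then there is a constant $c_*>0$, depending only on $\mu$ and the fixed height $h$ of the layer, such that the following holds. (a) For every $a\in BUC_\sigma(L^1)$ with $[a]_\mu<\infty$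 there are $T>0$ with $$\frac1T\le\max\big(c_*\,|||a|||,\,1\big)^{2/(1/2-\mu)}$$ and a mild solution $v\in C([0,T];BUC_\sigma(L^1))$ on $(0,T]$ with $v(0)=a$. It is unique: every mild solution in $C([0,T'];BUC_\sigma(L^1))$ with initial value $a$, $T'>0$, coincides with $v$ on $[0,\min(T,T')]$. (b) For every $a\in L^\infty_\sigma(L^1)$ with $[a]_\mu<\infty$ there are $T>0$ with the same bound for $1/T$ and a mild solution $v\in L^\infty((0,T);L^\infty_\sigma(L^1))$ on $(0,T)$. It is unique: every mild solution in $L^\infty((0,T');L^\infty_\sigma(L^1))$ with initial value $a$, $T'>0$, coincides with $v$ on $(0,\min(T,T'))$. -/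

import Mathlib

noncomputable section

namespace PrimEq

open MeasureTheory Set Filter Topology
open scoped ENNReal NNReal

/-- The horizontal plane `ℝ²`, with its Euclidean norm. -/
abbrev Plane : Type := EuclideanSpace ℝ (Fin 2)

/-- The values `(v₁, v₂)` of a horizontal velocity field (real, or complex). -/
abbrev Vel (𝕜 : Type*) [RCLike 𝕜] : Type _ := EuclideanSpace 𝕜 (Fin 2)

/-- The values `(∂₁v, ∂₂v, ∂_z v)` of a gradient, with the Euclidean (Frobenius) norm. -/
abbrev Grad (𝕜 : Type*) [RCLike 𝕜] : Type _ := PiLp 2 (fun _ : Fin 3 => Vel 𝕜)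

/-- The layer `Ω = ℝ² × J`, `J = (z₀, z₁)`. Functions on `Ω` are represented by functions on
`ℝ² × ℝ`, of which only the values on `Ω` matter. -/
def layer (z₀ z₁ : ℝ) : Set (Plane × ℝ) := univ ×ˢ Ioo z₀ z₁

/-! ### Function spaces -/

/-- `‖f‖_{∞,1} = ess sup_{x ∈ ℝ²} ∫_J |f(x, z)| dz`, with values in `[0, ∞]`. -/
def normInfOne {E : Type*} [NormedAddCommGroup E] (z₀ z₁ : ℝ) (f : Plane × ℝ → E) : ℝ≥0∞ :=
  essSup (fun x : Plane => ∫⁻ z in Ioo z₀ z₁, ‖f (x, z)‖ₑ) volume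

/-- `f ∈ L^∞(ℝ²; L¹(J))`. -/
def MemLinf {E : Type*} [NormedAddCommGroup E] (z₀ z₁ : ℝ) (f : Plane × ℝ → E) : Prop :=
  AEStronglyMeasurable f (volume.restrict (layer z₀ z₁)) ∧ normInfOne z₀ z₁ f < ∞

/-- The vertical average `(z₁ - z₀)⁻¹ ∫_J f(x, z) dz`. -/
def vertAvg {E : Type*} [NormedAddCommGroup E] [NormedSpace ℝ E] (z₀ z₁ : ℝ)
    (f : Plane × ℝ → E) (x : Plane) : E :=
  (z₁ - z₀)⁻¹ • ∫ z in Ioo z₀ z₁, f (x, z)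

/-- The partial derivative `∂ⱼ` of a scalar function on the plane. -/
def pd (j : Fin 2) (φ : Plane → ℝ) (x : Plane) : ℝ :=
  fderiv ℝ φ x (EuclideanSpace.single j 1)

variable {𝕜 : Type*} [RCLike 𝕜]

/-- `L^∞_σ(L¹)`: the fields `v ∈ L^∞(L¹)` whose vertical average is divergence free in the sense of
distributions on `ℝ²`. -/
def MemLinfSigma (z₀ z₁ : ℝ) (v : Plane × ℝ → Vel 𝕜) : Prop :=
  MemLinf z₀ z₁ v ∧
    ∀ φ : Plane → ℝ, ContDiff ℝ (⊤ : ℕ∞) φ → HasCompactSupport φ →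
      ∫ x : Plane, ∑ j : Fin 2, pd j φ x • (vertAvg z₀ z₁ v x) j = 0

/-- `v ∈ BUC(ℝ²; L¹(J))`: up to a null set, `x ↦ v(x, ·)` is a bounded uniformly continuous map
from the plane to `L¹(J)`. -/
def MemBUC (z₀ z₁ : ℝ) (v : Plane × ℝ → Vel 𝕜) : Prop :=
  MemLinf z₀ z₁ v ∧
    ∃ U : BoundedContinuousFunction Plane (Lp (Vel 𝕜) 1 (volume.restrict (Ioo z₀ z₁))),
      UniformContinuous U ∧
        ∀ᵐ x : Plane, (fun z => v (x, z)) =ᵐ[volume.restrict (Ioo z₀ z₁)] U x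

/-- `BUC_σ(L¹) = BUC(ℝ²; L¹(J)) ∩ L^∞_σ(L¹)`. -/
def MemBUCSigma (z₀ z₁ : ℝ) (v : Plane × ℝ → Vel 𝕜) : Prop :=
  MemBUC z₀ z₁ v ∧ MemLinfSigma z₀ z₁ v

/-- The three coordinate directions of `ℝ² × ℝ`. -/
def dir : Fin 3 → Plane × ℝ :=
  ![(EuclideanSpace.single 0 1, 0), (EuclideanSpace.single 1 1, 0), (0, 1)]

/-- `g = (∂₁f, ∂₂f, ∂_z f)` weakly on `Ω`. -/
def IsWeakGrad (z₀ z₁ : ℝ) (f : Plane × ℝ → Vel 𝕜) (g : Plane × ℝ → Grad 𝕜) : Prop :=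
  LocallyIntegrableOn f (layer z₀ z₁) ∧ LocallyIntegrableOn g (layer z₀ z₁) ∧
    ∀ φ : Plane × ℝ → ℝ, ContDiff ℝ (⊤ : ℕ∞) φ → HasCompactSupport φ →
      tsupport φ ⊆ layer z₀ z₁ → ∀ i : Fin 3,
        ∫ p in layer z₀ z₁, fderiv ℝ φ p (dir i) • f p = -∫ p in layer z₀ z₁, φ p • g p i

/-- `‖∇f‖_{∞,1}`, which is `∞` when `f` has no weak gradient. (Weak gradients are unique almost
everywhere, so the infimum is over a single value.) -/
def gradNorm (z₀ z₁ : ℝ) (f : Plane × ℝ → Vel 𝕜) : ℝ≥0∞ :=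
  ⨅ (g : Plane × ℝ → Grad 𝕜) (_ : IsWeakGrad z₀ z₁ f g), normInfOne z₀ z₁ g

/-! ### The hydrostatic Stokes semigroup -/

/-- The heat kernel `G_t` of `ℝ²`. -/
def heatKernel (t : ℝ) (x : Plane) : ℝ :=
  (4 * Real.pi * t)⁻¹ * Real.exp (-(‖x‖ ^ 2) / (4 * t))

/-- The heat kernel of `ℝ`. -/
def heatKernelOne (t z : ℝ) : ℝ :=
  (Real.sqrt (4 * Real.pi * t))⁻¹ * Real.exp (-(z ^ 2) / (4 * t))

/-- The kernel of `e^{tΔ_N}`, the heat semigroup on `J = (z₀, z₁)` with Neumann conditions at both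
ends: even reflection at `z₀`, then periodic extension with period `2 (z₁ - z₀)`. -/
def neumannKernel (z₀ z₁ t z ζ : ℝ) : ℝ :=
  ∑' k : ℤ, (heatKernelOne t (z - ζ - 2 * k * (z₁ - z₀)) +
    heatKernelOne t (z + ζ - 2 * z₀ - 2 * k * (z₁ - z₀)))

/-- The hydrostatic Stokes semigroup `S(t) = e^{tΔ_H} ⊗ e^{tΔ_N}`, for `t > 0`. -/
def stokes (z₀ z₁ t : ℝ) (f : Plane × ℝ → Vel 𝕜) (p : Plane × ℝ) : Vel 𝕜 :=
  ∫ q in layer z₀ z₁, (heatKernel t (p.1 - q.1) * neumannKernel z₀ z₁ t p.2 q.2) • f q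

/-- The kernel of `e^{tΔ_H} ∂ᵢ∂ⱼ∂ₖ (-Δ_H)⁻¹` on `ℝ²`, that is `∫_t^∞ ∂ᵢ∂ⱼ∂ₖ G_s ds`. -/
def rieszKernel (i j k : Fin 2) (t : ℝ) (x : Plane) : ℝ :=
  ∫ s in Ioi t, pd i (pd j (pd k (heatKernel s))) x

/-- `S(t) ∇·F`, where `∇·F = ∂₁F₁ + ∂₂F₂ + ∂_z F₃`, for a field `F` that is merely in `L^∞(L¹)`:
the derivatives are moved, by duality, onto the kernel of `S(t)`. -/
def stokesDiv (z₀ z₁ t : ℝ) (F : Fin 2 → Plane × ℝ → Vel 𝕜) (F₃ : Plane × ℝ → Vel 𝕜)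
    (p : Plane × ℝ) : Vel 𝕜 :=
  ∫ q in layer z₀ z₁,
    ((∑ j : Fin 2, (pd j (heatKernel t) (p.1 - q.1) * neumannKernel z₀ z₁ t p.2 q.2) • F j q) -
      (heatKernel t (p.1 - q.1) * deriv (fun ζ => neumannKernel z₀ z₁ t p.2 ζ) q.2) • F₃ q)

/-- `S(t) ℙ ∇·F`, where `ℙ f = f + ∇_H (-Δ_H)⁻¹ div_H f̄` is the hydrostatic Helmholtz projection.
The second part of `ℙ` contributes the field, independent of `z`, with the components
`∑_{j,k} e^{tΔ_H} ∂ᵢ∂ⱼ∂ₖ (-Δ_H)⁻¹ (F_{jk})‾`; the vertical flux `F₃` does not enter it. -/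
def stokesProjDiv (z₀ z₁ t : ℝ) (F : Fin 2 → Plane × ℝ → Vel 𝕜) (F₃ : Plane × ℝ → Vel 𝕜)
    (p : Plane × ℝ) : Vel 𝕜 :=
  stokesDiv z₀ z₁ t F F₃ p +
    WithLp.toLp 2 (fun i : Fin 2 => ∫ y : Plane,
      ∑ j : Fin 2, ∑ k : Fin 2, rieszKernel i j k t (p.1 - y) • (vertAvg z₀ z₁ (F j) y) k)

/-- `[a]_μ = sup_{0<t<1} t^μ ‖∇S(t)a‖_{∞,1}`. -/
def seminormMu (z₀ z₁ μ : ℝ) (a : Plane × ℝ → Vel 𝕜) : ℝ≥0∞ :=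
  ⨆ t ∈ Ioo (0 : ℝ) 1, ENNReal.ofReal (t ^ μ) * gradNorm z₀ z₁ (stokes z₀ z₁ t a)

/-- `|||a||| = [a]_μ + ‖a‖_{∞,1}`. -/
def tripleNorm (z₀ z₁ μ : ℝ) (a : Plane × ℝ → Vel 𝕜) : ℝ≥0∞ :=
  seminormMu z₀ z₁ μ a + normInfOne z₀ z₁ a

/-! ### Mild solutions -/

/-- The vertical velocity `w(x, z) = ∫_z^{z₁} div_H v(x, ζ) dζ`, from the gradient of `v`. -/
def vertVel (z₁ : ℝ) (Dv : Plane × ℝ → Grad 𝕜) (p : Plane × ℝ) : 𝕜 :=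
  ∫ ζ in p.2..z₁, (Dv (p.1, ζ) 0 0 + Dv (p.1, ζ) 1 1)

/-- `S(τ) ℙ ∇·(u ⊗ v)` with `u = (v, w)`. -/
def nonlin (z₀ z₁ τ : ℝ) (v : Plane × ℝ → Vel 𝕜) (Dv : Plane × ℝ → Grad 𝕜) :
    Plane × ℝ → Vel 𝕜 :=
  stokesProjDiv z₀ z₁ τ (fun j q => v q j • v q) (fun q => vertVel z₁ Dv q • v q)

/-- The integral equation
`v(t) = S(t)a - ∫₀ᵗ S(t-s) ℙ ∇·(u(s) ⊗ v(s)) ds`, `t ∈ I`, for a field `v(t)` with gradient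
`Dv(t)` such that `t^{1/2} ‖∇v(t)‖_{∞,1}` is bounded on `I` and tends to `0` as `t ↓ 0`.
Here `I` is `(0, T)` or `(0, T]`. -/
def IsMildOn (z₀ z₁ : ℝ) (a : Plane × ℝ → Vel 𝕜) (I : Set ℝ)
    (v : ℝ → Plane × ℝ → Vel 𝕜) : Prop :=
  ∃ Dv : ℝ → Plane × ℝ → Grad 𝕜,
    AEStronglyMeasurable (fun r : ℝ × (Plane × ℝ) => v r.1 r.2)
      ((volume.restrict I).prod (volume.restrict (layer z₀ z₁))) ∧
    AEStronglyMeasurable (fun r : ℝ × (Plane × ℝ) => Dv r.1 r.2)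
      ((volume.restrict I).prod (volume.restrict (layer z₀ z₁))) ∧
    (∀ t ∈ I, IsWeakGrad z₀ z₁ (v t) (Dv t)) ∧
    (∃ K : ℝ≥0, ∀ t ∈ I, ENNReal.ofReal (Real.sqrt t) * normInfOne z₀ z₁ (Dv t) ≤ K) ∧
    Tendsto (fun t => ENNReal.ofReal (Real.sqrt t) * normInfOne z₀ z₁ (Dv t)) (𝓝[>] 0) (𝓝 0) ∧
    ∀ t ∈ I, ∀ᵐ p ∂(volume.restrict (layer z₀ z₁)),
      IntegrableOn (fun s => nonlin z₀ z₁ (t - s) (v s) (Dv s) p) (Ioo 0 t) ∧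
      v t p = stokes z₀ z₁ t a p - ∫ s in Ioo 0 t, nonlin z₀ z₁ (t - s) (v s) (Dv s) p

/-- A mild solution `v ∈ C([0,T]; BUC_σ(L¹))` with initial value `a`. -/
def IsMildSolutionBUC (z₀ z₁ : ℝ) (a : Plane × ℝ → Vel 𝕜) (T : ℝ)
    (v : ℝ → Plane × ℝ → Vel 𝕜) : Prop :=
  (∀ t ∈ Icc 0 T, MemBUCSigma z₀ z₁ (v t)) ∧
  (∀ t ∈ Icc 0 T, Tendsto (fun s => normInfOne z₀ z₁ (v s - v t)) (𝓝[Icc 0 T] t) (𝓝 0)) ∧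
  v 0 =ᵐ[volume.restrict (layer z₀ z₁)] a ∧
  IsMildOn z₀ z₁ a (Ioc 0 T) v

/-- A mild solution `v ∈ L^∞((0,T); L^∞_σ(L¹))` with initial value `a`. -/
def IsMildSolutionLinf (z₀ z₁ : ℝ) (a : Plane × ℝ → Vel 𝕜) (T : ℝ)
    (v : ℝ → Plane × ℝ → Vel 𝕜) : Prop :=
  (∀ t ∈ Ioo 0 T, MemLinfSigma z₀ z₁ (v t)) ∧
  (∃ K : ℝ≥0, ∀ t ∈ Ioo 0 T, normInfOne z₀ z₁ (v t) ≤ K) ∧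
  IsMildOn z₀ z₁ a (Ioo 0 T) v

end PrimEq

end

set_option linter.unusedSectionVars false

noncomputable section

namespace PrimEq

open MeasureTheory Set Filter Topology
open scoped ENNReal NNReal Real
open ENNReal (ofReal ofReal_mul ofReal_le_ofReal ofReal_lt_top ofReal_add ofReal_ne_top ofReal_one ofReal_toReal mul_lt_top)
open Real (exp sqrt rpow_nonneg rpow_add)

/-- The vertical extent `(z₀, z₁)` of the layer. -/
class Layer where
  /-- the bottom -/
  z₀ : ℝ
  /-- the top -/
  z₁ : ℝ
  hz : z₀ < z₁

open Layer

/-- Points of `ℝ² × ℝ`. -/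
notation:max "ℝ³" => Plane × ℝ

/-- The layer. -/
notation:max "Ω" => layer z₀ z₁

/-- Lebesgue measure on the layer. -/
notation:max "μΩ" => volume.restrict (layer z₀ z₁)

/-- The norm of `L^∞(ℝ²; L¹(J))`. -/
notation:max "nrm" => normInfOne z₀ z₁

/-- Membership in `L^∞(ℝ²; L¹(J))`. -/
notation:max "MemL" => MemLinf z₀ z₁

section

variable {E E' : Type*} [NormedAddCommGroup E] [NormedAddCommGroup E']

theorem isOpen_layer [Layer] : IsOpen Ω := isOpen_univ.prod isOpen_Ioo

theorem measurableSet_layer [Layer] : MeasurableSet Ω := isOpen_layer.measurableSet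

/-- Lebesgue measure on the layer as a product measure. -/
theorem volume_restrict_layer [Layer] : (volume : Measure ℝ³).restrict Ω =
      (volume : Measure Plane).prod (volume.restrict (Ioo z₀ z₁)) := by
  rw [layer, Measure.volume_eq_prod, ← Measure.prod_restrict, Measure.restrict_univ]

instance : (volume : Measure ℝ³).IsAddHaarMeasure := by rw [Measure.volume_eq_prod]; infer_instance

theorem lintegral_layer [Layer] {F : ℝ³ → ℝ≥0∞} (hF : AEMeasurable F μΩ) :
    ∫⁻ p in Ω, F p = ∫⁻ x, ∫⁻ z in Ioo z₀ z₁, F (x, z) := by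
  rw [volume_restrict_layer] at hF ⊢
  exact lintegral_prod _ hF

/-- The vertical `L¹` norm of `f` above the point `x`, so that `normInfOne` is its essential
supremum. -/
def sliceNorm [Layer] (f : ℝ³ → E) (x : Plane) : ℝ≥0∞ := ∫⁻ z in Ioo z₀ z₁, ‖f (x, z)‖ₑ

theorem sliceNorm_le_normInfOne [Layer] (f : ℝ³ → E) : ∀ᵐ x : Plane, sliceNorm f x ≤ nrm f :=
  ENNReal.ae_le_essSup _

theorem normInfOne_le [Layer] {f : ℝ³ → E} {C : ℝ≥0∞}
    (h : ∀ᵐ x : Plane, sliceNorm f x ≤ C) : nrm f ≤ C :=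
  essSup_le_of_ae_le C h

theorem ae_slice [Layer] {P : ℝ³ → Prop} (h : ∀ᵐ p ∂μΩ, P p) :
    ∀ᵐ x : Plane, ∀ᵐ z ∂(volume.restrict (Ioo z₀ z₁)), P (x, z) := by
  rw [volume_restrict_layer] at h
  exact Measure.ae_ae_of_ae_prod h

theorem aesm_slice [Layer] {f : ℝ³ → E} (h : AEStronglyMeasurable f μΩ) :
    ∀ᵐ x : Plane, AEStronglyMeasurable (fun z => f (x, z)) (volume.restrict (Ioo z₀ z₁)) := by
  rw [volume_restrict_layer] at h
  exact h.prodMk_left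

theorem normInfOne_mono_ae [Layer] {f : ℝ³ → E} {g : ℝ³ → E'} (h : ∀ᵐ p ∂μΩ, ‖f p‖ₑ ≤ ‖g p‖ₑ) :
    nrm f ≤ nrm g := by
  refine normInfOne_le ?_
  filter_upwards [ae_slice h, sliceNorm_le_normInfOne g] with x hx hg
  exact (lintegral_mono_ae hx).trans hg

theorem normInfOne_congr [Layer] {f g : ℝ³ → E} (h : f =ᵐ[μΩ] g) : nrm f = nrm g :=
  le_antisymm (normInfOne_mono_ae (h.mono fun p hp => by rw [hp]))
    (normInfOne_mono_ae (h.mono fun p hp => by rw [hp]))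

theorem normInfOne_add_le [Layer] {f g : ℝ³ → E} (hf : AEStronglyMeasurable f μΩ) :
    nrm (f + g) ≤ nrm f + nrm g := by
  refine normInfOne_le ?_
  filter_upwards [aesm_slice hf, sliceNorm_le_normInfOne f, sliceNorm_le_normInfOne g]
    with x hm hx hg
  calc sliceNorm (f + g) x ≤ ∫⁻ z in Ioo z₀ z₁, (‖f (x, z)‖ₑ + ‖g (x, z)‖ₑ) :=
        lintegral_mono fun z => enorm_add_le _ _
    _ = sliceNorm f x + sliceNorm g x := lintegral_add_left' hm.enorm _
    _ ≤ _ := add_le_add hx hg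

theorem normInfOne_neg [Layer] (f : ℝ³ → E) : nrm (-f) = nrm f := by simp [normInfOne]

theorem normInfOne_sub_le [Layer] {f g : ℝ³ → E} (hf : AEStronglyMeasurable f μΩ) :
    nrm (f - g) ≤ nrm f + nrm g := by
  rw [sub_eq_add_neg, ← normInfOne_neg g]; exact normInfOne_add_le hf

theorem normInfOne_sub_comm [Layer] (f g : ℝ³ → E) : nrm (f - g) = nrm (g - f) := by
  rw [← neg_sub, normInfOne_neg]

theorem normInfOne_zero [Layer] : nrm (0 : ℝ³ → E) = 0 := by
  refine le_antisymm (normInfOne_le (ae_of_all _ fun x => ?_)) bot_le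
  simp [sliceNorm]

theorem ae_eq_zero_of_normInfOne [Layer] {f : ℝ³ → E} (hf : AEStronglyMeasurable f μΩ)
    (h : nrm f = 0) : f =ᵐ[μΩ] 0 := by
  have h1 : ∫⁻ p in Ω, ‖f p‖ₑ = 0 := by
    rw [volume_restrict_layer] at hf ⊢
    rw [lintegral_prod _ hf.enorm]
    rw [lintegral_eq_zero_iff' hf.enorm.lintegral_prod_right']
    filter_upwards [sliceNorm_le_normInfOne f] with x hx
    exact le_antisymm (hx.trans h.le) bot_le
  rw [lintegral_eq_zero_iff' hf.enorm] at h1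
  filter_upwards [h1] with p hp
  simpa using hp

/-- Integration over the layer of a field in `L^∞(L¹)` against a horizontal weight. -/
theorem lintegral_weight_le [Layer] {f : ℝ³ → E} (hf : AEStronglyMeasurable f μΩ) {k : Plane → ℝ≥0∞}
    (hk : Measurable k) (hk' : ∀ x, k x ≠ ∞) :
    ∫⁻ q in Ω, k q.1 * ‖f q‖ₑ ≤ (∫⁻ y, k y) * nrm f := by
  rw [volume_restrict_layer] at hf ⊢
  have hm : AEMeasurable (fun q : ℝ³ => k q.1 * ‖f q‖ₑ)
      (volume.prod (volume.restrict (Ioo z₀ z₁))) :=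
    (hk.comp measurable_fst).aemeasurable.mul hf.enorm
  rw [lintegral_prod _ hm, ← lintegral_mul_const _ hk]
  refine lintegral_mono_ae ?_
  filter_upwards [sliceNorm_le_normInfOne f] with x hx
  rw [lintegral_const_mul' _ _ (hk' x)]
  gcongr; exact hx

theorem MemLinf.congr [Layer] {f g : ℝ³ → E} (hf : MemL f) (h : f =ᵐ[μΩ] g) : MemL g :=
  ⟨hf.1.congr h, by rw [← normInfOne_congr h]; exact hf.2⟩

theorem MemLinf.add [Layer] {f g : ℝ³ → E} (hf : MemL f) (hg : MemL g) : MemL (f + g) :=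
  ⟨hf.1.add hg.1, (normInfOne_add_le hf.1).trans_lt (ENNReal.add_lt_top.2 ⟨hf.2, hg.2⟩)⟩

theorem MemLinf.sub [Layer] {f g : ℝ³ → E} (hf : MemL f) (hg : MemL g) : MemL (f - g) :=
  ⟨hf.1.sub hg.1, (normInfOne_sub_le hf.1).trans_lt (ENNReal.add_lt_top.2 ⟨hf.2, hg.2⟩)⟩

theorem MemLinf.ae_integrable [Layer] {f : ℝ³ → E} (hf : MemL f) :
    ∀ᵐ x : Plane, IntegrableOn (fun z => f (x, z)) (Ioo z₀ z₁) := by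
  filter_upwards [aesm_slice hf.1, sliceNorm_le_normInfOne f] with x h1 h2
  exact ⟨h1, h2.trans_lt hf.2⟩

theorem MemLinf.neg [Layer] {f : ℝ³ → E} (hf : MemL f) :
    MemL (-f) := ⟨hf.1.neg, by rw [normInfOne_neg]; exact hf.2⟩

theorem MemLinf.zero [Layer] : MemL (0 : ℝ³ → E) :=
  ⟨aestronglyMeasurable_zero, by rw [normInfOne_zero]; simp⟩

theorem MemLinf.sum {ι : Type*} (s : Finset ι) [Layer] {f : ι → ℝ³ → E}
    (hf : ∀ i ∈ s, MemL (f i)) : MemL (∑ i ∈ s, f i) := by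
  classical
  induction s using Finset.induction_on with
  | empty => simpa using MemLinf.zero
  | insert i s hi ih =>
    rw [Finset.sum_insert hi]
    exact (hf i (Finset.mem_insert_self _ _)).add
      (ih fun j hj => hf j (Finset.mem_insert_of_mem hj))

variable [NormedSpace ℝ E] [NormedSpace ℝ E']

/-- A field in `L^∞(L¹)` is integrable against weights that are bounded by an integrable function
of the horizontal variable. -/
theorem MemLinf.integrable_smul [Layer] {f : ℝ³ → E} (hf : MemL f)
    {φ : ℝ³ → ℝ} (hφ : AEStronglyMeasurable φ μΩ)
    {k : Plane → ℝ} (hk : Integrable k) (hkm : Measurable k)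
    (hb : ∀ p ∈ Ω, |φ p| ≤ k p.1) :
    Integrable (fun p => φ p • f p) μΩ := by
  refine ⟨hφ.smul hf.1, ?_⟩
  have h1 := lintegral_weight_le hf.1 hkm.enorm (fun x => enorm_ne_top)
  refine (lt_of_le_of_lt ?_ (h1.trans_lt (mul_lt_top hk.2 hf.2)))
  refine setLIntegral_mono_ae' measurableSet_layer (ae_of_all _ fun p hp => ?_)
  rw [enorm_smul]
  gcongr
  rw [← ofReal_norm, ← ofReal_norm]
  exact ofReal_le_ofReal ((hb p hp).trans (le_abs_self _))

theorem MemLinf.integrable_test_smul [Layer] {f : ℝ³ → E} (hf : MemL f)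
    {φ : ℝ³ → ℝ} (hφ : Continuous φ) (hc : HasCompactSupport φ) :
    Integrable (fun p => φ p • f p) μΩ := by
  obtain ⟨C, hC⟩ := hc.exists_bound_of_continuous hφ
  have hK : IsCompact (Prod.fst '' tsupport φ) := hc.isCompact.image continuous_fst
  refine hf.integrable_smul (k := (Prod.fst '' tsupport φ).indicator fun _ => C)
    hφ.aestronglyMeasurable ?_ ?_ ?_
  · exact (integrable_indicator_iff hK.measurableSet).2 (integrableOn_const hK.measure_lt_top.ne)
  · exact measurable_const.indicator hK.measurableSet
  · intro p _
    by_cases hp : p ∈ tsupport φ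
    · rw [indicator_of_mem (mem_image_of_mem _ hp)]; exact hC p
    · rw [image_eq_zero_of_notMem_tsupport hp, abs_zero]
      exact indicator_nonneg (fun _ _ => (norm_nonneg _).trans (hC p)) _

/-- A horizontal weight: a finite measurable function of finite integral. -/
structure IsWeight (K : Plane → ℝ≥0∞) : Prop where
  measurable : Measurable K
  ne_top : ∀ x, K x ≠ ∞
  lintegral_lt_top : ∫⁻ x, K x < ∞

theorem exists_isWeight {φ : ℝ³ → ℝ} (hφ : Continuous φ) (hc : HasCompactSupport φ) :
    ∃ K, IsWeight K ∧ ∀ p, ‖φ p‖ₑ ≤ K p.1 := by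
  obtain ⟨C, hC⟩ := hc.exists_bound_of_continuous hφ
  have hK : IsCompact (Prod.fst '' tsupport φ) := hc.isCompact.image continuous_fst
  refine ⟨(Prod.fst '' tsupport φ).indicator fun _ => ofReal C,
    ⟨measurable_const.indicator hK.measurableSet, fun x => ?_, ?_⟩, fun p => ?_⟩
  · by_cases hx : x ∈ Prod.fst '' tsupport φ
    · rw [indicator_of_mem hx]; exact ofReal_ne_top
    · rw [indicator_of_notMem hx]; exact ENNReal.zero_ne_top
  · rw [lintegral_indicator_const hK.measurableSet]
    exact mul_lt_top ofReal_lt_top hK.measure_lt_top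
  · by_cases hp : p ∈ tsupport φ
    · rw [indicator_of_mem (mem_image_of_mem _ hp), ← ofReal_norm]
      exact ofReal_le_ofReal (hC p)
    · rw [image_eq_zero_of_notMem_tsupport hp, enorm_zero]; exact bot_le

theorem MemLinf.locallyIntegrableOn [Layer] {f : ℝ³ → E} (hf : MemL f) :
    LocallyIntegrableOn f Ω := by
  intro p _
  have hB : IsCompact (Metric.closedBall p.1 1) := isCompact_closedBall _ _
  refine ⟨Ω ∩ (Metric.closedBall p.1 1 ×ˢ univ), ?_, ?_⟩
  · exact inter_mem_nhdsWithin _ (prod_mem_nhds (Metric.closedBall_mem_nhds _ one_pos) univ_mem)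
  · have h := hf.integrable_smul (φ := (Metric.closedBall p.1 1 ×ˢ (univ : Set ℝ)).indicator 1)
      (k := (Metric.closedBall p.1 1).indicator 1)
      ((measurable_one.indicator (hB.measurableSet.prod MeasurableSet.univ)).aestronglyMeasurable)
      ((integrable_indicator_iff hB.measurableSet).2 (integrableOn_const hB.measure_lt_top.ne))
      (measurable_one.indicator hB.measurableSet) (fun q _ => by
        by_cases hq : q.1 ∈ Metric.closedBall p.1 1
        · rw [indicator_of_mem (by simpa using hq), indicator_of_mem hq]; simp
        · rw [indicator_of_notMem (by simpa using hq), indicator_of_notMem hq]; simp)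
    rw [IntegrableOn, inter_comm, ← Measure.restrict_restrict (hB.measurableSet.prod MeasurableSet.univ)]
    rw [← IntegrableOn, ← integrable_indicator_iff (hB.measurableSet.prod MeasurableSet.univ)]
    refine h.congr (ae_of_all _ fun q => ?_)
    by_cases hq : q ∈ Metric.closedBall p.1 1 ×ˢ (univ : Set ℝ)
    · simp only [indicator_of_mem hq]; simp
    · simp only [indicator_of_notMem hq]; simp

/-- `g` is the weak derivative on the layer of `f` in the `i`-th coordinate direction. -/
def WeakDeriv [Layer] (i : Fin 3) (f g : ℝ³ → E) : Prop :=
  ∀ φ : ℝ³ → ℝ, ContDiff ℝ (⊤ : ℕ∞) φ → HasCompactSupport φ → tsupport φ ⊆ Ω →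
      ∫ p in Ω, fderiv ℝ φ p (dir i) • f p = -∫ p in Ω, φ p • g p

theorem continuous_dirDeriv {φ : ℝ³ → ℝ} (hφ : ContDiff ℝ (⊤ : ℕ∞) φ) (e : ℝ³) :
    Continuous fun p => fderiv ℝ φ p e :=
  (hφ.continuous_fderiv (by simp)).clm_apply continuous_const

theorem hasCompactSupport_dirDeriv {φ : ℝ³ → ℝ} (hφ : HasCompactSupport φ)
    (e : ℝ³) : HasCompactSupport fun p => fderiv ℝ φ p e :=
  (hφ.fderiv (𝕜 := ℝ)).comp_left (g := fun L : ℝ³ →L[ℝ] ℝ => L e) rfl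

theorem WeakDeriv.add [Layer] {i : Fin 3} {f g f' g' : ℝ³ → E}
    (h : WeakDeriv i f g) (h' : WeakDeriv i f' g') (hf : MemL f)
    (hg : MemL g) (hf' : MemL f') (hg' : MemL g') :
    WeakDeriv i (f + f') (g + g') := by
  intro φ h1 h2 h3
  have e1 := h φ h1 h2 h3
  have e2 := h' φ h1 h2 h3
  simp only [Pi.add_apply, smul_add]
  rw [integral_add, integral_add, e1, e2, neg_add]
  · exact hg.integrable_test_smul h1.continuous h2
  · exact hg'.integrable_test_smul h1.continuous h2
  · exact hf.integrable_test_smul (continuous_dirDeriv h1 _) (hasCompactSupport_dirDeriv h2 _)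
  · exact hf'.integrable_test_smul (continuous_dirDeriv h1 _) (hasCompactSupport_dirDeriv h2 _)

theorem WeakDeriv.neg [Layer] {i : Fin 3} {f g : ℝ³ → E}
    (h : WeakDeriv i f g) : WeakDeriv i (-f) (-g) := by
  intro φ h1 h2 h3
  simp only [Pi.neg_apply, smul_neg, integral_neg, h φ h1 h2 h3]

theorem WeakDeriv.sum {ι : Type*} (s : Finset ι) [Layer] {l : Fin 3}
    {f g : ι → ℝ³ → E} (hd : ∀ i ∈ s, WeakDeriv l (f i) (g i))
    (hf : ∀ i ∈ s, MemL (f i)) (hg : ∀ i ∈ s, MemL (g i)) :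
    WeakDeriv l (∑ i ∈ s, f i) (∑ i ∈ s, g i) := by
  classical
  induction s using Finset.induction_on with
  | empty => intro φ _ _ _; simp
  | insert i s hi ih =>
    rw [Finset.sum_insert hi, Finset.sum_insert hi]
    exact (hd i (Finset.mem_insert_self _ _)).add
      (ih (fun j hj => hd j (Finset.mem_insert_of_mem hj))
        (fun j hj => hf j (Finset.mem_insert_of_mem hj))
        (fun j hj => hg j (Finset.mem_insert_of_mem hj)))
      (hf i (Finset.mem_insert_self _ _)) (hg i (Finset.mem_insert_self _ _))
      (MemLinf.sum s fun j hj => hf j (Finset.mem_insert_of_mem hj))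
      (MemLinf.sum s fun j hj => hg j (Finset.mem_insert_of_mem hj))

theorem WeakDeriv.congr [Layer] {i : Fin 3} {f g f' g' : ℝ³ → E}
    (h : WeakDeriv i f g) (hf : f =ᵐ[μΩ] f')
    (hg : g =ᵐ[μΩ] g') : WeakDeriv i f' g' := by
  intro φ h1 h2 h3
  have e1 : (fun p => fderiv ℝ φ p (dir i) • f p) =ᵐ[μΩ]
      fun p => fderiv ℝ φ p (dir i) • f' p := hf.mono fun p hp => by simp only [hp]
  have e2 : (fun p => φ p • g p) =ᵐ[μΩ] fun p => φ p • g' p := hg.mono fun p hp => by simp only [hp]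
  rw [← integral_congr_ae e1, h φ h1 h2 h3, integral_congr_ae e2]

theorem WeakDeriv.ae_eq [Layer] {i : Fin 3} {f g g' : ℝ³ → E} [CompleteSpace E]
    (h : WeakDeriv i f g) (h' : WeakDeriv i f g')
    (hg : LocallyIntegrableOn g Ω) (hg' : LocallyIntegrableOn g' Ω) :
    g =ᵐ[μΩ] g' := by
  have key := isOpen_layer.ae_eq_zero_of_integral_contDiff_smul_eq_zero
    (f := g - g') (μ := volume) (hg.sub hg') ?_
  · rw [Filter.EventuallyEq, ae_restrict_iff' measurableSet_layer]
    filter_upwards [key] with p hp hpl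
    exact sub_eq_zero.1 (hp hpl)
  · intro φ h1 h2 h3
    have hint : ∀ {u : ℝ³ → E}, LocallyIntegrableOn u Ω → Integrable (fun p => φ p • u p) := by
      intro u hu
      have := (hu.integrableOn_compact_subset h3 h2.isCompact)
      have h4 : IntegrableOn (fun p => φ p • u p) (tsupport φ) :=
        this.continuousOn_smul h1.continuous.continuousOn h2.isCompact
      refine (integrableOn_iff_integrable_of_support_subset ?_).1 h4
      intro p hp
      exact subset_tsupport _ (left_ne_zero_of_smul hp)
    have hset : ∀ u : ℝ³ → E, ∫ p in Ω, φ p • u p = ∫ p, φ p • u p := fun u =>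
      setIntegral_eq_integral_of_forall_compl_eq_zero fun p hp => by
        rw [image_eq_zero_of_notMem_tsupport (fun hh => hp (h3 hh)), zero_smul]
    have e := (h φ h1 h2 h3).symm.trans (h' φ h1 h2 h3)
    rw [hset, hset, neg_inj] at e
    simp only [Pi.sub_apply, smul_sub]
    rw [integral_sub (hint hg) (hint hg'), e, sub_self]

end

/-- The `n`-th derivative in `y` of the heat kernel of `ℝ`, through the three-term recursion of the
Hermite polynomials. -/
def gaussDeriv : ℕ → ℝ → ℝ → ℝ
  | 0, t, y => heatKernelOne t y
  | 1, t, y => -(y / (2 * t)) * heatKernelOne t y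
  | n + 2, t, y => -(y / (2 * t)) * gaussDeriv (n + 1) t y - ((n + 1) / (2 * t)) * gaussDeriv n t y

theorem gaussDeriv_zero (t y : ℝ) : gaussDeriv 0 t y = heatKernelOne t y := by rw [gaussDeriv]

theorem gaussDeriv_one (t y : ℝ) :
    gaussDeriv 1 t y = -(y / (2 * t)) * heatKernelOne t y := by rw [gaussDeriv]

theorem gaussDeriv_add_two (n : ℕ) (t y : ℝ) : gaussDeriv (n + 2) t y =
    -(y / (2 * t)) * gaussDeriv (n + 1) t y - ((n + 1) / (2 * t)) * gaussDeriv n t y := by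
  rw [gaussDeriv]

/-- Induction two steps at a time, in the form in which the recursion of `gaussDeriv` is used. -/
theorem two_step_induction {P : ℕ → Prop} (h0 : P 0) (h1 : P 1)
    (h : ∀ n, P n → P (n + 1) → P (n + 2)) (n : ℕ) : P n := by
  have : P n ∧ P (n + 1) := by
    induction n with
    | zero => exact ⟨h0, h1⟩
    | succ n ih => exact ⟨ih.2, h n ih.1 ih.2⟩
  exact this.1

theorem hasDerivAt_heatKernelOne (t y : ℝ) : HasDerivAt (heatKernelOne t) (gaussDeriv 1 t y) y := by
  have h : HasDerivAt (fun y : ℝ => -(y ^ 2) / (4 * t)) (-(2 * y) / (4 * t)) y := by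
    simpa using ((hasDerivAt_pow 2 y).neg).div_const (4 * t)
  refine (h.exp.const_mul ((sqrt (4 * π * t))⁻¹)).congr_deriv ?_
  rw [gaussDeriv_one, heatKernelOne]; ring

theorem hasDerivAt_gaussDeriv (n : ℕ) (t y : ℝ) :
    HasDerivAt (gaussDeriv n t) (gaussDeriv (n + 1) t y) y := by
  have hl : HasDerivAt (fun y : ℝ => -(y / (2 * t))) (-(1 / (2 * t))) y :=
    ((hasDerivAt_id y).div_const _).neg
  induction n using two_step_induction with
  | h0 =>
    have : gaussDeriv 0 t = heatKernelOne t := funext fun y => gaussDeriv_zero t y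
    rw [this]; exact hasDerivAt_heatKernelOne t y
  | h1 =>
    have : gaussDeriv 1 t = fun y => -(y / (2 * t)) * heatKernelOne t y :=
      funext fun y => gaussDeriv_one t y
    rw [this]
    refine (hl.mul (hasDerivAt_heatKernelOne t y)).congr_deriv ?_
    rw [gaussDeriv_add_two, gaussDeriv_zero]; push_cast; ring
  | h n ih1 ih2 =>
    have : gaussDeriv (n + 2) t = fun y =>
      -(y / (2 * t)) * gaussDeriv (n + 1) t y - ((n + 1) / (2 * t)) * gaussDeriv n t y :=
      funext fun y => gaussDeriv_add_two n t y
    rw [this]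
    refine ((hl.mul ih2).sub (ih1.const_mul (((n : ℝ) + 1) / (2 * t)))).congr_deriv ?_
    rw [gaussDeriv_add_two (n + 1)]; push_cast; ring

theorem hasDerivAt_heatKernelOne_time {t : ℝ} (ht : 0 < t) (y : ℝ) :
    HasDerivAt (fun t => heatKernelOne t y) (gaussDeriv 2 t y) t := by
  have h1 : HasDerivAt (fun t : ℝ => -(y ^ 2) / (4 * t)) (y ^ 2 / (4 * t ^ 2)) t := by
    have := ((hasDerivAt_id t).const_mul 4).inv (by simp; exact ht.ne')
    refine (this.const_mul (-(y ^ 2))).congr_deriv ?_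
    simp only [id]; field_simp
  have hpos : 0 < 4 * π * t := by positivity
  have h2 : HasDerivAt (fun t : ℝ => (sqrt (4 * π * t))⁻¹)
      (-(1 / (2 * t)) * (sqrt (4 * π * t))⁻¹) t := by
    have h3 : HasDerivAt (fun t : ℝ => 4 * π * t) (4 * π) t := by
      simpa using (hasDerivAt_id t).const_mul (4 * π)
    have h4 := (h3.sqrt hpos.ne').inv (Real.sqrt_pos.2 hpos).ne'
    refine h4.congr_deriv ?_
    rw [Real.sq_sqrt hpos.le]; field_simp
    try ring
  refine (h2.mul h1.exp).congr_deriv ?_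
  rw [gaussDeriv_add_two, gaussDeriv_one, gaussDeriv_zero, heatKernelOne]
  push_cast; field_simp; ring

theorem hasDerivAt_gaussDeriv_time (n : ℕ) {t : ℝ} (ht : 0 < t) (y : ℝ) :
    HasDerivAt (fun t => gaussDeriv n t y) (gaussDeriv (n + 2) t y) t := by
  have hl : ∀ a : ℝ, HasDerivAt (fun t : ℝ => a / (2 * t)) (-(a / (2 * t)) / t) t := by
    intro a
    have := ((hasDerivAt_id t).const_mul 2).inv (by simp; exact ht.ne')
    refine (this.const_mul a).congr_deriv ?_
    simp only [id]; field_simp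
  have hln : HasDerivAt (fun t : ℝ => -(y / (2 * t))) (-(-(y / (2 * t)) / t)) t := (hl y).neg
  induction n using two_step_induction with
  | h0 => simpa only [gaussDeriv_zero] using hasDerivAt_heatKernelOne_time ht y
  | h1 =>
    simp only [gaussDeriv_one]
    refine (hln.mul (hasDerivAt_heatKernelOne_time ht y)).congr_deriv ?_
    rw [gaussDeriv_add_two 1, gaussDeriv_add_two 0, gaussDeriv_one, gaussDeriv_zero]
    push_cast; field_simp; ring
  | h n ih1 ih2 =>
    simp only [gaussDeriv_add_two n]
    refine ((hln.mul ih2).sub ((hl ((n : ℝ) + 1)).mul ih1)).congr_deriv ?_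
    rw [gaussDeriv_add_two (n + 2), gaussDeriv_add_two (n + 1), gaussDeriv_add_two n]
    push_cast; field_simp; ring

theorem contDiff_gaussDeriv (n : ℕ) (t : ℝ) : ContDiff ℝ (⊤ : ℕ∞) (gaussDeriv n t) := by
  have h0 : ContDiff ℝ (⊤ : ℕ∞) (heatKernelOne t) := by unfold heatKernelOne; fun_prop
  induction n using two_step_induction with
  | h0 => rwa [funext fun y => gaussDeriv_zero t y]
  | h1 =>
    rw [show gaussDeriv 1 t = fun y => -(y / (2 * t)) * heatKernelOne t y from
      funext fun y => gaussDeriv_one t y]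
    fun_prop
  | h n ih1 ih2 =>
    rw [show gaussDeriv (n + 2) t = fun y => -(y / (2 * t)) * gaussDeriv (n + 1) t y
      - ((n + 1) / (2 * t)) * gaussDeriv n t y from funext fun y => gaussDeriv_add_two n t y]
    fun_prop

theorem measurable_gaussDeriv (n : ℕ) : Measurable fun r : ℝ × ℝ => gaussDeriv n r.1 r.2 := by
  have h0 : Measurable fun r : ℝ × ℝ => heatKernelOne r.1 r.2 := by unfold heatKernelOne; fun_prop
  induction n using two_step_induction with
  | h0 => simpa only [gaussDeriv_zero] using h0
  | h1 => simp only [gaussDeriv_one]; fun_prop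
  | h n ih1 ih2 => simp only [gaussDeriv_add_two]; fun_prop

theorem heatKernelOne_nonneg (t y : ℝ) : 0 ≤ heatKernelOne t y := by
  unfold heatKernelOne; positivity

theorem gaussDeriv_of_nonpos (n : ℕ) {t : ℝ} (ht : t ≤ 0) (y : ℝ) : gaussDeriv n t y = 0 := by
  have h0 : heatKernelOne t y = 0 := by
    unfold heatKernelOne
    rw [Real.sqrt_eq_zero_of_nonpos (by nlinarith [Real.pi_pos]), inv_zero, zero_mul]
  induction n using two_step_induction with
  | h0 => rw [gaussDeriv_zero, h0]
  | h1 => rw [gaussDeriv_one, h0, mul_zero]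
  | h n ih1 ih2 => rw [gaussDeriv_add_two, ih1, ih2, mul_zero, mul_zero, sub_zero]

theorem exists_gaussDeriv_poly_bound (n : ℕ) : ∃ C : ℝ, 0 ≤ C ∧ ∀ t : ℝ, 0 < t → ∀ y : ℝ,
    |gaussDeriv n t y| ≤ C * (sqrt t)⁻¹ ^ n * (1 + |y| / sqrt t) ^ n * heatKernelOne t y := by
  have key : ∀ t : ℝ, 0 < t → ∀ y : ℝ, |y / (2 * t)| ≤ (sqrt t)⁻¹ * (1 + |y| / sqrt t) := by
    intro t ht y
    have hs := Real.sqrt_pos.2 ht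
    rw [abs_div, abs_of_pos (by positivity : (0:ℝ) < 2 * t)]
    have h2 : |y| / (2 * t) = (sqrt t)⁻¹ * (|y| / sqrt t) / 2 := by
      have := Real.mul_self_sqrt ht.le
      field_simp
      rw [sq, this]
    rw [h2]
    have : 0 ≤ (sqrt t)⁻¹ * (|y| / sqrt t) := by positivity
    have h3 : 0 ≤ (sqrt t)⁻¹ := by positivity
    nlinarith
  induction n using two_step_induction with
  | h0 => exact ⟨1, zero_le_one, fun t ht y => by
      rw [gaussDeriv_zero, abs_of_nonneg (heatKernelOne_nonneg _ _)]; simp⟩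
  | h1 => exact ⟨1, zero_le_one, fun t ht y => by
      rw [gaussDeriv_one, abs_mul, abs_neg, abs_of_nonneg (heatKernelOne_nonneg _ _)]
      have := key t ht y
      have h0 := heatKernelOne_nonneg t y
      simp only [pow_one, one_mul]
      gcongr⟩
  | h n ih1 ih2 =>
    obtain ⟨C1, hC1, h1⟩ := ih1
    obtain ⟨C2, hC2, h2⟩ := ih2
    refine ⟨C2 + (n + 1) * C1, by positivity, fun t ht y => ?_⟩
    have hs := Real.sqrt_pos.2 ht
    set r := (sqrt t)⁻¹ with hr
    set u := 1 + |y| / sqrt t with hu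
    have hr0 : 0 ≤ r := by positivity
    have hu1 : 1 ≤ u := by have : 0 ≤ |y| / sqrt t := by positivity
                           linarith
    have h0 := heatKernelOne_nonneg t y
    have hrr : 1 / (2 * t) ≤ r ^ 2 := by
      rw [hr, inv_pow, Real.sq_sqrt ht.le, one_div]
      exact inv_anti₀ ht (by linarith)
    rw [gaussDeriv_add_two]
    calc |-(y / (2 * t)) * gaussDeriv (n + 1) t y - (n + 1) / (2 * t) * gaussDeriv n t y|
        ≤ |y / (2 * t)| * |gaussDeriv (n + 1) t y| + (n + 1) * (1 / (2 * t)) * |gaussDeriv n t y| := by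
          refine (abs_sub _ _).trans ?_
          rw [abs_mul, abs_neg, abs_mul, abs_of_nonneg (by positivity : (0:ℝ) ≤ (n + 1) / (2 * t))]
          apply le_of_eq; ring
      _ ≤ (r * u) * (C2 * r ^ (n + 1) * u ^ (n + 1) * heatKernelOne t y) +
          (n + 1) * r ^ 2 * (C1 * r ^ n * u ^ n * heatKernelOne t y) := by
          gcongr
          · exact key t ht y
          · exact h2 t ht y
          · exact h1 t ht y
      _ ≤ (r * u) * (C2 * r ^ (n + 1) * u ^ (n + 1) * heatKernelOne t y) +
          (n + 1) * r ^ 2 * (C1 * r ^ n * u ^ (n + 2) * heatKernelOne t y) := by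
          gcongr
          exact Nat.le_add_right _ _
      _ = _ := by ring

theorem exists_gaussDeriv_bound (n : ℕ) : ∃ C : ℝ, 0 ≤ C ∧ ∀ t : ℝ, 0 < t → ∀ y : ℝ,
    |gaussDeriv n t y| ≤ C * t ^ (-(n : ℝ) / 2) * heatKernelOne (2 * t) y := by
  obtain ⟨C, hC, h⟩ := exists_gaussDeriv_poly_bound n
  refine ⟨C * (n.factorial * exp 3) * sqrt 2, by positivity, fun t ht y => ?_⟩
  have hs := Real.sqrt_pos.2 ht
  refine (h t ht y).trans ?_
  set u := |y| / sqrt t with hu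
  have hu0 : 0 ≤ u := by positivity
  have hu2 : u ^ 2 = y ^ 2 / t := by rw [hu, div_pow, sq_abs, Real.sq_sqrt ht.le]
  have h1 : (1 + u) ^ n ≤ n.factorial * exp 3 * exp (u ^ 2 / 8) := by
    have h2 := Real.pow_div_factorial_le_exp (1 + u) (by positivity) n
    rw [div_le_iff₀ (by positivity)] at h2
    refine h2.trans ?_
    rw [mul_assoc, ← Real.exp_add, mul_comm]
    refine mul_le_mul_of_nonneg_left (Real.exp_le_exp.2 ?_) (by positivity)
    nlinarith [sq_nonneg (u - 4)]
  have h3 : heatKernelOne t y * exp (u ^ 2 / 8) = sqrt 2 * heatKernelOne (2 * t) y := by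
    unfold heatKernelOne
    rw [show 4 * π * (2 * t) = 2 * (4 * π * t) by ring,
      Real.sqrt_mul (by norm_num : (0:ℝ) ≤ 2), mul_assoc, ← Real.exp_add, hu2]
    have : -y ^ 2 / (4 * t) + y ^ 2 / t / 8 = -y ^ 2 / (4 * (2 * t)) := by field_simp; ring
    rw [this, mul_inv]
    have h2 : sqrt 2 ≠ 0 := by positivity
    field_simp
  have h4 : (sqrt t)⁻¹ ^ n = t ^ (-(n : ℝ) / 2) := by
    rw [Real.sqrt_eq_rpow, ← Real.rpow_neg ht.le, ← Real.rpow_natCast, ← Real.rpow_mul ht.le]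
    congr 1; ring
  rw [h4]
  have h0 := heatKernelOne_nonneg t y
  calc C * t ^ (-(n : ℝ) / 2) * (1 + u) ^ n * heatKernelOne t y
      ≤ C * t ^ (-(n : ℝ) / 2) * (n.factorial * exp 3 * exp (u ^ 2 / 8))
        * heatKernelOne t y := by gcongr
    _ = C * t ^ (-(n : ℝ) / 2) * (n.factorial * exp 3)
        * (heatKernelOne t y * exp (u ^ 2 / 8)) := by ring
    _ = _ := by rw [h3]; ring

/-- The constant in the pointwise bound of `gaussDeriv n` by a wider Gaussian. -/
def gaussConst (n : ℕ) : ℝ := (exists_gaussDeriv_bound n).choose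

theorem gaussConst_nonneg (n : ℕ) : 0 ≤ gaussConst n := (exists_gaussDeriv_bound n).choose_spec.1

theorem abs_gaussDeriv_le (n : ℕ) {t : ℝ} (ht : 0 < t) (y : ℝ) :
    |gaussDeriv n t y| ≤ gaussConst n * t ^ (-(n : ℝ) / 2) * heatKernelOne (2 * t) y :=
  (exists_gaussDeriv_bound n).choose_spec.2 t ht y

theorem integrable_exp_neg_mul_sq_norm {V : Type*} [NormedAddCommGroup V] [InnerProductSpace ℝ V]
    [FiniteDimensional ℝ V] [MeasurableSpace V] [BorelSpace V] {b : ℝ} (hb : 0 < b) :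
    Integrable fun v : V => exp (-b * ‖v‖ ^ 2) := by
  by_contra h
  have h1 := GaussianFourier.integral_rexp_neg_mul_sq_norm (V := V) hb
  rw [integral_undef h] at h1
  have : 0 < (π / b) ^ ((Module.finrank ℝ V : ℝ) / 2) :=
    Real.rpow_pos_of_pos (div_pos Real.pi_pos hb) _
  linarith

theorem heatKernelOne_eq (t y : ℝ) : heatKernelOne t y =
    (sqrt (4 * π * t))⁻¹ * exp (-(1 / (4 * t)) * ‖y‖ ^ 2) := by
  unfold heatKernelOne
  rw [Real.norm_eq_abs, sq_abs]; congr 2; ring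

theorem integrable_heatKernelOne {t : ℝ} (ht : 0 < t) : Integrable (heatKernelOne t) := by
  have := (integrable_exp_neg_mul_sq_norm (V := ℝ) (b := 1 / (4 * t)) (by positivity)).const_mul
    (sqrt (4 * π * t))⁻¹
  exact this.congr (ae_of_all _ fun y => (heatKernelOne_eq t y).symm)

theorem integral_heatKernelOne {t : ℝ} (ht : 0 < t) : ∫ y, heatKernelOne t y = 1 := by
  simp_rw [heatKernelOne_eq]
  rw [integral_const_mul, GaussianFourier.integral_rexp_neg_mul_sq_norm (by positivity)]
  have : π / (1 / (4 * t)) = 4 * π * t := by field_simp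
  rw [this, Real.sqrt_eq_rpow]
  simp only [Module.finrank_self, Nat.cast_one]
  exact inv_mul_cancel₀ (Real.rpow_pos_of_pos (by positivity) _).ne'

theorem lintegral_heatKernelOne {t : ℝ} (ht : 0 < t) : ∫⁻ y, ‖heatKernelOne t y‖ₑ = 1 := by
  have h := ofReal_integral_eq_lintegral_ofReal (integrable_heatKernelOne ht)
    (ae_of_all _ (heatKernelOne_nonneg t))
  rw [integral_heatKernelOne ht, ofReal_one] at h
  rw [h]
  exact lintegral_congr fun y => (Real.enorm_of_nonneg (heatKernelOne_nonneg t y))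

theorem lintegral_gaussDeriv_le (n : ℕ) {t : ℝ} (ht : 0 < t) :
    ∫⁻ y, ‖gaussDeriv n t y‖ₑ ≤ ofReal (gaussConst n * t ^ (-(n : ℝ) / 2)) := by
  have hc : 0 ≤ gaussConst n * t ^ (-(n : ℝ) / 2) := mul_nonneg (gaussConst_nonneg n) (by positivity)
  calc ∫⁻ y, ‖gaussDeriv n t y‖ₑ
      ≤ ∫⁻ y, ofReal (gaussConst n * t ^ (-(n : ℝ) / 2)) * ‖heatKernelOne (2 * t) y‖ₑ := by
        refine lintegral_mono fun y => ?_
        rw [← Real.enorm_of_nonneg hc, ← enorm_mul, enorm_le_iff_norm_le, Real.norm_eq_abs,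
          Real.norm_eq_abs]
        exact (abs_gaussDeriv_le n ht y).trans (le_abs_self _)
    _ = _ := by
        rw [lintegral_const_mul' _ _ ofReal_ne_top,
          lintegral_heatKernelOne (by positivity), mul_one]

/-- A Gaussian bound for `gaussDeriv n`, uniform under bounded shifts of the space variable and for
times in a compact subinterval of `(0, ∞)`. -/
theorem exists_gaussDeriv_local_bound (n : ℕ) {a b : ℝ} (ha : 0 < a) (hab : a ≤ b) (R : ℝ) :
    ∃ C c : ℝ, 0 ≤ C ∧ 0 < c ∧ ∀ t ∈ Icc a b, ∀ r : ℝ, |r| ≤ R → ∀ y : ℝ,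
      |gaussDeriv n t (y + r)| ≤ C * exp (-c * y ^ 2) := by
  have hb : 0 < b := ha.trans_le hab
  refine ⟨gaussConst n * a ^ (-(n : ℝ) / 2) * (sqrt (4 * π * (2 * a)))⁻¹
    * exp (R ^ 2 / (8 * b)), 1 / (16 * b), ?_, by positivity, ?_⟩
  · have := gaussConst_nonneg n
    positivity
  intro t ht r hr y
  have ht0 : 0 < t := ha.trans_le ht.1
  have hg := gaussConst_nonneg n
  refine (abs_gaussDeriv_le n ht0 _).trans ?_
  have e1 : t ^ (-(n : ℝ) / 2) ≤ a ^ (-(n : ℝ) / 2) := Real.rpow_le_rpow_of_nonpos ha ht.1 (by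
      have : (0 : ℝ) ≤ n := Nat.cast_nonneg n
      linarith)
  have e2 : (sqrt (4 * π * (2 * t)))⁻¹ ≤ (sqrt (4 * π * (2 * a)))⁻¹ := by
    apply inv_anti₀ (Real.sqrt_pos.2 (by positivity))
    apply Real.sqrt_le_sqrt
    have := Real.pi_pos
    have := ht.1
    gcongr
  have e3 : exp (-((y + r) ^ 2) / (4 * (2 * t))) ≤
      exp (R ^ 2 / (8 * b)) * exp (-(1 / (16 * b)) * y ^ 2) := by
    rw [← Real.exp_add]
    apply Real.exp_le_exp.2
    have h1 : -((y + r) ^ 2) / (4 * (2 * t)) ≤ -((y + r) ^ 2) / (8 * b) := by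
      rw [neg_div, neg_div, neg_le_neg_iff]
      apply div_le_div_of_nonneg_left (sq_nonneg _) (by positivity)
      linarith [ht.2]
    refine h1.trans ?_
    have h2 : R ^ 2 / (8 * b) + -(1 / (16 * b)) * y ^ 2 = (R ^ 2 - y ^ 2 / 2) / (8 * b) := by
      field_simp
      try ring
    rw [h2]
    gcongr
    have : r ^ 2 ≤ R ^ 2 := by rw [← sq_abs r]; gcongr
    nlinarith [sq_nonneg (y + 2 * r)]
  unfold heatKernelOne
  calc gaussConst n * t ^ (-(n : ℝ) / 2) * ((sqrt (4 * π * (2 * t)))⁻¹ *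
        exp (-((y + r) ^ 2) / (4 * (2 * t))))
      ≤ gaussConst n * a ^ (-(n : ℝ) / 2) * ((sqrt (4 * π * (2 * a)))⁻¹ *
        (exp (R ^ 2 / (8 * b)) * exp (-(1 / (16 * b)) * y ^ 2))) := by gcongr
    _ = _ := by ring

/-- The derivative `∂₁^{α 0} ∂₂^{α 1} G_t` of the heat kernel of the plane. -/
def planeDeriv (α : Fin 2 → ℕ) (t : ℝ) (x : Plane) : ℝ :=
  gaussDeriv (α 0) t (x 0) * gaussDeriv (α 1) t (x 1)

theorem heatKernel_nonneg {t : ℝ} (ht : 0 < t) (x : Plane) : 0 ≤ heatKernel t x := by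
  unfold heatKernel; positivity

theorem heatKernel_eq_mul {t : ℝ} (ht : 0 < t) (x : Plane) :
    heatKernel t x = heatKernelOne t (x 0) * heatKernelOne t (x 1) := by
  unfold heatKernel heatKernelOne
  have h1 : (4 * π * t)⁻¹ = (sqrt (4 * π * t))⁻¹ * (sqrt (4 * π * t))⁻¹ := by
    rw [← mul_inv, Real.mul_self_sqrt (by positivity)]
  have h2 : exp (-(‖x‖ ^ 2) / (4 * t)) =
      exp (-((x 0) ^ 2) / (4 * t)) * exp (-((x 1) ^ 2) / (4 * t)) := by
    rw [← Real.exp_add, EuclideanSpace.real_norm_sq_eq, Fin.sum_univ_two]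
    congr 1; ring
  rw [h1, h2]; ring

theorem heatKernel_eq {t : ℝ} (ht : 0 < t) : heatKernel t = planeDeriv 0 t := by
  funext x
  rw [heatKernel_eq_mul ht, planeDeriv]
  simp [gaussDeriv_zero]

theorem contDiff_planeDeriv (α : Fin 2 → ℕ) (t : ℝ) : ContDiff ℝ (⊤ : ℕ∞) (planeDeriv α t) := by
  have h : ∀ i : Fin 2, ContDiff ℝ (⊤ : ℕ∞) fun x : Plane => x i := fun i =>
    (EuclideanSpace.proj (𝕜 := ℝ) i).contDiff
  exact ((contDiff_gaussDeriv _ t).comp (h 0)).mul ((contDiff_gaussDeriv _ t).comp (h 1))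

theorem hasDerivAt_planeDeriv_line (α : Fin 2 → ℕ) (t : ℝ) (x ξ : Plane) (s : ℝ) :
    HasDerivAt (fun s : ℝ => planeDeriv α t (x + s • ξ))
      (∑ j : Fin 2, ξ j * planeDeriv (α + Pi.single j 1) t (x + s • ξ)) s := by
  have h : ∀ i : Fin 2, HasDerivAt (fun s : ℝ => (x + s • ξ) i) (ξ i) s := by
    intro i
    simpa using ((hasDerivAt_id s).mul_const (ξ i)).const_add (x i)
  have h1 := ((hasDerivAt_gaussDeriv (α 0) t _).comp s (h 0)).mul
    ((hasDerivAt_gaussDeriv (α 1) t _).comp s (h 1))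
  refine h1.congr_deriv ?_
  simp [planeDeriv]
  ring

theorem fderiv_planeDeriv (α : Fin 2 → ℕ) (t : ℝ) (x ξ : Plane) :
    fderiv ℝ (planeDeriv α t) x ξ = ∑ j : Fin 2, ξ j * planeDeriv (α + Pi.single j 1) t x := by
  have h0 : DifferentiableAt ℝ (planeDeriv α t) x :=
    (contDiff_planeDeriv α t).differentiable (by simp) x
  have h1 := hasDerivAt_planeDeriv_line α t x ξ 0
  have h2 : HasLineDerivAt ℝ (planeDeriv α t) (fderiv ℝ (planeDeriv α t) x ξ) x ξ :=
    h0.hasFDerivAt.hasLineDerivAt ξ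
  simp only [zero_smul, add_zero] at h1
  exact HasDerivAt.unique h2 h1

theorem pd_planeDeriv (j : Fin 2) (α : Fin 2 → ℕ) (t : ℝ) :
    pd j (planeDeriv α t) = planeDeriv (α + Pi.single j 1) t := by
  funext x
  rw [pd, fderiv_planeDeriv, Finset.sum_eq_single j]
  · simp
  · intro b _ hb; simp [hb]
  · simp

theorem hasDerivAt_planeDeriv_time (α : Fin 2 → ℕ) {t : ℝ} (ht : 0 < t) (x : Plane) :
    HasDerivAt (fun t => planeDeriv α t x) (∑ j : Fin 2, planeDeriv (α + Pi.single j 2) t x) t := by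
  refine ((hasDerivAt_gaussDeriv_time (α 0) ht (x 0)).mul
    (hasDerivAt_gaussDeriv_time (α 1) ht (x 1))).congr_deriv ?_
  simp [planeDeriv]

theorem measurable_planeDeriv (α : Fin 2 → ℕ) :
    Measurable fun r : ℝ × Plane => planeDeriv α r.1 r.2 := by
  have h : ∀ i : Fin 2, Measurable fun r : ℝ × Plane => r.2 i := fun i =>
    (EuclideanSpace.proj (𝕜 := ℝ) i).continuous.measurable.comp measurable_snd
  exact ((measurable_gaussDeriv _).comp (measurable_fst.prodMk (h 0))).mul
    ((measurable_gaussDeriv _).comp (measurable_fst.prodMk (h 1)))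

theorem integrable_heatKernel {t : ℝ} (ht : 0 < t) : Integrable (heatKernel t) := by
  have := (integrable_exp_neg_mul_sq_norm (V := Plane) (b := 1 / (4 * t)) (by positivity)).const_mul
    (4 * π * t)⁻¹
  refine this.congr (ae_of_all _ fun y => ?_)
  unfold heatKernel; ring_nf

theorem integral_heatKernel {t : ℝ} (ht : 0 < t) : ∫ x, heatKernel t x = 1 := by
  have : ∀ x, heatKernel t x = (4 * π * t)⁻¹ * exp (-(1 / (4 * t)) * ‖x‖ ^ 2) := fun x => by
    unfold heatKernel; ring_nf
  simp_rw [this]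
  rw [integral_const_mul, GaussianFourier.integral_rexp_neg_mul_sq_norm (by positivity)]
  have : π / (1 / (4 * t)) = 4 * π * t := by field_simp
  rw [this]
  simp only [finrank_euclideanSpace, Fintype.card_fin, Nat.cast_ofNat]
  rw [div_self two_ne_zero, Real.rpow_one]
  exact inv_mul_cancel₀ (by positivity)

theorem lintegral_heatKernel {t : ℝ} (ht : 0 < t) : ∫⁻ x, ‖heatKernel t x‖ₑ = 1 := by
  have h := ofReal_integral_eq_lintegral_ofReal (integrable_heatKernel ht)
    (ae_of_all _ (heatKernel_nonneg ht))
  rw [integral_heatKernel ht, ofReal_one] at h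
  rw [h]
  exact lintegral_congr fun y => (Real.enorm_of_nonneg (heatKernel_nonneg ht y))

/-- The constant in the bound of `planeDeriv α` by a wider heat kernel. -/
def planeConst (α : Fin 2 → ℕ) : ℝ := gaussConst (α 0) * gaussConst (α 1)

theorem planeConst_nonneg (α : Fin 2 → ℕ) : 0 ≤ planeConst α :=
  mul_nonneg (gaussConst_nonneg _) (gaussConst_nonneg _)

theorem abs_planeDeriv_le (α : Fin 2 → ℕ) {t : ℝ} (ht : 0 < t) (x : Plane) : |planeDeriv α t x| ≤
      planeConst α * t ^ (-((α 0 + α 1 : ℕ) : ℝ) / 2) * heatKernel (2 * t) x := by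
  rw [planeDeriv, abs_mul, heatKernel_eq_mul (by positivity)]
  have e : t ^ (-((α 0 + α 1 : ℕ) : ℝ) / 2) = t ^ (-(α 0 : ℝ) / 2) * t ^ (-(α 1 : ℝ) / 2) := by
    rw [← rpow_add ht]; congr 1; push_cast; ring
  rw [e, planeConst]
  refine (mul_le_mul (abs_gaussDeriv_le _ ht _) (abs_gaussDeriv_le _ ht _) (abs_nonneg _)
    ((abs_nonneg _).trans (abs_gaussDeriv_le _ ht _))).trans (le_of_eq ?_)
  ring

theorem lintegral_planeDeriv_le (α : Fin 2 → ℕ) {t : ℝ} (ht : 0 < t) : ∫⁻ x, ‖planeDeriv α t x‖ₑ ≤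
      ofReal (planeConst α * t ^ (-((α 0 + α 1 : ℕ) : ℝ) / 2)) := by
  have hc : 0 ≤ planeConst α * t ^ (-((α 0 + α 1 : ℕ) : ℝ) / 2) :=
    mul_nonneg (planeConst_nonneg α) (by positivity)
  calc ∫⁻ y, ‖planeDeriv α t y‖ₑ
      ≤ ∫⁻ y, ofReal (planeConst α * t ^ (-((α 0 + α 1 : ℕ) : ℝ) / 2)) *
          ‖heatKernel (2 * t) y‖ₑ := by
        refine lintegral_mono fun y => ?_
        rw [← Real.enorm_of_nonneg hc, ← enorm_mul, enorm_le_iff_norm_le, Real.norm_eq_abs,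
          Real.norm_eq_abs]
        exact (abs_planeDeriv_le α ht y).trans (le_abs_self _)
    _ = _ := by
        rw [lintegral_const_mul' _ _ ofReal_ne_top, lintegral_heatKernel (by positivity), mul_one]

theorem exists_planeDeriv_local_bound (α : Fin 2 → ℕ) {a b : ℝ} (ha : 0 < a) (hab : a ≤ b)
    (R : ℝ) : ∃ C c : ℝ, 0 ≤ C ∧ 0 < c ∧ ∀ t ∈ Icc a b, ∀ r : Plane, ‖r‖ ≤ R → ∀ x : Plane,
      |planeDeriv α t (x + r)| ≤ C * exp (-c * ‖x‖ ^ 2) := by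
  obtain ⟨C0, c0, hC0, hc0, h0⟩ := exists_gaussDeriv_local_bound (α 0) ha hab R
  obtain ⟨C1, c1, hC1, hc1, h1⟩ := exists_gaussDeriv_local_bound (α 1) ha hab R
  refine ⟨C0 * C1, min c0 c1, by positivity, lt_min hc0 hc1, fun t ht r hr x => ?_⟩
  have hn : ∀ i, |r i| ≤ R := fun i => (PiLp.norm_apply_le r i).trans hr
  rw [planeDeriv, abs_mul]
  have e0 := h0 t ht (r 0) (hn 0) (x 0)
  have e1 := h1 t ht (r 1) (hn 1) (x 1)
  refine (mul_le_mul e0 e1 (abs_nonneg _) ((abs_nonneg _).trans e0)).trans ?_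
  rw [mul_mul_mul_comm, ← Real.exp_add]
  gcongr
  rw [EuclideanSpace.real_norm_sq_eq, Fin.sum_univ_two]
  nlinarith [min_le_left c0 c1, min_le_right c0 c1, sq_nonneg (x 0), sq_nonneg (x 1)]

theorem integrable_planeDeriv (α : Fin 2 → ℕ) {t : ℝ} (ht : 0 < t) : Integrable (planeDeriv α t) :=
  ⟨(contDiff_planeDeriv α t).continuous.aestronglyMeasurable,
    (lintegral_planeDeriv_le α ht).trans_lt ofReal_lt_top⟩

/-- Mean value inequality in `L¹`, along a path of functions. -/
theorem lintegral_sub_le_of_hasDerivAt {X : Type*} [MeasurableSpace X] {ν : Measure X} [SFinite ν]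
    {u u' : ℝ → X → ℝ} {a b : ℝ} (hab : a ≤ b)
    (hd : ∀ x, ∀ s ∈ Icc a b, HasDerivAt (fun s => u s x) (u' s x) s)
    (hc : ∀ x, ContinuousOn (fun s => u' s x) (Icc a b))
    (hm : Measurable fun r : ℝ × X => u' r.1 r.2) {C : ℝ≥0∞}
    (hC : ∀ s ∈ Icc a b, ∫⁻ x, ‖u' s x‖ₑ ∂ν ≤ C) :
    ∫⁻ x, ‖u b x - u a x‖ₑ ∂ν ≤ C * ofReal (b - a) := by
  have h1 : ∀ x, ‖u b x - u a x‖ₑ ≤ ∫⁻ s in Icc a b, ‖u' s x‖ₑ := by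
    intro x
    have hi : IntervalIntegrable (fun s => u' s x) volume a b := by
      apply ContinuousOn.intervalIntegrable
      rw [uIcc_of_le hab]; exact hc x
    rw [← intervalIntegral.integral_eq_sub_of_hasDerivAt
      (fun s hs => hd x s (by rwa [uIcc_of_le hab] at hs)) hi,
      intervalIntegral.integral_of_le hab]
    exact (enorm_integral_le_lintegral_enorm _).trans (lintegral_mono_set Ioc_subset_Icc_self)
  calc ∫⁻ x, ‖u b x - u a x‖ₑ ∂ν ≤ ∫⁻ x, (∫⁻ s in Icc a b, ‖u' s x‖ₑ) ∂ν := lintegral_mono h1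
    _ = ∫⁻ s in Icc a b, (∫⁻ x, ‖u' s x‖ₑ ∂ν) := by
        apply lintegral_lintegral_swap
        exact (hm.comp measurable_swap).enorm.aemeasurable
    _ ≤ ∫⁻ _ in Icc a b, C := setLIntegral_mono measurable_const hC
    _ = _ := by rw [setLIntegral_const, Real.volume_Icc]

theorem continuousOn_planeDeriv_time (α : Fin 2 → ℕ) {a b : ℝ} (ha : 0 < a) (x : Plane) :
    ContinuousOn (fun s => planeDeriv α s x) (Icc a b) := fun _ hs =>
  (hasDerivAt_planeDeriv_time α (ha.trans_le hs.1) x).continuousAt.continuousWithinAt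

theorem lintegral_planeDeriv_time_sub_le (α : Fin 2 → ℕ) {a b : ℝ} (ha : 0 < a) (hab : a ≤ b) :
    ∫⁻ x, ‖planeDeriv α b x - planeDeriv α a x‖ₑ ≤
      ofReal ((∑ j : Fin 2, planeConst (α + Pi.single j 2)) *
        a ^ (-((α 0 + α 1 + 2 : ℕ) : ℝ) / 2)) * ofReal (b - a) := by
  refine lintegral_sub_le_of_hasDerivAt hab (u := planeDeriv α)
    (u' := fun s x => ∑ j : Fin 2, planeDeriv (α + Pi.single j 2) s x)
    (fun x s hs => hasDerivAt_planeDeriv_time α (ha.trans_le hs.1) x)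
    (fun x => continuousOn_finsetSum _ fun j _ => continuousOn_planeDeriv_time _ ha x)
    (Finset.measurable_sum _ fun j _ => measurable_planeDeriv _) (fun s hs => ?_)
  have hs0 := ha.trans_le hs.1
  have hdeg : ∀ j : Fin 2, (α + Pi.single j 2 : Fin 2 → ℕ) 0 + (α + Pi.single j 2 : Fin 2 → ℕ) 1
      = α 0 + α 1 + 2 := by
    intro j; fin_cases j <;> simp <;> ring
  calc ∫⁻ x, ‖∑ j : Fin 2, planeDeriv (α + Pi.single j 2) s x‖ₑ
      ≤ ∫⁻ x, ∑ j : Fin 2, ‖planeDeriv (α + Pi.single j 2) s x‖ₑ :=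
        lintegral_mono fun x => enorm_sum_le _ _
    _ = ∑ j : Fin 2, ∫⁻ x, ‖planeDeriv (α + Pi.single j 2) s x‖ₑ := lintegral_finsetSum _ fun j _ =>
          (contDiff_planeDeriv _ s).continuous.measurable.enorm
    _ ≤ ∑ j : Fin 2, ofReal (planeConst (α + Pi.single j 2) *
          a ^ (-((α 0 + α 1 + 2 : ℕ) : ℝ) / 2)) := by
        refine Finset.sum_le_sum fun j _ => (lintegral_planeDeriv_le _ hs0).trans ?_
        rw [hdeg j]
        apply ofReal_le_ofReal
        refine mul_le_mul_of_nonneg_left ?_ (planeConst_nonneg _)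
        refine Real.rpow_le_rpow_of_nonpos ha hs.1 ?_
        have : (0 : ℝ) ≤ ((α 0 + α 1 + 2 : ℕ) : ℝ) := Nat.cast_nonneg _
        linarith
    _ = _ := by
        rw [← ENNReal.ofReal_sum_of_nonneg, Finset.sum_mul]
        intro j _
        exact mul_nonneg (planeConst_nonneg _) (by positivity)

theorem lintegral_planeDeriv_space_sub_le (α : Fin 2 → ℕ) {t : ℝ} (ht : 0 < t) (ξ : Plane) :
    ∫⁻ x, ‖planeDeriv α t (x + ξ) - planeDeriv α t x‖ₑ ≤
      ofReal (‖ξ‖ * ((∑ j : Fin 2, planeConst (α + Pi.single j 1)) *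
        t ^ (-((α 0 + α 1 + 1 : ℕ) : ℝ) / 2))) := by
  have h := lintegral_sub_le_of_hasDerivAt (ν := (volume : Measure Plane)) zero_le_one
    (u := fun s x => planeDeriv α t (x + s • ξ))
    (u' := fun s x => ∑ j : Fin 2, ξ j * planeDeriv (α + Pi.single j 1) t (x + s • ξ))
    (fun x s _ => hasDerivAt_planeDeriv_line α t x ξ s)
    (fun x => by
      refine Continuous.continuousOn (continuous_finsetSum _ fun j _ => ?_)
      exact continuous_const.mul ((contDiff_planeDeriv _ t).continuous.comp (by fun_prop)))
    (Finset.measurable_sum _ fun j _ => by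
      refine measurable_const.mul ((contDiff_planeDeriv _ t).continuous.measurable.comp ?_)
      fun_prop)
    (C := ofReal (‖ξ‖ * ((∑ j : Fin 2, planeConst (α + Pi.single j 1)) *
        t ^ (-((α 0 + α 1 + 1 : ℕ) : ℝ) / 2)))) ?_
  · simpa using h
  intro s _
  have hdeg : ∀ j : Fin 2, (α + Pi.single j 1 : Fin 2 → ℕ) 0 + (α + Pi.single j 1 : Fin 2 → ℕ) 1
      = α 0 + α 1 + 1 := by
    intro j; fin_cases j <;> simp <;> ring
  calc ∫⁻ x, ‖∑ j : Fin 2, ξ j * planeDeriv (α + Pi.single j 1) t (x + s • ξ)‖ₑ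
      ≤ ∫⁻ x, ∑ j : Fin 2, ofReal ‖ξ‖ * ‖planeDeriv (α + Pi.single j 1) t (x + s • ξ)‖ₑ := by
        refine lintegral_mono fun x => (enorm_sum_le _ _).trans (Finset.sum_le_sum fun j _ => ?_)
        rw [enorm_mul]
        gcongr
        rw [← ofReal_norm]
        exact ofReal_le_ofReal (PiLp.norm_apply_le ξ j)
    _ = ∑ j : Fin 2, ofReal ‖ξ‖ * ∫⁻ x, ‖planeDeriv (α + Pi.single j 1) t x‖ₑ := by
        rw [lintegral_finsetSum]
        · refine Finset.sum_congr rfl fun j _ => ?_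
          rw [lintegral_const_mul' _ _ ofReal_ne_top]
          congr 1
          exact lintegral_add_right_eq_self (μ := volume)
            (fun x : Plane => ‖planeDeriv (α + Pi.single j 1) t x‖ₑ) (s • ξ)
        · intro j _
          refine Measurable.const_mul (Measurable.enorm ?_) _
          exact (contDiff_planeDeriv _ t).continuous.measurable.comp (by fun_prop)
    _ ≤ ∑ j : Fin 2, ofReal ‖ξ‖ * ofReal (planeConst (α + Pi.single j 1) *
          t ^ (-((α 0 + α 1 + 1 : ℕ) : ℝ) / 2)) := by
        refine Finset.sum_le_sum fun j _ => ?_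
        gcongr
        refine (lintegral_planeDeriv_le _ ht).trans ?_
        rw [hdeg j]
    _ = _ := by
        rw [← Finset.mul_sum, ← ENNReal.ofReal_sum_of_nonneg, ← ofReal_mul (norm_nonneg _),
          Finset.sum_mul]
        intro j _
        exact mul_nonneg (planeConst_nonneg _) (by positivity)

/-- The kernel on `(z₀, z₁)` generated by the function `u` on `ℝ`: reflection at `z₀` (even for
`σ = 1`, odd for `σ = -1`), followed by periodization with period `2 (z₁ - z₀)`. -/
def reflKernel [Layer] (σ : ℝ) (u : ℝ → ℝ) (z ζ : ℝ) : ℝ :=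
  ∑' k : ℤ, (u (z - ζ - 2 * k * (z₁ - z₀)) + σ * u (z + ζ - 2 * z₀ - 2 * k * (z₁ - z₀)))

theorem neumannKernel_eq [Layer] (t z ζ : ℝ) :
    neumannKernel z₀ z₁ t z ζ = reflKernel 1 (gaussDeriv 0 t) z ζ := by
  simp only [neumannKernel, reflKernel, gaussDeriv_zero, one_mul]

theorem summable_exp_neg_mul_int_sq {c : ℝ} (hc : 0 < c) :
    Summable fun k : ℤ => exp (-c * (k : ℝ) ^ 2) := by
  refine Summable.of_norm_bounded_eventually ((Real.summable_one_div_int_pow.2 one_lt_two).mul_left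
    c⁻¹) ?_
  filter_upwards [eventually_cofinite_ne 0] with k hk
  rw [Real.norm_of_nonneg (Real.exp_nonneg _)]
  have hk2 : 0 < (k : ℝ) ^ 2 := by positivity
  have h2 := Real.add_one_le_exp (c * k ^ 2)
  rw [neg_mul, Real.exp_neg, one_div, ← mul_inv]
  bound

/-- The `k`-th term of `reflKernel` for `u = gaussDeriv n t` is bounded, uniformly for `t`, `z`
and `ζ` in bounded sets, by a summable sequence. -/
theorem exists_reflKernel_term_bound [Layer] (n : ℕ) {a b : ℝ} (ha : 0 < a)
    (hab : a ≤ b) (R : ℝ) : ∃ B : ℤ → ℝ, Summable B ∧ ∀ t ∈ Icc a b, ∀ r : ℝ, |r| ≤ R → ∀ k : ℤ,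
      |gaussDeriv n t (r - 2 * k * (z₁ - z₀))| ≤ B k := by
  obtain ⟨C, c, hC, hc, h⟩ := exists_gaussDeriv_local_bound n ha hab R
  have hh := sub_pos.2 hz
  refine ⟨fun k => C * exp (-(c * (4 * (z₁ - z₀) ^ 2)) * k ^ 2),
    (summable_exp_neg_mul_int_sq (by positivity)).mul_left C, fun t ht r hr k => ?_⟩
  have := h t ht r hr (-(2 * k * (z₁ - z₀)))
  grind

theorem summable_gaussDeriv_shift [Layer] (n : ℕ) (t r : ℝ) :
    Summable fun k : ℤ => gaussDeriv n t (r - 2 * k * (z₁ - z₀)) := by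
  rcases le_or_gt t 0 with ht | ht
  · simp only [gaussDeriv_of_nonpos n ht]; exact summable_zero
  · obtain ⟨B, hB, h⟩ := exists_reflKernel_term_bound n ht le_rfl |r|
    exact Summable.of_norm_bounded hB fun k => h t ⟨le_rfl, le_rfl⟩ r le_rfl k

theorem summable_reflKernel [Layer] (σ : ℝ) (n : ℕ) (t z ζ : ℝ) :
    Summable fun k : ℤ => (gaussDeriv n t (z - ζ - 2 * k * (z₁ - z₀)) +
      σ * gaussDeriv n t (z + ζ - 2 * z₀ - 2 * k * (z₁ - z₀))) :=
  (summable_gaussDeriv_shift n t _).add ((summable_gaussDeriv_shift n t _).mul_left σ)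

theorem exists_reflKernel_bound [Layer] (σ : ℝ) (n : ℕ) {a b : ℝ} (ha : 0 < a)
    (hab : a ≤ b) : ∃ M : ℝ, 0 ≤ M ∧ ∀ t ∈ Icc a b, ∀ z ∈ Icc z₀ z₁, ∀ ζ ∈ Icc z₀ z₁,
      |reflKernel σ (gaussDeriv n t) z ζ| ≤ M := by
  obtain ⟨B, hB, h⟩ := exists_reflKernel_term_bound n ha hab (2 * (z₁ - z₀))
  have hB0 := fun k => (abs_nonneg _).trans
    (h a ⟨le_rfl, hab⟩ 0 (by rw [abs_zero]; linarith [hz]) k)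
  refine ⟨∑' k, (B k + |σ| * B k), tsum_nonneg fun k => add_nonneg (hB0 k)
    (mul_nonneg (abs_nonneg _) (hB0 k)), fun t ht z hz' ζ hζ => ?_⟩
  have h1 : |z - ζ| ≤ 2 * (z₁ - z₀) := by
    grind
  have h2 : |z + ζ - 2 * z₀| ≤ 2 * (z₁ - z₀) := by
    grind
  have := tsum_of_norm_bounded (hB.add (hB.mul_left |σ|)).hasSum
    (f := fun k : ℤ => (gaussDeriv n t (z - ζ - 2 * k * (z₁ - z₀)) +
      σ * gaussDeriv n t (z + ζ - 2 * z₀ - 2 * k * (z₁ - z₀)))) fun k => by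
      refine (norm_add_le _ _).trans ?_
      rw [norm_mul]
      bound
  exact this

theorem measurable_reflKernel [Layer] (σ : ℝ) (n : ℕ) :
    Measurable fun r : ℝ × ℝ × ℝ => reflKernel σ (gaussDeriv n r.1) r.2.1 r.2.2 := by
  have hterm : ∀ k : ℤ, Measurable fun r : ℝ × ℝ × ℝ =>
      (gaussDeriv n r.1 (r.2.1 - r.2.2 - 2 * k * (z₁ - z₀)) +
      σ * gaussDeriv n r.1 (r.2.1 + r.2.2 - 2 * z₀ - 2 * k * (z₁ - z₀))) := by
    have hg := measurable_gaussDeriv n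
    fun_prop
  obtain ⟨e⟩ : Nonempty (ℕ ≃ ℤ) := ⟨Equiv.intEquivNat.symm⟩
  refine measurable_of_tendsto_metrizable (f := fun N r => ∑ i ∈ Finset.range N,
      (gaussDeriv n r.1 (r.2.1 - r.2.2 - 2 * (e i) * (z₁ - z₀)) +
      σ * gaussDeriv n r.1 (r.2.1 + r.2.2 - 2 * z₀ - 2 * (e i) * (z₁ - z₀))))
    (fun N => Finset.measurable_sum _ fun i _ => hterm (e i)) ?_
  rw [tendsto_pi_nhds]
  intro r
  exact ((e.hasSum_iff (f := fun k : ℤ =>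
    (gaussDeriv n r.1 (r.2.1 - r.2.2 - 2 * k * (z₁ - z₀)) +
      σ * gaussDeriv n r.1 (r.2.1 + r.2.2 - 2 * z₀ - 2 * k * (z₁ - z₀))))).2 ((summable_reflKernel
        σ n r.1 r.2.1 r.2.2).hasSum)).tendsto_sum_nat

theorem hasDerivAt_tsum_gaussDeriv [Layer] (n : ℕ) {t : ℝ} (ht : 0 < t) (r : ℝ) :
    HasDerivAt (fun r => ∑' k : ℤ, gaussDeriv n t (r - 2 * k * (z₁ - z₀)))
      (∑' k : ℤ, gaussDeriv (n + 1) t (r - 2 * k * (z₁ - z₀))) r := by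
  obtain ⟨B, hB, h⟩ := exists_reflKernel_term_bound (n + 1) ht le_rfl (|r| + 1)
  have hr : r ∈ Ioo (r - 1) (r + 1) := ⟨by linarith, by linarith⟩
  refine hasDerivAt_tsum_of_isPreconnected hB isOpen_Ioo isPreconnected_Ioo
   
    (g' := fun k : ℤ => fun r => gaussDeriv (n + 1) t (r - 2 * k * (z₁ - z₀)))
    (fun k y _ => ?_) (fun k y hy => ?_) hr (summable_gaussDeriv_shift n t r) hr
  · exact (hasDerivAt_gaussDeriv n t _).comp_sub_const y _
  · refine h t ⟨le_rfl, le_rfl⟩ y ?_ k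
    grind

theorem reflKernel_eq_add [Layer] (σ : ℝ) (n : ℕ) (t z ζ : ℝ) : reflKernel σ (gaussDeriv n t) z ζ =
      (∑' k : ℤ, gaussDeriv n t (z - ζ - 2 * k * (z₁ - z₀))) +
      σ * ∑' k : ℤ, gaussDeriv n t (z + ζ - 2 * z₀ - 2 * k * (z₁ - z₀)) := by
  rw [reflKernel, Summable.tsum_add (summable_gaussDeriv_shift n t _)
    ((summable_gaussDeriv_shift n t _).mul_left σ), tsum_mul_left]

theorem hasDerivAt_reflKernel_left [Layer] (σ : ℝ) (n : ℕ) {t : ℝ} (ht : 0 < t)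
    (z ζ : ℝ) : HasDerivAt (fun z => reflKernel σ (gaussDeriv n t) z ζ)
      (reflKernel σ (gaussDeriv (n + 1) t) z ζ) z := by
  simp only [reflKernel_eq_add]
  have h2 := (hasDerivAt_tsum_gaussDeriv n ht (z + (ζ - 2 * z₀))).comp_add_const z (ζ - 2 * z₀)
  simp only [← add_sub_assoc] at h2
  exact ((hasDerivAt_tsum_gaussDeriv n ht (z - ζ)).comp_sub_const z ζ).add (h2.const_mul σ)

theorem hasDerivAt_reflKernel_right [Layer] (σ : ℝ) (n : ℕ) {t : ℝ}
    (ht : 0 < t) (z ζ : ℝ) : HasDerivAt (fun ζ => reflKernel σ (gaussDeriv n t) z ζ)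
      (-reflKernel (-σ) (gaussDeriv (n + 1) t) z ζ) ζ := by
  simp only [reflKernel_eq_add]
  have h1 := (hasDerivAt_tsum_gaussDeriv n ht (z - ζ)).comp_const_sub z ζ
  have h2 := (hasDerivAt_tsum_gaussDeriv n ht ((z - 2 * z₀) + ζ)).comp_const_add (z - 2 * z₀) ζ
  have e : ∀ ζ : ℝ, z - 2 * z₀ + ζ = z + ζ - 2 * z₀ := fun ζ => by ring
  simp only [e] at h2
  refine (h1.add (h2.const_mul σ)).congr_deriv ?_
  ring

theorem hasDerivAt_reflKernel_time [Layer] (σ : ℝ) (n : ℕ) {t : ℝ} (ht : 0 < t)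
    (z ζ : ℝ) : HasDerivAt (fun t => reflKernel σ (gaussDeriv n t) z ζ)
      (reflKernel σ (gaussDeriv (n + 2) t) z ζ) t := by
  have key : ∀ r : ℝ, HasDerivAt (fun t => ∑' k : ℤ, gaussDeriv n t (r - 2 * k * (z₁ - z₀)))
      (∑' k : ℤ, gaussDeriv (n + 2) t (r - 2 * k * (z₁ - z₀))) t := by
    intro r
    obtain ⟨B, hB, h⟩ := exists_reflKernel_term_bound (n + 2) (half_pos ht)
      (by linarith : t / 2 ≤ 2 * t) |r|
    have htt : t ∈ Ioo (t / 2) (2 * t) := ⟨by linarith, by linarith⟩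
    exact hasDerivAt_tsum_of_isPreconnected hB isOpen_Ioo isPreconnected_Ioo
      (g := fun k : ℤ => fun t => gaussDeriv n t (r - 2 * k * (z₁ - z₀)))
      (g' := fun k : ℤ => fun t => gaussDeriv (n + 2) t (r - 2 * k * (z₁ - z₀)))
      (fun k s hs => hasDerivAt_gaussDeriv_time n (by linarith [hs.1]) _)
      (fun k s hs => h s ⟨hs.1.le, hs.2.le⟩ r le_rfl k) htt (summable_gaussDeriv_shift n t r) htt
  simp only [reflKernel_eq_add]
  exact (key _).add ((key _).const_mul σ)

/-- Unfolding: the integral over a period of the periodization. -/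
theorem lintegral_tsum_shift (v : ℝ → ℝ≥0∞) (hv : Measurable v) {H : ℝ} (hH : 0 < H) (c : ℝ) :
    ∫⁻ z in Ioc c (c + H), ∑' k : ℤ, v (z - k * H) = ∫⁻ y, v y := by
  rw [lintegral_tsum (f := fun (k : ℤ) (z : ℝ) => v (z - k * H))
    fun k => (hv.comp (measurable_id.sub_const _)).aemeasurable]
  rw [(isAddFundamentalDomain_Ioc hH c volume).lintegral_eq_tsum'' v]
  have hbij : Function.Bijective (fun k : ℤ => (⟨(-k) • H, -k, rfl⟩ : AddSubgroup.zmultiples H)) := by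
    constructor
    · intro k l hkl
      aesop
    · rintro ⟨x, k, rfl⟩
      exact ⟨-k, by simp⟩
  rw [← (Equiv.ofBijective _ hbij).tsum_eq]
  refine tsum_congr fun k => lintegral_congr fun z => ?_
  congr 1
  rw [Equiv.ofBijective_apply, AddSubgroup.vadd_def, vadd_eq_add]
  simp; ring

theorem lintegral_reflKernel_le [Layer] {σ : ℝ} (hσ : |σ| ≤ 1) {u : ℝ → ℝ}
    (hu : Measurable u) (ζ : ℝ) :
    ∫⁻ z in Ioo z₀ z₁, ‖reflKernel σ u z ζ‖ₑ ≤ 2 * ∫⁻ y, ‖u y‖ₑ := by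
  have hH : 0 < 2 * (z₁ - z₀) := by linarith [hz]
  have key : ∀ c : ℝ, ∫⁻ z in Ioo z₀ z₁, ∑' k : ℤ, ‖u (z + c - 2 * k * (z₁ - z₀))‖ₑ
      ≤ ∫⁻ y, ‖u y‖ₑ := by
    intro c
    have h := lintegral_tsum_shift (fun y => ‖u (y + c)‖ₑ) (hu.comp (by fun_prop)).enorm hH z₀
    rw [lintegral_add_right_eq_self (μ := volume) (fun y : ℝ => ‖u y‖ₑ) c] at h
    rw [← h]
    refine (lintegral_mono_set (fun z (hz' : z ∈ Ioo z₀ z₁) =>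
      (⟨hz'.1, by linarith [hz'.1, hz'.2]⟩ : z ∈ Ioc z₀ (z₀ + 2 * (z₁ - z₀))))).trans ?_
    refine le_of_eq (lintegral_congr fun z => tsum_congr fun k => ?_)
    congr 2; ring
  have hm : ∀ c : ℝ, Measurable fun z => ∑' k : ℤ, ‖u (z + c - 2 * k * (z₁ - z₀))‖ₑ := fun c =>
    Measurable.tsum fun k => (hu.comp (by fun_prop)).enorm
  calc ∫⁻ z in Ioo z₀ z₁, ‖reflKernel σ u z ζ‖ₑ
      ≤ ∫⁻ z in Ioo z₀ z₁, ((∑' k : ℤ, ‖u (z + (-ζ) - 2 * k * (z₁ - z₀))‖ₑ) +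
          ∑' k : ℤ, ‖u (z + (ζ - 2 * z₀) - 2 * k * (z₁ - z₀))‖ₑ) := by
        refine lintegral_mono fun z => ?_
        rw [← ENNReal.tsum_add]
        refine enorm_tsum_le_tsum_enorm.trans (ENNReal.tsum_le_tsum fun k => ?_)
        refine (enorm_add_le _ _).trans ?_
        rw [enorm_mul]
        have : ‖σ‖ₑ ≤ 1 := by
          solve_by_elim
        have e1 : z - ζ = z + (-ζ) := by ring
        have e2 : z + ζ - 2 * z₀ = z + (ζ - 2 * z₀) := by ring
        rw [e1, e2]
        gcongr
        exact mul_le_of_le_one_left' this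
    _ = _ + _ := lintegral_add_left (hm _) _
    _ ≤ _ := by rw [two_mul (∫⁻ y, ‖u y‖ₑ)]; exact add_le_add (key _) (key _)

theorem lintegral_reflKernel_gaussDeriv_le [Layer] {σ : ℝ} (hσ : |σ| ≤ 1)
    (n : ℕ) {t : ℝ} (ht : 0 < t) (ζ : ℝ) :
    ∫⁻ z in Ioo z₀ z₁, ‖reflKernel σ (gaussDeriv n t) z ζ‖ₑ ≤
      ofReal (2 * gaussConst n * t ^ (-(n : ℝ) / 2)) := by
  refine (lintegral_reflKernel_le hσ (contDiff_gaussDeriv n t).continuous.measurable ζ).trans ?_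
  rw [mul_assoc, ofReal_mul zero_le_two, ENNReal.ofReal_ofNat]
  gcongr
  exact lintegral_gaussDeriv_le n ht

theorem lintegral_gaussDeriv_time_sub_le (n : ℕ) {a b : ℝ} (ha : 0 < a) (hab : a ≤ b) :
    ∫⁻ y, ‖gaussDeriv n b y - gaussDeriv n a y‖ₑ ≤
      ofReal (gaussConst (n + 2) * a ^ (-((n + 2 : ℕ) : ℝ) / 2)) * ofReal (b - a) := by
  refine lintegral_sub_le_of_hasDerivAt hab (u := gaussDeriv n) (u' := gaussDeriv (n + 2))
    (fun y s hs => hasDerivAt_gaussDeriv_time n (ha.trans_le hs.1) y)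
    (fun y s hs => (hasDerivAt_gaussDeriv_time (n + 2)
      (ha.trans_le hs.1) y).continuousAt.continuousWithinAt)
    (measurable_gaussDeriv _) (fun s hs => (lintegral_gaussDeriv_le _ (ha.trans_le hs.1)).trans ?_)
  apply ofReal_le_ofReal
  refine mul_le_mul_of_nonneg_left ?_ (gaussConst_nonneg _)
  refine Real.rpow_le_rpow_of_nonpos ha hs.1 ?_
  grind

theorem lintegral_reflKernel_time_sub_le [Layer] {σ : ℝ} (hσ : |σ| ≤ 1)
    (n : ℕ) {a b : ℝ} (ha : 0 < a) (hab : a ≤ b) (ζ : ℝ) :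
    ∫⁻ z in Ioo z₀ z₁, ‖reflKernel σ (gaussDeriv n b) z ζ - reflKernel σ (gaussDeriv n a) z ζ‖ₑ ≤
      ofReal (2 * gaussConst (n + 2) * a ^ (-((n + 2 : ℕ) : ℝ) / 2)) * ofReal (b - a) := by
  have e : ∀ z, reflKernel σ (gaussDeriv n b) z ζ - reflKernel σ (gaussDeriv n a) z ζ
      = reflKernel σ (fun y => gaussDeriv n b y - gaussDeriv n a y) z ζ := by
    intro z
    unfold reflKernel
    rw [← Summable.tsum_sub (summable_reflKernel σ n b z ζ) (summable_reflKernel σ n a z ζ)]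
    grind
  simp only [e]
  refine (lintegral_reflKernel_le hσ ((contDiff_gaussDeriv n b).continuous.measurable.sub
    (contDiff_gaussDeriv n a).continuous.measurable) ζ).trans ?_
  rw [mul_assoc, ofReal_mul zero_le_two, ENNReal.ofReal_ofNat, mul_assoc]
  gcongr
  exact lintegral_gaussDeriv_time_sub_le n ha hab

section

variable {E E' : Type*} [NormedAddCommGroup E] [NormedSpace ℝ E] [NormedAddCommGroup E']
  [NormedSpace ℝ E']

/-- The integral operator on fields on the layer whose kernel is a convolution kernel `k` in the
horizontal variable times a kernel `m` in the vertical variable. -/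
def layerOp [Layer] (k : Plane → ℝ) (m : ℝ → ℝ → ℝ) (f : ℝ³ → E) (p : ℝ³) : E :=
  ∫ q in Ω, (k (p.1 - q.1) * m p.2 q.2) • f q

/-- The conditions on a pair of kernels under which `layerOp` is defined everywhere in the layer:
an integrable and continuous horizontal kernel and a bounded measurable vertical one. -/
structure Admissible [Layer] (k : Plane → ℝ) (m : ℝ → ℝ → ℝ) : Prop where
  measurable_left : Measurable k
  integrable_left : Integrable k
  measurable_right : Measurable (Function.uncurry m)
  bounded_right : ∃ M : ℝ, ∀ z ∈ Ioo z₀ z₁, ∀ ζ ∈ Ioo z₀ z₁, |m z ζ| ≤ M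

variable [Layer] {k k' : Plane → ℝ} {m m' : ℝ → ℝ → ℝ} {f g : ℝ³ → E}

theorem Admissible.measurable_kernel (h : Admissible k m) :
    Measurable fun r : ℝ³ × ℝ³ => k (r.1.1 - r.2.1) * m r.1.2 r.2.2 :=
  (h.measurable_left.comp (by fun_prop)).mul
    (h.measurable_right.comp (f := fun r : ℝ³ × ℝ³ => (r.1.2, r.2.2)) (by fun_prop))

theorem Admissible.integrable (h : Admissible k m) (hf : MemL f) {p : ℝ³} (hp : p ∈ Ω) :
    Integrable (fun q => (k (p.1 - q.1) * m p.2 q.2) • f q) μΩ := by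
  obtain ⟨M, hM⟩ := h.bounded_right
  refine hf.integrable_smul (k := fun y => |k (p.1 - y)| * M) ?_ ?_ ?_ ?_
  · exact (h.measurable_kernel.comp (measurable_const.prodMk measurable_id)).aestronglyMeasurable
  · exact ((h.integrable_left.comp_sub_left p.1).abs).mul_const M
  · exact ((h.measurable_left.comp (by fun_prop)).abs).mul_const M
  · intro q hq
    rw [abs_mul]
    exact mul_le_mul_of_nonneg_left (hM _ hp.2 _ hq.2) (abs_nonneg _)

theorem lintegral_kernel_le (hk : Measurable k) (hm : Measurable (Function.uncurry m)) {M : ℝ≥0∞}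
    (hM : ∀ ζ ∈ Ioo z₀ z₁, ∫⁻ z in Ioo z₀ z₁, ‖m z ζ‖ₑ ≤ M)
    (hf : AEStronglyMeasurable f μΩ) (x : Plane) :
    ∫⁻ z in Ioo z₀ z₁, ∫⁻ q in Ω, ‖(k (x - q.1) * m z q.2) • f q‖ₑ ≤
      (∫⁻ y, ‖k y‖ₑ) * M * nrm f := by
  have hk2 : Measurable fun y => ‖k (x - y)‖ₑ := (hk.comp (by fun_prop)).enorm
  have hmeas : AEMeasurable (Function.uncurry fun (z : ℝ) (q : ℝ³) =>
      ‖(k (x - q.1) * m z q.2) • f q‖ₑ)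
      ((volume.restrict (Ioo z₀ z₁)).prod μΩ) := by
    refine AEStronglyMeasurable.enorm (AEStronglyMeasurable.smul ?_ hf.comp_snd)
    refine Measurable.aestronglyMeasurable ((hk.comp (by fun_prop)).mul ?_)
    exact hm.comp (f := fun r : ℝ × ℝ³ => (r.1, r.2.2)) (by fun_prop)
  rw [lintegral_lintegral_swap hmeas]
  calc ∫⁻ q in Ω, ∫⁻ z in Ioo z₀ z₁, ‖(k (x - q.1) * m z q.2) • f q‖ₑ
      ≤ ∫⁻ q in Ω, M * (‖k (x - q.1)‖ₑ * ‖f q‖ₑ) := by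
        refine setLIntegral_mono_ae' measurableSet_layer (ae_of_all _ fun q hq => ?_)
        have : ∀ z, ‖(k (x - q.1) * m z q.2) • f q‖ₑ =
            ‖m z q.2‖ₑ * (‖k (x - q.1)‖ₑ * ‖f q‖ₑ) := fun z => by
          rw [enorm_smul, enorm_mul]; ring
        simp only [this]
        rw [lintegral_mul_const' _ _ (ENNReal.mul_ne_top enorm_ne_top enorm_ne_top)]
        gcongr
        exact hM _ hq.2
    _ = M * ∫⁻ q in Ω, ‖k (x - q.1)‖ₑ * ‖f q‖ₑ :=
        lintegral_const_mul'' _ ((hk2.comp measurable_fst).aemeasurable.mul hf.enorm)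
    _ ≤ M * ((∫⁻ y, ‖k (x - y)‖ₑ) * nrm f) := by
        gcongr
        exact lintegral_weight_le hf hk2 fun _ => enorm_ne_top
    _ = _ := by rw [lintegral_sub_left_eq_self (fun y => ‖k y‖ₑ) x]; ring

theorem sliceNorm_layerOp_le (hk : Measurable k) (hm : Measurable (Function.uncurry m)) {M : ℝ≥0∞}
    (hM : ∀ ζ ∈ Ioo z₀ z₁, ∫⁻ z in Ioo z₀ z₁, ‖m z ζ‖ₑ ≤ M)
    (hf : AEStronglyMeasurable f μΩ) (x : Plane) :
    sliceNorm (layerOp k m f) x ≤ (∫⁻ y, ‖k y‖ₑ) * M * nrm f :=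
  (lintegral_mono fun _ => enorm_integral_le_lintegral_enorm _).trans
    (lintegral_kernel_le hk hm hM hf x)

theorem layerOp_congr (h : f =ᵐ[μΩ] g) : layerOp k m f = layerOp k m g := by
  funext p
  exact integral_congr_ae (h.mono fun q hq => by simp only [hq])

/-- Joint measurability of `layerOp` in a parameter and the point. -/
theorem stronglyMeasurable_layerOp_param {X : Type*} [MeasurableSpace X] {k : X → Plane → ℝ}
    (hk : Measurable fun r : X × Plane => k r.1 r.2) {m : X → ℝ → ℝ → ℝ}
    (hm : Measurable fun r : X × ℝ × ℝ => m r.1 r.2.1 r.2.2) {f : X → ℝ³ → E}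
    (hf : StronglyMeasurable fun r : X × ℝ³ => f r.1 r.2) :
    StronglyMeasurable fun r : X × ℝ³ => layerOp (k r.1) (m r.1) (f r.1) r.2 := by
  unfold layerOp
  refine StronglyMeasurable.integral_prod_right' (f := fun r : (X × ℝ³) × ℝ³ =>
      (k r.1.1 (r.1.2.1 - r.2.1) * m r.1.1 r.1.2.2 r.2.2) • f r.1.1 r.2) ?_
  refine StronglyMeasurable.smul (Measurable.stronglyMeasurable (Measurable.mul ?_ ?_)) ?_
  · exact hk.comp (f := fun r : (X × ℝ³) × ℝ³ => (r.1.1, r.1.2.1 - r.2.1)) (by fun_prop)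
  · exact hm.comp (f := fun r : (X × ℝ³) × ℝ³ => (r.1.1, r.1.2.2, r.2.2)) (by fun_prop)
  · exact hf.comp_measurable (g := fun r : (X × ℝ³) × ℝ³ => (r.1.1, r.2)) (by fun_prop)

theorem stronglyMeasurable_layerOp (h : Admissible k m) (hf : AEStronglyMeasurable f μΩ) :
    StronglyMeasurable (layerOp k m f) := by
  rw [layerOp_congr hf.ae_eq_mk]
  have := stronglyMeasurable_layerOp_param (X := Unit) (k := fun _ => k)
    (h.measurable_left.comp measurable_snd) (m := fun _ => m)
    (h.measurable_right.comp measurable_snd) (f := fun _ => hf.mk f)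
    (hf.stronglyMeasurable_mk.comp_measurable measurable_snd)
  exact this.comp_measurable (g := fun p : ℝ³ => ((), p)) (by fun_prop)

theorem Admissible.exists_slice_bound (h : Admissible k m) : ∃ M : ℝ≥0∞, M < ∞ ∧
    ∀ ζ ∈ Ioo z₀ z₁, ∫⁻ z in Ioo z₀ z₁, ‖m z ζ‖ₑ ≤ M := by
  obtain ⟨M, hM⟩ := h.bounded_right
  refine ⟨ofReal M * ofReal (z₁ - z₀), mul_lt_top ofReal_lt_top ofReal_lt_top, fun ζ hζ => ?_⟩
  calc ∫⁻ z in Ioo z₀ z₁, ‖m z ζ‖ₑ ≤ ∫⁻ _ in Ioo z₀ z₁, ofReal M := by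
        refine setLIntegral_mono measurable_const fun z hz => ?_
        rw [← ofReal_norm]
        exact ofReal_le_ofReal (hM z hz ζ hζ)
    _ = _ := by rw [setLIntegral_const, Real.volume_Ioo]

theorem Admissible.memLinf (h : Admissible k m) (hf : MemL f) : MemL (layerOp k m f) := by
  obtain ⟨M, hM0, hM⟩ := h.exists_slice_bound
  refine ⟨(stronglyMeasurable_layerOp h hf.1).aestronglyMeasurable, ?_⟩
  refine (normInfOne_le (ae_of_all _
    (sliceNorm_layerOp_le h.measurable_left h.measurable_right hM hf.1))).trans_lt ?_
  exact mul_lt_top (mul_lt_top h.integrable_left.2 hM0) hf.2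

theorem layerOp_sub (h : Admissible k m) (hf : MemL f) (hg : MemL g) {p : ℝ³} (hp : p ∈ Ω) :
    layerOp k m (f - g) p = layerOp k m f p - layerOp k m g p := by
  unfold layerOp
  rw [← integral_sub (h.integrable hf hp) (h.integrable hg hp)]
  simp only [Pi.sub_apply, smul_sub]

theorem layerOp_sub_left (h : Admissible k m) (h' : Admissible k' m)
    (hf : MemL f) {p : ℝ³} (hp : p ∈ Ω) :
    layerOp (k - k') m f p = layerOp k m f p - layerOp k' m f p := by
  unfold layerOp
  rw [← integral_sub (h.integrable hf hp) (h'.integrable hf hp)]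
  simp only [Pi.sub_apply, sub_mul, sub_smul]

theorem layerOp_sub_right (h : Admissible k m) (h' : Admissible k m')
    (hf : MemL f) {p : ℝ³} (hp : p ∈ Ω) :
    layerOp k (m - m') f p = layerOp k m f p - layerOp k m' f p := by
  unfold layerOp
  rw [← integral_sub (h.integrable hf hp) (h'.integrable hf hp)]
  simp only [Pi.sub_apply, mul_sub, sub_smul]

theorem layerOp_clm [CompleteSpace E] [CompleteSpace E'] (h : Admissible k m)
    (hf : MemL f) (L : E →L[ℝ] E') {p : ℝ³} (hp : p ∈ Ω) :
    layerOp k m (fun q => L (f q)) p = L (layerOp k m f p) := by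
  unfold layerOp
  rw [← L.integral_comp_comm (h.integrable hf hp)]
  simp only [map_smul]

/-- Fubini's theorem for `layerOp` tested against a weighted function. -/
theorem integral_smul_layerOp [CompleteSpace E] (h : Admissible k m) (hf : MemL f)
    {φ : ℝ³ → ℝ} (hφ : Measurable φ) {K : Plane → ℝ≥0∞} (hK : IsWeight K)
    (hb : ∀ p, ‖φ p‖ₑ ≤ K p.1) :
    Integrable (fun q => (∫ p in Ω, φ p * (k (p.1 - q.1) * m p.2 q.2)) • f q)
      μΩ ∧ ∫ p in Ω, φ p • layerOp k m f p =
      ∫ q in Ω, (∫ p in Ω, φ p * (k (p.1 - q.1) * m p.2 q.2)) • f q := by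
  obtain ⟨M, hM0, hM⟩ := h.exists_slice_bound
  have hKm := hK.measurable
  have hsm : AEStronglyMeasurable (Function.uncurry fun (p q : ℝ³) =>
      φ p • ((k (p.1 - q.1) * m p.2 q.2) • f q))
      ((μΩ).prod μΩ) := by
    refine AEStronglyMeasurable.smul (hφ.comp measurable_fst).aestronglyMeasurable ?_
    exact AEStronglyMeasurable.smul h.measurable_kernel.aestronglyMeasurable hf.1.comp_snd
  have hint : Integrable (Function.uncurry fun (p q : ℝ³) =>
      φ p • ((k (p.1 - q.1) * m p.2 q.2) • f q))
      ((μΩ).prod μΩ) := by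
    refine ⟨hsm, ?_⟩
    rw [HasFiniteIntegral, lintegral_prod _ hsm.enorm]
    have hmi : AEMeasurable (fun p : ℝ³ => ∫⁻ q in Ω, ‖(k (p.1 - q.1) * m p.2 q.2) • f q‖ₑ) μΩ := by
      have : AEStronglyMeasurable (Function.uncurry fun (p q : ℝ³) =>
        (k (p.1 - q.1) * m p.2 q.2) • f q)
        ((μΩ).prod μΩ) :=
        AEStronglyMeasurable.smul h.measurable_kernel.aestronglyMeasurable hf.1.comp_snd
      exact this.enorm.lintegral_prod_right'
    calc ∫⁻ p in Ω, ∫⁻ q in Ω,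
          ‖φ p • ((k (p.1 - q.1) * m p.2 q.2) • f q)‖ₑ
        ≤ ∫⁻ p in Ω, K p.1 * ∫⁻ q in Ω, ‖(k (p.1 - q.1) * m p.2 q.2) • f q‖ₑ := by
          refine lintegral_mono fun p => ?_
          simp only [enorm_smul (φ p)]
          rw [lintegral_const_mul' _ _ enorm_ne_top]
          gcongr
          exact hb p
      _ ≤ ∫⁻ x, K x * ((∫⁻ y, ‖k y‖ₑ) * M * nrm f) := by
          refine (lintegral_layer ((hKm.comp measurable_fst).aemeasurable.mul hmi)).trans_le ?_
          refine lintegral_mono fun x => ?_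
          refine (lintegral_const_mul' _ _ (hK.ne_top x)).trans_le ?_
          gcongr
          exact lintegral_kernel_le h.measurable_left h.measurable_right hM hf.1 x
      _ < ∞ := by
          rw [lintegral_mul_const _ hKm]
          exact mul_lt_top hK.lintegral_lt_top (mul_lt_top
            (mul_lt_top h.integrable_left.2 hM0) hf.2)
  refine ⟨hint.integral_prod_right.congr (ae_of_all _ fun q => ?_), ?_⟩
  · simp only [Function.uncurry, smul_smul]
    rw [integral_smul_const]
  calc ∫ p in Ω, φ p • layerOp k m f p
      = ∫ p in Ω, ∫ q in Ω, φ p • ((k (p.1 - q.1) * m p.2 q.2) • f q) := by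
        refine integral_congr_ae (ae_of_all _ fun p => ?_)
        simp only [layerOp, integral_smul]
    _ = ∫ q in Ω, ∫ p in Ω, φ p • ((k (p.1 - q.1) * m p.2 q.2) • f q) := integral_integral_swap hint
    _ = _ := by
        refine integral_congr_ae (ae_of_all _ fun q => ?_)
        simp only [smul_smul]
        rw [integral_smul_const]

/-- Differentiation of `layerOp` under the integral, in the weak sense. -/
theorem weakDeriv_layerOp [CompleteSpace E] (h : Admissible k m)
    (h' : Admissible k' m') (hf : MemL f) {i : Fin 3}
    (hk : Continuous k) (hk' : Continuous k') (hm : ∀ ζ, Continuous fun z => m z ζ)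
    (hm' : ∀ ζ, Continuous fun z => m' z ζ)
    (hd : ∀ p q : ℝ³, HasLineDerivAt ℝ (fun p : ℝ³ => k (p.1 - q.1) * m p.2 q.2)
      (k' (p.1 - q.1) * m' p.2 q.2) p (dir i)) :
    WeakDeriv i (layerOp k m f) (layerOp k' m' f) := by
  intro φ h1 h2 h3
  obtain ⟨K, hK, hKb⟩ := exists_isWeight (continuous_dirDeriv h1 (dir i))
    (hasCompactSupport_dirDeriv h2 _)
  obtain ⟨K', hK', hKb'⟩ := exists_isWeight h1.continuous h2
  rw [(integral_smul_layerOp h hf (continuous_dirDeriv h1 _).measurable hK hKb).2,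
    (integral_smul_layerOp h' hf h1.continuous.measurable hK' hKb').2, ← integral_neg]
  refine integral_congr_ae (ae_of_all _ fun q => ?_)
  simp only
  rw [← neg_smul]
  congr 1
  have hc1 : Continuous fun p : ℝ³ => k (p.1 - q.1) * m p.2 q.2 :=
    (hk.comp (by fun_prop)).mul ((hm q.2).comp continuous_snd)
  have hc2 : Continuous fun p : ℝ³ => k' (p.1 - q.1) * m' p.2 q.2 :=
    (hk'.comp (by fun_prop)).mul ((hm' q.2).comp continuous_snd)
  have hd1 := continuous_dirDeriv h1 (dir i)
  have hs1 := hasCompactSupport_dirDeriv h2 (dir i)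
  have hset : ∀ ψ : ℝ³ → ℝ, (∀ p, p ∉ tsupport φ → ψ p = 0) →
      ∫ p in Ω, ψ p = ∫ p, ψ p := fun ψ hψ =>
    setIntegral_eq_integral_of_forall_compl_eq_zero fun p hp => hψ p fun hh => hp (h3 hh)
  have hz1 : ∀ p, p ∉ tsupport φ → φ p = 0 := fun p hp => image_eq_zero_of_notMem_tsupport hp
  have hz2 : ∀ p, p ∉ tsupport φ → fderiv ℝ φ p (dir i) = 0 := fun p hp => by
    rw [image_eq_zero_of_notMem_tsupport (fun hh => hp (tsupport_fderiv_subset ℝ hh))]; rfl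
  rw [hset _ fun p hp => by rw [hz2 p hp, zero_mul], hset _ fun p hp => by rw [hz1 p hp, zero_mul]]
  have key := integral_bilinear_hasLineDerivAt_right_eq_neg_left_of_integrable
    (μ := (volume : Measure ℝ³)) (B := ContinuousLinearMap.mul ℝ ℝ) (v := dir i)
    (f := fun p : ℝ³ => k (p.1 - q.1) * m p.2 q.2)
    (f' := fun p : ℝ³ => k' (p.1 - q.1) * m' p.2 q.2)
    (g := φ) (g' := fun p => fderiv ℝ φ p (dir i))
    ((hc2.mul h1.continuous).integrable_of_hasCompactSupport h2.mul_left)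
    ((hc1.mul hd1).integrable_of_hasCompactSupport hs1.mul_left)
    ((hc1.mul h1.continuous).integrable_of_hasCompactSupport h2.mul_left)
    (fun p _ => hd p q)
    (fun p _ => ((h1.differentiable (by simp)) p).hasFDerivAt.hasLineDerivAt _)
  simp only [ContinuousLinearMap.mul_apply'] at key
  simp only [mul_comm (φ _), mul_comm (fderiv ℝ φ _ _)]
  exact key

end

section

variable {E E' : Type*} [NormedAddCommGroup E] [NormedSpace ℝ E] [NormedAddCommGroup E']
  [NormedSpace ℝ E'] [Layer]
  {S : Type*} [MeasurableSpace S] {ν : Measure S} [SFinite ν] {U W : S → ℝ³ → E}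

theorem measurable_sliceNorm_param (hW : StronglyMeasurable fun r : S × ℝ³ => W r.1 r.2) :
    Measurable fun r : S × Plane => sliceNorm (W r.1) r.2 := by
  unfold sliceNorm
  refine Measurable.lintegral_prod_right'
    (f := fun r : (S × Plane) × ℝ => ‖W r.1.1 (r.1.2, r.2)‖ₑ) ?_
  exact (hW.comp_measurable (g := fun r : (S × Plane) × ℝ => (r.1.1, (r.1.2, r.2)))
    (by fun_prop)).enorm

theorem lintegral_slice_param (hW : StronglyMeasurable fun r : S × ℝ³ => W r.1 r.2)
    (x : Plane) : ∫⁻ z in Ioo z₀ z₁, ∫⁻ s, ‖W s (x, z)‖ₑ ∂ν = ∫⁻ s, sliceNorm (W s) x ∂ν := by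
  refine lintegral_lintegral_swap ?_
  exact (hW.comp_measurable (g := fun r : ℝ × S => (r.2, (x, r.1)))
    (by fun_prop)).enorm.aemeasurable

/-- Minkowski's integral inequality on the vertical line above `x`. -/
theorem sliceNorm_integral_le (hW : StronglyMeasurable fun r : S × ℝ³ => W r.1 r.2) (x : Plane) :
    sliceNorm (fun p => ∫ s, W s p ∂ν) x ≤ ∫⁻ s, sliceNorm (W s) x ∂ν := by
  rw [← lintegral_slice_param hW x]
  exact lintegral_mono fun z => enorm_integral_le_lintegral_enorm _

theorem ae_integrable_slice_param (hW : StronglyMeasurable fun r : S × ℝ³ => W r.1 r.2) {x : Plane}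
    (h : ∫⁻ s, sliceNorm (W s) x ∂ν < ∞) :
    ∀ᵐ z ∂(volume.restrict (Ioo z₀ z₁)), Integrable (fun s => W s (x, z)) ν := by
  rw [← lintegral_slice_param hW x] at h
  have hm : Measurable fun z => ∫⁻ s, ‖W s (x, z)‖ₑ ∂ν := by
    refine Measurable.lintegral_prod_right' (f := fun r : ℝ × S => ‖W r.2 (x, r.1)‖ₑ) ?_
    exact (hW.comp_measurable (g := fun r : ℝ × S => (r.2, (x, r.1))) (by fun_prop)).enorm
  filter_upwards [ae_lt_top hm h.ne] with z hz
  exact ⟨(hW.comp_measurable (g := fun s : S => (s, (x, z)))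
    (by fun_prop)).aestronglyMeasurable, hz⟩

theorem ae_ae_sliceNorm_le (hW : StronglyMeasurable fun r : S × ℝ³ => W r.1 r.2)
    {γ : S → ℝ≥0∞} (hγm : Measurable γ) (hγ : ∀ᵐ s ∂ν, nrm (W s) ≤ γ s) :
    ∀ᵐ x : Plane, ∀ᵐ s ∂ν, sliceNorm (W s) x ≤ γ s := by
  have hset : MeasurableSet {r : S × Plane | sliceNorm (W r.1) r.2 ≤ γ r.1} :=
    measurableSet_le (measurable_sliceNorm_param hW) (hγm.comp measurable_fst)
  refine (Measure.ae_ae_comm (p := fun s x => sliceNorm (W s) x ≤ γ s) hset).1 ?_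
  filter_upwards [hγ] with s hs
  filter_upwards [sliceNorm_le_normInfOne (W s)] with x hx
  exact hx.trans hs

/-- Minkowski's integral inequality in `L^∞(L¹)`. -/
theorem normInfOne_integral_le (hW : StronglyMeasurable fun r : S × ℝ³ => W r.1 r.2)
    {γ : S → ℝ≥0∞} (hγm : Measurable γ) (hγ : ∀ᵐ s ∂ν, nrm (W s) ≤ γ s) :
    nrm (fun p => ∫ s, W s p ∂ν) ≤ ∫⁻ s, γ s ∂ν := by
  refine normInfOne_le ?_
  filter_upwards [ae_ae_sliceNorm_le hW hγm hγ] with x hx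
  exact (sliceNorm_integral_le hW x).trans (lintegral_mono_ae hx)

theorem ae_layer_of_slice {P : ℝ³ → Prop} (hP : MeasurableSet {p | P p})
    (h : ∀ᵐ x : Plane, ∀ᵐ z ∂(volume.restrict (Ioo z₀ z₁)), P (x, z)) :
    ∀ᵐ p ∂μΩ, P p := by
  rw [volume_restrict_layer]
  exact (Measure.ae_prod_mem_iff_ae_ae_mem hP).2 h

theorem ae_integrable_param (hW : StronglyMeasurable fun r : S × ℝ³ => W r.1 r.2)
    {γ : S → ℝ≥0∞} (hγm : Measurable γ) (hγ : ∀ᵐ s ∂ν, nrm (W s) ≤ γ s)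
    (hfin : ∫⁻ s, γ s ∂ν < ∞) :
    ∀ᵐ p ∂μΩ, Integrable (fun s => W s p) ν := by
  refine ae_layer_of_slice ?_ ?_
  · exact measurableSet_integrable (f := fun p s => W s p) (hW.comp_measurable measurable_swap)
  · filter_upwards [ae_ae_sliceNorm_le hW hγm hγ] with x hx
    exact ae_integrable_slice_param hW ((lintegral_mono_ae hx).trans_lt hfin)

theorem stronglyMeasurable_integral_param (hW : StronglyMeasurable fun r : S × ℝ³ => W r.1 r.2) :
    StronglyMeasurable fun p => ∫ s, W s p ∂ν :=
  StronglyMeasurable.integral_prod_right' (f := fun r : ℝ³ × S => W r.2 r.1)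
    (hW.comp_measurable measurable_swap)

theorem memLinf_integral (hW : StronglyMeasurable fun r : S × ℝ³ => W r.1 r.2)
    {γ : S → ℝ≥0∞} (hγm : Measurable γ) (hγ : ∀ᵐ s ∂ν, nrm (W s) ≤ γ s)
    (hfin : ∫⁻ s, γ s ∂ν < ∞) : MemL fun p => ∫ s, W s p ∂ν :=
  ⟨(stronglyMeasurable_integral_param hW).aestronglyMeasurable,
    (normInfOne_integral_le hW hγm hγ).trans_lt hfin⟩

theorem integral_smul_integral_param [CompleteSpace E]
    (hW : StronglyMeasurable fun r : S × ℝ³ => W r.1 r.2)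
    {γ : S → ℝ≥0∞} (hγm : Measurable γ) (hγ : ∀ᵐ s ∂ν, nrm (W s) ≤ γ s)
    (hfin : ∫⁻ s, γ s ∂ν < ∞) {φ : ℝ³ → ℝ} (hφ : Measurable φ) {K : Plane → ℝ≥0∞}
    (hK : IsWeight K) (hb : ∀ p, ‖φ p‖ₑ ≤ K p.1) :
    ∫ p in Ω, φ p • ∫ s, W s p ∂ν = ∫ s, (∫ p in Ω, φ p • W s p) ∂ν := by
  have hsm : StronglyMeasurable (Function.uncurry fun (s : S) (p : ℝ³) => φ p • W s p) :=
    StronglyMeasurable.smul (hφ.comp measurable_snd).stronglyMeasurable hW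
  have hint : Integrable (Function.uncurry fun (s : S) (p : ℝ³) => φ p • W s p) (ν.prod μΩ) := by
    refine ⟨hsm.aestronglyMeasurable, ?_⟩
    rw [HasFiniteIntegral, lintegral_prod _ hsm.aestronglyMeasurable.enorm]
    calc ∫⁻ s, (∫⁻ p in Ω, ‖φ p • W s p‖ₑ) ∂ν
        ≤ ∫⁻ s, (∫⁻ x, K x) * γ s ∂ν := by
          refine lintegral_mono_ae ?_
          filter_upwards [hγ] with s hs
          calc ∫⁻ p in Ω, ‖φ p • W s p‖ₑ
              ≤ ∫⁻ p in Ω, K p.1 * ‖W s p‖ₑ := by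
                refine lintegral_mono fun p => ?_
                rw [enorm_smul]
                gcongr
                exact hb p
            _ ≤ (∫⁻ x, K x) * nrm (W s) :=
                lintegral_weight_le (hW.comp_measurable (g := fun p : ℝ³ => (s, p))
                  (by fun_prop)).aestronglyMeasurable hK.measurable hK.ne_top
            _ ≤ _ := by gcongr
      _ < ∞ := by
          rw [lintegral_const_mul _ hγm]
          exact mul_lt_top hK.lintegral_lt_top hfin
  rw [integral_integral_swap hint]
  refine integral_congr_ae (ae_of_all _ fun p => ?_)
  simp only [integral_smul]

/-- Weak derivatives commute with integration in a parameter. -/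
theorem weakDeriv_integral [CompleteSpace E] {i : Fin 3}
    (hU : StronglyMeasurable fun r : S × ℝ³ => U r.1 r.2)
    (hW : StronglyMeasurable fun r : S × ℝ³ => W r.1 r.2)
    {γ γ' : S → ℝ≥0∞} (hγm : Measurable γ) (hγ : ∀ᵐ s ∂ν, nrm (U s) ≤ γ s)
    (hfin : ∫⁻ s, γ s ∂ν < ∞)
    (hγm' : Measurable γ') (hγ' : ∀ᵐ s ∂ν, nrm (W s) ≤ γ' s)
    (hfin' : ∫⁻ s, γ' s ∂ν < ∞) (hd : ∀ᵐ s ∂ν, WeakDeriv i (U s) (W s)) :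
    WeakDeriv i (fun p => ∫ s, U s p ∂ν) (fun p => ∫ s, W s p ∂ν) := by
  intro φ h1 h2 h3
  obtain ⟨K, hK, hKb⟩ := exists_isWeight (continuous_dirDeriv h1 (dir i))
    (hasCompactSupport_dirDeriv h2 _)
  obtain ⟨K', hK', hKb'⟩ := exists_isWeight h1.continuous h2
  rw [integral_smul_integral_param hU hγm hγ hfin (continuous_dirDeriv h1 _).measurable hK hKb,
    integral_smul_integral_param hW hγm' hγ' hfin' h1.continuous.measurable hK' hKb',
    ← integral_neg]
  refine integral_congr_ae ?_
  filter_upwards [hd] with s hs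
  exact hs φ h1 h2 h3

theorem WeakDeriv.clm [CompleteSpace E] [CompleteSpace E'] {i : Fin 3} {f g : ℝ³ → E}
    (h : WeakDeriv i f g) (hf : MemL f) (hg : MemL g) (L : E →L[ℝ] E') :
    WeakDeriv i (fun p => L (f p)) (fun p => L (g p)) := by
  intro φ h1 h2 h3
  have e1 := L.integral_comp_comm
    (hf.integrable_test_smul (continuous_dirDeriv h1 (dir i)) (hasCompactSupport_dirDeriv h2 _))
  have e2 := L.integral_comp_comm (hg.integrable_test_smul h1.continuous h2)
  simp only [map_smul] at e1 e2
  rw [e1, e2, h φ h1 h2 h3, map_neg]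

omit [NormedSpace ℝ E] [NormedSpace ℝ E'] in
theorem normInfOne_le_mul {f : ℝ³ → E} {g : ℝ³ → E'} (C : ℝ≥0) (h : ∀ᵐ p ∂μΩ, ‖g p‖ₑ ≤ C * ‖f p‖ₑ) :
    nrm g ≤ C * nrm f := by
  refine normInfOne_le ?_
  filter_upwards [ae_slice h, sliceNorm_le_normInfOne f] with x h1 h2
  calc sliceNorm g x ≤ ∫⁻ z in Ioo z₀ z₁, C * ‖f (x, z)‖ₑ := lintegral_mono_ae h1
    _ = C * sliceNorm f x := lintegral_const_mul' _ _ ENNReal.coe_ne_top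
    _ ≤ _ := by gcongr

end

section

variable {𝕜 : Type*} [RCLike 𝕜] {E : Type*} [NormedAddCommGroup E] [NormedSpace ℝ E]
  [NormedSpace 𝕜 E] [Layer]

/-- The product rule for absolutely continuous functions, in integrated form. -/
theorem setIntegral_product_rule [CompleteSpace E] {a b : ℝ} {α : ℝ → 𝕜} {β : ℝ → E}
    (hα : IntegrableOn α (Ioc a b)) (hβ : IntegrableOn β (Ioc a b)) (A : 𝕜) (B : E) :
    (A + ∫ σ in Ioc a b, α σ) • (B + ∫ σ in Ioc a b, β σ) - A • B =
      ∫ σ in Ioc a b, (α σ • (B + ∫ ρ in Ioc a σ, β ρ) + (A + ∫ ρ in Ioc a σ, α ρ) • β σ) := by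
  set μ := (volume : Measure ℝ).restrict (Ioc a b) with hμ
  set F : ℝ × ℝ → E := fun r => α r.1 • β r.2
  set S := {r : ℝ × ℝ | r.2 ≤ r.1}
  have hS : MeasurableSet S := measurableSet_le measurable_snd measurable_fst
  have hF : Integrable F (μ.prod μ) := hα.smul_prod hβ
  have e1 : ∀ σ, ∫ ρ, S.indicator F (σ, ρ) ∂μ = α σ • ∫ ρ in Iic σ, β ρ ∂μ := fun σ => by
    rw [← integral_smul, ← integral_indicator measurableSet_Iic]; rfl
  have e2 : ∀ σ, ∫ ρ, Sᶜ.indicator F (ρ, σ) ∂μ = (∫ ρ in (Ici σ)ᶜ, α ρ ∂μ) • β σ := fun σ => by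
    rw [← integral_smul_const, ← integral_indicator measurableSet_Ici.compl]; rfl
  have h1 := (hF.indicator hS).integral_prod_left
  have h2 := (hF.indicator hS.compl).integral_prod_right
  have key := integral_add_compl hS hF
  rw [← integral_indicator hS, ← integral_indicator hS.compl, integral_prod _ (hF.indicator hS),
    integral_prod_symm _ (hF.indicator hS.compl), integral_prod_smul] at key
  simp only [e1, e2] at h1 h2 key
  have h3 : Integrable (fun σ => α σ • B) μ := hα.smul_const B
  have h4 : Integrable (fun σ => A • β σ) μ := hβ.smul A
  have e : ∫ σ in Ioc a b, (α σ • (B + ∫ ρ in Ioc a σ, β ρ) + (A + ∫ ρ in Ioc a σ, α ρ) • β σ) =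
      ∫ σ, ((α σ • B + A • β σ) +
        (α σ • (∫ ρ in Iic σ, β ρ ∂μ) + (∫ ρ in (Ici σ)ᶜ, α ρ ∂μ) • β σ)) ∂μ := by
    refine setIntegral_congr_fun measurableSet_Ioc fun σ hσ => ?_
    have h3 : Iic σ ∩ Ioc a b = Ioc a σ := by grind
    have h4 : (Ici σ)ᶜ ∩ Ioc a b = Ioo a σ := by grind
    simp only [hμ, Measure.restrict_restrict measurableSet_Iic,
      Measure.restrict_restrict measurableSet_Ici.compl, h3, h4, smul_add, add_smul,
      integral_Ioc_eq_integral_Ioo (f := α)]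
    abel
  refine Eq.symm (e.trans ((integral_add (h3.add h4) (h1.add h2)).trans ?_))
  rw [integral_add' h3 h4, integral_add' h1 h2, key, integral_smul_const, integral_smul, smul_add,
    add_smul, add_smul]
  abel

omit [NormedSpace 𝕜 E] in
theorem stronglyMeasurable_setIntegral_Ioc {X : Type*} [MeasurableSpace X] {a b : X → ℝ}
    (ha : Measurable a) (hb : Measurable b) {g : X × ℝ → E} (hg : StronglyMeasurable g) :
    StronglyMeasurable fun x => ∫ ρ in Ioc (a x) (b x), g (x, ρ) := by
  have hS : MeasurableSet {r : X × ℝ | a r.1 < r.2 ∧ r.2 ≤ b r.1} :=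
    (measurableSet_lt (ha.comp measurable_fst) measurable_snd).inter
      (measurableSet_le measurable_snd (hb.comp measurable_fst))
  have := StronglyMeasurable.integral_prod_right' (ν := (volume : Measure ℝ)) (hg.indicator hS)
  refine (funext fun x => ?_ : (fun x => ∫ ρ in Ioc (a x) (b x), g (x, ρ)) = _) ▸ this
  rw [← integral_indicator measurableSet_Ioc]
  rfl

theorem dir_two : dir 2 = (0, 1) := rfl

theorem dir_castSucc (j : Fin 2) : dir j.castSucc = (EuclideanSpace.single j 1, 0) := by
  fin_cases j <;> rfl

omit [NormedSpace ℝ E] [NormedSpace 𝕜 E] in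
theorem normInfOne_indicator_shift_le {g : ℝ³ → E} (e : ℝ³) :
    nrm (fun p => (Ω).indicator g (p + e)) ≤ nrm g := by
  refine normInfOne_le ?_
  have h := (measurePreserving_add_right (volume : Measure Plane) e.1).quasiMeasurePreserving.ae
    (sliceNorm_le_normInfOne g)
  filter_upwards [h] with x hx
  refine ((setLIntegral_le_lintegral _ _).trans_eq <| (lintegral_add_right_eq_self
    (fun z => ‖(Ω).indicator g (x + e.1, z)‖ₑ) e.2).trans ?_).trans hx
  rw [sliceNorm, ← lintegral_indicator measurableSet_Ioo]
  refine lintegral_congr fun z => ?_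
  by_cases hz : z ∈ Ioo z₀ z₁ <;> simp [layer, hz, indicator]

omit [NormedSpace 𝕜 E] in
/-- A weak derivative yields the fundamental theorem of calculus along almost every segment in its
direction that stays in the layer. -/
theorem WeakDeriv.ae_sub_eq_setIntegral [CompleteSpace E] {i : Fin 3} {f g : ℝ³ → E}
    (hd : WeakDeriv i f g) (hf : MemL f) (hg : MemL g)
    (hfm : StronglyMeasurable f) (hgm : StronglyMeasurable g) {s : ℝ} (hs : 0 < s) :
    ∀ᵐ p : ℝ³, p ∈ Ω → p + s • dir i ∈ Ω →
      f (p + s • dir i) - f p = ∫ σ in Ioc 0 s, g (p + σ • dir i) := by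
  set e := dir i with he
  have hΩm : MeasurableSet Ω := measurableSet_layer
  have hconv : ∀ p ∈ Ω, p + s • e ∈ Ω → ∀ σ ∈ Icc 0 s, p + σ • e ∈ Ω := by
    intro p hp hps σ hσ
    have := (convex_univ.prod (convex_Ioo z₀ z₁)).add_smul_mem hp hps
      (t := σ / s) ⟨div_nonneg hσ.1 hs.le, (div_le_one hs).2 hσ.2⟩
    rwa [smul_smul, div_mul_cancel₀ _ hs.ne'] at this
  set F := (Ω).indicator f with hF
  set G := (Ω).indicator g with hG
  have hFm : StronglyMeasurable F := hfm.indicator hΩm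
  have hGm : StronglyMeasurable G := hgm.indicator hΩm
  -- the translates of `F` and `G` are again in `L^∞(L¹)`
  have hshift : ∀ {u : ℝ³ → E}, StronglyMeasurable u → MemL u → ∀ σ : ℝ,
      MemL fun p => (Ω).indicator u (p + σ • e) := fun hu hu' σ =>
    ⟨((hu.indicator hΩm).comp_measurable (by fun_prop)).aestronglyMeasurable,
      (normInfOne_indicator_shift_le _).trans_lt hu'.2⟩
  have hFmem : MemL F := hf.congr (by rw [hF]; exact (indicator_ae_eq_restrict hΩm).symm)
  have hGpar : StronglyMeasurable fun r : ℝ × ℝ³ => G (r.2 + r.1 • e) :=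
    hGm.comp_measurable (by fun_prop)
  have hγ : ∀ᵐ σ ∂(volume.restrict (Ioc 0 s)), nrm (fun p => G (p + σ • e)) ≤ nrm g :=
    ae_of_all _ fun σ => normInfOne_indicator_shift_le _
  have hγfin : ∫⁻ _ in Ioc 0 s, nrm g < ∞ := by
    rw [setLIntegral_const]
    exact mul_lt_top hg.2 (by simp)
  have hIntmem : MemL fun p => ∫ σ in Ioc 0 s, G (p + σ • e) :=
    memLinf_integral hGpar measurable_const hγ hγfin
  set V : Set ℝ³ := Ω ∩ (fun p => p + s • e) ⁻¹' Ω with hV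
  have hVo : IsOpen V := isOpen_layer.inter (isOpen_layer.preimage (by fun_prop))
  set H : ℝ³ → E := fun p => F (p + s • e) - F p - ∫ σ in Ioc 0 s, G (p + σ • e) with hH
  have hHmem : MemL H := ((hshift hfm hf s).sub hFmem).sub hIntmem
  have key := hVo.ae_eq_zero_of_integral_contDiff_smul_eq_zero (f := H) (μ := volume)
    (hHmem.locallyIntegrableOn.mono_set inter_subset_left) ?_
  · filter_upwards [key] with p hp hp1 hp2
    have h0 := hp ⟨hp1, hp2⟩
    simp only [hH, hF, hG, indicator_of_mem hp1, indicator_of_mem hp2] at h0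
    rw [sub_eq_zero] at h0
    rw [h0]
    refine setIntegral_congr_fun measurableSet_Ioc fun σ hσ => ?_
    exact indicator_of_mem (hconv p hp1 hp2 σ ⟨hσ.1.le, hσ.2⟩) _
  · intro φ h1 h2 h3
    have hsub : tsupport φ ⊆ Ω := h3.trans inter_subset_left
    have hout : ∀ (u : ℝ³ → E) (ψ : ℝ³ → ℝ), (∀ p, p ∉ Ω → ψ p = 0) →
        ∫ p, ψ p • u p = ∫ p in Ω, ψ p • u p := fun u ψ hψ =>
      (setIntegral_eq_integral_of_forall_compl_eq_zero fun p hp => by rw [hψ p hp, zero_smul]).symm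
    have hφ0 : ∀ p, p ∉ Ω → φ p = 0 := fun p hp =>
      image_eq_zero_of_notMem_tsupport fun hh => hp (hsub hh)
    -- translated test functions
    have hφs : ∀ σ : ℝ, ContDiff ℝ (⊤ : ℕ∞) fun p => φ (p - σ • e) := fun σ =>
      h1.comp (contDiff_id.sub (contDiff_const (c := σ • e)))
    have hφc : ∀ σ : ℝ, HasCompactSupport fun p => φ (p - σ • e) := fun σ =>
      h2.comp_homeomorph (Homeomorph.subRight (σ • e))
    have hφt : ∀ σ ∈ Icc 0 s, tsupport (fun p => φ (p - σ • e)) ⊆ Ω := by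
      intro σ hσ p hp
      have hp' : p - σ • e ∈ tsupport φ :=
        tsupport_comp_subset_preimage φ (f := fun p => p - σ • e) (by fun_prop) hp
      have := hconv _ (h3 hp').1 (h3 hp').2 σ hσ
      simpa using this
    have hfd : ∀ (σ : ℝ) p, fderiv ℝ (fun p => φ (p - σ • e)) p e = fderiv ℝ φ (p - σ • e) e := by
      intro σ p
      have h0 : (fun p => φ (p - σ • e)) = fun p => φ (p + -(σ • e)) := by
        funext p; rw [sub_eq_add_neg]
      rw [h0, fderiv_comp_add_right, sub_eq_add_neg]
    obtain ⟨K, hK, hKb⟩ := exists_isWeight h1.continuous h2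
    have i1 := (hshift hfm hf s).integrable_test_smul h1.continuous h2
    have i2 := hFmem.integrable_test_smul h1.continuous h2
    have i3 := hIntmem.integrable_test_smul h1.continuous h2
    rw [hout _ _ hφ0]
    simp only [hH, smul_sub]
    have eA : ∫ p in Ω, (φ p • F (p + s • e) - φ p • F p - φ p • ∫ σ in Ioc 0 s, G (p + σ • e)) =
        (∫ p in Ω, φ p • F (p + s • e)) - (∫ p in Ω, φ p • F p) -
          ∫ p in Ω, φ p • ∫ σ in Ioc 0 s, G (p + σ • e) :=
      (integral_sub (i1.sub i2) i3).trans
        (congrArg (fun u => u - ∫ p in Ω, φ p • ∫ σ in Ioc 0 s, G (p + σ • e)) (integral_sub i1 i2))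
    rw [eA,
      integral_smul_integral_param hGpar measurable_const hγ hγfin h1.continuous.measurable hK hKb]
    have hshiftint : ∀ (u : ℝ³ → E) (σ : ℝ), σ ∈ Icc 0 s →
        ∫ p in Ω, φ p • (Ω).indicator u (p + σ • e) = ∫ p in Ω, φ (p - σ • e) • u p := by
      intro u σ hσ
      rw [← hout _ _ hφ0]
      rw [← integral_sub_right_eq_self (μ := volume)
        (fun p => φ p • (Ω).indicator u (p + σ • e)) (σ • e)]
      simp only [sub_add_cancel]
      rw [hout ((Ω).indicator u) (fun p => φ (p - σ • e)) fun p hp =>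
        image_eq_zero_of_notMem_tsupport (f := fun p => φ (p - σ • e)) fun hh => hp (hφt σ hσ hh)]
      exact setIntegral_congr_fun hΩm fun p hp => by simp only [indicator_of_mem hp]
    have i4 : ∫ p in Ω, φ p • F (p + s • e) = ∫ p in Ω, φ (p - s • e) • f p :=
      hshiftint f s ⟨hs.le, le_rfl⟩
    have i5 : ∫ p in Ω, φ p • F p = ∫ p in Ω, φ p • f p :=
      setIntegral_congr_fun hΩm fun p hp => by simp only [hF, indicator_of_mem hp]
    have i6 : ∫ σ in Ioc 0 s, (∫ p in Ω, φ p • G (p + σ • e)) =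
        -∫ σ in Ioc 0 s, (∫ p in Ω, fderiv ℝ φ (p - σ • e) e • f p) := by
      rw [← integral_neg]
      refine setIntegral_congr_fun measurableSet_Ioc fun σ hσ => ?_
      have hσ' : σ ∈ Icc 0 s := ⟨hσ.1.le, hσ.2⟩
      change (∫ p in Ω, φ p • (Ω).indicator g (p + σ • e)) = -_
      rw [hshiftint g σ hσ']
      have := hd (fun p => φ (p - σ • e)) (hφs σ) (hφc σ) (hφt σ hσ')
      rw [← he] at this
      simp only [hfd] at this
      rw [this, neg_neg]
    -- Fubini, and the fundamental theorem for `φ`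
    have hdφ := continuous_dirDeriv h1 e
    have hdc := hasCompactSupport_dirDeriv h2 e
    obtain ⟨C, hC⟩ := hdc.exists_bound_of_continuous hdφ
    have hK : IsCompact ((fun r : ℝ × ℝ³ => r.2 + r.1 • e) '' Icc 0 s ×ˢ tsupport φ) :=
      (isCompact_Icc.prod h2).image (by fun_prop)
    obtain ⟨χ, hχ1, -, hχc, hχ⟩ := exists_continuous_one_zero_of_isCompact hK isClosed_empty
      (disjoint_empty _)
    have hprod : Integrable (Function.uncurry fun (σ : ℝ) (p : ℝ³) =>
        fderiv ℝ φ (p - σ • e) e • f p) ((volume.restrict (Ioc 0 s)).prod μΩ) := by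
      refine (((hf.integrable_test_smul χ.continuous hχc).smul C).comp_snd _).mono ?_ ?_
      · exact (hdφ.comp (f := fun r : ℝ × ℝ³ => r.2 - r.1 • e) (by fun_prop)).aestronglyMeasurable.smul
          (hfm.comp_measurable measurable_snd).aestronglyMeasurable
      · rw [Measure.prod_restrict, ae_restrict_iff' (measurableSet_Ioc.prod hΩm)]
        refine ae_of_all _ fun r hr => ?_
        simp only [Function.uncurry, Pi.smul_apply, norm_smul, ← mul_assoc]
        gcongr
        by_cases hp : r.2 - r.1 • e ∈ tsupport φ
        · rw [hχ1 ⟨(r.1, r.2 - r.1 • e), ⟨Ioc_subset_Icc_self hr.1, hp⟩, sub_add_cancel _ _⟩]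
          simpa using (hC _).trans (le_abs_self _)
        · rw [fderiv_of_notMem_tsupport ℝ hp]
          simpa using by positivity
    have i7 : ∫ σ in Ioc 0 s, (∫ p in Ω, fderiv ℝ φ (p - σ • e) e • f p) =
        ∫ p in Ω, (φ p - φ (p - s • e)) • f p := by
      rw [integral_integral_swap hprod]
      refine integral_congr_ae (ae_of_all _ fun p => ?_)
      simp only
      rw [integral_smul_const]
      congr 1
      have hder : ∀ σ : ℝ, HasDerivAt (fun σ : ℝ => -φ (p - σ • e)) (fderiv ℝ φ (p - σ • e) e) σ := by
        intro σ
        have hl : HasDerivAt (fun σ : ℝ => p - σ • e) (-e) σ := by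
          simpa using ((hasDerivAt_id σ).smul_const e).const_sub p
        have := ((h1.differentiable (by simp) (p - σ • e)).hasFDerivAt.comp_hasDerivAt σ hl).neg
        refine this.congr_deriv ?_
        simp
      have := intervalIntegral.integral_eq_sub_of_hasDerivAt (a := 0) (b := s)
        (fun σ _ => hder σ) ((hdφ.comp (by fun_prop)).intervalIntegrable _ _)
      rw [intervalIntegral.integral_of_le hs.le] at this
      rw [this]; simp; ring
    have i8 := hf.integrable_test_smul h1.continuous h2
    have i9 := hf.integrable_test_smul (hφs s).continuous (hφc s)
    rw [i4, i5, i6, i7]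
    simp only [sub_smul]
    rw [integral_sub i8 i9]
    abel

end

section

variable {𝕜 : Type*} [RCLike 𝕜] {E : Type*} [NormedAddCommGroup E] [NormedSpace ℝ E]
  [NormedSpace 𝕜 E] [Layer]

omit [NormedSpace 𝕜 E] in
/-- On almost every vertical line, a field with a weak vertical derivative is absolutely
continuous. -/
theorem WeakDeriv.exists_vertical_primitive [CompleteSpace E] {f g : ℝ³ → E}
    (hd : WeakDeriv 2 f g) (hf : MemL f) (hg : MemL g)
    (hfm : StronglyMeasurable f) (hgm : StronglyMeasurable g) :
    ∀ᵐ x : Plane, ∃ c : E, ∀ᵐ z ∂(volume.restrict (Ioo z₀ z₁)),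
      f (x, z) = c + ∫ ζ in Ioc z₀ z, g (x, ζ) := by
  set A : ℝ³ → E := fun p => ∫ ζ in Ioc z₀ p.2, g (p.1, ζ) with hA
  have hAm : StronglyMeasurable A :=
    stronglyMeasurable_setIntegral_Ioc (X := ℝ³) (g := fun r => g (r.1.1, r.2))
      measurable_const measurable_snd (hgm.comp_measurable (by fun_prop))
  set H : ℝ³ → E := fun p => f p - A p with hH
  have hHm : StronglyMeasurable H := hfm.sub hAm
  have h1 : ∀ s : ℝ, 0 < s → ∀ᵐ p : ℝ³,
      p.2 ∈ Ioo z₀ z₁ → p.2 + s ∈ Ioo z₀ z₁ → H (p.1, p.2 + s) = H p := by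
    intro s hs
    have hgi : ∀ᵐ p : ℝ³, IntegrableOn (fun z => g (p.1, z)) (Ioo z₀ z₁) :=
      Measure.quasiMeasurePreserving_fst.ae hg.ae_integrable
    filter_upwards [hd.ae_sub_eq_setIntegral hf hg hfm hgm hs, hgi] with p hp hpi hp1 hp2
    have e2 : ∀ σ : ℝ, p + σ • dir 2 = (p.1, p.2 + σ) := fun σ => by ext <;> simp [dir_two]
    simp only [e2] at hp
    have h2 := hp ⟨mem_univ _, hp1⟩ ⟨mem_univ _, hp2⟩
    have hi : ∀ z ∈ Ioo z₀ z₁, IntervalIntegrable (fun ζ => g (p.1, ζ)) volume z₀ z := fun z hz => by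
      rw [intervalIntegrable_iff_integrableOn_Ioc_of_le hz.1.le]
      exact hpi.mono_set fun ζ hζ => ⟨hζ.1, hζ.2.trans_lt hz.2⟩
    have e3 := intervalIntegral.integral_interval_sub_left (hi _ hp2) (hi _ hp1)
    rw [intervalIntegral.integral_of_le hp1.1.le, intervalIntegral.integral_of_le hp2.1.le] at e3
    rw [← intervalIntegral.integral_of_le hs.le,
      intervalIntegral.integral_comp_add_left (fun ζ => g (p.1, ζ)), add_zero] at h2
    grind
  have h2 : ∀ s : ℝ, ∀ᵐ p : ℝ³,
      p.2 ∈ Ioo z₀ z₁ → p.2 + s ∈ Ioo z₀ z₁ → H (p.1, p.2 + s) = H p := fun s => by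
    rcases lt_trichotomy s 0 with hs | rfl | hs
    · filter_upwards [(measurePreserving_add_right (volume : Measure ℝ³)
        (0, s)).quasiMeasurePreserving.ae (h1 (-s) (neg_pos.2 hs))] with p hp h3 h4
      have := hp h4 (by simpa using h3)
      have e : p + (0, s) = (p.1, p.2 + s) := by ext <;> simp
      simpa [e] using this.symm
    · simp
    · exact h1 s hs
  -- hence, for almost every `p`, `H` is almost everywhere constant above and below `p`
  have hset : MeasurableSet {r : ℝ × ℝ³ | r.2.2 ∈ Ioo z₀ z₁ →
      r.2.2 + r.1 ∈ Ioo z₀ z₁ → H (r.2.1, r.2.2 + r.1) = H r.2} :=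
    (measurableSet_Ioo.preimage (f := fun r : ℝ × ℝ³ => r.2.2) (by fun_prop)).imp
      ((measurableSet_Ioo.preimage (f := fun r : ℝ × ℝ³ => r.2.2 + r.1) (by fun_prop)).imp
        ((hHm.comp_measurable (g := fun r : ℝ × ℝ³ => (r.2.1, r.2.2 + r.1))
          (by fun_prop)).measurableSet_eq_fun (hHm.comp_measurable measurable_snd)))
  have h3 := (Measure.ae_ae_comm (μ := (volume : Measure ℝ)) (ν := (volume : Measure ℝ³)) (p := fun (s : ℝ) (p : ℝ³) => p.2 ∈ Ioo z₀ z₁ →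
      p.2 + s ∈ Ioo z₀ z₁ → H (p.1, p.2 + s) = H p) hset).1 (ae_of_all _ h2)
  rw [Measure.volume_eq_prod] at h3
  filter_upwards [Measure.ae_ae_of_ae_prod h3] with x hx
  have : NeZero (volume.restrict (Ioo z₀ z₁)) := ⟨by simp [Layer.hz]⟩
  obtain ⟨y, hy, hyJ⟩ := ((ae_restrict_of_ae hx).and
    (ae_restrict_mem (measurableSet_Ioo (a := z₀) (b := z₁)))).exists
  refine ⟨H (x, y), ?_⟩
  filter_upwards [ae_restrict_of_ae ((measurePreserving_sub_right (volume : Measure ℝ)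
    y).quasiMeasurePreserving.ae hy), ae_restrict_mem measurableSet_Ioo] with z h4 h5
  grind

omit [NormedSpace 𝕜 E] in
/-- The embedding of `W^{1,1}(J)` into `L^∞(J)` on almost every vertical line. -/
theorem WeakDeriv.ae_enorm_le [CompleteSpace E] {f g : ℝ³ → E}
    (hd : WeakDeriv 2 f g) (hf : MemL f) (hg : MemL g)
    (hfm : StronglyMeasurable f) (hgm : StronglyMeasurable g) :
    ∀ᵐ p ∂μΩ, ‖f p‖ₑ ≤ ofReal (z₁ - z₀)⁻¹ * nrm f + nrm g := by
  have hh : 0 < z₁ - z₀ := sub_pos.2 hz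
  refine ae_layer_of_slice (measurableSet_le hfm.enorm measurable_const) ?_
  filter_upwards [hd.exists_vertical_primitive hf hg hfm hgm, hg.ae_integrable,
    sliceNorm_le_normInfOne f, sliceNorm_le_normInfOne g] with x hx hgi hfx hgx
  obtain ⟨c, hc⟩ := hx
  have hdiff : ∀ z ∈ Ioo z₀ z₁, ∀ z' ∈ Ioo z₀ z₁, f (x, z) = c + ∫ ζ in Ioc z₀ z, g (x, ζ) →
      f (x, z') = c + ∫ ζ in Ioc z₀ z', g (x, ζ) → ‖f (x, z)‖ₑ ≤ ‖f (x, z')‖ₑ + sliceNorm g x := by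
    intro z hzm z' hzm' h1 h2
    have hI : ∀ y ∈ Ioo z₀ z₁, IntervalIntegrable (fun ζ => g (x, ζ)) volume z₀ y := by
      intro y hy
      rw [intervalIntegrable_iff_integrableOn_Ioc_of_le hy.1.le]
      exact hgi.mono_set fun ζ hζ => ⟨hζ.1, hζ.2.trans_lt hy.2⟩
    have h3 : f (x, z) = f (x, z') + ∫ ζ in z'..z, g (x, ζ) := by
      rw [h1, h2, ← intervalIntegral.integral_of_le hzm.1.le,
        ← intervalIntegral.integral_of_le hzm'.1.le,
        ← intervalIntegral.integral_interval_sub_left (hI z hzm) (hI z' hzm')]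
      abel
    rw [h3]
    refine (enorm_add_le _ _).trans ?_
    gcongr
    rw [intervalIntegral.intervalIntegral_eq_integral_uIoc, enorm_smul]
    have h4 : ‖(if z' ≤ z then (1 : ℝ) else -1)‖ₑ = 1 := by split_ifs <;> simp
    rw [h4, one_mul]
    refine (enorm_integral_le_lintegral_enorm _).trans (lintegral_mono_set ?_)
    grind
  filter_upwards [hc, ae_restrict_mem measurableSet_Ioo] with z hz1 hzm
  have h5 : ∫⁻ _ in Ioo z₀ z₁, ‖f (x, z)‖ₑ ≤
      ∫⁻ z' in Ioo z₀ z₁, (‖f (x, z')‖ₑ + sliceNorm g x) := by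
    refine lintegral_mono_ae ?_
    filter_upwards [hc, ae_restrict_mem measurableSet_Ioo] with z' hz2 hzm'
    grind
  rw [lintegral_add_right _ measurable_const, setLIntegral_const, setLIntegral_const,
    Real.volume_Ioo] at h5
  have h6 : ofReal (z₁ - z₀)⁻¹ * ofReal (z₁ - z₀) = 1 := by
    rw [← ofReal_mul (by positivity), inv_mul_cancel₀ hh.ne', ofReal_one]
  calc ‖f (x, z)‖ₑ = ofReal (z₁ - z₀)⁻¹ * (‖f (x, z)‖ₑ * ofReal (z₁ - z₀)) := by
        rw [mul_comm ‖f (x, z)‖ₑ, ← mul_assoc, h6, one_mul]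
    _ ≤ ofReal (z₁ - z₀)⁻¹ * (sliceNorm f x +
          sliceNorm g x * ofReal (z₁ - z₀)) := by gcongr; exact h5
    _ = ofReal (z₁ - z₀)⁻¹ * sliceNorm f x + sliceNorm g x := by
        rw [mul_add, mul_comm (sliceNorm g x), ← mul_assoc, h6, one_mul]
    _ ≤ _ := by gcongr

/-- The integrated form of a horizontal derivative along almost every segment. -/
def HorizDeriv (j : Fin 2) (f g : ℝ³ → E) : Prop := ∀ s : ℝ, 0 < s → ∀ᵐ p ∂μΩ,
    f (p + s • dir j.castSucc) - f p = ∫ σ in Ioc 0 s, g (p + σ • dir j.castSucc)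

theorem add_smul_dir_mem_layer_iff (j : Fin 2) (σ : ℝ) (p : ℝ³) :
    p + σ • dir j.castSucc ∈ Ω ↔ p ∈ Ω := by
  simp [layer, dir_castSucc]

omit [NormedSpace 𝕜 E] in
theorem WeakDeriv.horizDeriv [CompleteSpace E] {j : Fin 2} {f g : ℝ³ → E}
    (hd : WeakDeriv j.castSucc f g) (hf : MemL f) (hg : MemL g)
    (hfm : StronglyMeasurable f) (hgm : StronglyMeasurable g) : HorizDeriv j f g := by
  intro s hs
  rw [ae_restrict_iff' measurableSet_layer]
  filter_upwards [hd.ae_sub_eq_setIntegral hf hg hfm hgm hs] with p hp hpm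
  exact hp hpm ((add_smul_dir_mem_layer_iff j s p).2 hpm)

theorem measurePreserving_shift (j : Fin 2) (s : ℝ) :
    MeasurePreserving (fun p : ℝ³ => p + s • dir j.castSucc) μΩ μΩ := by
  have h := (measurePreserving_add_right (volume : Measure ℝ³)
    (s • dir j.castSucc)).restrict_preimage measurableSet_layer
  have e : (fun p : ℝ³ => p + s • dir j.castSucc) ⁻¹' Ω = Ω :=
    ext fun p => add_smul_dir_mem_layer_iff j s p
  rwa [e] at h

/-- Along horizontal lines a derivative in integrated form is integrable on segments. -/
theorem MemLinf.ae_integrableOn_segment {E : Type*} [NormedAddCommGroup E] [NormedSpace ℝ E]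
    {g : ℝ³ → E} (hg : MemL g)
    (hgm : StronglyMeasurable g) (j : Fin 2) (s : ℝ) :
    ∀ᵐ p ∂μΩ, IntegrableOn (fun σ => g (p + σ • dir j.castSucc)) (Ioc 0 s) := by
  have hW : StronglyMeasurable fun r : ℝ × ℝ³ => g (r.2 + r.1 • dir j.castSucc) :=
    hgm.comp_measurable (by fun_prop)
  refine ae_integrable_param (E := E) (ν := volume.restrict (Ioc 0 s)) hW
    (γ := fun _ => nrm g) measurable_const (ae_of_all _ fun σ => ?_) ?_
  · refine le_trans (le_of_eq (normInfOne_congr ?_))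
      (normInfOne_indicator_shift_le (g := g) (σ • dir j.castSucc))
    filter_upwards [ae_restrict_mem measurableSet_layer] with p hp
    rw [indicator_of_mem ((add_smul_dir_mem_layer_iff j σ p).2 hp)]
  · rw [setLIntegral_const]
    exact mul_lt_top hg.2 (by simp)

theorem stronglyMeasurable_segment {E : Type*} [NormedAddCommGroup E] [NormedSpace ℝ E]
    {g : ℝ³ → E} (hgm : StronglyMeasurable g) (j : Fin 2) :
    StronglyMeasurable fun r : ℝ × ℝ³ => ∫ σ in Ioc 0 r.1, g (r.2 + σ • dir j.castSucc) :=
  stronglyMeasurable_setIntegral_Ioc (X := ℝ × ℝ³)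
    (g := fun r => g (r.1.2 + r.2 • dir j.castSucc)) measurable_const measurable_fst
    (hgm.comp_measurable (by fun_prop))

omit [NormedSpace 𝕜 E] in
theorem HorizDeriv.ae_ae {j : Fin 2} {f g : ℝ³ → E} (h : HorizDeriv j f g)
    (hfm : StronglyMeasurable f) (hgm : StronglyMeasurable g) :
    ∀ᵐ p ∂μΩ, ∀ᵐ s : ℝ, 0 < s →
      f (p + s • dir j.castSucc) - f p = ∫ σ in Ioc 0 s, g (p + σ • dir j.castSucc) := by
  have hset : MeasurableSet {r : ℝ × ℝ³ | 0 < r.1 →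
      f (r.2 + r.1 • dir j.castSucc) - f r.2 = ∫ σ in Ioc 0 r.1, g (r.2 + σ • dir j.castSucc)} := by
    refine (measurableSet_lt measurable_const measurable_fst).imp ?_
    exact StronglyMeasurable.measurableSet_eq_fun
      ((hfm.comp_measurable (by fun_prop)).sub (hfm.comp_measurable measurable_snd))
      (stronglyMeasurable_segment hgm j)
  refine (Measure.ae_ae_comm (μ := (volume : Measure ℝ)) (p := fun (s : ℝ) (p : ℝ³) =>
    0 < s → f (p + s • dir j.castSucc) - f p = ∫ σ in Ioc 0 s, g (p + σ • dir j.castSucc)) hset).1 ?_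
  refine ae_of_all _ fun s => ?_
  by_cases hs : 0 < s
  · filter_upwards [h s hs] with p hp _ using hp
  · simp [*]

theorem HorizDeriv.smul [CompleteSpace E] {j : Fin 2} {u u' : ℝ³ → 𝕜}
    {v v' : ℝ³ → E} (hu : HorizDeriv j u u') (hv : HorizDeriv j v v')
    (hum : StronglyMeasurable u) (hum' : StronglyMeasurable u') (hvm : StronglyMeasurable v)
    (hvm' : StronglyMeasurable v') (hu' : MemL u') (hv' : MemL v') :
    HorizDeriv j (fun p => u p • v p) (fun p => u' p • v p + u p • v' p) := by
  intro s hs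
  filter_upwards [hu s hs, hv s hs, hu.ae_ae hum hum', hv.ae_ae hvm hvm',
    hu'.ae_integrableOn_segment hum' j s, hv'.ae_integrableOn_segment hvm' j s]
    with p h1 h2 h3 h4 h5 h6
  have key := setIntegral_product_rule h5 h6 (u p) (v p)
  rw [← h1, ← h2, add_sub_cancel, add_sub_cancel] at key
  rw [key]
  refine setIntegral_congr_ae measurableSet_Ioc ?_
  filter_upwards [h3, h4] with σ h7 h8 hσ
  rw [← h7 hσ.1, ← h8 hσ.1, add_sub_cancel, add_sub_cancel]

end

theorem abs_planeDeriv_le_rpow (α : Fin 2 → ℕ) {t : ℝ} (ht : 0 < t) (x : Plane) :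
    |planeDeriv α t x| ≤ planeConst α * t ^ (-((α 0 + α 1 : ℕ) : ℝ) / 2 - 1) := by
  refine (abs_planeDeriv_le α ht x).trans ?_
  have h1 : heatKernel (2 * t) x ≤ t⁻¹ := by
    rw [heatKernel]
    have h2 : exp (-(‖x‖ ^ 2) / (4 * (2 * t))) ≤ 1 := by
      rw [Real.exp_le_one_iff]
      exact div_nonpos_of_nonpos_of_nonneg (by nlinarith [sq_nonneg ‖x‖]) (by positivity)
    have h3 : (4 * π * (2 * t))⁻¹ ≤ t⁻¹ := by
      apply inv_anti₀ ht
      nlinarith [Real.pi_gt_three]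
    calc (4 * π * (2 * t))⁻¹ * exp (-(‖x‖ ^ 2) / (4 * (2 * t)))
        ≤ t⁻¹ * 1 := by gcongr
      _ = t⁻¹ := mul_one _
  rw [Real.rpow_sub_one ht.ne', mul_assoc]
  have := planeConst_nonneg α
  refine mul_le_mul_of_nonneg_left ?_ this
  rw [div_eq_mul_inv (t ^ _) t]
  exact mul_le_mul_of_nonneg_left h1 (by positivity)

theorem integrableOn_rpow_planeDeriv (α : Fin 2 → ℕ) (hα : 1 ≤ α 0 + α 1) {τ : ℝ} (hτ : 0 < τ) :
    IntegrableOn (fun s : ℝ => planeConst α * s ^ (-((α 0 + α 1 : ℕ) : ℝ) / 2 - 1)) (Ioi τ) := by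
  have : (1 : ℝ) ≤ ((α 0 + α 1 : ℕ) : ℝ) := by exact_mod_cast hα
  exact (integrableOn_Ioi_rpow_of_lt (by linarith) hτ).const_mul _

theorem integrableOn_planeDeriv_time (α : Fin 2 → ℕ) (hα : 1 ≤ α 0 + α 1) {τ : ℝ} (hτ : 0 < τ)
    (x : Plane) : IntegrableOn (fun s => planeDeriv α s x) (Ioi τ) := by
  refine (integrableOn_rpow_planeDeriv α hα hτ).mono' ?_ ?_
  · exact ((measurable_planeDeriv α).comp measurable_prodMk_right).aestronglyMeasurable
  · exact (ae_restrict_iff' measurableSet_Ioi).2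
      (ae_of_all _ fun s hs => abs_planeDeriv_le_rpow α (hτ.trans hs) x)

/-- The kernel `∫_τ^∞ ∂^α G_s ds` of `e^{τΔ} ∂^α (-Δ)⁻¹` on the plane. -/
def tailKernel (α : Fin 2 → ℕ) (τ : ℝ) (x : Plane) : ℝ := ∫ s in Ioi τ, planeDeriv α s x

theorem measurable_tailKernel (α : Fin 2 → ℕ) :
    Measurable fun r : ℝ × Plane => tailKernel α r.1 r.2 := by
  have h : Measurable fun r : (ℝ × Plane) × ℝ =>
      {r : (ℝ × Plane) × ℝ | r.1.1 < r.2}.indicator (fun r => planeDeriv α r.2 r.1.2) r :=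
    ((measurable_planeDeriv α).comp (by fun_prop : Measurable
      fun r : (ℝ × Plane) × ℝ => (r.2, r.1.2))).indicator
      (measurableSet_lt (by fun_prop) (by fun_prop))
  have h2 := (h.stronglyMeasurable.integral_prod_right' (ν := volume)).measurable
  convert h2 using 2 with r
  rw [tailKernel, ← integral_indicator measurableSet_Ioi]
  rfl

theorem lintegral_tailKernel_le (α : Fin 2 → ℕ) (hα : 3 ≤ α 0 + α 1) {τ : ℝ} (hτ : 0 < τ) :
    ∫⁻ x, ‖tailKernel α τ x‖ₑ ≤
      ofReal (2 * planeConst α * τ ^ (-(((α 0 + α 1 : ℕ) : ℝ) / 2 - 1))) := by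
  have hn : (3 : ℝ) ≤ ((α 0 + α 1 : ℕ) : ℝ) := by exact_mod_cast hα
  have hc := planeConst_nonneg α
  calc ∫⁻ x, ‖tailKernel α τ x‖ₑ ≤ ∫⁻ x, ∫⁻ s in Ioi τ, ‖planeDeriv α s x‖ₑ :=
        lintegral_mono fun x => enorm_integral_le_lintegral_enorm _
    _ = ∫⁻ s in Ioi τ, ∫⁻ x, ‖planeDeriv α s x‖ₑ := by
        refine lintegral_lintegral_swap ?_
        exact ((measurable_planeDeriv α).comp measurable_swap).enorm.aemeasurable
    _ ≤ ∫⁻ s in Ioi τ, ofReal (planeConst α * s ^ (-((α 0 + α 1 : ℕ) : ℝ) / 2)) :=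
        setLIntegral_mono' measurableSet_Ioi fun s hs => lintegral_planeDeriv_le α (hτ.trans hs)
    _ = ofReal (∫ s in Ioi τ, planeConst α * s ^ (-((α 0 + α 1 : ℕ) : ℝ) / 2)) := by
        rw [ofReal_integral_eq_lintegral_ofReal]
        · exact (integrableOn_Ioi_rpow_of_lt (by linarith) hτ).const_mul _
        · exact (ae_restrict_iff' measurableSet_Ioi).2 (ae_of_all _ fun s hs => by
            have : (0 : ℝ) < s := hτ.trans hs
            positivity)
    _ ≤ _ := by
        apply ofReal_le_ofReal
        rw [integral_const_mul, integral_Ioi_rpow_of_lt (by linarith) hτ]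
        set n : ℝ := ((α 0 + α 1 : ℕ) : ℝ)
        have e : -n / 2 + 1 = -(n / 2 - 1) := by ring
        rw [e, neg_div_neg_eq, mul_comm 2, mul_assoc]
        gcongr
        have hp : 0 < τ ^ (-(n / 2 - 1)) := by positivity
        rw [div_le_iff₀ (by linarith)]
        nlinarith

theorem integrable_tailKernel (α : Fin 2 → ℕ) (hα : 3 ≤ α 0 + α 1) {τ : ℝ} (hτ : 0 < τ) :
    Integrable (tailKernel α τ) :=
  ⟨((measurable_tailKernel α).comp measurable_prodMk_left).aestronglyMeasurable,
    (lintegral_tailKernel_le α hα hτ).trans_lt ofReal_lt_top⟩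

theorem continuous_tailKernel (α : Fin 2 → ℕ) (hα : 1 ≤ α 0 + α 1) {τ : ℝ} (hτ : 0 < τ) :
    Continuous (tailKernel α τ) := by
  refine continuous_of_dominated (F := fun x s => planeDeriv α s x)
    (bound := fun s => planeConst α * s ^ (-((α 0 + α 1 : ℕ) : ℝ) / 2 - 1)) ?_ ?_
    (integrableOn_rpow_planeDeriv α hα hτ) ?_
  · exact fun x => ((measurable_planeDeriv α).comp measurable_prodMk_right).aestronglyMeasurable
  · exact fun x => (ae_restrict_iff' measurableSet_Ioi).2
      (ae_of_all _ fun s hs => abs_planeDeriv_le_rpow α (hτ.trans hs) x)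
  · exact ae_of_all _ fun s => (contDiff_planeDeriv α s).continuous

theorem order_add_single (α : Fin 2 → ℕ) (j : Fin 2) (n : ℕ) :
    (α + Pi.single j n : Fin 2 → ℕ) 0 + (α + Pi.single j n : Fin 2 → ℕ) 1 = α 0 + α 1 + n := by
  fin_cases j <;> simp <;> omega

theorem hasDerivAt_tailKernel_line (α : Fin 2 → ℕ) (hα : 1 ≤ α 0 + α 1) {τ : ℝ} (hτ : 0 < τ)
    (x ξ : Plane) (r : ℝ) :
    HasDerivAt (fun r : ℝ => tailKernel α τ (x + r • ξ))
      (∑ j : Fin 2, ξ j * tailKernel (α + Pi.single j 1) τ (x + r • ξ)) r := by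
  have hα' : ∀ j : Fin 2, 1 ≤ (α + Pi.single j 1 : Fin 2 → ℕ) 0 + (α + Pi.single j 1 : Fin 2 → ℕ) 1 := fun j => by
    rw [order_add_single]; omega
  have hsm : ∀ (β : Fin 2 → ℕ) (y : Plane), AEStronglyMeasurable (fun s => planeDeriv β s y)
      (volume.restrict (Ioi τ)) := fun β y =>
    ((measurable_planeDeriv β).comp measurable_prodMk_right).aestronglyMeasurable
  have key := (hasDerivAt_integral_of_dominated_loc_of_deriv_le (μ := volume.restrict (Ioi τ))
    (s := univ) (x₀ := r) (F := fun r s => planeDeriv α s (x + r • ξ))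
    (F' := fun r s => ∑ j : Fin 2, ξ j * planeDeriv (α + Pi.single j 1) s (x + r • ξ))
    (bound := fun s => ∑ j : Fin 2, |ξ j| * (planeConst (α + Pi.single j 1) *
      s ^ (-(((α + Pi.single j 1 : Fin 2 → ℕ) 0 + (α + Pi.single j 1 : Fin 2 → ℕ) 1 : ℕ) : ℝ) / 2 - 1)))
    univ_mem ?_ ?_ ?_ ?_ ?_ ?_).2
  · refine key.congr_deriv ?_
    rw [integral_finsetSum]
    · exact Finset.sum_congr rfl fun j _ => integral_const_mul _ _
    · exact fun j _ => (integrableOn_planeDeriv_time _ (hα' j) hτ _).const_mul _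
  · exact Eventually.of_forall fun r => hsm α _
  · exact integrableOn_planeDeriv_time α hα hτ _
  · exact (Finset.aestronglyMeasurable_fun_sum _ fun j _ => (hsm _ _).const_mul _)
  · refine (ae_restrict_iff' measurableSet_Ioi).2 (ae_of_all _ fun s hs r _ => ?_)
    rw [Real.norm_eq_abs]
    refine (Finset.abs_sum_le_sum_abs _ _).trans (Finset.sum_le_sum fun j _ => ?_)
    rw [abs_mul]
    gcongr
    exact abs_planeDeriv_le_rpow _ (hτ.trans hs) _
  · exact integrable_finsetSum _ fun j _ => (integrableOn_rpow_planeDeriv _ (hα' j) hτ).const_mul _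
  · exact ae_of_all _ fun s r _ => hasDerivAt_planeDeriv_line α s x ξ r

theorem tailKernel_sub (α : Fin 2 → ℕ) (hα : 1 ≤ α 0 + α 1) {a b : ℝ} (ha : 0 < a) (hab : a ≤ b)
    (x : Plane) : tailKernel α a x - tailKernel α b x = ∫ s in Ioc a b, planeDeriv α s x := by
  rw [tailKernel, tailKernel, ← Ioc_union_Ioi_eq_Ioi hab, setIntegral_union
    (Ioc_disjoint_Ioi le_rfl) measurableSet_Ioi, add_sub_cancel_right]
  · exact (integrableOn_planeDeriv_time α hα ha x).mono_set Ioc_subset_Ioi_self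
  · exact integrableOn_planeDeriv_time α hα (ha.trans_le hab) x

/-- Since `Δ G_s = ∂_s G_s`, the Laplacian of the tail kernel is minus the heat kernel derivative. -/
theorem sum_tailKernel (α : Fin 2 → ℕ) {τ : ℝ} (hτ : 0 < τ) (x : Plane) :
    ∑ j : Fin 2, tailKernel (α + Pi.single j 2) τ x = -planeDeriv α τ x := by
  have hα' : ∀ j : Fin 2, 1 ≤ (α + Pi.single j 2 : Fin 2 → ℕ) 0 + (α + Pi.single j 2 : Fin 2 → ℕ) 1 := fun j => by
    rw [order_add_single]; omega
  have hint : ∀ j ∈ (Finset.univ : Finset (Fin 2)),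
      IntegrableOn (fun s => planeDeriv (α + Pi.single j 2) s x) (Ioi τ) := fun j _ =>
    integrableOn_planeDeriv_time _ (hα' j) hτ x
  have h0 : Tendsto (fun s => planeDeriv α s x) atTop (𝓝 0) := by
    have hlim : Tendsto (fun s : ℝ => planeConst α * s ^ (-((α 0 + α 1 : ℕ) : ℝ) / 2 - 1))
        atTop (𝓝 0) := by
      have := (tendsto_rpow_neg_atTop (y := ((α 0 + α 1 : ℕ) : ℝ) / 2 + 1)
        (by positivity)).const_mul (planeConst α)
      rw [mul_zero] at this
      refine this.congr fun s => ?_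
      congr 2; ring
    refine squeeze_zero_norm' ?_ hlim
    filter_upwards [eventually_gt_atTop 0] with s hs using abs_planeDeriv_le_rpow α hs x
  have := integral_Ioi_of_hasDerivAt_of_tendsto' (f := fun s => planeDeriv α s x) (a := τ)
    (fun s hs => hasDerivAt_planeDeriv_time α (hτ.trans_le hs) x)
    (integrable_finsetSum _ hint) h0
  rw [zero_sub] at this
  rw [← this, integral_finsetSum _ hint]
  rfl

section

/-- A family `k t`, `t > 0`, of kernels on the plane that scales like a derivative of order `2a` of
the heat kernel, in `L¹` and together with its increments in space and time. -/
structure HorizKernel (C a : ℝ) (k : ℝ → Plane → ℝ) : Prop where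
  measurable : Measurable fun r : ℝ × Plane => k r.1 r.2
  bound : ∀ t, 0 < t → ∫⁻ x, ‖k t x‖ₑ ≤ ofReal (C * t ^ (-a))
  space : ∀ t, 0 < t → ∀ ξ : Plane,
    ∫⁻ x, ‖k t (x + ξ) - k t x‖ₑ ≤ ofReal (C * (‖ξ‖ * t ^ (-a - 1 / 2)))
  time : ∀ t t', 0 < t → t ≤ t' →
    ∫⁻ x, ‖k t' x - k t x‖ₑ ≤ ofReal (C * ((t' - t) * t ^ (-a - 1)))

/-- The analogue of `HorizKernel` for kernels on the interval. -/
structure VertKernel [Layer] (D b : ℝ) (m : ℝ → ℝ → ℝ → ℝ) : Prop where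
  measurable : Measurable fun r : ℝ × ℝ × ℝ => m r.1 r.2.1 r.2.2
  bounded : ∀ t, 0 < t → ∃ M : ℝ, ∀ z ∈ Ioo z₀ z₁, ∀ ζ ∈ Ioo z₀ z₁, |m t z ζ| ≤ M
  bound : ∀ t, 0 < t → ∀ ζ ∈ Ioo z₀ z₁,
    ∫⁻ z in Ioo z₀ z₁, ‖m t z ζ‖ₑ ≤ ofReal (D * t ^ (-b))
  time : ∀ t t', 0 < t → t ≤ t' → ∀ ζ ∈ Ioo z₀ z₁,
    ∫⁻ z in Ioo z₀ z₁, ‖m t' z ζ - m t z ζ‖ₑ ≤ ofReal (D * ((t' - t) * t ^ (-b - 1)))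

theorem exists_horizKernel_planeDeriv (α : Fin 2 → ℕ) :
    ∃ C, 0 ≤ C ∧ HorizKernel C (((α 0 + α 1 : ℕ) : ℝ) / 2) (planeDeriv α) := by
  have h0 := planeConst_nonneg
  have h1 : 0 ≤ ∑ j : Fin 2, planeConst (α + Pi.single j 1) := Finset.sum_nonneg fun _ _ => h0 _
  have h2 : 0 ≤ ∑ j : Fin 2, planeConst (α + Pi.single j 2) := Finset.sum_nonneg fun _ _ => h0 _
  refine ⟨planeConst α + (∑ j : Fin 2, planeConst (α + Pi.single j 1)) +
    ∑ j : Fin 2, planeConst (α + Pi.single j 2), by have := h0 α; positivity,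
    measurable_planeDeriv α, fun t ht => ?_, fun t ht ξ => ?_, fun t t' ht htt' => ?_⟩
  · refine (lintegral_planeDeriv_le α ht).trans (ofReal_le_ofReal ?_)
    rw [neg_div]
    gcongr
    linarith
  · refine (lintegral_planeDeriv_space_sub_le α ht ξ).trans (ofReal_le_ofReal ?_)
    have e : -((α 0 + α 1 + 1 : ℕ) : ℝ) / 2 = -(((α 0 + α 1 : ℕ) : ℝ) / 2) - 1 / 2 := by
      push_cast; ring
    rw [e, mul_left_comm]
    gcongr
    linarith [h0 α]
  · refine (lintegral_planeDeriv_time_sub_le α ht htt').trans ?_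
    rw [← ofReal_mul (by positivity)]
    refine ofReal_le_ofReal ?_
    have e : -((α 0 + α 1 + 2 : ℕ) : ℝ) / 2 = -(((α 0 + α 1 : ℕ) : ℝ) / 2) - 1 := by push_cast; ring
    have : 0 ≤ t' - t := sub_nonneg.2 htt'
    rw [e, mul_assoc, mul_comm _ (t' - t)]
    gcongr
    linarith [h0 α]

theorem exists_horizKernel_tailKernel (α : Fin 2 → ℕ) (hα : 3 ≤ α 0 + α 1) :
    ∃ C, 0 ≤ C ∧ HorizKernel C (((α 0 + α 1 : ℕ) : ℝ) / 2 - 1) (tailKernel α) := by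
  have h0 := planeConst_nonneg
  set n : ℝ := ((α 0 + α 1 : ℕ) : ℝ) with hn
  have hn3 : (3 : ℝ) ≤ n := by rw [hn]; exact_mod_cast hα
  set S : ℝ := ∑ j : Fin 2, planeConst (α + Pi.single j 1) with hS
  have h1 : 0 ≤ S := Finset.sum_nonneg fun _ _ => h0 _
  refine ⟨2 * planeConst α + 2 * S, by have := h0 α; positivity,
    measurable_tailKernel α, fun t ht => ?_, fun t ht ξ => ?_, fun t t' ht htt' => ?_⟩
  · refine (lintegral_tailKernel_le α hα ht).trans (ofReal_le_ofReal ?_)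
    gcongr
    linarith
  · calc ∫⁻ x, ‖tailKernel α t (x + ξ) - tailKernel α t x‖ₑ
        ≤ ∫⁻ x, ∫⁻ s in Ioi t, ‖planeDeriv α s (x + ξ) - planeDeriv α s x‖ₑ := by
          refine lintegral_mono fun x => ?_
          rw [tailKernel, tailKernel, ← integral_sub
            (integrableOn_planeDeriv_time α (by omega) ht _)
            (integrableOn_planeDeriv_time α (by omega) ht _)]
          exact enorm_integral_le_lintegral_enorm _
      _ = ∫⁻ s in Ioi t, ∫⁻ x, ‖planeDeriv α s (x + ξ) - planeDeriv α s x‖ₑ := by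
          refine lintegral_lintegral_swap ?_
          exact (((measurable_planeDeriv α).comp (by fun_prop : Measurable
            fun r : ℝ³ => (r.2, r.1 + ξ))).sub ((measurable_planeDeriv α).comp
            (by fun_prop : Measurable fun r : ℝ³ => (r.2, r.1)))).enorm.aemeasurable
      _ ≤ ∫⁻ s in Ioi t, ofReal (‖ξ‖ * S * s ^ (-(n + 1) / 2)) := by
          refine setLIntegral_mono' measurableSet_Ioi fun s hs => ?_
          refine (lintegral_planeDeriv_space_sub_le α (ht.trans hs) ξ).trans (le_of_eq ?_)
          rw [mul_assoc, hn]
          push_cast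
          rfl
      _ = ofReal (∫ s in Ioi t, ‖ξ‖ * S * s ^ (-(n + 1) / 2)) := by
          rw [ofReal_integral_eq_lintegral_ofReal]
          · exact (integrableOn_Ioi_rpow_of_lt (by linarith) ht).const_mul _
          · exact (ae_restrict_iff' measurableSet_Ioi).2 (ae_of_all _ fun s hs => by
              have : (0 : ℝ) < s := ht.trans hs
              positivity)
      _ ≤ _ := by
          apply ofReal_le_ofReal
          rw [integral_const_mul, integral_Ioi_rpow_of_lt (by linarith) ht]
          have e : -(n + 1) / 2 + 1 = -(n / 2 - 1) - 1 / 2 := by ring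
          have e2 : -t ^ (-(n + 1) / 2 + 1) / (-(n + 1) / 2 + 1) =
              t ^ (-(n / 2 - 1) - 1 / 2) / ((n - 1) / 2) := by
            rw [← neg_div_neg_eq, neg_neg, e]; congr 1; ring
          rw [e2]
          have hp : 0 < t ^ (-(n / 2 - 1) - 1 / 2) := by positivity
          have h3 : t ^ (-(n / 2 - 1) - 1 / 2) / ((n - 1) / 2) ≤ t ^ (-(n / 2 - 1) - 1 / 2) := by
            rw [div_le_iff₀ (by linarith)]; nlinarith
          calc ‖ξ‖ * S * (t ^ (-(n / 2 - 1) - 1 / 2) / ((n - 1) / 2))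
              ≤ ‖ξ‖ * S * t ^ (-(n / 2 - 1) - 1 / 2) := by gcongr
            _ = S * (‖ξ‖ * t ^ (-(n / 2 - 1) - 1 / 2)) := by ring
            _ ≤ _ := by
                gcongr
                linarith [h0 α]
  · calc ∫⁻ x, ‖tailKernel α t' x - tailKernel α t x‖ₑ
        ≤ ∫⁻ x, ∫⁻ s in Ioc t t', ‖planeDeriv α s x‖ₑ := by
          refine lintegral_mono fun x => ?_
          rw [← enorm_neg, neg_sub, tailKernel_sub α (by omega) ht htt']
          exact enorm_integral_le_lintegral_enorm _
      _ = ∫⁻ s in Ioc t t', ∫⁻ x, ‖planeDeriv α s x‖ₑ := by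
          refine lintegral_lintegral_swap ?_
          exact ((measurable_planeDeriv α).comp measurable_swap).enorm.aemeasurable
      _ ≤ ∫⁻ s in Ioc t t', ofReal (planeConst α * t ^ (-n / 2)) := by
          refine setLIntegral_mono' measurableSet_Ioc fun s hs => ?_
          have hs0 : 0 < s := ht.trans hs.1
          refine (lintegral_planeDeriv_le α hs0).trans (ofReal_le_ofReal ?_)
          refine mul_le_mul_of_nonneg_left ?_ (h0 α)
          exact Real.rpow_le_rpow_of_nonpos ht hs.1.le (by linarith)
      _ ≤ _ := by
          have := h0 α
          rw [setLIntegral_const, Real.volume_Ioc, ← ofReal_mul (by positivity)]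
          apply ofReal_le_ofReal
          have e : -(n / 2 - 1) - 1 = -n / 2 := by ring
          have : 0 ≤ t' - t := sub_nonneg.2 htt'
          rw [e, mul_assoc, mul_comm (t ^ _)]
          gcongr
          linarith

theorem vertKernel_reflKernel [Layer] {σ : ℝ} (hσ : |σ| ≤ 1) (n : ℕ) :
    VertKernel (2 * gaussConst n + 2 * gaussConst (n + 2)) ((n : ℝ) / 2)
      (fun t => reflKernel σ (gaussDeriv n t)) := by
  have h0 := gaussConst_nonneg n
  have h2 := gaussConst_nonneg (n + 2)
  refine ⟨measurable_reflKernel σ n, fun t ht => ?_, fun t ht ζ _ => ?_, fun t t' ht htt' ζ _ => ?_⟩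
  · obtain ⟨M, _, hM⟩ := exists_reflKernel_bound σ n ht le_rfl
    exact ⟨M, fun z hzm ζ hζ => hM t (left_mem_Icc.2 le_rfl) z (Ioo_subset_Icc_self hzm) ζ
      (Ioo_subset_Icc_self hζ)⟩
  · refine (lintegral_reflKernel_gaussDeriv_le hσ n ht ζ).trans (ofReal_le_ofReal ?_)
    rw [neg_div]
    gcongr
    linarith
  · refine (lintegral_reflKernel_time_sub_le hσ n ht htt' ζ).trans ?_
    rw [← ofReal_mul (by positivity)]
    apply ofReal_le_ofReal
    have e : -((n + 2 : ℕ) : ℝ) / 2 = -((n : ℝ) / 2) - 1 := by push_cast; ring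
    have : 0 ≤ t' - t := sub_nonneg.2 htt'
    rw [e, mul_assoc, mul_comm (t ^ _)]
    gcongr
    linarith

theorem vertKernel_const [Layer] : VertKernel 1 0 (fun _ _ _ => (z₁ - z₀)⁻¹) := by
  have hh : 0 < z₁ - z₀ := sub_pos.2 hz
  refine ⟨measurable_const, fun t _ => ⟨|(z₁ - z₀)⁻¹|, fun _ _ _ _ => le_rfl⟩, fun t ht ζ _ => ?_,
    fun t t' ht htt' ζ _ => ?_⟩
  · rw [setLIntegral_const, Real.volume_Ioo, Real.enorm_eq_ofReal (by positivity),
      ← ofReal_mul (by positivity), inv_mul_cancel₀ hh.ne']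
    simp
  · simp

variable {E E' : Type*} [NormedAddCommGroup E] [NormedSpace ℝ E] [NormedAddCommGroup E']
  [NormedSpace ℝ E'] [Layer] {C D a b : ℝ} {k : ℝ → Plane → ℝ} {m : ℝ → ℝ → ℝ → ℝ}

/-- A family `T τ`, `τ > 0`, of linear operators on `L^∞(L¹)` given by kernels that scale like a
derivative of order `2a` of the heat kernel. The bounds hold on every vertical line. -/
structure IsSmoothingOp (C a : ℝ)
    (T : ℝ → (ℝ³ → E) → ℝ³ → E') : Prop where
  const_nonneg : 0 ≤ C
  measurable : ∀ {X : Type} [MeasurableSpace X] {τ : X → ℝ} {f : X → ℝ³ → E},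
    Measurable τ → (StronglyMeasurable fun r : X × ℝ³ => f r.1 r.2) →
      StronglyMeasurable fun r : X × ℝ³ => T (τ r.1) (f r.1) r.2
  congr : ∀ {τ : ℝ} {f g : ℝ³ → E}, f =ᵐ[μΩ] g → T τ f = T τ g
  sub : ∀ {τ : ℝ} {f g : ℝ³ → E}, 0 < τ → MemL f → MemL g →
    ∀ p ∈ Ω, T τ (f - g) p = T τ f p - T τ g p
  bound : ∀ {τ : ℝ} {f : ℝ³ → E}, 0 < τ → MemL f → ∀ x,
    sliceNorm (T τ f) x ≤ ofReal (C * τ ^ (-a)) * nrm f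
  space : ∀ {τ : ℝ} {f : ℝ³ → E}, 0 < τ → MemL f → ∀ x ξ : Plane,
    sliceNorm (fun p => T τ f (p.1 + ξ, p.2) - T τ f p) x ≤
      ofReal (C * (‖ξ‖ * τ ^ (-a - 1 / 2))) * nrm f
  time : ∀ {τ τ' : ℝ} {f : ℝ³ → E}, 0 < τ → τ ≤ τ' → MemL f → ∀ x,
    sliceNorm (fun p => T τ' f p - T τ f p) x ≤
      ofReal (C * ((τ' - τ) * τ ^ (-a - 1))) * nrm f

theorem sliceNorm_congr_layer {E : Type*} [NormedAddCommGroup E] {f g : ℝ³ → E}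
    (h : ∀ p ∈ Ω, f p = g p) (x : Plane) :
    sliceNorm f x = sliceNorm g x :=
  setLIntegral_congr_fun measurableSet_Ioo fun z hz => by simp only [h (x, z) ⟨mem_univ _, hz⟩]

theorem sliceNorm_add_le {E : Type*} [NormedAddCommGroup E] {f g : ℝ³ → E}
    (hf : StronglyMeasurable f) (x : Plane) :
    sliceNorm (fun p => f p + g p) x ≤ sliceNorm f x + sliceNorm g x := by
  refine (lintegral_mono fun z => enorm_add_le (f (x, z)) (g (x, z))).trans (le_of_eq ?_)
  exact lintegral_add_left (hf.comp_measurable measurable_prodMk_left).enorm _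

theorem HorizKernel.admissible (hk : HorizKernel C a k) (hm : VertKernel D b m) {t t' : ℝ}
    (ht : 0 < t) (ht' : 0 < t') : Admissible (k t) (m t') where
  measurable_left := hk.measurable.comp measurable_prodMk_left
  integrable_left := ⟨(hk.measurable.comp measurable_prodMk_left).aestronglyMeasurable,
    (hk.bound t ht).trans_lt ofReal_lt_top⟩
  measurable_right := hm.measurable.comp measurable_prodMk_left
  bounded_right := hm.bounded t' ht'

theorem memLinf_clm (L : E →L[ℝ] E') {f : ℝ³ → E} (hf : MemL f) : MemL (fun q => L (f q)) ∧
      nrm (fun q => L (f q)) ≤ ‖L‖₊ * nrm f := by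
  have h := normInfOne_le_mul (f := f) (g := fun q => L (f q)) ‖L‖₊ (ae_of_all _ fun p => by
      simpa only [enorm_eq_nnnorm, ← ENNReal.coe_mul, ENNReal.coe_le_coe] using L.le_opNNNorm (f p))
  exact ⟨⟨L.continuous.comp_aestronglyMeasurable hf.1,
    h.trans_lt (mul_lt_top ENNReal.coe_lt_top hf.2)⟩, h⟩

theorem isSmoothingOp_layerOp [CompleteSpace E'] (hC : 0 ≤ C) (hD : 0 ≤ D)
    (hk : HorizKernel C a k) (hm : VertKernel D b m) (hb : 0 ≤ b) (L : E →L[ℝ] E') :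
    IsSmoothingOp (2 * C * D * ‖L‖) (a + b) (fun τ f => layerOp (k τ) (m τ) fun q => L (f q)) where
  const_nonneg := by positivity
  measurable := by
    intro X _ τ f hτ hf
    exact stronglyMeasurable_layerOp_param (X := X) (k := fun x => k (τ x)) (m := fun x => m (τ x))
      (f := fun x q => L (f x q))
      (hk.measurable.comp ((hτ.comp measurable_fst).prodMk measurable_snd))
      (hm.measurable.comp ((hτ.comp measurable_fst).prodMk measurable_snd))
      (L.continuous.comp_stronglyMeasurable hf)
  congr := by
    intro τ f g h
    refine layerOp_congr ?_
    filter_upwards [h] with q hq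
    rw [hq]
  sub := by
    intro τ f g hτ hf hg p hp
    have := layerOp_sub (hk.admissible hm hτ hτ) (memLinf_clm L hf).1 (memLinf_clm L hg).1 hp
    rw [← this]
    congr 1
    funext q
    simp
  bound := by
    intro τ f hτ hf x
    obtain ⟨hLf, hLn⟩ := memLinf_clm L hf
    refine (sliceNorm_layerOp_le (hk.admissible hm hτ hτ).measurable_left
      (hk.admissible hm hτ hτ).measurable_right (hm.bound τ hτ) hLf.1 x).trans ?_
    calc _ ≤ ofReal (C * τ ^ (-a)) * ofReal (D * τ ^ (-b)) *
          (‖L‖₊ * nrm f) := by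
          gcongr
          exact hk.bound τ hτ
      _ = ofReal (C * D * ‖L‖ * τ ^ (-(a + b))) * nrm f := by
          rw [← mul_assoc, ← enorm_eq_nnnorm, ← ofReal_norm, ← ofReal_mul (by positivity),
            ← ofReal_mul (by positivity), neg_add, rpow_add hτ]
          congr 2; ring
      _ ≤ _ := by
          gcongr
          nlinarith [show 0 ≤ C * D * ‖L‖ by positivity]
  space := by
    intro τ f hτ hf x ξ
    obtain ⟨hLf, hLn⟩ := memLinf_clm L hf
    have had := hk.admissible hm hτ hτ
    have had' : Admissible (fun y => k τ (y + ξ)) (m τ) :=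
      ⟨had.measurable_left.comp (by fun_prop), had.integrable_left.comp_add_right ξ,
        had.measurable_right, had.bounded_right⟩
    have e : ∀ p ∈ Ω, layerOp (k τ) (m τ) (fun q => L (f q)) (p.1 + ξ, p.2) -
          layerOp (k τ) (m τ) (fun q => L (f q)) p =
        layerOp ((fun y => k τ (y + ξ)) - k τ) (m τ) (fun q => L (f q)) p := by
      intro p hp
      rw [layerOp_sub_left had' had hLf hp]
      congr 1
      simp only [layerOp]
      congr 1
      funext q
      congr 3
      abel
    rw [sliceNorm_congr_layer e x]
    refine (sliceNorm_layerOp_le (had'.measurable_left.sub had.measurable_left)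
      had.measurable_right (hm.bound τ hτ) hLf.1 x).trans ?_
    calc _ ≤ ofReal (C * (‖ξ‖ * τ ^ (-a - 1 / 2))) * ofReal (D * τ ^ (-b)) *
          (‖L‖₊ * nrm f) := by
          gcongr
          exact hk.space τ hτ ξ
      _ = ofReal (C * D * ‖L‖ * (‖ξ‖ * τ ^ (-(a + b) - 1 / 2))) * nrm f := by
          rw [← mul_assoc, ← enorm_eq_nnnorm, ← ofReal_norm, ← ofReal_mul (by positivity),
            ← ofReal_mul (by positivity),
            show -(a + b) - 1 / 2 = (-a - 1 / 2) + -b by ring, rpow_add hτ]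
          congr 2; ring
      _ ≤ _ := by
          gcongr
          nlinarith [show 0 ≤ C * D * ‖L‖ by positivity]
  time := by
    intro τ τ' f hτ hττ' hf x
    have hτ' := hτ.trans_le hττ'
    obtain ⟨hLf, hLn⟩ := memLinf_clm L hf
    have h1 := hk.admissible hm hτ hτ
    have h2 := hk.admissible hm hτ' hτ'
    have h3 := hk.admissible hm hτ hτ'
    have hd0 : 0 ≤ τ' - τ := sub_nonneg.2 hττ'
    have e : ∀ p ∈ Ω, layerOp (k τ') (m τ') (fun q => L (f q)) p -
          layerOp (k τ) (m τ) (fun q => L (f q)) p =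
        layerOp (k τ' - k τ) (m τ') (fun q => L (f q)) p +
        layerOp (k τ) (m τ' - m τ) (fun q => L (f q)) p := by
      intro p hp
      rw [layerOp_sub_left h2 h3 hLf hp, layerOp_sub_right h3 h1 hLf hp]
      abel
    rw [sliceNorm_congr_layer e x]
    have had1 : Admissible (k τ' - k τ) (m τ') :=
      ⟨h2.measurable_left.sub h1.measurable_left, h2.integrable_left.sub h1.integrable_left,
        h2.measurable_right, h2.bounded_right⟩
    refine (sliceNorm_add_le (stronglyMeasurable_layerOp had1 hLf.1) x).trans ?_
    have i1 := sliceNorm_layerOp_le had1.measurable_left had1.measurable_right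
      (hm.bound τ' hτ') hLf.1 x
    have i2 := sliceNorm_layerOp_le (m := m τ' - m τ) h1.measurable_left
      (h2.measurable_right.sub h1.measurable_right) (hm.time τ τ' hτ hττ') hLf.1 x
    have hbb : τ' ^ (-b) ≤ τ ^ (-b) := Real.rpow_le_rpow_of_nonpos hτ hττ' (by linarith)
    calc _ ≤ ofReal (C * ((τ' - τ) * τ ^ (-a - 1))) * ofReal (D * τ ^ (-b)) *
            (‖L‖₊ * nrm f) + ofReal (C * τ ^ (-a)) *
            ofReal (D * ((τ' - τ) * τ ^ (-b - 1))) * (‖L‖₊ * nrm f) := by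
          refine add_le_add (i1.trans ?_) (i2.trans ?_)
          · gcongr
            exact hk.time τ τ' hτ hττ'
          · gcongr
            exact hk.bound τ hτ
      _ = _ := by
          rw [← mul_assoc (_ * _) (‖L‖₊ : ℝ≥0∞), ← mul_assoc (_ * _) (‖L‖₊ : ℝ≥0∞), ← add_mul, ← enorm_eq_nnnorm, ← ofReal_norm,
            ← ofReal_mul (by positivity), ← ofReal_mul (by positivity),
            ← ofReal_mul (by positivity), ← ofReal_mul (by positivity),
            ← ofReal_add (by positivity) (by positivity)]
          congr 2
          rw [show -(a + b) - 1 = (-a - 1) + -b by ring, rpow_add hτ,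
            Real.rpow_sub_one hτ.ne', Real.rpow_sub_one hτ.ne']
          ring

theorem IsSmoothingOp.mono {T : ℝ → (ℝ³ → E) → ℝ³ → E'}
    (h : IsSmoothingOp C a T) {C' : ℝ} (hC : C ≤ C') : IsSmoothingOp C' a T where
  const_nonneg := h.const_nonneg.trans hC
  measurable := h.measurable
  congr := h.congr
  sub := h.sub
  bound := fun hτ hf x => (h.bound hτ hf x).trans (by gcongr)
  space := fun hτ hf x ξ => (h.space hτ hf x ξ).trans (by gcongr)
  time := fun hτ hττ' hf x => (h.time hτ hττ' hf x).trans (by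
    have := sub_nonneg.2 hττ'
    gcongr)

theorem isSmoothingOp_zero : IsSmoothingOp 0 a (fun _ _ _ => 0 : ℝ → (ℝ³ → E) → ℝ³ → E') where
  const_nonneg := le_rfl
  measurable := fun _ _ => stronglyMeasurable_const
  congr := fun _ => rfl
  sub := fun _ _ _ _ _ => (sub_zero _).symm
  bound := fun _ _ _ => by simp [sliceNorm]
  space := fun _ _ _ _ => by simp [sliceNorm]
  time := fun _ _ _ _ => by simp [sliceNorm]

theorem IsSmoothingOp.stronglyMeasurable {T : ℝ → (ℝ³ → E) → ℝ³ → E'}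
    (h : IsSmoothingOp C a T) {f : ℝ³ → E}
    (hf : AEStronglyMeasurable f μΩ) (τ : ℝ) :
    StronglyMeasurable (T τ f) := by
  rw [h.congr hf.ae_eq_mk]
  exact (h.measurable (X := Unit) (τ := fun _ => τ) (f := fun _ => hf.mk f) measurable_const
    (hf.stronglyMeasurable_mk.comp_measurable measurable_snd)).comp_measurable
      (measurable_prodMk_left (x := ()))

theorem IsSmoothingOp.add {T T' : ℝ → (ℝ³ → E) → ℝ³ → E'} {C C' : ℝ}
    (h : IsSmoothingOp C a T) (h' : IsSmoothingOp C' a T') :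
    IsSmoothingOp (C + C') a (fun τ f p => T τ f p + T' τ f p) where
  const_nonneg := add_nonneg h.const_nonneg h'.const_nonneg
  measurable := fun hτ hf => (h.measurable hτ hf).add (h'.measurable hτ hf)
  congr := fun hfg => by simp only [h.congr hfg, h'.congr hfg]
  sub := fun hτ hf hg p hp => by
    simp only [h.sub hτ hf hg p hp, h'.sub hτ hf hg p hp]
    abel
  bound := fun {τ f} hτ hf x => by
    refine (sliceNorm_add_le (h.stronglyMeasurable hf.1 τ) x).trans
      ((add_le_add (h.bound hτ hf x) (h'.bound hτ hf x)).trans (le_of_eq ?_))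
    have := h.const_nonneg
    have := h'.const_nonneg
    rw [← add_mul, ← ofReal_add (by positivity) (by positivity), add_mul]
  space := fun {τ f} hτ hf x ξ => by
    have e : (fun p : ℝ³ => T τ f (p.1 + ξ, p.2) + T' τ f (p.1 + ξ, p.2) -
        (T τ f p + T' τ f p)) = fun p => (T τ f (p.1 + ξ, p.2) - T τ f p) +
          (T' τ f (p.1 + ξ, p.2) - T' τ f p) := by
      funext p; abel
    rw [e]
    refine (sliceNorm_add_le (((h.stronglyMeasurable hf.1 τ).comp_measurable
      (by fun_prop)).sub (h.stronglyMeasurable hf.1 τ)) x).trans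
      ((add_le_add (h.space hτ hf x ξ) (h'.space hτ hf x ξ)).trans (le_of_eq ?_))
    have := h.const_nonneg
    have := h'.const_nonneg
    rw [← add_mul, ← ofReal_add (by positivity) (by positivity), add_mul]
  time := fun {τ τ' f} hτ hττ' hf x => by
    have e : (fun p : ℝ³ => T τ' f p + T' τ' f p - (T τ f p + T' τ f p)) =
        fun p => (T τ' f p - T τ f p) + (T' τ' f p - T' τ f p) := by
      funext p; abel
    rw [e]
    refine (sliceNorm_add_le ((h.stronglyMeasurable hf.1 τ').sub
      (h.stronglyMeasurable hf.1 τ)) x).trans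
      ((add_le_add (h.time hτ hττ' hf x) (h'.time hτ hττ' hf x)).trans (le_of_eq ?_))
    have := h.const_nonneg
    have := h'.const_nonneg
    have := sub_nonneg.2 hττ'
    rw [← add_mul, ← ofReal_add (by positivity) (by positivity), add_mul]

theorem IsSmoothingOp.sum {ι : Type*} (s : Finset ι) {T : ι → ℝ → (ℝ³ → E) → ℝ³ → E'} {C : ι → ℝ}
    (h : ∀ i ∈ s, IsSmoothingOp (C i) a (T i)) :
    IsSmoothingOp (∑ i ∈ s, C i) a (fun τ f p => ∑ i ∈ s, T i τ f p) := by
  classical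
  induction s using Finset.induction_on with
  | empty => simpa using isSmoothingOp_zero
  | insert i s hi ih =>
    simp only [Finset.sum_insert hi]
    exact (h i (Finset.mem_insert_self _ _)).add (ih fun j hj => h j (Finset.mem_insert_of_mem hj))

theorem IsSmoothingOp.normInfOne_le {T : ℝ → (ℝ³ → E) → ℝ³ → E'}
    (h : IsSmoothingOp C a T) {τ : ℝ} {f : ℝ³ → E} (hτ : 0 < τ)
    (hf : MemL f) :
    nrm (T τ f) ≤ ofReal (C * τ ^ (-a)) * nrm f :=
  PrimEq.normInfOne_le (ae_of_all _ (h.bound hτ hf))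

theorem IsSmoothingOp.memLinf {T : ℝ → (ℝ³ → E) → ℝ³ → E'}
    (h : IsSmoothingOp C a T) {τ : ℝ} {f : ℝ³ → E} (hτ : 0 < τ)
    (hf : MemL f) : MemL (T τ f) :=
  ⟨(h.stronglyMeasurable hf.1 τ).aestronglyMeasurable,
    (h.normInfOne_le hτ hf).trans_lt (mul_lt_top ofReal_lt_top hf.2)⟩

end

section

variable {E E' E'' : Type*} [NormedAddCommGroup E] [NormedSpace ℝ E] [NormedAddCommGroup E']
  [NormedSpace ℝ E'] [NormedAddCommGroup E''] [NormedSpace ℝ E''] {C D a b : ℝ}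

theorem sliceNorm_clm_le [Layer] (L : E →L[ℝ] E') (f : ℝ³ → E) (x : Plane) :
    sliceNorm (fun p => L (f p)) x ≤ ofReal ‖L‖ * sliceNorm f x := by
  unfold sliceNorm
  rw [← lintegral_const_mul' _ _ ofReal_ne_top]
  refine lintegral_mono fun z => ?_
  rw [← ofReal_norm, ← ofReal_norm, ← ofReal_mul (norm_nonneg _)]
  exact ofReal_le_ofReal (L.le_opNorm _)

theorem IsSmoothingOp.clm_comp [Layer] {T : ℝ → (ℝ³ → E) → ℝ³ → E'}
    (h : IsSmoothingOp C a T) (L : E' →L[ℝ] E'') :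
    IsSmoothingOp (‖L‖ * C) a (fun τ f p => L (T τ f p)) where
  const_nonneg := mul_nonneg (norm_nonneg _) h.const_nonneg
  measurable := fun hτ hf => L.continuous.comp_stronglyMeasurable (h.measurable hτ hf)
  congr := fun hfg => by simp only [h.congr hfg]
  sub := fun hτ hf hg p hp => by simp only [h.sub hτ hf hg p hp, map_sub]
  bound := fun hτ hf x => by
    refine (sliceNorm_clm_le L _ x).trans ?_
    rw [mul_assoc, ofReal_mul (norm_nonneg _), mul_assoc]
    gcongr
    exact h.bound hτ hf x
  space := fun hτ hf x ξ => by
    simp only [← map_sub]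
    refine (sliceNorm_clm_le L _ x).trans ?_
    rw [mul_assoc, ofReal_mul (norm_nonneg _), mul_assoc]
    gcongr
    exact h.space hτ hf x ξ
  time := fun hτ hττ' hf x => by
    simp only [← map_sub]
    refine (sliceNorm_clm_le L _ x).trans ?_
    rw [mul_assoc, ofReal_mul (norm_nonneg _), mul_assoc]
    gcongr
    exact h.time hτ hττ' hf x

/-- The order of the derivative `∂ᵢ` of the layer in the plane variables. -/
def horizOrder : Fin 3 → Fin 2 → ℕ := ![Pi.single 0 1, Pi.single 1 1, 0]

/-- The order of the derivative `∂ᵢ` of the layer in the vertical variable. -/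
def vertOrder : Fin 3 → ℕ := ![0, 0, 1]

theorem horizOrder_castSucc (j : Fin 2) : horizOrder j.castSucc = Pi.single j 1 := by
  fin_cases j <;> rfl

theorem vertOrder_castSucc (j : Fin 2) : vertOrder j.castSucc = 0 := by fin_cases j <;> rfl

theorem castSucc_or_eq_two (i : Fin 3) : (∃ j : Fin 2, i = j.castSucc) ∨ i = 2 := by
  fin_cases i
  · exact Or.inl ⟨0, rfl⟩
  · exact Or.inl ⟨1, rfl⟩
  · exact Or.inr rfl

theorem castSucc_ne_two (j : Fin 2) : (j.castSucc : Fin 3) ≠ 2 := by fin_cases j <;> decide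

section
variable [Layer]

/-- The kernel `∂^α G_τ(x) · (∂ⁿ N_τ)(z, ζ)`, where `σ = 1` for even and `σ = -1` for odd
reflection at the walls. -/
def heatOp (α : Fin 2 → ℕ) (σ : ℝ) (n : ℕ) (τ : ℝ) (f : ℝ³ → E) : ℝ³ → E :=
  layerOp (planeDeriv α τ) (reflKernel σ (gaussDeriv n τ)) f

/-- The operator `f ↦ c ∫_J (∫_τ^∞ ∂^α G_s ds) * f(·, ζ) dζ`. -/
def tailOp (α : Fin 2 → ℕ) (c : ℝ) (τ : ℝ) (f : ℝ³ → E) : ℝ³ → E :=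
  layerOp (tailKernel α τ) (fun _ _ => c) f

theorem lineDeriv_kernel_horiz {k k' : Plane → ℝ} {m : ℝ → ℝ → ℝ} {j : Fin 2}
    (hd : ∀ x, HasDerivAt (fun s : ℝ => k (x + s • EuclideanSpace.single j (1 : ℝ))) (k' x) 0)
    (p q : ℝ³) :
    HasLineDerivAt ℝ (fun p : ℝ³ => k (p.1 - q.1) * m p.2 q.2)
      (k' (p.1 - q.1) * m p.2 q.2) p (dir j.castSucc) := by
  rw [dir_castSucc]
  have := (hd (p.1 - q.1)).mul_const (m p.2 q.2)
  unfold HasLineDerivAt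
  refine this.congr_of_eventuallyEq (Eventually.of_forall fun s => ?_)
  simp only [Prod.fst_add, Prod.snd_add, Prod.smul_fst, Prod.smul_snd, smul_zero, add_zero]
  congr 2
  abel

theorem lineDeriv_kernel_vert {k : Plane → ℝ} {m m' : ℝ → ℝ → ℝ}
    (hd : ∀ z ζ, HasDerivAt (fun z => m z ζ) (m' z ζ) z) (p q : ℝ³) :
    HasLineDerivAt ℝ (fun p : ℝ³ => k (p.1 - q.1) * m p.2 q.2)
      (k (p.1 - q.1) * m' p.2 q.2) p (dir 2) := by
  rw [dir_two]
  unfold HasLineDerivAt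
  have h1 : HasDerivAt (fun s : ℝ => p.2 + s) 1 0 := by
    simpa using (hasDerivAt_id (0 : ℝ)).const_add p.2
  have h2 := (hd (p.2 + 0) q.2).comp (0 : ℝ) h1
  have := (h2.const_mul (k (p.1 - q.1)))
  rw [add_zero, mul_one] at this
  refine this.congr_of_eventuallyEq (Eventually.of_forall fun s => ?_)
  simp

theorem hasDerivAt_planeDeriv_single (α : Fin 2 → ℕ) (t : ℝ) (j : Fin 2) (x : Plane) :
    HasDerivAt (fun s : ℝ => planeDeriv α t (x + s • EuclideanSpace.single j (1 : ℝ)))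
      (planeDeriv (α + Pi.single j 1) t x) 0 := by
  refine (hasDerivAt_planeDeriv_line α t x (EuclideanSpace.single j 1) 0).congr_deriv ?_
  simp [EuclideanSpace.single]

theorem hasDerivAt_tailKernel_single (α : Fin 2 → ℕ) (hα : 1 ≤ α 0 + α 1) {t : ℝ} (ht : 0 < t)
    (j : Fin 2) (x : Plane) :
    HasDerivAt (fun s : ℝ => tailKernel α t (x + s • EuclideanSpace.single j (1 : ℝ)))
      (tailKernel (α + Pi.single j 1) t x) 0 := by
  refine (hasDerivAt_tailKernel_line α hα ht x (EuclideanSpace.single j 1) 0).congr_deriv ?_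
  simp [EuclideanSpace.single]

theorem admissible_heat (α : Fin 2 → ℕ) {σ : ℝ} (hσ : |σ| ≤ 1) (n : ℕ) {τ : ℝ} (hτ : 0 < τ) :
    Admissible (planeDeriv α τ) (reflKernel σ (gaussDeriv n τ)) :=
  (exists_horizKernel_planeDeriv α).choose_spec.2.admissible (vertKernel_reflKernel hσ n) hτ hτ

theorem admissible_tail (α : Fin 2 → ℕ) (hα : 3 ≤ α 0 + α 1) (c : ℝ) {τ : ℝ} (hτ : 0 < τ) :
    Admissible (tailKernel α τ) (fun _ _ => c) := by
  obtain ⟨C, _, h⟩ := exists_horizKernel_tailKernel α hα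
  exact ⟨h.measurable.comp measurable_prodMk_left,
    ⟨(h.measurable.comp measurable_prodMk_left).aestronglyMeasurable,
    (h.bound τ hτ).trans_lt ofReal_lt_top⟩, measurable_const, |c|, fun _ _ _ _ => le_rfl⟩

theorem continuous_reflKernel_left (σ : ℝ) (n : ℕ) {τ : ℝ} (hτ : 0 < τ) (ζ : ℝ) :
    Continuous fun z => reflKernel σ (gaussDeriv n τ) z ζ :=
  continuous_iff_continuousAt.2 fun z => (hasDerivAt_reflKernel_left σ n hτ z ζ).continuousAt

theorem weakDeriv_heatOp [CompleteSpace E] (α : Fin 2 → ℕ) {σ : ℝ} (hσ : |σ| ≤ 1)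
    (n : ℕ) {τ : ℝ} (hτ : 0 < τ) {f : ℝ³ → E} (hf : MemL f) (i : Fin 3) :
    WeakDeriv i (heatOp α σ n τ f) (heatOp (α + horizOrder i) σ (n + vertOrder i) τ f) := by
  refine weakDeriv_layerOp (admissible_heat α hσ n hτ) (admissible_heat _ hσ _ hτ) hf
    (contDiff_planeDeriv _ _).continuous (contDiff_planeDeriv _ _).continuous
    (continuous_reflKernel_left σ _ hτ) (continuous_reflKernel_left σ _ hτ) ?_
  rcases castSucc_or_eq_two i with ⟨j, rfl⟩ | rfl
  · rw [horizOrder_castSucc, vertOrder_castSucc]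
    exact lineDeriv_kernel_horiz fun x => hasDerivAt_planeDeriv_single α τ j x
  · exact lineDeriv_kernel_vert fun z ζ => hasDerivAt_reflKernel_left σ n hτ z ζ

theorem tailOp_zero (α : Fin 2 → ℕ) (τ : ℝ) (f : ℝ³ → E) : tailOp α 0 τ f = fun _ => 0 := by
  funext p
  simp [tailOp, layerOp]

/-- The factor by which a `z`-independent kernel changes under `∂ᵢ`. -/
def tailFactor (i : Fin 3) : ℝ := if i = 2 then 0 else (z₁ - z₀)⁻¹

theorem weakDeriv_tailOp [CompleteSpace E] (α : Fin 2 → ℕ) (hα : 3 ≤ α 0 + α 1)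
    {τ : ℝ} (hτ : 0 < τ) {f : ℝ³ → E} (hf : MemL f) (i : Fin 3) :
    WeakDeriv i (tailOp α (z₁ - z₀)⁻¹ τ f) (tailOp (α + horizOrder i) (tailFactor i) τ f) := by
  have hα' : 3 ≤ (α + horizOrder i : Fin 2 → ℕ) 0 + (α + horizOrder i : Fin 2 → ℕ) 1 := by
    simp only [Pi.add_apply]; omega
  refine weakDeriv_layerOp (admissible_tail α hα _ hτ) (admissible_tail _ hα' _ hτ) hf
    (continuous_tailKernel _ (by omega) hτ) (continuous_tailKernel _ (by omega) hτ)
    (fun _ => continuous_const) (fun _ => continuous_const) ?_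
  rcases castSucc_or_eq_two i with ⟨j, rfl⟩ | rfl
  · rw [horizOrder_castSucc, tailFactor, if_neg (castSucc_ne_two j)]
    exact lineDeriv_kernel_horiz (m := fun _ _ => (z₁ - z₀)⁻¹) fun x =>
      hasDerivAt_tailKernel_single α (by omega) hτ j x
  · have : α + horizOrder 2 = α := by
      change α + 0 = α
      exact add_zero α
    rw [this]
    exact lineDeriv_kernel_vert (m := fun _ _ => (z₁ - z₀)⁻¹) fun z ζ => hasDerivAt_const z _

end

theorem exists_isSmoothingOp_heatOp [CompleteSpace E'] (α : Fin 2 → ℕ) (n : ℕ) (L : E →L[ℝ] E')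
    {a : ℝ} (ha : ((α 0 + α 1 + n : ℕ) : ℝ) / 2 = a) : ∃ C, ∀ [Layer], ∀ {σ : ℝ}, |σ| ≤ 1 →
      IsSmoothingOp C a (fun τ (f : ℝ³ → E) => heatOp α σ n τ fun q => L (f q)) := by
  obtain ⟨C, hC, hk⟩ := exists_horizKernel_planeDeriv α
  refine ⟨2 * C * (2 * gaussConst n + 2 * gaussConst (n + 2)) * ‖L‖, fun hσ => ?_⟩
  have := isSmoothingOp_layerOp hC (by have := gaussConst_nonneg n; have := gaussConst_nonneg (n + 2); positivity) hk
    (vertKernel_reflKernel hσ n) (by positivity) L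
  rwa [← add_div, ← Nat.cast_add, ha] at this

theorem exists_isSmoothingOp_tailOp [CompleteSpace E'] (α : Fin 2 → ℕ) (hα : 3 ≤ α 0 + α 1)
    (L : E →L[ℝ] E') :
    ∃ C, ∀ [Layer], IsSmoothingOp C (((α 0 + α 1 : ℕ) : ℝ) / 2 - 1)
        (fun τ (f : ℝ³ → E) => tailOp α (z₁ - z₀)⁻¹ τ fun q => L (f q)) := by
  obtain ⟨C, hC, hk⟩ := exists_horizKernel_tailKernel α hα
  refine ⟨2 * C * 1 * ‖L‖, fun [_] => ?_⟩
  have := isSmoothingOp_layerOp hC zero_le_one hk (vertKernel_const) le_rfl L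
  rw [add_zero] at this
  exact this

theorem exists_isSmoothingOp_tailFactor [CompleteSpace E'] (α : Fin 2 → ℕ) (i : Fin 3)
    (hα : i ≠ 2 → 3 ≤ α 0 + α 1) (L : E →L[ℝ] E') :
    ∃ C, ∀ [Layer], IsSmoothingOp C (((α 0 + α 1 : ℕ) : ℝ) / 2 - 1)
        (fun τ (f : ℝ³ → E) => tailOp α (tailFactor i) τ fun q => L (f q)) := by
  by_cases hi : i = 2
  · refine ⟨0, fun [_] => ?_⟩
    simp only [tailFactor, if_pos hi, tailOp_zero]
    exact isSmoothingOp_zero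
  · simp only [tailFactor, if_neg hi]
    exact exists_isSmoothingOp_tailOp α (hα hi) L

end

section

section
variable {E E' : Type*} [NormedAddCommGroup E] [NormedSpace ℝ E] [NormedAddCommGroup E']
  [NormedSpace ℝ E'] [Layer]

/-- A differentiable integrable kernel on the plane, with continuous integrable derivatives. -/
structure C1Kernel (k : Plane → ℝ) (k' : Fin 2 → Plane → ℝ) : Prop where
  measurable : Measurable k
  integrable : Integrable k
  continuous' : ∀ j, Continuous (k' j)
  integrable' : ∀ j, Integrable (k' j)
  deriv : ∀ j x, HasDerivAt (fun s : ℝ => k (x + s • EuclideanSpace.single j (1 : ℝ))) (k' j x) 0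

theorem C1Kernel.reflect {k : Plane → ℝ} {k' : Fin 2 → Plane → ℝ} (h : C1Kernel k k') (x : Plane) :
    C1Kernel (fun y => k (x - y)) (fun j y => -k' j (x - y)) := by
  refine ⟨h.measurable.comp (by fun_prop), h.integrable.comp_sub_left x,
    fun j => ((h.continuous' j).comp (by fun_prop)).neg,
    fun j => ((h.integrable' j).comp_sub_left x).neg, fun j y => ?_⟩
  have h1 : HasDerivAt (fun s : ℝ => -s) (-1) 0 := hasDerivAt_neg 0
  have h2 : HasDerivAt (fun s : ℝ => k (x - y + s • EuclideanSpace.single j (1 : ℝ)))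
    (k' j (x - y)) (-0) := by rw [neg_zero]; exact h.deriv j (x - y)
  have h3 := h2.comp (0 : ℝ) h1
  rw [mul_neg_one] at h3
  refine h3.congr_of_eventuallyEq (Eventually.of_forall fun s => ?_)
  simp only [Function.comp]
  congr 1
  rw [neg_smul]; abel

theorem c1Kernel_planeDeriv (α : Fin 2 → ℕ) {τ : ℝ} (hτ : 0 < τ) :
    C1Kernel (planeDeriv α τ) (fun j => planeDeriv (α + Pi.single j 1) τ) :=
  ⟨(measurable_planeDeriv _).comp measurable_prodMk_left, integrable_planeDeriv _ hτ,
    fun _ => (contDiff_planeDeriv _ τ).continuous, fun _ => integrable_planeDeriv _ hτ,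
    fun j x => hasDerivAt_planeDeriv_single α τ j x⟩

theorem c1Kernel_tailKernel (α : Fin 2 → ℕ) (hα : 3 ≤ α 0 + α 1) {τ : ℝ} (hτ : 0 < τ) :
    C1Kernel (tailKernel α τ) (fun j => tailKernel (α + Pi.single j 1) τ) :=
  ⟨(measurable_tailKernel _).comp measurable_prodMk_left, integrable_tailKernel α hα hτ,
    fun j => continuous_tailKernel _ (by rw [order_add_single]; omega) hτ,
    fun j => integrable_tailKernel _ (by rw [order_add_single]; omega) hτ,
    fun j x => hasDerivAt_tailKernel_single α (by omega) hτ j x⟩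

/-- `f = ∇·F`, with vanishing normal flux through the walls, tested against products of a kernel in
the plane and a function of the vertical variable that need not vanish at the walls. -/
def IsFluxDiv (F : ℝ³ → Fin 3 → E) (f : ℝ³ → E) : Prop :=
  ∀ (κ : Plane → ℝ) (κ' : Fin 2 → Plane → ℝ) (ψ ψ' : ℝ → ℝ), C1Kernel κ κ' →
    (∀ ζ, HasDerivAt ψ (ψ' ζ) ζ) → Continuous ψ' →
    (∑ j : Fin 2, ∫ q in Ω, (κ' j q.1 * ψ q.2) • F q j.castSucc) +
      ∫ q in Ω, (κ q.1 * ψ' q.2) • F q 2 = -∫ q in Ω, (κ q.1 * ψ q.2) • f q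

theorem continuous_reflKernel_right (σ : ℝ) (n : ℕ) {τ : ℝ} (hτ : 0 < τ) (z : ℝ) :
    Continuous fun ζ => reflKernel σ (gaussDeriv n τ) z ζ :=
  continuous_iff_continuousAt.2 fun ζ => (hasDerivAt_reflKernel_right σ n hτ z ζ).continuousAt

theorem IsFluxDiv.layerOp_eq {F : ℝ³ → Fin 3 → E} {f : ℝ³ → E}
    (h : IsFluxDiv F f) {k : Plane → ℝ} {k' : Fin 2 → Plane → ℝ} {m m' : ℝ → ℝ → ℝ}
    (hk : C1Kernel k k') (hm : ∀ z ζ, HasDerivAt (m z) (-m' z ζ) ζ) (hm' : ∀ z, Continuous (m' z))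
    (p : ℝ³) :
    (∑ j : Fin 2, layerOp (k' j) m (fun q => F q j.castSucc) p) +
      layerOp k m' (fun q => F q 2) p = layerOp k m f p := by
  have := h (fun y => k (p.1 - y)) (fun j y => -k' j (p.1 - y)) (m p.2) (fun ζ => -m' p.2 ζ)
    (hk.reflect p.1) (hm p.2) (hm' p.2).neg
  simp only [neg_mul, mul_neg, neg_smul, integral_neg, Finset.sum_neg_distrib] at this
  rw [← neg_add, neg_inj] at this
  exact this

theorem IsFluxDiv.heatOp_eq {F : ℝ³ → Fin 3 → E} {f : ℝ³ → E}
    (h : IsFluxDiv F f) {τ : ℝ} (hτ : 0 < τ) (p : ℝ³) :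
    (∑ j : Fin 2, heatOp (0 + Pi.single j 1) 1 0 τ (fun q => F q j.castSucc) p) +
      heatOp 0 (-1) 1 τ (fun q => F q 2) p = heatOp 0 1 0 τ f p :=
  h.layerOp_eq (c1Kernel_planeDeriv 0 hτ) (fun z ζ => hasDerivAt_reflKernel_right 1 0 hτ z ζ)
    (fun z => continuous_reflKernel_right (-1) 1 hτ z) p

theorem IsFluxDiv.tailOp_eq {F : ℝ³ → Fin 3 → E} {f : ℝ³ → E}
    (h : IsFluxDiv F f) (α : Fin 2 → ℕ) (hα : 3 ≤ α 0 + α 1) (c : ℝ) {τ : ℝ} (hτ : 0 < τ)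
    (p : ℝ³) :
    ∑ j : Fin 2, tailOp (α + Pi.single j 1) c τ (fun q => F q j.castSucc) p = tailOp α c τ f p := by
  have := h.layerOp_eq (m := fun _ _ => c) (m' := fun _ _ => 0) (c1Kernel_tailKernel α hα hτ)
    (fun z ζ => by simpa using hasDerivAt_const ζ c) (fun z => continuous_const) p
  have e : layerOp (tailKernel α τ) (fun _ _ => 0) (fun q => F q 2) p = 0 := by simp [layerOp]
  rw [e, add_zero] at this
  exact this

theorem WeakDeriv.fun_sum {ι : Type*} (s : Finset ι) {l : Fin 3}
    {f g : ι → ℝ³ → E} (hd : ∀ i ∈ s, WeakDeriv l (f i) (g i))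
    (hf : ∀ i ∈ s, MemL (f i)) (hg : ∀ i ∈ s, MemL (g i)) :
    WeakDeriv l (fun p => ∑ i ∈ s, f i p) (fun p => ∑ i ∈ s, g i p) := by
  simpa only [Finset.sum_fn] using WeakDeriv.sum s hd hf hg

theorem MemLinf.fun_sum {ι : Type*} (s : Finset ι) {f : ι → ℝ³ → E}
    (hf : ∀ i ∈ s, MemL (f i)) : MemL (fun p => ∑ i ∈ s, f i p) := by
  simpa only [Finset.sum_fn] using MemLinf.sum s hf

theorem memLinf_heatOp (α : Fin 2 → ℕ) {σ : ℝ} (hσ : |σ| ≤ 1) (n : ℕ) {τ : ℝ}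
    (hτ : 0 < τ) {f : ℝ³ → E} (hf : MemL f) :
    MemL (heatOp α σ n τ f) := (admissible_heat α hσ n hτ).memLinf hf

theorem memLinf_tailOp (α : Fin 2 → ℕ) (hα : 3 ≤ α 0 + α 1) (c : ℝ) {τ : ℝ}
    (hτ : 0 < τ) {f : ℝ³ → E} (hf : MemL f) :
    MemL (tailOp α c τ f) := (admissible_tail α hα c hτ).memLinf hf

end

variable {𝕜 : Type*} [RCLike 𝕜] [Layer]

/-- The matrix unit `v ↦ v_k e_i`. -/
def matUnit (𝕜 : Type*) [RCLike 𝕜] (i k : Fin 2) : Vel 𝕜 →L[ℝ] Vel 𝕜 :=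
  ((EuclideanSpace.proj k : Vel 𝕜 →L[𝕜] 𝕜).smulRight
    (EuclideanSpace.single i (1 : 𝕜))).restrictScalars ℝ

theorem matUnit_apply (i k l : Fin 2) (v : Vel 𝕜) :
    matUnit 𝕜 i k v l = if l = i then v k else 0 := by
  simp [matUnit, EuclideanSpace.single]

/-- The order `e_k + e_j + e_i` of a third derivative. -/
def tripleOrder (i j k : Fin 2) : Fin 2 → ℕ := 0 + Pi.single k 1 + Pi.single j 1 + Pi.single i 1

omit [Layer] in
theorem order_tripleOrder (i j k : Fin 2) : tripleOrder i j k 0 + tripleOrder i j k 1 = 3 := by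
  rw [tripleOrder, order_add_single, order_add_single, order_add_single]; rfl

/-- `S(τ) ℙ ∇·F` for a flux field `F = (F₁, F₂, F₃)`. -/
def projOp (τ : ℝ) (F : ℝ³ → Fin 3 → Vel 𝕜) (p : ℝ³) : Vel 𝕜 :=
  ((∑ j : Fin 2, heatOp (0 + Pi.single j 1) 1 0 τ (fun q => F q j.castSucc) p) +
    heatOp 0 (-1) 1 τ (fun q => F q 2) p) +
  ∑ i : Fin 2, ∑ k : Fin 2, ∑ j : Fin 2, tailOp (tripleOrder i j k) (z₁ - z₀)⁻¹ τ
    (fun q => matUnit 𝕜 i k (F q j.castSucc)) p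

/-- `∂_l S(τ) ℙ ∇·F`. -/
def projGradOp (l : Fin 3) (τ : ℝ) (F : ℝ³ → Fin 3 → Vel 𝕜) (p : ℝ³) : Vel 𝕜 :=
  ((∑ j : Fin 2, heatOp (0 + Pi.single j 1 + horizOrder l) 1 (0 + vertOrder l) τ
      (fun q => F q j.castSucc) p) +
    heatOp (0 + horizOrder l) (-1) (1 + vertOrder l) τ (fun q => F q 2) p) +
  ∑ i : Fin 2, ∑ k : Fin 2, ∑ j : Fin 2, tailOp (tripleOrder i j k + horizOrder l)
    (tailFactor l) τ (fun q => matUnit 𝕜 i k (F q j.castSucc)) p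

/-- `∂_l S(τ) ℙ f` for `f = ∇·F`. -/
def convOp (l : Fin 3) (τ : ℝ) (f : ℝ³ → Vel 𝕜) (p : ℝ³) : Vel 𝕜 :=
  heatOp (0 + horizOrder l) 1 (0 + vertOrder l) τ f p +
  ∑ i : Fin 2, ∑ k : Fin 2, tailOp (0 + Pi.single k 1 + Pi.single i 1 + horizOrder l)
    (tailFactor l) τ (fun q => matUnit 𝕜 i k (f q)) p

theorem MemLinf.flux {F : ℝ³ → Fin 3 → Vel 𝕜} (hF : MemL F) (i : Fin 3) : MemL fun q => F q i :=
  (memLinf_clm (ContinuousLinearMap.proj (R := ℝ) (φ := fun _ : Fin 3 => Vel 𝕜) i) hF).1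

theorem weakDeriv_projOp {τ : ℝ} (hτ : 0 < τ) {F : ℝ³ → Fin 3 → Vel 𝕜} (hF : MemL F) (l : Fin 3) :
    WeakDeriv l (projOp τ F) (projGradOp l τ F) := by
  have h1 : |(1 : ℝ)| ≤ 1 := by simp
  have h2 : |(-1 : ℝ)| ≤ 1 := by simp
  have h3 : ∀ i j k : Fin 2, 3 ≤ tripleOrder i j k 0 + tripleOrder i j k 1 := fun i j k =>
    (order_tripleOrder i j k).ge
  have h4 : ∀ i j k : Fin 2, 3 ≤ (tripleOrder i j k + horizOrder l : Fin 2 → ℕ) 0 +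
      (tripleOrder i j k + horizOrder l : Fin 2 → ℕ) 1 := fun i j k => by
    have := h3 i j k
    simp only [Pi.add_apply]; omega
  have hM : ∀ i j k : Fin 2, MemL fun q => matUnit 𝕜 i k (F q j.castSucc) :=
    fun i j k => (memLinf_clm _ (hF.flux _)).1
  refine ((WeakDeriv.fun_sum _ (fun j _ => weakDeriv_heatOp _ h1 _ hτ (hF.flux _) l)
    (fun j _ => memLinf_heatOp _ h1 _ hτ (hF.flux _))
    (fun j _ => memLinf_heatOp _ h1 _ hτ (hF.flux _))).add
    (weakDeriv_heatOp _ h2 _ hτ (hF.flux _) l) ?_ ?_ ?_ ?_).add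
    (WeakDeriv.fun_sum _ (fun i _ => WeakDeriv.fun_sum _ (fun k _ => WeakDeriv.fun_sum _
      (fun j _ => weakDeriv_tailOp _ (h3 i j k) hτ (hM i j k) l)
      (fun j _ => memLinf_tailOp _ (h3 i j k) _ hτ (hM i j k))
      (fun j _ => memLinf_tailOp _ (h4 i j k) _ hτ (hM i j k))) ?_ ?_) ?_ ?_) ?_ ?_ ?_ ?_
  · exact MemLinf.fun_sum _ fun j _ => memLinf_heatOp _ h1 _ hτ (hF.flux _)
  · exact MemLinf.fun_sum _ fun j _ => memLinf_heatOp _ h1 _ hτ (hF.flux _)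
  · exact memLinf_heatOp _ h2 _ hτ (hF.flux _)
  · exact memLinf_heatOp _ h2 _ hτ (hF.flux _)
  · exact fun k _ => MemLinf.fun_sum _ fun j _ => memLinf_tailOp _ (h3 i j k) _ hτ (hM i j k)
  · exact fun k _ => MemLinf.fun_sum _ fun j _ => memLinf_tailOp _ (h4 i j k) _ hτ (hM i j k)
  · exact fun i _ => MemLinf.fun_sum _ fun k _ => MemLinf.fun_sum _ fun j _ =>
      memLinf_tailOp _ (h3 i j k) _ hτ (hM i j k)
  · exact fun i _ => MemLinf.fun_sum _ fun k _ => MemLinf.fun_sum _ fun j _ =>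
      memLinf_tailOp _ (h4 i j k) _ hτ (hM i j k)
  · exact (MemLinf.fun_sum _ fun j _ => memLinf_heatOp _ h1 _ hτ (hF.flux _)).add
      (memLinf_heatOp _ h2 _ hτ (hF.flux _))
  · exact (MemLinf.fun_sum _ fun j _ => memLinf_heatOp _ h1 _ hτ (hF.flux _)).add
      (memLinf_heatOp _ h2 _ hτ (hF.flux _))
  · exact MemLinf.fun_sum _ fun i _ => MemLinf.fun_sum _ fun k _ => MemLinf.fun_sum _ fun j _ =>
      memLinf_tailOp _ (h3 i j k) _ hτ (hM i j k)
  · exact MemLinf.fun_sum _ fun i _ => MemLinf.fun_sum _ fun k _ => MemLinf.fun_sum _ fun j _ =>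
      memLinf_tailOp _ (h4 i j k) _ hτ (hM i j k)

/-- Integrating by parts once, the gradient of `S(τ) ℙ ∇·F` is expressed through `f = ∇·F` with
kernels of the same order as those of `S(τ) ℙ ∇·F` itself. -/
theorem ae_projGradOp_eq_convOp {τ : ℝ} (hτ : 0 < τ)
    {F : ℝ³ → Fin 3 → Vel 𝕜} {f : ℝ³ → Vel 𝕜} (hF : MemL F)
    (hf : MemL f) (h : IsFluxDiv F f) (l : Fin 3) :
    projGradOp l τ F =ᵐ[μΩ] convOp l τ f := by
  have h1 : |(1 : ℝ)| ≤ 1 := by simp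
  have h2 : |(-1 : ℝ)| ≤ 1 := by simp
  have hfj : ∀ j : Fin 2, MemL fun q => F q j.castSucc := fun j => hF.flux _
  have ms1 := MemLinf.fun_sum Finset.univ fun j (_ : j ∈ Finset.univ) =>
    memLinf_heatOp (0 + Pi.single j 1) h1 0 hτ (hfj j)
  have ms2 := MemLinf.fun_sum Finset.univ fun j (_ : j ∈ Finset.univ) =>
    memLinf_heatOp (0 + Pi.single j 1 + horizOrder l) h1 (0 + vertOrder l) hτ (hfj j)
  have mt1 := memLinf_heatOp 0 h2 1 hτ (hF.flux 2)
  have mt2 := memLinf_heatOp (0 + horizOrder l) h2 (1 + vertOrder l) hτ (hF.flux 2)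
  have hheat := (WeakDeriv.fun_sum Finset.univ
    (fun j _ => weakDeriv_heatOp (0 + Pi.single j 1) h1 0 hτ (hfj j) l)
    (fun j _ => memLinf_heatOp _ h1 _ hτ (hfj j))
    (fun j _ => memLinf_heatOp _ h1 _ hτ (hfj j))).add
    (weakDeriv_heatOp 0 h2 1 hτ (hF.flux 2) l) ms1 ms2 mt1 mt2
  have hheat' := hheat.congr (ae_of_all _ fun p => h.heatOp_eq hτ p) EventuallyEq.rfl
  have key := hheat'.ae_eq (weakDeriv_heatOp 0 h1 0 hτ hf l)
    (ms2.add mt2).locallyIntegrableOn (memLinf_heatOp _ h1 _ hτ hf).locallyIntegrableOn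
  filter_upwards [key, ae_restrict_mem measurableSet_layer] with p hp hpm
  rw [projGradOp, convOp]
  congr 1
  refine Finset.sum_congr rfl fun i _ => Finset.sum_congr rfl fun k _ => ?_
  rcases castSucc_or_eq_two l with ⟨n, rfl⟩ | rfl
  · have e : ∀ j : Fin 2, tripleOrder i j k + horizOrder n.castSucc =
        (0 + Pi.single k 1 + Pi.single i 1 + horizOrder n.castSucc) + Pi.single j 1 := fun j => by
      rw [tripleOrder]; abel
    have hα : 3 ≤ (0 + Pi.single k 1 + Pi.single i 1 + horizOrder n.castSucc : Fin 2 → ℕ) 0 +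
        (0 + Pi.single k 1 + Pi.single i 1 + horizOrder n.castSucc : Fin 2 → ℕ) 1 := by
      rw [horizOrder_castSucc, order_add_single, order_add_single, order_add_single]
      simp
    simp only [e]
    have hα' : ∀ j : Fin 2, 3 ≤
        ((0 + Pi.single k 1 + Pi.single i 1 + horizOrder n.castSucc) + Pi.single j 1 : Fin 2 → ℕ) 0
        + ((0 + Pi.single k 1 + Pi.single i 1 + horizOrder n.castSucc) + Pi.single j 1 :
          Fin 2 → ℕ) 1 := fun j => by
      rw [order_add_single]; omega
    have := congrArg (matUnit 𝕜 i k) (h.tailOp_eq _ hα (tailFactor n.castSucc) hτ p)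
    rw [map_sum] at this
    refine Eq.trans (Finset.sum_congr rfl fun j _ => ?_) (this.trans ?_)
    · exact layerOp_clm (admissible_tail _ (hα' j) _ hτ) (hfj j) (matUnit 𝕜 i k) hpm
    · exact (layerOp_clm (admissible_tail _ hα _ hτ) hf (matUnit 𝕜 i k) hpm).symm
  · simp only [tailFactor, if_true, tailOp_zero, Finset.sum_const_zero]

end

section

variable {𝕜 : Type*} [RCLike 𝕜]

theorem order_single (j : Fin 2) :
    (0 + Pi.single j 1 : Fin 2 → ℕ) 0 + (0 + Pi.single j 1 : Fin 2 → ℕ) 1 = 1 := by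
  rw [order_add_single]; rfl

theorem order_add (α β : Fin 2 → ℕ) : (α + β) 0 + (α + β) 1 = (α 0 + α 1) + (β 0 + β 1) := by
  simp only [Pi.add_apply]; omega

theorem order_horizOrder (l : Fin 3) : horizOrder l 0 + horizOrder l 1 + vertOrder l = 1 := by
  fin_cases l <;> rfl

theorem order_horizOrder_of_ne {l : Fin 3} (hl : l ≠ 2) : horizOrder l 0 + horizOrder l 1 = 1 := by
  rcases castSucc_or_eq_two l with ⟨n, rfl⟩ | rfl
  · fin_cases n <;> rfl
  · exact absurd rfl hl

theorem exists_isSmoothingOp_stokes : ∃ C, ∀ [Layer],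
    IsSmoothingOp C 0 (heatOp (E := Vel 𝕜) 0 1 0) := by
  obtain ⟨C, hC⟩ := exists_isSmoothingOp_heatOp 0 0 (ContinuousLinearMap.id ℝ (Vel 𝕜)) (a := 0)
    (by simp)
  exact ⟨C, hC (by simp)⟩

theorem exists_isSmoothingOp_stokesGrad (l : Fin 3) : ∃ C, ∀ [Layer], IsSmoothingOp C (1 / 2)
      (heatOp (E := Vel 𝕜) (0 + horizOrder l) 1 (0 + vertOrder l)) := by
  obtain ⟨C, hC⟩ := exists_isSmoothingOp_heatOp (0 + horizOrder l) (0 + vertOrder l)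
    (ContinuousLinearMap.id ℝ (Vel 𝕜)) (a := 1 / 2) (by
      have := order_horizOrder l
      simp only [zero_add]; rw [this]; norm_num)
  exact ⟨C, hC (by simp)⟩

theorem exists_isSmoothingOp_convOp (l : Fin 3) : ∃ C, ∀ [Layer],
    IsSmoothingOp C (1 / 2) (convOp (𝕜 := 𝕜) l) := by
  obtain ⟨C, hC⟩ := exists_isSmoothingOp_stokesGrad (𝕜 := 𝕜) l
  by_cases hl : l = 2
  · refine ⟨C, fun [_] => ?_⟩
    convert hC using 1
    funext τ f p
    simp [convOp, tailFactor, hl, tailOp_zero]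
  · have ho : ∀ i k : Fin 2, ((0 + Pi.single k 1 + Pi.single i 1 + horizOrder l : Fin 2 → ℕ) 0 +
        (0 + Pi.single k 1 + Pi.single i 1 + horizOrder l : Fin 2 → ℕ) 1) = 3 := fun i k => by
      rw [order_add, order_add_single, order_single, order_horizOrder_of_ne hl]
    choose D hD using fun i k : Fin 2 => exists_isSmoothingOp_tailFactor
      (0 + Pi.single k 1 + Pi.single i 1 + horizOrder l) l (fun _ => (ho i k).ge) (matUnit 𝕜 i k)
    simp only [ho] at hD
    have e : ((3 : ℕ) : ℝ) / 2 - 1 = 1 / 2 := by norm_num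
    rw [e] at hD
    exact ⟨_, hC.add (IsSmoothingOp.sum _ fun i _ => IsSmoothingOp.sum _ fun k _ => hD i k)⟩

theorem exists_isSmoothingOp_projOp : ∃ C, ∀ [Layer],
    IsSmoothingOp C (1 / 2) (projOp (𝕜 := 𝕜)) := by
  let pr := fun i : Fin 3 => ContinuousLinearMap.proj (R := ℝ) (φ := fun _ : Fin 3 => Vel 𝕜) i
  choose A hA using fun j : Fin 2 => exists_isSmoothingOp_heatOp (0 + Pi.single j 1) 0
    (pr j.castSucc) (a := 1 / 2) (by rw [order_single]; norm_num)
  obtain ⟨B, hB⟩ := exists_isSmoothingOp_heatOp 0 1 (pr 2) (a := 1 / 2) (by norm_num)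
  choose D hD using fun i k j : Fin 2 => exists_isSmoothingOp_tailOp
    (tripleOrder i j k) (order_tripleOrder i j k).ge ((matUnit 𝕜 i k).comp (pr j.castSucc))
  simp only [order_tripleOrder] at hD
  have e : ((3 : ℕ) : ℝ) / 2 - 1 = 1 / 2 := by norm_num
  rw [e] at hD
  exact ⟨_, ((IsSmoothingOp.sum _ fun j _ => hA j (by simp)).add
    (hB (by simp))).add (IsSmoothingOp.sum _ fun i _ => IsSmoothingOp.sum _ fun k _ =>
      IsSmoothingOp.sum _ fun j _ => hD i k j)⟩

theorem exists_isSmoothingOp_projGradOp (l : Fin 3) : ∃ C, ∀ [Layer],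
    IsSmoothingOp C 1 (projGradOp (𝕜 := 𝕜) l) := by
  let pr := fun i : Fin 3 => ContinuousLinearMap.proj (R := ℝ) (φ := fun _ : Fin 3 => Vel 𝕜) i
  have hl := order_horizOrder l
  choose A hA using fun j : Fin 2 => exists_isSmoothingOp_heatOp (0 + Pi.single j 1 + horizOrder l)
    (0 + vertOrder l) (pr j.castSucc) (a := 1) (by
      rw [order_add, order_single]
      have : 1 + (horizOrder l 0 + horizOrder l 1) + (0 + vertOrder l) = 2 := by omega
      rw [this]; norm_num)
  obtain ⟨B, hB⟩ := exists_isSmoothingOp_heatOp (0 + horizOrder l) (1 + vertOrder l) (pr 2) (a := 1) (by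
      have : (0 + horizOrder l) 0 + (0 + horizOrder l) 1 + (1 + vertOrder l) = 2 := by
        simp only [zero_add]; omega
      rw [this]; norm_num)
  have h1 : ∀ [Layer], IsSmoothingOp ((∑ j, A j) + B) 1 (fun τ (F : ℝ³ → Fin 3 → Vel 𝕜) p =>
        (∑ j : Fin 2, heatOp (0 + Pi.single j 1 + horizOrder l) 1 (0 + vertOrder l) τ
          (fun q => F q j.castSucc) p) +
        heatOp (0 + horizOrder l) (-1) (1 + vertOrder l) τ (fun q => F q 2) p) :=
    (IsSmoothingOp.sum _ fun j _ => hA j (by simp)).add (hB (by simp))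
  by_cases hl2 : l = 2
  · refine ⟨(∑ j, A j) + B, fun [_] => ?_⟩
    convert h1 using 1
    funext τ F p
    simp [projGradOp, tailFactor, hl2, tailOp_zero]
  · have ho : ∀ i j k : Fin 2, (tripleOrder i j k + horizOrder l : Fin 2 → ℕ) 0 +
        (tripleOrder i j k + horizOrder l : Fin 2 → ℕ) 1 = 4 := fun i j k => by
      rw [order_add, order_tripleOrder, order_horizOrder_of_ne hl2]
    choose D hD using fun i k j : Fin 2 => exists_isSmoothingOp_tailFactor
      (tripleOrder i j k + horizOrder l) l (fun _ => by rw [ho]; norm_num)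
      ((matUnit 𝕜 i k).comp (pr j.castSucc))
    simp only [ho] at hD
    have e : ((4 : ℕ) : ℝ) / 2 - 1 = 1 := by norm_num
    rw [e] at hD
    exact ⟨_, h1.add (IsSmoothingOp.sum _ fun i _ => IsSmoothingOp.sum _ fun k _ =>
      IsSmoothingOp.sum _ fun j _ => hD i k j)⟩

variable [Layer]

theorem stokes_eq {t : ℝ} (ht : 0 < t) (f : ℝ³ → Vel 𝕜) : stokes z₀ z₁ t f = heatOp 0 1 0 t f := by
  funext p
  simp only [stokes, heatOp, layerOp, heatKernel_eq ht, neumannKernel_eq]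

theorem rieszKernel_eq (i j k : Fin 2) {t : ℝ} (ht : 0 < t) (x : Plane) :
    rieszKernel i j k t x = tailKernel (tripleOrder i j k) t x := by
  refine setIntegral_congr_fun measurableSet_Ioi fun s hs => ?_
  simp only [heatKernel_eq (ht.trans hs), pd_planeDeriv, tripleOrder]

theorem stokesDiv_eq {t : ℝ} (ht : 0 < t) {F : ℝ³ → Fin 3 → Vel 𝕜}
    (hF : MemL F) {p : ℝ³} (hp : p ∈ Ω) :
    stokesDiv z₀ z₁ t (fun j q => F q j.castSucc) (fun q => F q 2) p =
      (∑ j : Fin 2, heatOp (0 + Pi.single j 1) 1 0 t (fun q => F q j.castSucc) p) +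
        heatOp 0 (-1) 1 t (fun q => F q 2) p := by
  have hd : ∀ q : ℝ³, deriv (fun ζ => neumannKernel z₀ z₁ t p.2 ζ) q.2 =
      -reflKernel (-1) (gaussDeriv 1 t) p.2 q.2 := fun q => by
    simp only [neumannKernel_eq]
    exact (hasDerivAt_reflKernel_right 1 0 ht p.2 q.2).deriv
  simp only [stokesDiv, hd, heatKernel_eq ht, pd_planeDeriv, heatOp, layerOp,
    mul_neg, neg_smul, sub_neg_eq_add]
  simp only [neumannKernel_eq]
  have i1 : ∀ j : Fin 2, Integrable (fun q : ℝ³ => (planeDeriv (0 + Pi.single j 1) t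
      (p.1 - q.1) * reflKernel 1 (gaussDeriv 0 t) p.2 q.2) • F q j.castSucc)
      μΩ := fun j =>
    (admissible_heat _ (by simp) _ ht).integrable (hF.flux _) hp
  have i2 : Integrable (fun q : ℝ³ => (planeDeriv 0 t
      (p.1 - q.1) * reflKernel (-1) (gaussDeriv 1 t) p.2 q.2) • F q 2)
      μΩ :=
    (admissible_heat _ (by simp) _ ht).integrable (hF.flux _) hp
  rw [integral_add (integrable_finsetSum _ fun j _ => i1 j) i2, integral_finsetSum _ fun j _ => i1 j]

theorem tailOp_eq_integral_vertAvg {α : Fin 2 → ℕ} (hα : 3 ≤ α 0 + α 1) {t : ℝ} (ht : 0 < t)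
    {g : ℝ³ → 𝕜} (hg : MemL g) {p : ℝ³} (hp : p ∈ Ω) :
    Integrable (fun y => tailKernel α t (p.1 - y) • vertAvg z₀ z₁ g y) ∧
    tailOp α (z₁ - z₀)⁻¹ t g p = ∫ y, tailKernel α t (p.1 - y) • vertAvg z₀ z₁ g y := by
  have hi := (admissible_tail α hα (z₁ - z₀)⁻¹ ht).integrable hg hp
  rw [volume_restrict_layer] at hi
  have e : ∀ y, ∫ ζ in Ioo z₀ z₁, (tailKernel α t (p.1 - y) * (z₁ - z₀)⁻¹) • g (y, ζ) =
      tailKernel α t (p.1 - y) • vertAvg z₀ z₁ g y := fun y => by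
    rw [integral_smul, vertAvg, smul_smul]
  have h1 := hi.integral_prod_left
  simp only [e] at h1
  refine ⟨h1, ?_⟩
  rw [tailOp, layerOp, volume_restrict_layer, integral_prod _ hi]
  simp only [e]

theorem stokesProjDiv_eq {t : ℝ} (ht : 0 < t) {F : ℝ³ → Fin 3 → Vel 𝕜}
    (hF : MemL F) {p : ℝ³} (hp : p ∈ Ω) :
    stokesProjDiv z₀ z₁ t (fun j q => F q j.castSucc) (fun q => F q 2) p = projOp t F p := by
  rw [stokesProjDiv, projOp, stokesDiv_eq ht hF hp]
  congr 1
  let co := fun k : Fin 2 => (EuclideanSpace.proj k : Vel 𝕜 →L[𝕜] 𝕜).restrictScalars ℝ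
  have hco : ∀ j k : Fin 2, MemL fun q => F q j.castSucc k := fun j k =>
    (memLinf_clm (co k) (hF.flux j.castSucc)).1
  have havg : ∀ᵐ y : Plane, ∀ j k : Fin 2,
      (vertAvg z₀ z₁ (fun q => F q j.castSucc) y) k = vertAvg z₀ z₁ (fun q => F q j.castSucc k) y := by
    refine ae_all_iff.2 fun j => ?_
    filter_upwards [(hF.flux j.castSucc).ae_integrable] with y hy k
    simp only [vertAvg, PiLp.smul_apply]
    congr 1
    exact ((co k).integral_comp_comm hy).symm
  have hmem : ∀ i k j : Fin 2, MemL fun q => matUnit 𝕜 i k (F q j.castSucc) :=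
    fun i k j => (memLinf_clm _ (hF.flux _)).1
  ext i
  have hcomp : ∀ i' k j : Fin 2, (tailOp (tripleOrder i' j k) (z₁ - z₀)⁻¹ t
      (fun q => matUnit 𝕜 i' k (F q j.castSucc)) p) i = if i = i' then
        tailOp (tripleOrder i' j k) (z₁ - z₀)⁻¹ t (fun q => F q j.castSucc k) p else 0 := by
    intro i' k j
    have h1 := layerOp_clm (admissible_tail (tripleOrder i' j k)
      (order_tripleOrder i' j k).ge (z₁ - z₀)⁻¹ ht) (hmem i' k j) (co i) hp
    have h2 : ∀ q, co i (matUnit 𝕜 i' k (F q j.castSucc)) =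
        if i = i' then F q j.castSucc k else 0 := fun q => matUnit_apply _ _ _ _
    simp only [h2] at h1
    refine Eq.trans h1.symm ?_
    split_ifs
    · rfl
    · simp [layerOp]
  simp only [WithLp.ofLp_sum, Finset.sum_apply, hcomp]
  have hint : ∀ j k : Fin 2, Integrable fun y => rieszKernel i j k t (p.1 - y) •
      (vertAvg z₀ z₁ (fun q => F q j.castSucc) y) k := by
    intro j k
    refine (tailOp_eq_integral_vertAvg (order_tripleOrder i j k).ge ht (hco j k) hp).1.congr ?_
    filter_upwards [havg] with y hy
    rw [hy, rieszKernel_eq i j k ht]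
  rw [integral_finsetSum _ fun j _ => integrable_finsetSum _ fun k _ => hint j k]
  have hterm : ∀ j : Fin 2, ∫ y, ∑ k : Fin 2, rieszKernel i j k t (p.1 - y) •
      (vertAvg z₀ z₁ (fun q => F q j.castSucc) y) k = ∑ k : Fin 2,
        tailOp (tripleOrder i j k) (z₁ - z₀)⁻¹ t (fun q => F q j.castSucc k) p := by
    intro j
    rw [integral_finsetSum _ fun k _ => hint j k]
    refine Finset.sum_congr rfl fun k _ => ?_
    rw [(tailOp_eq_integral_vertAvg (order_tripleOrder i j k).ge ht (hco j k) hp).2]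
    refine integral_congr_ae ?_
    filter_upwards [havg] with y hy
    rw [hy, rieszKernel_eq i j k ht]
  simp only [hterm]
  rw [Finset.sum_comm]
  symm
  rw [Fintype.sum_eq_single i fun i' hi' => by simp [Ne.symm hi']]
  simp only [if_true]

end

section

section
variable {𝕜 : Type*} [RCLike 𝕜] {E : Type*} [NormedAddCommGroup E] [NormedSpace ℝ E] [Layer]

theorem exists_bound_Icc {ψ : ℝ → ℝ} (hψ : Continuous ψ) :
    ∃ M : ℝ, 0 ≤ M ∧ ∀ ζ ∈ Ioo z₀ z₁, |ψ ζ| ≤ M := by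
  obtain ⟨M, hM⟩ := isCompact_Icc.exists_bound_of_continuousOn (hψ.continuousOn (s := Icc z₀ z₁))
  exact ⟨|M|, abs_nonneg _, fun ζ hζ => (hM ζ (Ioo_subset_Icc_self hζ)).trans (le_abs_self _)⟩

theorem MemLinf.integrable_mul_smul {k : Plane → ℝ} (hk : Measurable k) (hki : Integrable k)
    {ψ : ℝ → ℝ} (hψ : Continuous ψ) {f : ℝ³ → E} (hf : MemL f) :
    Integrable (fun q => (k q.1 * ψ q.2) • f q) μΩ := by
  obtain ⟨M, hM0, hM⟩ := exists_bound_Icc hψ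
  refine hf.integrable_smul (k := fun x => |k x| * M) ((hk.comp measurable_fst).mul
    (hψ.measurable.comp measurable_snd)).aestronglyMeasurable (hki.abs.mul_const M)
    (hk.abs.mul_const M) fun p hp => ?_
  rw [abs_mul]
  exact mul_le_mul_of_nonneg_left (hM _ hp.2) (abs_nonneg _)

/-- Horizontal integration by parts: the increments of the product of the two functions along
horizontal segments have the integral zero. -/
theorem HorizDeriv.integral_kernel_smul [CompleteSpace E] {j : Fin 2} {f g : ℝ³ → E}
    (h : HorizDeriv j f g) (hf : MemL f) (hg : MemL g) (hfm : StronglyMeasurable f)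
    (hgm : StronglyMeasurable g) {κ : Plane → ℝ} {κ' : Fin 2 → Plane → ℝ} (hκ : C1Kernel κ κ')
    {ψ : ℝ → ℝ} (hψ : Continuous ψ) :
    ∫ q in Ω, (κ' j q.1 * ψ q.2) • f q = -∫ q in Ω, (κ q.1 * ψ q.2) • g q := by
  set e := dir j.castSucc
  set Φ : ℝ³ → ℝ := fun q => κ q.1 * ψ q.2
  set Φ' : ℝ³ → ℝ := fun q => κ' j q.1 * ψ q.2
  have hc' := hκ.continuous' j
  have hΦ' : Continuous Φ' := by fun_prop
  have i1 : Integrable (fun q => Φ' q • f q) μΩ :=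
    hf.integrable_mul_smul hc'.measurable (hκ.integrable' j) hψ
  have i2 : Integrable (fun q => Φ q • g q) μΩ :=
    hg.integrable_mul_smul hκ.measurable hκ.integrable hψ
  have i3 : Integrable (fun q => Φ q • f q) μΩ :=
    hf.integrable_mul_smul hκ.measurable hκ.integrable hψ
  set F : ℝ³ → E := fun q => Φ' q • f q + Φ q • g q
  have hFm : StronglyMeasurable F := (hΦ'.measurable.stronglyMeasurable.smul hfm).add
    (((hκ.measurable.comp measurable_fst).mul
      (hψ.measurable.comp measurable_snd)).stronglyMeasurable.smul hgm)
  have mp := measurePreserving_shift j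
  have inc : ∀ᵐ p ∂μΩ, Φ (p + (1 : ℝ) • e) • f (p + (1 : ℝ) • e) - Φ p • f p =
      ∫ σ in Ioc (0 : ℝ) 1, F (p + σ • e) := by
    filter_upwards [h 1 one_pos, h.ae_ae hfm hgm, hg.ae_integrableOn_segment hgm j 1]
      with p h1 h2 h3
    have hder : ∀ σ : ℝ, HasDerivAt (fun σ : ℝ => Φ (p + σ • e)) (Φ' (p + σ • e)) σ := fun σ => by
      have hl : HasLineDerivAt ℝ Φ (Φ' (p + σ • e)) (p + σ • e) e := by
        have := lineDeriv_kernel_horiz (k := κ) (m := fun z _ => ψ z) (j := j) (hκ.deriv j)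
          (p + σ • e) (0, 0)
        simpa only [sub_zero, Prod.fst_zero] using this
      have := HasDerivAt.comp_sub_const σ σ (f := fun t : ℝ => Φ (p + σ • e + t • e))
        (by rw [sub_self]; exact hl)
      simpa [add_assoc, ← add_smul] using this
    have hΦs : Continuous fun σ : ℝ => Φ' (p + σ • e) := by fun_prop
    have ftc : ∀ σ ∈ Ioc (0 : ℝ) 1, ∫ ρ in Ioc 0 σ, Φ' (p + ρ • e) = Φ (p + σ • e) - Φ p :=
      fun σ hσ => by
        rw [← intervalIntegral.integral_of_le hσ.1.le,
          intervalIntegral.integral_eq_sub_of_hasDerivAt (fun ρ _ => hder ρ)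
            (hΦs.intervalIntegrable _ _), zero_smul, add_zero]
    have key := setIntegral_product_rule hΦs.integrableOn_Ioc h3 (Φ p) (f p)
    rw [ftc 1 (by simp), ← h1, add_sub_cancel, add_sub_cancel] at key
    rw [key]
    refine setIntegral_congr_ae measurableSet_Ioc ?_
    filter_upwards [h2] with σ h4 hσ
    rw [ftc σ hσ, ← h4 hσ.1, add_sub_cancel, add_sub_cancel]
  have hFi : Integrable (Function.uncurry fun (p : ℝ³) (σ : ℝ) => F (p + σ • e))
      ((μΩ).prod (volume.restrict (Ioc 0 1))) := by
    have hm : StronglyMeasurable (Function.uncurry fun (p : ℝ³) (σ : ℝ) => F (p + σ • e)) :=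
      hFm.comp_measurable (by fun_prop)
    refine ⟨hm.aestronglyMeasurable, ?_⟩
    rw [HasFiniteIntegral, lintegral_prod_symm _ hm.enorm.aemeasurable]
    have hs : ∀ σ, ∫⁻ p in Ω, ‖F (p + σ • e)‖ₑ = ∫⁻ p in Ω, ‖F p‖ₑ := fun σ =>
      (mp σ).lintegral_comp hFm.enorm
    simp only [Function.uncurry, hs, lintegral_const]
    exact mul_lt_top (i1.add i2).2 (by simp)
  have h0 : ∫ p in Ω, ∫ σ in Ioc (0 : ℝ) 1, F (p + σ • e) = ∫ p in Ω, F p := by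
    rw [integral_integral_swap hFi]
    exact (setIntegral_congr_fun measurableSet_Ioc fun σ _ =>
      (mp σ).integral_comp (measurableEmbedding_addRight _) F).trans (by simp)
  have i4 : Integrable (fun p => Φ (p + (1 : ℝ) • e) • f (p + (1 : ℝ) • e)) μΩ :=
    ((mp 1).integrable_comp_emb (measurableEmbedding_addRight _)).2 i3
  rw [← integral_congr_ae inc, integral_sub i4 i3, (mp 1).integral_comp
    (measurableEmbedding_addRight _) (fun p => Φ p • f p), sub_self, integral_add i1 i2] at h0
  exact eq_neg_of_add_eq_zero_left h0.symm

/-- Integration by parts for an absolutely continuous function, the boundary terms cancelling. -/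
theorem setIntegral_deriv_smul [CompleteSpace E] {a b : ℝ} (hab : a < b) {θ : ℝ → E}
    (hθ : IntegrableOn θ (Ioc a b)) (c : E) {ψ ψ' : ℝ → ℝ} (hψ : ∀ ζ, HasDerivAt ψ (ψ' ζ) ζ)
    (hψ' : Continuous ψ') (hbd : ψ b • (c + ∫ ρ in Ioc a b, θ ρ) = ψ a • c) :
    ∫ ζ in Ioc a b, ψ' ζ • (c + ∫ ρ in Ioc a ζ, θ ρ) = -∫ ζ in Ioc a b, ψ ζ • θ ζ := by
  have hFT : ∀ ζ, a ≤ ζ → ψ a + ∫ ρ in Ioc a ζ, ψ' ρ = ψ ζ := fun ζ hζ => by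
    rw [← intervalIntegral.integral_of_le hζ, intervalIntegral.integral_eq_sub_of_hasDerivAt
      (fun x _ => hψ x) (hψ'.intervalIntegrable _ _)]
    ring
  have hα : IntegrableOn ψ' (Ioc a b) := hψ'.integrableOn_Ioc
  have key := setIntegral_product_rule (𝕜 := ℝ) hα hθ (ψ a) c
  rw [hFT b hab.le, hbd, sub_self] at key
  have hψc : Continuous ψ := continuous_iff_continuousAt.2 fun ζ => (hψ ζ).continuousAt
  have i1 : IntegrableOn (fun ζ => ψ ζ • θ ζ) (Ioc a b) :=
    hθ.continuousOn_smul_of_subset hψc.continuousOn isCompact_Icc measurableSet_Ioc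
      Ioc_subset_Icc_self
  have hV : ContinuousOn (fun ζ => c + ∫ ρ in Ioc a ζ, θ ρ) (Icc a b) :=
    continuousOn_const.add (intervalIntegral.continuousOn_primitive
      ((integrableOn_Icc_iff_integrableOn_Ioc (by simp)).2 hθ))
  have i2 : IntegrableOn (fun ζ => ψ' ζ • (c + ∫ ρ in Ioc a ζ, θ ρ)) (Ioc a b) :=
    ((hψ'.continuousOn.smul hV).integrableOn_Icc).mono_set Ioc_subset_Icc_self
  have e : ∫ ζ in Ioc a b, (ψ' ζ • (c + ∫ ρ in Ioc a ζ, θ ρ) + (ψ a + ∫ ρ in Ioc a ζ, ψ' ρ) • θ ζ) =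
      ∫ ζ in Ioc a b, (ψ' ζ • (c + ∫ ρ in Ioc a ζ, θ ρ) + ψ ζ • θ ζ) :=
    setIntegral_congr_fun measurableSet_Ioc fun ζ hζ => by simp only [hFT ζ hζ.1.le]
  rw [e, integral_add i2 i1] at key
  exact eq_neg_of_add_eq_zero_left key.symm

/-- A vertical integration by parts that holds on almost every line holds in the layer. -/
theorem integral_kernel_smul_of_slices {κ : Plane → ℝ} {κ' : Fin 2 → Plane → ℝ}
    (hκ : C1Kernel κ κ') {ψ ψ' : ℝ → ℝ} (hψ : Continuous ψ) (hψ' : Continuous ψ')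
    {u θ : ℝ³ → E} (hu : MemL u) (hθ : MemL θ)
    (h : ∀ᵐ x : Plane, ∫ ζ in Ioo z₀ z₁, ψ' ζ • u (x, ζ) = -∫ ζ in Ioo z₀ z₁, ψ ζ • θ (x, ζ)) :
    ∫ q in Ω, (κ q.1 * ψ' q.2) • u q = -∫ q in Ω, (κ q.1 * ψ q.2) • θ q := by
  have i1 := hu.integrable_mul_smul hκ.measurable hκ.integrable hψ'
  have i2 := hθ.integrable_mul_smul hκ.measurable hκ.integrable hψ
  rw [volume_restrict_layer] at i1 i2 ⊢
  rw [integral_prod _ i1, integral_prod _ i2, ← integral_neg]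
  refine integral_congr_ae ?_
  filter_upwards [h] with x hx
  simp only [mul_smul]
  rw [integral_smul, integral_smul, hx, smul_neg]

/-- Vertical integration by parts against a function vanishing at the walls. -/
theorem WeakDeriv.integral_kernel_smul [CompleteSpace E] {f g : ℝ³ → E}
    (hd : WeakDeriv 2 f g) (hf : MemL f) (hg : MemL g)
    (hfm : StronglyMeasurable f) (hgm : StronglyMeasurable g) {κ : Plane → ℝ}
    {κ' : Fin 2 → Plane → ℝ} (hκ : C1Kernel κ κ') {ψ ψ' : ℝ → ℝ}
    (hψ : ∀ ζ, HasDerivAt ψ (ψ' ζ) ζ) (hψ' : Continuous ψ') (h0 : ψ z₀ = 0) (h1 : ψ z₁ = 0) :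
    ∫ q in Ω, (κ q.1 * ψ' q.2) • f q = -∫ q in Ω, (κ q.1 * ψ q.2) • g q := by
  have hψc : Continuous ψ := continuous_iff_continuousAt.2 fun ζ => (hψ ζ).continuousAt
  refine integral_kernel_smul_of_slices hκ hψc hψ' hf hg ?_
  filter_upwards [hd.exists_vertical_primitive hf hg hfm hgm, hg.ae_integrable] with x ⟨c, hc⟩ hgi
  have hgi' : IntegrableOn (fun ζ => g (x, ζ)) (Ioc z₀ z₁) :=
    (integrableOn_Ioc_iff_integrableOn_Ioo (by simp)).2 hgi
  have := setIntegral_deriv_smul hz hgi' c hψ hψ' (by rw [h0, h1, zero_smul, zero_smul])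
  rw [integral_Ioc_eq_integral_Ioo, integral_Ioc_eq_integral_Ioo] at this
  rw [← this]
  refine integral_congr_ae ?_
  filter_upwards [hc] with ζ hζ
  rw [hζ]

/-- Compactly supported test functions on the plane are admissible weights. -/
theorem c1Kernel_test {φ : Plane → ℝ} (h : ContDiff ℝ (⊤ : ℕ∞) φ) (hc : HasCompactSupport φ) :
    C1Kernel φ (fun j => pd j φ) := by
  have hpdc : ∀ j, Continuous (pd j φ) := fun j =>
    (h.continuous_fderiv (by simp)).clm_apply continuous_const
  have hpds : ∀ j, HasCompactSupport (pd j φ) := fun j =>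
    (hc.fderiv (𝕜 := ℝ)).mono' fun x hx => subset_tsupport _ fun h0 => hx (by
      simp only [pd, h0]; rfl)
  refine ⟨h.continuous.measurable, h.continuous.integrable_of_hasCompactSupport hc, hpdc,
    fun j => (hpdc j).integrable_of_hasCompactSupport (hpds j), fun j x => ?_⟩
  have h1 := (h.differentiable (by simp) (x + (0 : ℝ) • EuclideanSpace.single j 1)).hasFDerivAt
  have h2 : HasDerivAt (fun s : ℝ => x + s • EuclideanSpace.single j (1 : ℝ))
      (EuclideanSpace.single j 1) 0 := by
    simpa using ((hasDerivAt_id (0 : ℝ)).smul_const (EuclideanSpace.single j (1 : ℝ))).const_add x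
  refine (h1.comp_hasDerivAt 0 h2).congr_deriv ?_
  rw [zero_smul, add_zero]; rfl
end

variable {𝕜 : Type*} [RCLike 𝕜] [Layer]

/-- The vertical average of `v` is divergence free, written as an integral over the layer. -/
def DivFree (v : ℝ³ → Vel 𝕜) : Prop :=
  ∀ φ : Plane → ℝ, ContDiff ℝ (⊤ : ℕ∞) φ → HasCompactSupport φ →
    ∑ j : Fin 2, ∫ p in Ω, pd j φ p.1 • v p j = 0

theorem MemLinf.coord {v : ℝ³ → Vel 𝕜} (hv : MemL v) (j : Fin 2) : MemL fun p => v p j :=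
  (memLinf_clm ((EuclideanSpace.proj j : Vel 𝕜 →L[𝕜] 𝕜).restrictScalars ℝ) hv).1

theorem memLinfSigma_iff {v : ℝ³ → Vel 𝕜} : MemLinfSigma z₀ z₁ v ↔ MemL v ∧ DivFree v := by
  refine and_congr_right fun hv => forall_congr' fun φ => forall_congr' fun h1 =>
    forall_congr' fun h2 => ?_
  have hi : ∀ j : Fin 2, Integrable (fun p : ℝ³ => pd j φ p.1 • v p j) μΩ := fun j => by
    have hκ := c1Kernel_test h1 h2
    simpa using (hv.coord j).integrable_mul_smul (hκ.continuous' j).measurable (hκ.integrable' j)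
      (continuous_const (y := (1 : ℝ)))
  have e : ∀ᵐ x : Plane, ∀ j : Fin 2, (vertAvg z₀ z₁ v x) j =
      (z₁ - z₀)⁻¹ • ∫ ζ in Ioo z₀ z₁, v (x, ζ) j := by
    filter_upwards [hv.ae_integrable] with x hx j
    simp only [vertAvg, PiLp.smul_apply]
    congr 1
    exact (((EuclideanSpace.proj j : Vel 𝕜 →L[𝕜] 𝕜).restrictScalars ℝ).integral_comp_comm hx).symm
  have hj : ∀ j : Fin 2, Integrable (fun x => pd j φ x • (vertAvg z₀ z₁ v x) j) ∧
      ∫ x, pd j φ x • (vertAvg z₀ z₁ v x) j = (z₁ - z₀)⁻¹ • ∫ p in Ω, pd j φ p.1 • v p j := by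
    intro j
    have hij := hi j
    rw [volume_restrict_layer] at hij ⊢
    have h3 : (fun x => (z₁ - z₀)⁻¹ • ∫ ζ in Ioo z₀ z₁, pd j φ x • v (x, ζ) j) =ᵐ[volume]
        fun x => pd j φ x • (vertAvg z₀ z₁ v x) j := by
      filter_upwards [e] with x hx
      rw [hx, integral_smul, smul_comm]
    refine ⟨(hij.integral_prod_left.smul (z₁ - z₀)⁻¹).congr h3, ?_⟩
    rw [integral_prod _ hij, ← integral_smul]
    exact integral_congr_ae h3.symm
  rw [integral_finsetSum _ fun j _ => (hj j).1]
  simp only [(hj _).2]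
  rw [← Finset.smul_sum, smul_eq_zero]
  exact or_iff_right (inv_ne_zero (sub_pos.2 hz).ne')

/-- A field `v` in `L^∞(L¹)` with weak gradient `Dv` in `L^∞(L¹)`, given by representatives that are
measurable everywhere. -/
structure IsPreField (v : ℝ³ → Vel 𝕜) (Dv : ℝ³ → Grad 𝕜) : Prop where
  sm : StronglyMeasurable v
  sm' : StronglyMeasurable Dv
  mem : MemL v
  mem' : MemL Dv
  weak : ∀ i : Fin 3, WeakDeriv i v fun p => Dv p i

/-- The horizontal divergence, read off from the gradient. -/
def hdiv (Dv : ℝ³ → Grad 𝕜) (p : ℝ³) : 𝕜 := Dv p 0 0 + Dv p 1 1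

section
variable {v v' : ℝ³ → Vel 𝕜} {Dv Dv' : ℝ³ → Grad 𝕜}

/-- The component `g ↦ g i` of a gradient. -/
def gradProj (𝕜 : Type*) [RCLike 𝕜] (i : Fin 3) : Grad 𝕜 →L[ℝ] Vel 𝕜 :=
  PiLp.proj (𝕜 := ℝ) 2 (fun _ : Fin 3 => Vel 𝕜) i

/-- The component `v ↦ v j` of a velocity. -/
def velProj (𝕜 : Type*) [RCLike 𝕜] (j : Fin 2) : Vel 𝕜 →L[ℝ] 𝕜 :=
  (EuclideanSpace.proj j : Vel 𝕜 →L[𝕜] 𝕜).restrictScalars ℝ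

theorem velProj_apply (j : Fin 2) (v : Vel 𝕜) : velProj 𝕜 j v = v j := rfl

theorem enorm_grad_le (i : Fin 3) (g : Grad 𝕜) : ‖g i‖ₑ ≤ ‖g‖ₑ := by
  rw [enorm_le_iff_norm_le]; exact PiLp.norm_apply_le g i

theorem enorm_vel_le (j : Fin 2) (v : Vel 𝕜) : ‖v j‖ₑ ≤ ‖v‖ₑ := by
  rw [enorm_le_iff_norm_le]; exact PiLp.norm_apply_le v j

theorem enorm_hdiv_le (Dv : ℝ³ → Grad 𝕜) (p : ℝ³) : ‖hdiv Dv p‖ₑ ≤ (2 : ℝ≥0) * ‖Dv p‖ₑ := by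
  refine (enorm_add_le _ _).trans ?_
  rw [show ((2 : ℝ≥0) : ℝ≥0∞) = 2 by norm_num, two_mul]
  exact add_le_add ((enorm_vel_le _ _).trans (enorm_grad_le _ _))
    ((enorm_vel_le _ _).trans (enorm_grad_le _ _))

theorem stronglyMeasurable_hdiv {X : Type*} [MeasurableSpace X] {g : X → Grad 𝕜}
    (h : StronglyMeasurable g) : StronglyMeasurable fun x => g x 0 0 + g x 1 1 :=
  (((velProj 𝕜 0).comp (gradProj 𝕜 0)).continuous.comp_stronglyMeasurable h).add
    (((velProj 𝕜 1).comp (gradProj 𝕜 1)).continuous.comp_stronglyMeasurable h)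

theorem IsPreField.memLinf_grad (h : IsPreField v Dv) (i : Fin 3) :
    MemL fun p => Dv p i := (memLinf_clm (gradProj 𝕜 i) h.mem').1

theorem IsPreField.sm_grad (h : IsPreField v Dv) (i : Fin 3) : StronglyMeasurable fun p => Dv p i :=
  (gradProj 𝕜 i).continuous.comp_stronglyMeasurable h.sm'

theorem IsPreField.memLinf_hdiv (h : IsPreField v Dv) : MemL (hdiv Dv) :=
  ((h.memLinf_grad 0).coord 0).add ((h.memLinf_grad 1).coord 1)

theorem IsPreField.horizDeriv (h : IsPreField v Dv) (j : Fin 2) :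
    HorizDeriv j v fun p => Dv p j.castSucc :=
  (h.weak _).horizDeriv h.mem (h.memLinf_grad _) h.sm (h.sm_grad _)

theorem IsPreField.horizDeriv_coord (h : IsPreField v Dv) (j k : Fin 2) :
    HorizDeriv j (fun p => v p k) fun p => Dv p j.castSucc k :=
  ((h.weak _).clm h.mem (h.memLinf_grad _) (velProj 𝕜 k)).horizDeriv (h.mem.coord k)
    ((h.memLinf_grad _).coord k) ((velProj 𝕜 k).continuous.comp_stronglyMeasurable h.sm)
    ((velProj 𝕜 k).continuous.comp_stronglyMeasurable (h.sm_grad _))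

theorem IsPreField.sub (h : IsPreField v Dv) (h' : IsPreField v' Dv') :
    IsPreField (v - v') (Dv - Dv') where
  sm := h.sm.sub h'.sm
  sm' := h.sm'.sub h'.sm'
  mem := h.mem.sub h'.mem
  mem' := h.mem'.sub h'.mem'
  weak := fun i => by
    have := (h.weak i).add (h'.weak i).neg h.mem (h.memLinf_grad i) h'.mem.neg
      (h'.memLinf_grad i).neg
    rw [← sub_eq_add_neg, ← sub_eq_add_neg] at this
    exact this

theorem isPreField_zero : IsPreField (0 : ℝ³ → Vel 𝕜) 0 where
  sm := stronglyMeasurable_zero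
  sm' := stronglyMeasurable_zero
  mem := MemLinf.zero
  mem' := MemLinf.zero
  weak := fun i φ _ _ _ => by simp

/-- For a field with a gradient the divergence condition holds pointwise in `x`. -/
theorem IsPreField.divFree_iff (h : IsPreField v Dv) :
    DivFree v ↔ ∀ᵐ x : Plane, ∫ ζ in Ioo z₀ z₁, hdiv Dv (x, ζ) = 0 := by
  have key : ∀ φ : Plane → ℝ, ContDiff ℝ (⊤ : ℕ∞) φ → HasCompactSupport φ →
      ∑ j : Fin 2, ∫ p in Ω, pd j φ p.1 • v p j = -∫ x, φ x • ∫ ζ in Ioo z₀ z₁, hdiv Dv (x, ζ) := by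
    intro φ h1 h2
    have hκ := c1Kernel_test h1 h2
    have hj : ∀ j : Fin 2, ∫ p in Ω, pd j φ p.1 • v p j =
        -∫ p in Ω, φ p.1 • Dv p j.castSucc j := fun j => by
      have := (h.horizDeriv_coord j j).integral_kernel_smul (h.mem.coord j)
        ((h.memLinf_grad _).coord j) ((velProj 𝕜 j).continuous.comp_stronglyMeasurable h.sm)
        ((velProj 𝕜 j).continuous.comp_stronglyMeasurable (h.sm_grad _)) hκ
        (continuous_const (y := (1 : ℝ)))
      simpa using this
    have hi : ∀ g : ℝ³ → 𝕜, MemL g → Integrable (fun p => φ p.1 • g p) μΩ := fun g hg => by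
      simpa using hg.integrable_mul_smul hκ.measurable hκ.integrable (continuous_const (y := (1 : ℝ)))
    rw [Fin.sum_univ_two, hj, hj, ← neg_add]
    congr 1
    have i1 := hi _ ((h.memLinf_grad 0).coord 0)
    have i2 := hi _ ((h.memLinf_grad 1).coord 1)
    have i3 := hi _ h.memLinf_hdiv
    refine (integral_add i1 i2).symm.trans ?_
    have e : ∀ p, φ p.1 • Dv p 0 0 + φ p.1 • Dv p 1 1 = φ p.1 • hdiv Dv p := fun p => by
      rw [hdiv, smul_add]
    simp only [e]
    rw [volume_restrict_layer] at i3 ⊢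
    rw [integral_prod _ i3]
    simp only [integral_smul]
  constructor
  · intro hd
    have hloc : LocallyIntegrable fun x : Plane => ∫ ζ in Ioo z₀ z₁, hdiv Dv (x, ζ) := by
      have hsm : StronglyMeasurable fun x : Plane => ∫ ζ in Ioo z₀ z₁, hdiv Dv (x, ζ) :=
        ((stronglyMeasurable_hdiv h.sm').integral_prod_right' (ν := volume.restrict (Ioo z₀ z₁)))
      have hb : ∀ᵐ x : Plane, ‖∫ ζ in Ioo z₀ z₁, hdiv Dv (x, ζ)‖ ≤ (nrm (hdiv Dv)).toReal := by
        filter_upwards [sliceNorm_le_normInfOne (hdiv Dv)] with x hx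
        rw [← toReal_enorm]
        exact ENNReal.toReal_mono h.memLinf_hdiv.2.ne
          ((enorm_integral_le_lintegral_enorm _).trans hx)
      refine (locallyIntegrable_const (nrm (hdiv Dv)).toReal).mono hsm.aestronglyMeasurable ?_
      filter_upwards [hb] with x hx
      rwa [Real.norm_of_nonneg ENNReal.toReal_nonneg]
    refine ae_eq_zero_of_integral_contDiff_smul_eq_zero hloc fun φ h1 h2 => ?_
    have := key φ h1 h2
    rw [hd φ h1 h2] at this
    exact neg_eq_zero.1 this.symm
  · intro h0 φ h1 h2
    rw [key φ h1 h2, neg_eq_zero]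
    refine integral_eq_zero_of_ae ?_
    filter_upwards [h0] with x hx
    rw [hx, smul_zero]; rfl
end

end

section

section
variable {E E₁ E₂ : Type*} [NormedAddCommGroup E] [NormedAddCommGroup E₁] [NormedAddCommGroup E₂]
  [Layer]

theorem normInfOne_le_add_mul {f₁ : ℝ³ → E₁} {f₂ : ℝ³ → E₂} {g : ℝ³ → E}
    (h₁ : AEStronglyMeasurable f₁ μΩ) (c₁ c₂ : ℝ≥0)
    (h : ∀ᵐ p ∂μΩ, ‖g p‖ₑ ≤ c₁ * ‖f₁ p‖ₑ + c₂ * ‖f₂ p‖ₑ) :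
    nrm g ≤ c₁ * nrm f₁ + c₂ * nrm f₂ := by
  refine normInfOne_le ?_
  filter_upwards [ae_slice h, aesm_slice h₁, sliceNorm_le_normInfOne f₁,
    sliceNorm_le_normInfOne f₂] with x hx hm b₁ b₂
  refine (lintegral_mono_ae hx).trans ?_
  rw [lintegral_add_left' (hm.enorm.const_mul _), lintegral_const_mul' _ _ ENNReal.coe_ne_top,
    lintegral_const_mul' _ _ ENNReal.coe_ne_top]
  gcongr <;> assumption

theorem MemLinf.of_le_mul {f : ℝ³ → E₁} {g : ℝ³ → E} (hf : MemL f)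
    (hg : AEStronglyMeasurable g μΩ) {c : ℝ≥0∞} (hc : c ≠ ∞)
    (h : ∀ᵐ p ∂μΩ, ‖g p‖ₑ ≤ c * ‖f p‖ₑ) : MemL g := by
  lift c to ℝ≥0 using hc
  exact ⟨hg, (normInfOne_le_mul c h).trans_lt (mul_lt_top ENNReal.coe_lt_top hf.2)⟩

theorem exists_coe_eq {a : ℝ≥0∞} (h : a ≠ ∞) : ∃ c : ℝ≥0, (c : ℝ≥0∞) = a :=
  ⟨_, ENNReal.coe_toNNReal h⟩

theorem enorm_pi_le {ι : Type*} [Fintype ι] {f : ι → E} {c : ℝ≥0∞} (h : ∀ i, ‖f i‖ₑ ≤ c) :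
    ‖f‖ₑ ≤ c := by
  by_cases hc : c = ∞
  · simp [hc]
  lift c to ℝ≥0 using hc
  exact ENNReal.coe_le_coe.2 (pi_nnnorm_le_iff.2 fun i => ENNReal.coe_le_coe.1 (h i))

theorem ae_layer_of_ae {P : Plane → Prop} (h : ∀ᵐ x : Plane, P x) : ∀ᵐ p ∂μΩ, P p.1 := by
  rw [volume_restrict_layer]
  exact Measure.quasiMeasurePreserving_fst.ae h
end

variable {𝕜 : Type*} [RCLike 𝕜] [Layer] {v v' : ℝ³ → Vel 𝕜} {Dv Dv' : ℝ³ → Grad 𝕜}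

theorem vertVel_eq {p : ℝ³} (hp : p ∈ Ω) : vertVel z₁ Dv p = ∫ ζ in Ioc p.2 z₁, hdiv Dv (p.1, ζ) :=
  intervalIntegral.integral_of_le hp.2.2.le

theorem stronglyMeasurable_vertVel {X : Type*} [MeasurableSpace X]
    {Dv : X → ℝ³ → Grad 𝕜} (h : StronglyMeasurable fun r : X × ℝ³ => Dv r.1 r.2) :
    StronglyMeasurable fun r : X × ℝ³ => vertVel z₁ (Dv r.1) r.2 := by
  have hg : StronglyMeasurable fun r : (X × ℝ³) × ℝ => hdiv (Dv r.1.1) (r.1.2.1, r.2) :=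
    stronglyMeasurable_hdiv (h.comp_measurable (g := fun r : (X × ℝ³) × ℝ =>
      (r.1.1, (r.1.2.1, r.2))) (by fun_prop))
  have hz : Measurable fun r : X × ℝ³ => r.2.2 := by fun_prop
  exact (stronglyMeasurable_setIntegral_Ioc hz measurable_const hg).sub
    (stronglyMeasurable_setIntegral_Ioc measurable_const hz hg)

theorem ae_enorm_vertVel_le : ∀ᵐ p ∂μΩ, ‖vertVel z₁ Dv p‖ₑ ≤ 2 * nrm Dv := by
  filter_upwards [ae_layer_of_ae (sliceNorm_le_normInfOne Dv),
    ae_restrict_mem measurableSet_layer] with p hx hp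
  rw [vertVel_eq hp]
  refine (enorm_integral_le_lintegral_enorm _).trans ?_
  calc ∫⁻ ζ in Ioc p.2 z₁, ‖hdiv Dv (p.1, ζ)‖ₑ ≤ ∫⁻ ζ in Ioc z₀ z₁, ‖hdiv Dv (p.1, ζ)‖ₑ :=
        lintegral_mono_set (Ioc_subset_Ioc_left hp.2.1.le)
    _ = ∫⁻ ζ in Ioo z₀ z₁, ‖hdiv Dv (p.1, ζ)‖ₑ := by rw [restrict_Ioo_eq_restrict_Ioc]
    _ ≤ ∫⁻ ζ in Ioo z₀ z₁, 2 * ‖Dv (p.1, ζ)‖ₑ := lintegral_mono fun ζ => enorm_hdiv_le _ _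
    _ = 2 * sliceNorm Dv p.1 := lintegral_const_mul' _ _ (by simp)
    _ ≤ _ := by gcongr

theorem IsPreField.ae_integrable_hdiv (h : IsPreField v Dv) :
    ∀ᵐ x : Plane, IntegrableOn (fun ζ => hdiv Dv (x, ζ)) (Ioc z₀ z₁) := by
  filter_upwards [h.memLinf_hdiv.ae_integrable] with x hx
  exact (integrableOn_Ioc_iff_integrableOn_Ioo (by simp)).2 hx

theorem IsPreField.ae_vertVel_sub (h : IsPreField v Dv) (h' : IsPreField v' Dv') : ∀ᵐ p ∂μΩ,
      vertVel z₁ (Dv - Dv') p = vertVel z₁ Dv p - vertVel z₁ Dv' p := by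
  filter_upwards [ae_layer_of_ae h.ae_integrable_hdiv, ae_layer_of_ae h'.ae_integrable_hdiv,
    ae_restrict_mem measurableSet_layer] with p h1 h2 hp
  have hs : Ioc p.2 z₁ ⊆ Ioc z₀ z₁ := Ioc_subset_Ioc_left hp.2.1.le
  rw [vertVel_eq hp, vertVel_eq hp, vertVel_eq hp, ← integral_sub (h1.mono_set hs) (h2.mono_set hs)]
  refine integral_congr_ae (Eventually.of_forall fun ζ => ?_)
  simp only [hdiv, Pi.sub_apply, PiLp.sub_apply]
  ring

/-- The full velocity `(v₁, v₂, w)`. -/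
def fullVel (v : ℝ³ → Vel 𝕜) (Dv : ℝ³ → Grad 𝕜) (q : ℝ³) :
    Fin 3 → 𝕜 := ![v q 0, v q 1, vertVel z₁ Dv q]

/-- The flux `u ⊗ v`, as the three fields `v₁ v`, `v₂ v`, `w v`. -/
def flux (v : ℝ³ → Vel 𝕜) (Dv : ℝ³ → Grad 𝕜) (q : ℝ³) :
    Fin 3 → Vel 𝕜 := fun i => fullVel v Dv q i • v q

/-- The convective term `(u · ∇) v`. -/
def conv (v : ℝ³ → Vel 𝕜) (Dv : ℝ³ → Grad 𝕜) (q : ℝ³) : Vel 𝕜 :=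
  ∑ i : Fin 3, fullVel v Dv q i • Dv q i

theorem fullVel_castSucc (j : Fin 2) (q : ℝ³) :
    fullVel v Dv q j.castSucc = v q j := by fin_cases j <;> rfl

theorem stronglyMeasurable_fullVel {X : Type*} [MeasurableSpace X] {v : X → ℝ³ → Vel 𝕜}
    {Dv : X → ℝ³ → Grad 𝕜} (h : StronglyMeasurable fun r : X × ℝ³ => v r.1 r.2)
    (h' : StronglyMeasurable fun r : X × ℝ³ => Dv r.1 r.2) (i : Fin 3) :
    StronglyMeasurable fun r : X × ℝ³ => fullVel (v r.1) (Dv r.1) r.2 i := by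
  rcases castSucc_or_eq_two i with ⟨j, rfl⟩ | rfl
  · simp only [fullVel_castSucc]
    exact (velProj 𝕜 j).continuous.comp_stronglyMeasurable h
  · exact stronglyMeasurable_vertVel h'

theorem stronglyMeasurable_flux {X : Type*} [MeasurableSpace X] {v : X → ℝ³ → Vel 𝕜}
    {Dv : X → ℝ³ → Grad 𝕜} (h : StronglyMeasurable fun r : X × ℝ³ => v r.1 r.2)
    (h' : StronglyMeasurable fun r : X × ℝ³ => Dv r.1 r.2) :
    StronglyMeasurable fun r : X × ℝ³ => flux (v r.1) (Dv r.1) r.2 := by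
  have : Measurable fun r : X × ℝ³ => flux (v r.1) (Dv r.1) r.2 :=
    measurable_pi_lambda _ fun i => ((stronglyMeasurable_fullVel h h' i).smul h).measurable
  exact this.stronglyMeasurable

theorem stronglyMeasurable_conv {X : Type*} [MeasurableSpace X] {v : X → ℝ³ → Vel 𝕜}
    {Dv : X → ℝ³ → Grad 𝕜} (h : StronglyMeasurable fun r : X × ℝ³ => v r.1 r.2)
    (h' : StronglyMeasurable fun r : X × ℝ³ => Dv r.1 r.2) :
    StronglyMeasurable fun r : X × ℝ³ => conv (v r.1) (Dv r.1) r.2 :=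
  Finset.stronglyMeasurable_fun_sum _ fun i _ => (stronglyMeasurable_fullVel h h' i).smul
    ((gradProj 𝕜 i).continuous.comp_stronglyMeasurable h')

/-- The constant of the vertical Sobolev estimate, which is the only one that depends on the
height of the layer. -/
def sobConst : ℝ≥0 := Real.toNNReal (z₁ - z₀)⁻¹ + 2

theorem IsPreField.ae_enorm_fullVel_le (h : IsPreField v Dv) : ∀ᵐ p ∂μΩ, ‖v p‖ₑ ≤ sobConst *
      (nrm v + nrm Dv) ∧ ∀ i, ‖fullVel v Dv p i‖ₑ ≤ sobConst *
      (nrm v + nrm Dv) := by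
  have hD : nrm (fun p => Dv p 2) ≤ nrm Dv :=
    normInfOne_mono_ae (Eventually.of_forall fun p => enorm_grad_le 2 _)
  filter_upwards [(h.weak 2).ae_enorm_le h.mem (h.memLinf_grad 2) h.sm (h.sm_grad 2),
    ae_enorm_vertVel_le (Dv := Dv)] with p h1 h2
  have hc : (sobConst : ℝ≥0∞) = ofReal (z₁ - z₀)⁻¹ + 2 := by simp [sobConst, ofReal]
  have hv : ‖v p‖ₑ ≤ sobConst * (nrm v + nrm Dv) := by
    refine h1.trans ?_
    rw [hc, mul_add]
    refine add_le_add (by gcongr; exact le_self_add) (hD.trans ?_)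
    refine le_mul_of_one_le_left' ?_
    exact le_add_left (by norm_num)
  refine ⟨hv, fun i => ?_⟩
  rcases castSucc_or_eq_two i with ⟨j, rfl⟩ | rfl
  · rw [fullVel_castSucc]; exact (enorm_vel_le j _).trans hv
  · refine h2.trans ?_
    rw [hc]
    gcongr
    · exact le_add_self
    · exact le_add_self

theorem IsPreField.ae_fullVel_sub (h : IsPreField v Dv) (h' : IsPreField v' Dv') : ∀ᵐ p ∂μΩ, ∀ i,
      fullVel (v - v') (Dv - Dv') p i = fullVel v Dv p i - fullVel v' Dv' p i := by
  filter_upwards [h.ae_vertVel_sub h'] with p hp i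
  rcases castSucc_or_eq_two i with ⟨j, rfl⟩ | rfl
  · simp [fullVel_castSucc]
  · exact hp

/-- The two products of the difference of two bilinear expressions. -/
theorem smul_sub_smul_eq {E : Type*} [NormedAddCommGroup E] [NormedSpace 𝕜 E] (a b : 𝕜) (x y : E) :
    a • x - b • y = (a - b) • x + b • (x - y) := by
  rw [sub_smul, smul_sub]; abel

theorem IsPreField.norm_ne_top (h : IsPreField v Dv) : (sobConst : ℝ≥0∞) * (nrm v + nrm Dv) ≠ ∞ :=
  ENNReal.mul_ne_top ENNReal.coe_ne_top (ENNReal.add_lt_top.2 ⟨h.mem.2, h.mem'.2⟩).ne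

theorem IsPreField.normInfOne_flux_sub_le (h : IsPreField v Dv) (h' : IsPreField v' Dv') :
    nrm (flux v Dv - flux v' Dv') ≤ sobConst * (nrm (v - v') + nrm (Dv - Dv')) * nrm v +
        sobConst * (nrm v' + nrm Dv') * nrm (v - v') := by
  obtain ⟨c₁, hc₁⟩ := exists_coe_eq (h.sub h').norm_ne_top
  obtain ⟨c₂, hc₂⟩ := exists_coe_eq h'.norm_ne_top
  rw [← hc₁, ← hc₂]
  refine normInfOne_le_add_mul h.mem.1 c₁ c₂ ?_
  filter_upwards [(h.sub h').ae_enorm_fullVel_le, h'.ae_enorm_fullVel_le,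
    h.ae_fullVel_sub h'] with p h1 h2 h3
  rw [← hc₁] at h1
  rw [← hc₂] at h2
  refine enorm_pi_le fun i => ?_
  simp only [Pi.sub_apply, flux]
  rw [smul_sub_smul_eq, ← h3]
  refine (enorm_add_le _ _).trans ?_
  rw [enorm_smul, enorm_smul]
  exact add_le_add (mul_le_mul_left (h1.2 i) _) (mul_le_mul_left (h2.2 i) _)

theorem IsPreField.normInfOne_conv_sub_le (h : IsPreField v Dv) (h' : IsPreField v' Dv') :
    nrm (conv v Dv - conv v' Dv') ≤ 3 * (sobConst * (nrm (v - v') + nrm (Dv - Dv')) * nrm Dv +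
        sobConst * (nrm v' + nrm Dv') * nrm (Dv - Dv')) := by
  obtain ⟨c₁, hc₁⟩ := exists_coe_eq (h.sub h').norm_ne_top
  obtain ⟨c₂, hc₂⟩ := exists_coe_eq h'.norm_ne_top
  rw [← hc₁, ← hc₂, mul_add, ← mul_assoc, ← mul_assoc]
  refine normInfOne_le_add_mul h.mem'.1 (3 * c₁) (3 * c₂) ?_
  filter_upwards [(h.sub h').ae_enorm_fullVel_le, h'.ae_enorm_fullVel_le,
    h.ae_fullVel_sub h'] with p h1 h2 h3
  rw [← hc₁] at h1
  rw [← hc₂] at h2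
  simp only [Pi.sub_apply, conv]
  rw [← Finset.sum_sub_distrib]
  refine (enorm_sum_le _ _).trans ?_
  have : ∀ i ∈ (Finset.univ : Finset (Fin 3)),
      ‖fullVel v Dv p i • Dv p i - fullVel v' Dv' p i • Dv' p i‖ₑ ≤
        c₁ * ‖Dv p‖ₑ + c₂ * ‖Dv p - Dv' p‖ₑ := fun i _ => by
    rw [smul_sub_smul_eq, ← h3]
    refine (enorm_add_le _ _).trans ?_
    rw [enorm_smul, enorm_smul]
    exact add_le_add (mul_le_mul' (h1.2 i) (enorm_grad_le i _))
      (mul_le_mul' (h2.2 i) (enorm_grad_le i (Dv p - Dv' p)))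
  refine (Finset.sum_le_card_nsmul _ _ _ this).trans (le_of_eq ?_)
  simp only [Finset.card_univ, Fintype.card_fin, nsmul_eq_mul, ENNReal.coe_mul]
  push_cast
  ring

theorem IsPreField.memLinf_flux (h : IsPreField v Dv) : MemL (flux v Dv) := by
  refine h.mem.of_le_mul ?_ h.norm_ne_top ?_
  · exact ((stronglyMeasurable_flux (X := Unit) (v := fun _ => v) (Dv := fun _ => Dv) (h.sm.comp_measurable measurable_snd)
      (h.sm'.comp_measurable measurable_snd)).comp_measurable
        (g := fun p => ((), p)) measurable_prodMk_left).aestronglyMeasurable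
  · filter_upwards [h.ae_enorm_fullVel_le] with p hp
    refine enorm_pi_le fun i => ?_
    rw [flux, enorm_smul]
    exact mul_le_mul_left (hp.2 i) _

theorem IsPreField.memLinf_fullVel_smul (h : IsPreField v Dv)
    {f : ℝ³ → Vel 𝕜} (hf : MemL f) (i : Fin 3) :
    MemL fun p => fullVel v Dv p i • f p := by
  refine hf.of_le_mul ?_ h.norm_ne_top ?_
  · exact AEStronglyMeasurable.smul ((stronglyMeasurable_fullVel (X := Unit) (v := fun _ => v) (Dv := fun _ => Dv)
      (h.sm.comp_measurable measurable_snd) (h.sm'.comp_measurable measurable_snd) i).comp_measurable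
        (g := fun p => ((), p)) measurable_prodMk_left).aestronglyMeasurable hf.1
  · filter_upwards [h.ae_enorm_fullVel_le] with p hp
    rw [enorm_smul]
    exact mul_le_mul_left (hp.2 i) _

theorem IsPreField.memLinf_conv (h : IsPreField v Dv) : MemL (conv v Dv) :=
  MemLinf.fun_sum _ fun i _ => h.memLinf_fullVel_smul (h.memLinf_grad i) i

theorem IsPreField.memLinf_smul (h : IsPreField v Dv)
    {f : ℝ³ → 𝕜} (hf : MemL f) : MemL fun p => f p • v p := by
  refine hf.of_le_mul (AEStronglyMeasurable.smul hf.1 h.mem.1) h.norm_ne_top ?_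
  filter_upwards [h.ae_enorm_fullVel_le] with p hp
  rw [enorm_smul, mul_comm]
  exact mul_le_mul_left hp.1 _

end

section

variable {𝕜 : Type*} [RCLike 𝕜] [Layer] {v v' : ℝ³ → Vel 𝕜} {Dv Dv' : ℝ³ → Grad 𝕜}

/-- A field with a gradient, whose vertical average is divergence free. -/
structure IsField (v : ℝ³ → Vel 𝕜) (Dv : ℝ³ → Grad 𝕜) : Prop
    extends IsPreField v Dv where
  div : ∀ᵐ x : Plane, ∫ ζ in Ioo z₀ z₁, hdiv Dv (x, ζ) = 0

/-- The derivative of the vertical flux `w v`, integrated against a function that need not vanish at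
the walls: `w` vanishes at both of them. -/
theorem IsField.integral_vertFlux (h : IsField v Dv) {κ : Plane → ℝ}
    {κ' : Fin 2 → Plane → ℝ} (hκ : C1Kernel κ κ') {ψ ψ' : ℝ → ℝ}
    (hψ : ∀ ζ, HasDerivAt ψ (ψ' ζ) ζ) (hψ' : Continuous ψ') :
    ∫ q in Ω, (κ q.1 * ψ' q.2) • (vertVel z₁ Dv q • v q) = -∫ q in Ω, (κ q.1 * ψ q.2) •
        (-(hdiv Dv q • v q) + vertVel z₁ Dv q • Dv q 2) := by
  have hψc : Continuous ψ := continuous_iff_continuousAt.2 fun ζ => (hψ ζ).continuousAt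
  refine integral_kernel_smul_of_slices hκ hψc hψ' (h.memLinf_fullVel_smul h.mem 2)
    (θ := fun q => -(hdiv Dv q • v q) + vertVel z₁ Dv q • Dv q 2)
    ((h.memLinf_smul h.memLinf_hdiv).neg.add (h.memLinf_fullVel_smul (h.memLinf_grad 2) 2)) ?_
  filter_upwards [(h.weak 2).exists_vertical_primitive h.mem (h.memLinf_grad 2) h.sm (h.sm_grad 2),
    (h.memLinf_grad 2).ae_integrable, h.ae_integrable_hdiv, h.div] with x ⟨c, hc⟩ hg hd h0
  have hg' : IntegrableOn (fun ζ => Dv (x, ζ) 2) (Ioc z₀ z₁) :=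
    (integrableOn_Ioc_iff_integrableOn_Ioo (by simp)).2 hg
  have hα : IntegrableOn (fun ζ => -hdiv Dv (x, ζ)) (Ioc z₀ z₁) := hd.neg
  rw [← integral_Ioc_eq_integral_Ioo] at h0
  set V : ℝ → Vel 𝕜 := fun ζ => c + ∫ ρ in Ioc z₀ ζ, Dv (x, ρ) 2
  set W : ℝ → 𝕜 := fun ζ => 0 + ∫ ρ in Ioc z₀ ζ, -hdiv Dv (x, ρ)
  set θ : ℝ → Vel 𝕜 := fun ζ => -hdiv Dv (x, ζ) • V ζ + W ζ • Dv (x, ζ) 2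
  have hW : ∀ ζ ∈ Ioo z₀ z₁, vertVel z₁ Dv (x, ζ) = W ζ := fun ζ hζ => by
    rw [vertVel_eq (show (x, ζ) ∈ Ω from ⟨mem_univ _, hζ⟩)]
    simp only [W, integral_neg, zero_add]
    rw [← Ioc_union_Ioc_eq_Ioc hζ.1.le hζ.2.le, setIntegral_union
      (Ioc_disjoint_Ioc_of_le le_rfl) measurableSet_Ioc (hd.mono_set (Ioc_subset_Ioc_right hζ.2.le))
      (hd.mono_set (Ioc_subset_Ioc_left hζ.1.le))] at h0
    exact eq_neg_of_add_eq_zero_right h0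
  have hVc : ContinuousOn V (Icc z₀ z₁) := continuousOn_const.add
    (intervalIntegral.continuousOn_primitive ((integrableOn_Icc_iff_integrableOn_Ioc (by simp)).2 hg'))
  have hWc : ContinuousOn W (Icc z₀ z₁) := continuousOn_const.add
    (intervalIntegral.continuousOn_primitive ((integrableOn_Icc_iff_integrableOn_Ioc (by simp)).2 hα))
  have hθ : IntegrableOn θ (Ioc z₀ z₁) :=
    (hα.smul_continuousOn_of_subset hVc measurableSet_Ioc isCompact_Icc Ioc_subset_Icc_self).add
      (hg'.continuousOn_smul_of_subset hWc isCompact_Icc measurableSet_Ioc Ioc_subset_Icc_self)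
  have hprod : ∀ ζ ∈ Icc z₀ z₁, W ζ • V ζ = 0 + ∫ ρ in Ioc z₀ ζ, θ ρ := fun ζ hζ => by
    have := setIntegral_product_rule (hα.mono_set (Ioc_subset_Ioc_right hζ.2))
      (hg'.mono_set (Ioc_subset_Ioc_right hζ.2)) 0 c
    rw [zero_smul, sub_zero] at this
    rw [zero_add]
    exact this
  have hz1 : (0 : Vel 𝕜) + ∫ ρ in Ioc z₀ z₁, θ ρ = 0 := by
    rw [← hprod z₁ (right_mem_Icc.2 hz.le)]
    simp only [W, integral_neg, h0, neg_zero, add_zero, zero_smul]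
  have key := setIntegral_deriv_smul hz hθ 0 hψ hψ' (by rw [hz1, smul_zero, smul_zero])
  rw [integral_Ioc_eq_integral_Ioo, integral_Ioc_eq_integral_Ioo] at key
  refine (Eq.trans ?_ key).trans (congrArg Neg.neg ?_)
  · refine integral_congr_ae ?_
    filter_upwards [hc, ae_restrict_mem measurableSet_Ioo] with ζ h1 h2
    rw [← hprod ζ (Ioo_subset_Icc_self h2), hW ζ h2, h1]
  · refine integral_congr_ae ?_
    filter_upwards [hc, ae_restrict_mem measurableSet_Ioo] with ζ h1 h2
    simp only [θ, V]
    rw [hW ζ h2, h1, neg_smul]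

/-- `∇·(u ⊗ v) = (u · ∇) v`. -/
theorem IsField.isFluxDiv (h : IsField v Dv) : IsFluxDiv (flux v Dv) (conv v Dv) := by
  intro κ κ' ψ ψ' hκ hψ hψ'
  have hψc : Continuous ψ := continuous_iff_continuousAt.2 fun ζ => (hψ ζ).continuousAt
  have hm1 : ∀ j : Fin 2, MemL fun p => Dv p j.castSucc j • v p := fun j =>
    h.memLinf_smul ((h.memLinf_grad _).coord j)
  have hm2 : ∀ i : Fin 3, MemL fun p => fullVel v Dv p i • Dv p i := fun i =>
    h.memLinf_fullVel_smul (h.memLinf_grad i) i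
  have hmd := h.memLinf_smul h.memLinf_hdiv
  have I : ∀ {f : ℝ³ → Vel 𝕜}, MemL f → Integrable (fun q => (κ q.1 * ψ q.2) • f q) μΩ :=
    fun hf => MemLinf.integrable_mul_smul hκ.measurable hκ.integrable hψc hf
  have hH : ∀ j : Fin 2, ∫ q in Ω, (κ' j q.1 * ψ q.2) • flux v Dv q j.castSucc =
      -((∫ q in Ω, (κ q.1 * ψ q.2) • (Dv q j.castSucc j • v q)) +
        ∫ q in Ω, (κ q.1 * ψ q.2) • (fullVel v Dv q j.castSucc • Dv q j.castSucc)) := fun j => by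
    have sc := (velProj 𝕜 j).continuous.comp_stronglyMeasurable (h.sm_grad j.castSucc)
    have sv := (velProj 𝕜 j).continuous.comp_stronglyMeasurable h.sm
    have := ((h.horizDeriv_coord j j).smul (h.horizDeriv j) sv sc h.sm (h.sm_grad _)
      ((h.memLinf_grad _).coord j) (h.memLinf_grad _)).integral_kernel_smul
      (by have := h.memLinf_fullVel_smul h.mem j.castSucc
          simpa only [fullVel_castSucc] using this)
      ((hm1 j).add (by simpa only [fullVel_castSucc] using hm2 j.castSucc))
      (sv.smul h.sm) ((sc.smul h.sm).add (sv.smul (h.sm_grad _))) hκ hψc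
    simp only [flux]
    simp only [fullVel_castSucc]
    rw [this, ← integral_add (I (hm1 j)) (by
      simpa only [fullVel_castSucc] using I (hm2 j.castSucc))]
    simp only [smul_add]
  have hV : ∫ q in Ω, (κ q.1 * ψ' q.2) • flux v Dv q 2 =
      -(-(∫ q in Ω, (κ q.1 * ψ q.2) • (hdiv Dv q • v q)) +
        ∫ q in Ω, (κ q.1 * ψ q.2) • (fullVel v Dv q 2 • Dv q 2)) := by
    refine (h.integral_vertFlux hκ hψ hψ').trans (congrArg Neg.neg ?_)
    rw [← integral_neg]
    simp only [smul_add, smul_neg]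
    exact integral_add (I hmd).neg (I (hm2 2))
  have hdv : ∫ q in Ω, (κ q.1 * ψ q.2) • (hdiv Dv q • v q) =
      ∑ j : Fin 2, ∫ q in Ω, (κ q.1 * ψ q.2) • (Dv q j.castSucc j • v q) := by
    rw [← integral_finsetSum _ fun j _ => I (hm1 j)]
    simp only [← Finset.smul_sum, ← Finset.sum_smul, Fin.sum_univ_two]
    rfl
  have hcv : ∫ q in Ω, (κ q.1 * ψ q.2) • conv v Dv q =
      ∑ i : Fin 3, ∫ q in Ω, (κ q.1 * ψ q.2) • (fullVel v Dv q i • Dv q i) := by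
    rw [← integral_finsetSum _ fun j _ => I (hm2 j)]
    simp only [conv, Finset.smul_sum]
  rw [hV, hdv, hcv, Fin.sum_univ_castSucc (n := 2), Finset.sum_congr rfl fun j _ => hH j,
    Finset.sum_neg_distrib, Finset.sum_add_distrib, show (Fin.last 2 : Fin 3) = 2 from rfl]
  abel

/-- The inclusion of the `l`-th component into the gradients. -/
def gradInj (𝕜 : Type*) [RCLike 𝕜] (l : Fin 3) : Vel 𝕜 →L[ℝ] Grad 𝕜 :=
  ((PiLp.continuousLinearEquiv 2 ℝ (fun _ : Fin 3 => Vel 𝕜)).symm : _ →L[ℝ] Grad 𝕜).comp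
    (ContinuousLinearMap.single ℝ (fun _ : Fin 3 => Vel 𝕜) l)

/-- The gradient field with the components `T l τ f`. -/
def gradOf {E : Type*} (T : Fin 3 → ℝ → (ℝ³ → E) → ℝ³ → Vel 𝕜) (τ : ℝ)
    (f : ℝ³ → E) (p : ℝ³) : Grad 𝕜 :=
  ∑ l : Fin 3, gradInj 𝕜 l (T l τ f p)

theorem gradOf_apply {E : Type*} (T : Fin 3 → ℝ → (ℝ³ → E) → ℝ³ → Vel 𝕜) (τ : ℝ)
    (f : ℝ³ → E) (p : ℝ³) (l : Fin 3) : gradOf T τ f p l = T l τ f p := by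
  rw [gradOf, WithLp.ofLp_sum, Finset.sum_apply, Finset.sum_eq_single l]
  · simp [gradInj]
  · intro b _ hb
    simp [gradInj, hb.symm]
  · simp

omit [Layer] in
theorem exists_isSmoothingOp_gradOf {E : Type*} [NormedAddCommGroup E] [NormedSpace ℝ E]
    {T : [Layer] → Fin 3 → ℝ → (ℝ³ → E) → ℝ³ → Vel 𝕜} {a : ℝ}
    (h : ∀ l, ∃ C, ∀ [Layer], IsSmoothingOp C a (T l)) :
    ∃ C, ∀ [Layer], IsSmoothingOp C a (gradOf T) := by
  choose C hC using h
  exact ⟨∑ l, ‖gradInj 𝕜 l‖ * C l, 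
    IsSmoothingOp.sum Finset.univ fun l _ => (hC l).clm_comp (gradInj 𝕜 l)⟩

/-- `∇S(τ)f`. -/
def stokesGrad : ℝ → (ℝ³ → Vel 𝕜) → ℝ³ → Grad 𝕜 :=
  gradOf fun l => heatOp (0 + horizOrder l) 1 (0 + vertOrder l)

/-- `∇S(τ)ℙf`, for a field `f` that is a divergence. -/
def convGrad : ℝ → (ℝ³ → Vel 𝕜) → ℝ³ → Grad 𝕜 := gradOf convOp

/-- `∇S(τ)ℙ∇·F`. -/
def projGrad : ℝ → (ℝ³ → Fin 3 → Vel 𝕜) → ℝ³ → Grad 𝕜 := gradOf projGradOp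

/-- All the smoothing estimates, with one constant. -/
structure KernelBounds (𝕜 : Type*) [RCLike 𝕜] (C : ℝ) : Prop where
  stokes : IsSmoothingOp C 0 (heatOp (E := Vel 𝕜) 0 1 0)
  stokesGrad : IsSmoothingOp C (1 / 2) (stokesGrad (𝕜 := 𝕜))
  proj : IsSmoothingOp C (1 / 2) (projOp (𝕜 := 𝕜))
  projGrad : IsSmoothingOp C 1 (projGrad (𝕜 := 𝕜))
  convGrad : IsSmoothingOp C (1 / 2) (convGrad (𝕜 := 𝕜))

omit [Layer] in
/-- The constant in the smoothing estimates does not depend on the layer. -/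
theorem exists_kernelBounds (𝕜 : Type*) [RCLike 𝕜] :
    ∃ C : ℝ, 1 ≤ C ∧ ∀ _ : Layer, KernelBounds 𝕜 C := by
  obtain ⟨C₁, h₁⟩ := exists_isSmoothingOp_stokes (𝕜 := 𝕜)
  obtain ⟨C₂, h₂⟩ := exists_isSmoothingOp_gradOf (exists_isSmoothingOp_stokesGrad (𝕜 := 𝕜))
  obtain ⟨C₃, h₃⟩ := exists_isSmoothingOp_projOp (𝕜 := 𝕜)
  obtain ⟨C₄, h₄⟩ := exists_isSmoothingOp_gradOf (exists_isSmoothingOp_projGradOp (𝕜 := 𝕜))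
  obtain ⟨C₅, h₅⟩ := exists_isSmoothingOp_gradOf (exists_isSmoothingOp_convOp (𝕜 := 𝕜))
  refine ⟨max 1 (max C₁ (max C₂ (max C₃ (max C₄ C₅)))), le_max_left _ _, fun _ => ?_⟩
  exact ⟨h₁.mono (by simp), h₂.mono (by simp), h₃.mono (by simp),
    h₄.mono (by simp), h₅.mono (by simp)⟩

end

section

section
variable [Layer]

/-- Unfolding the reflections: integrating the reflected and periodized kernel over `J` amounts to
integrating the kernel itself over the line. -/
theorem lintegral_unfold {u φ : ℝ → ℝ≥0∞} (hu : Measurable u) (hφ : Measurable φ)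
    (hr : ∀ η, φ (2 * z₀ - η) = φ η) (hp : ∀ η (k : ℤ), φ (η + 2 * k * (z₁ - z₀)) = φ η) (z : ℝ) :
    ∫⁻ η in Ioo z₀ z₁, (∑' k : ℤ, (u (z - η - 2 * k * (z₁ - z₀)) +
      u (z + η - 2 * z₀ - 2 * k * (z₁ - z₀)))) * φ η = ∫⁻ η, u (z - η) * φ η := by
  set Φ : ℝ → ℝ≥0∞ := fun η => (∑' k : ℤ, u (z - η - 2 * k * (z₁ - z₀))) * φ η
  have hΦ : Measurable Φ := (Measurable.tsum fun k => hu.comp (by fun_prop)).mul hφ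
  have hrefl : ∫⁻ η in Ioo z₀ z₁, Φ (2 * z₀ - η) = ∫⁻ η in Ioo (2 * z₀ - z₁) z₀, Φ η := by
    have h := (Measure.measurePreserving_sub_left (volume : Measure ℝ) (2 * z₀)).setLIntegral_comp_preimage
      (measurableSet_Ioo (a := 2 * z₀ - z₁) (b := z₀)) hΦ
    rw [← h, preimage_const_sub_Ioo]
    congr 3 <;> ring_nf
  have hH : 0 < 2 * (z₁ - z₀) := by linarith [hz]
  have h1 : ∀ η, (∑' k : ℤ, (u (z - η - 2 * k * (z₁ - z₀)) +
      u (z + η - 2 * z₀ - 2 * k * (z₁ - z₀)))) * φ η = Φ η + Φ (2 * z₀ - η) := fun η => by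
    rw [ENNReal.tsum_add, add_mul]
    simp only [Φ, hr]
    congr 3
    funext k; congr 1; ring
  simp only [h1]
  rw [lintegral_add_left hΦ, hrefl, restrict_Ioo_eq_restrict_Ioc, restrict_Ioo_eq_restrict_Ioc,
    add_comm, ← lintegral_union measurableSet_Ioc (Ioc_disjoint_Ioc_of_le le_rfl),
    Ioc_union_Ioc_eq_Ioc (by linarith) hz.le]
  have h2 := lintegral_tsum_shift (fun y => u (z - y) * φ y)
    ((hu.comp (by fun_prop)).mul hφ) hH (2 * z₀ - z₁)
  rw [show 2 * z₀ - z₁ + 2 * (z₁ - z₀) = z₁ by ring] at h2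
  rw [← h2]
  refine lintegral_congr fun η => ?_
  simp only [Φ]
  rw [← ENNReal.tsum_mul_right, ← (Equiv.neg ℤ).tsum_eq]
  refine tsum_congr fun k => ?_
  rw [← hp η (-k)]
  simp only [Equiv.neg_apply, Int.cast_neg]
  congr 2 <;> ring

theorem enorm_neumann (t z ζ : ℝ) : ‖reflKernel 1 (gaussDeriv 0 t) z ζ‖ₑ =
      ∑' k : ℤ, (ofReal (heatKernelOne t (z - ζ - 2 * k * (z₁ - z₀))) +
        ofReal (heatKernelOne t (z + ζ - 2 * z₀ - 2 * k * (z₁ - z₀)))) := by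
  have h0 := heatKernelOne_nonneg t
  have hs := summable_reflKernel 1 0 t z ζ
  simp only [gaussDeriv_zero, one_mul] at hs
  simp only [reflKernel, gaussDeriv_zero, one_mul]
  rw [Real.enorm_of_nonneg (tsum_nonneg fun k => add_nonneg (h0 _) (h0 _)),
    ENNReal.ofReal_tsum_of_nonneg (fun k => add_nonneg (h0 _) (h0 _)) hs]
  exact tsum_congr fun k => ofReal_add (h0 _) (h0 _)

theorem neumann_nonneg (t z ζ : ℝ) : 0 ≤ reflKernel 1 (gaussDeriv 0 t) z ζ := by
  simp only [reflKernel, gaussDeriv_zero, one_mul]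
  exact tsum_nonneg fun k => add_nonneg (heatKernelOne_nonneg _ _) (heatKernelOne_nonneg _ _)

theorem heatKernelOne_neg (t y : ℝ) : heatKernelOne t (-y) = heatKernelOne t y := by
  simp [heatKernelOne]

theorem neumann_symm (t z ζ : ℝ) : reflKernel 1 (gaussDeriv 0 t) z ζ =
    reflKernel 1 (gaussDeriv 0 t) ζ z := by
  rw [reflKernel_eq_add, reflKernel_eq_add]
  congr 1
  · rw [← (Equiv.neg ℤ).tsum_eq]
    refine tsum_congr fun k => ?_
    simp only [gaussDeriv_zero]
    rw [← heatKernelOne_neg]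
    congr 1
    simp only [Equiv.neg_apply, Int.cast_neg]; ring
  · rw [add_comm z ζ]

theorem measurable_heatKernelOne (t : ℝ) : Measurable (heatKernelOne t) := by
  have := (contDiff_gaussDeriv 0 t).continuous.measurable
  rwa [show gaussDeriv 0 t = heatKernelOne t from funext (gaussDeriv_zero t)] at this

theorem lintegral_ofReal_heatKernelOne {t : ℝ} (ht : 0 < t) (z : ℝ) :
    ∫⁻ η, ofReal (heatKernelOne t (z - η)) = 1 := by
  rw [lintegral_sub_left_eq_self (fun y => ofReal (heatKernelOne t y)) z,
    ← lintegral_heatKernelOne ht]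
  exact lintegral_congr fun y => (Real.enorm_of_nonneg (heatKernelOne_nonneg t y)).symm

/-- The Neumann heat semigroup preserves the integral. -/
theorem lintegral_neumann {t : ℝ} (ht : 0 < t) (ζ : ℝ) :
    ∫⁻ z in Ioo z₀ z₁, ‖reflKernel 1 (gaussDeriv 0 t) z ζ‖ₑ = 1 := by
  have h := lintegral_unfold (measurable_heatKernelOne t).ennreal_ofReal
    (measurable_const (a := (1 : ℝ≥0∞))) (fun _ => rfl) (fun _ _ => rfl) ζ
  simp only [mul_one] at h
  rw [lintegral_ofReal_heatKernelOne ht] at h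
  rw [← h]
  exact lintegral_congr fun z => by rw [neumann_symm, enorm_neumann]

theorem integral_neumann {t : ℝ} (ht : 0 < t) (ζ : ℝ) :
    ∫ z in Ioo z₀ z₁, reflKernel 1 (gaussDeriv 0 t) z ζ = 1 := by
  have hm : Measurable fun z => reflKernel 1 (gaussDeriv 0 t) z ζ :=
    (continuous_reflKernel_left 1 0 ht ζ).measurable
  rw [integral_eq_lintegral_of_nonneg_ae (Eventually.of_forall fun z => neumann_nonneg t z ζ)
    hm.aestronglyMeasurable]
  have h := lintegral_neumann ht ζ
  simp only [Real.enorm_of_nonneg (neumann_nonneg _ _ _)] at h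
  rw [h, ENNReal.toReal_one]

variable {E : Type*} [NormedAddCommGroup E] [NormedSpace ℝ E] [CompleteSpace E]

/-- Vertical integration removes a vertical kernel of integral one. -/
theorem integral_layerOp {k : Plane → ℝ} {m : ℝ → ℝ → ℝ} (h : Admissible k m)
    (hm : ∀ ζ, ∫ z in Ioo z₀ z₁, m z ζ = 1) {f : ℝ³ → E} (hf : MemL f)
    (x : Plane) : IntegrableOn (fun z => layerOp k m f (x, z)) (Ioo z₀ z₁) ∧
    ∫ z in Ioo z₀ z₁, layerOp k m f (x, z) = ∫ q in Ω, k (x - q.1) • f q := by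
  obtain ⟨M, hM, hMb⟩ := h.exists_slice_bound
  have hlt := (lintegral_kernel_le h.measurable_left h.measurable_right hMb hf.1 x).trans_lt
    (mul_lt_top (mul_lt_top h.integrable_left.2 hM) hf.2)
  have hmeas : AEStronglyMeasurable (fun r : ℝ × ℝ³ => (k (x - r.2.1) * m r.1 r.2.2) • f r.2)
      ((volume.restrict (Ioo z₀ z₁)).prod μΩ) := by
    refine AEStronglyMeasurable.smul ?_ hf.1.comp_snd
    exact (h.measurable_kernel.comp (f := fun r : ℝ × ℝ³ => ((x, r.1), r.2))
      (by fun_prop)).aestronglyMeasurable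
  have hint : Integrable (fun r : ℝ × ℝ³ => (k (x - r.2.1) * m r.1 r.2.2) • f r.2)
      ((volume.restrict (Ioo z₀ z₁)).prod μΩ) := by
    refine ⟨hmeas, ?_⟩
    rw [HasFiniteIntegral, lintegral_prod _ hmeas.enorm]
    exact hlt
  refine ⟨hint.integral_prod_left, ?_⟩
  simp only [layerOp]
  rw [integral_integral_swap (f := fun z q => (k (x - q.1) * m z q.2) • f q) hint]
  refine integral_congr_ae (Eventually.of_forall fun q => ?_)
  simp only
  rw [integral_smul_const, integral_const_mul, hm, mul_one]
end

variable {𝕜 : Type*} [RCLike 𝕜] [Layer]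

theorem MemLinf.integrable_kernel_smul {E : Type*} [NormedAddCommGroup E] [NormedSpace ℝ E]
    {f : ℝ³ → E} (hf : MemL f) {k : Plane → ℝ}
    (hk : Measurable k) (hki : Integrable k) (x : Plane) :
    Integrable (fun q => k (x - q.1) • f q) μΩ :=
  hf.integrable_smul (k := fun y => |k (x - y)|) (hk.comp (by fun_prop)).aestronglyMeasurable
    (hki.comp_sub_left x).abs (hk.comp (measurable_id.const_sub x)).abs fun _ _ => le_rfl

/-- `ℙ` maps onto the fields with divergence free average. -/
theorem integral_hdiv_convGrad {τ : ℝ} (hτ : 0 < τ) {f : ℝ³ → Vel 𝕜} (hf : MemL f) (x : Plane) :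
    ∫ z in Ioo z₀ z₁, hdiv (convGrad τ f) (x, z) = 0 := by
  have h1 : |(1 : ℝ)| ≤ 1 := by simp
  have hc : ∀ ζ : ℝ, ∫ _ in Ioo z₀ z₁, (z₁ - z₀)⁻¹ = 1 := fun _ => by
    have : z₁ - z₀ ≠ 0 := (sub_pos.2 hz).ne'
    simp [hz.le, this]
  have ho : ∀ k i : Fin 2, 3 ≤ (0 + Pi.single k 1 + Pi.single i 2 : Fin 2 → ℕ) 0 +
      (0 + Pi.single k 1 + Pi.single i 2 : Fin 2 → ℕ) 1 := fun k i => by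
    rw [order_add_single, order_single]
  have hL : ∀ (i : Fin 2) (z : ℝ), z ∈ Ioo z₀ z₁ → convOp i.castSucc τ f (x, z) i =
        heatOp (0 + Pi.single i 1) 1 0 τ (fun q => f q i) (x, z) +
          ∑ k : Fin 2, tailOp (0 + Pi.single k 1 + Pi.single i 2) (z₁ - z₀)⁻¹ τ
            (fun q => f q k) (x, z) := by
    intro i z hz'
    have hp : (x, z) ∈ Ω := ⟨mem_univ _, hz'⟩
    have e2 : ∀ k : Fin 2, (0 + Pi.single k 1 + Pi.single i 2 : Fin 2 → ℕ) =
        0 + Pi.single k 1 + Pi.single i 1 + Pi.single i 1 := fun k => by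
      rw [add_assoc (0 + Pi.single k 1), ← Pi.single_add]
    have e3 : ∀ l k : Fin 2, 3 ≤ (0 + Pi.single k 1 + Pi.single l 1 + Pi.single i 1 : Fin 2 → ℕ) 0 +
        (0 + Pi.single k 1 + Pi.single l 1 + Pi.single i 1 : Fin 2 → ℕ) 1 := fun l k => by
      rw [order_add_single, order_add_single, order_single]
    have e4 : ∀ l k : Fin 2, velProj 𝕜 i (tailOp (0 + Pi.single k 1 + Pi.single l 1 +
        Pi.single i 1) (z₁ - z₀)⁻¹ τ (fun q => matUnit 𝕜 l k (f q)) (x, z)) =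
        if i = l then tailOp (0 + Pi.single k 1 + Pi.single l 1 + Pi.single i 1)
          (z₁ - z₀)⁻¹ τ (fun q => f q k) (x, z) else 0 := fun l k => by
      rw [tailOp, ← layerOp_clm (admissible_tail _ (e3 l k) _ hτ) (memLinf_clm _ hf).1 _ hp]
      simp only [velProj_apply, matUnit_apply]
      split_ifs
      · rfl
      · simp [layerOp]
    rw [← velProj_apply, convOp]
    simp only [horizOrder_castSucc, vertOrder_castSucc, tailFactor, castSucc_ne_two, if_false,
      map_add, map_sum, e4, e2]
    rw [heatOp, ← layerOp_clm (admissible_heat _ h1 _ hτ) hf _ hp]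
    simp only [Finset.sum_ite_irrel, Finset.sum_const_zero, Finset.sum_ite_eq, Finset.mem_univ,
      if_true]
    rfl
  have hH := fun i : Fin 2 => integral_layerOp (admissible_heat (0 + Pi.single i 1) h1 0 hτ)
    (fun ζ => integral_neumann hτ ζ) (hf.coord i) x
  have hT := fun i k : Fin 2 => integral_layerOp (admissible_tail _ (ho k i) (z₁ - z₀)⁻¹ hτ) hc
    (hf.coord k) x
  have hI : ∀ i : Fin 2, IntegrableOn (fun z => convOp i.castSucc τ f (x, z) i) (Ioo z₀ z₁) ∧
      ∫ z in Ioo z₀ z₁, convOp i.castSucc τ f (x, z) i =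
      (∫ q in Ω, planeDeriv (0 + Pi.single i 1) τ (x - q.1) • f q i) +
      ∑ k : Fin 2, ∫ q in Ω,
        tailKernel (0 + Pi.single k 1 + Pi.single i 2) τ (x - q.1) • f q k := fun i => by
    have hs := integrable_finsetSum Finset.univ fun k _ => (hT i k).1
    refine ⟨(IntegrableOn.congr_fun ((hH i).1.add hs) (fun z hz' => (hL i z hz').symm)
      measurableSet_Ioo), ?_⟩
    rw [setIntegral_congr_fun measurableSet_Ioo (hL i)]
    refine (integral_add (hH i).1 hs).trans ?_
    rw [integral_finsetSum _ fun k _ => (hT i k).1]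
    simp only [(hH i).2, (hT i _).2]
  have e : ∀ z, hdiv (convGrad τ f) (x, z) =
      ∑ i : Fin 2, convOp i.castSucc τ f (x, z) i := fun z => by
    simp only [hdiv, convGrad, gradOf_apply, Fin.sum_univ_two]; rfl
  simp only [e]
  rw [integral_finsetSum _ fun i _ => (hI i).1]
  simp only [(hI _).2]
  rw [Finset.sum_add_distrib, Finset.sum_comm, ← Finset.sum_add_distrib]
  refine Finset.sum_eq_zero fun k _ => ?_
  have hti : ∀ i : Fin 2, Integrable (fun q : ℝ³ =>
      tailKernel (0 + Pi.single k 1 + Pi.single i 2) τ (x - q.1) • f q k)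
      μΩ := fun i =>
    have ha := admissible_tail _ (ho k i) 1 hτ
    (hf.coord k).integrable_kernel_smul ha.measurable_left ha.integrable_left x
  rw [← integral_finsetSum _ fun i _ => hti i, ← integral_add
    ((hf.coord k).integrable_kernel_smul (contDiff_planeDeriv _ τ).continuous.measurable
      (integrable_planeDeriv _ hτ) x) (integrable_finsetSum _ fun i _ => hti i)]
  refine integral_eq_zero_of_ae (Eventually.of_forall fun q => ?_)
  simp only [Pi.zero_apply]
  rw [← Finset.sum_smul, sum_tailKernel _ hτ, neg_smul, add_neg_cancel]

/-- A field with divergence free average keeps this property under the Stokes semigroup: the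
average is convolved with the heat kernel. -/
theorem DivFree.stokes {τ : ℝ} (hτ : 0 < τ) {a : ℝ³ → Vel 𝕜}
    (ha : MemL a) (hd : DivFree a) : DivFree (heatOp 0 1 0 τ a) := by
  intro φ h1 h2
  have hadm := admissible_heat 0 (show |(1 : ℝ)| ≤ 1 by simp) 0 hτ
  set G := planeDeriv 0 τ
  have hGm : Measurable G := (contDiff_planeDeriv _ τ).continuous.measurable
  have hGi : Integrable G := integrable_planeDeriv _ hτ
  have hk := c1Kernel_test h1 h2
  have hpc := hk.continuous'
  have hpi := hk.integrable'
  have hw : ∀ j, IsWeight fun x => ‖pd j φ x‖ₑ := fun j =>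
    ⟨(hpc j).measurable.enorm, fun _ => enorm_ne_top, (hpi j).2⟩
  have hsw : ∀ j : Fin 2, Integrable (fun r : ℝ³ × Plane =>
      (pd j φ (r.2 + r.1.1) * G r.2) • a r.1 j) ((μΩ).prod volume) := by
    intro j
    have hm : AEStronglyMeasurable (fun r : ℝ³ × Plane =>
        (pd j φ (r.2 + r.1.1) * G r.2) • a r.1 j) ((μΩ).prod volume) :=
      AEStronglyMeasurable.smul (((hpc j).measurable.comp (by fun_prop)).mul
        (hGm.comp measurable_snd)).aestronglyMeasurable (ha.coord j).1.comp_fst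
    refine ⟨hm, ?_⟩
    rw [HasFiniteIntegral, lintegral_prod_symm _ hm.enorm]
    have hb : ∀ w : Plane, ∫⁻ q in Ω, ‖(pd j φ (w + q.1) * G w) • a q j‖ₑ ≤
        ‖G w‖ₑ * ((∫⁻ y, ‖pd j φ y‖ₑ) * nrm fun q => a q j) := fun w => by
      simp only [enorm_smul, enorm_mul, mul_comm _ ‖G w‖ₑ, mul_assoc]
      rw [lintegral_const_mul' _ _ enorm_ne_top]
      gcongr
      refine (lintegral_weight_le (ha.coord j).1 (k := fun y => ‖pd j φ (w + y)‖ₑ)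
        ((hpc j).measurable.comp (by fun_prop)).enorm fun _ => enorm_ne_top).trans (le_of_eq ?_)
      rw [lintegral_add_left_eq_self (fun y => ‖pd j φ y‖ₑ) w]
    refine (lintegral_mono hb).trans_lt ?_
    rw [lintegral_mul_const _ hGm.enorm]
    exact mul_lt_top hGi.2 (mul_lt_top (hpi j).2 (ha.coord j).2)
  have hin : ∀ j w, ∫ q in Ω, (pd j φ (w + q.1) * G w) • a q j =
      G w • ∫ q in Ω, pd j (fun y => φ (w + y)) q.1 • a q j := fun j w => by
    rw [← integral_smul]
    refine integral_congr_ae (.of_forall fun q => ?_)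
    simp only [pd]
    rw [fderiv_comp_add_left, smul_smul, mul_comm]
  have hj : ∀ j : Fin 2, ∫ p in Ω, pd j φ p.1 • heatOp 0 1 0 τ a p j =
      ∫ w, G w • ∫ q in Ω, pd j (fun y => φ (w + y)) q.1 • a q j := by
    intro j
    have e1 : ∫ p in Ω, pd j φ p.1 • heatOp 0 1 0 τ a p j =
        ∫ p in Ω, pd j φ p.1 • heatOp 0 1 0 τ (fun q => a q j) p :=
      setIntegral_congr_fun measurableSet_layer fun p hp => by
        simp only
        rw [← velProj_apply, heatOp, ← layerOp_clm hadm ha _ hp]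
        rfl
    rw [e1]
    refine (integral_smul_layerOp hadm (ha.coord j) (φ := fun p => pd j φ p.1)
      ((hpc j).measurable.comp measurable_fst) (hw j) fun p => le_rfl).2.trans ?_
    have e2 : ∀ q : ℝ³, ∫ p in Ω, pd j φ p.1 * (G (p.1 - q.1) *
        reflKernel 1 (gaussDeriv 0 τ) p.2 q.2) = ∫ w, pd j φ (w + q.1) * G w := fun q => by
      rw [volume_restrict_layer]
      simp only [← mul_assoc]
      refine (integral_prod_mul (fun x => pd j φ x * G (x - q.1))
        fun z => reflKernel 1 (gaussDeriv 0 τ) z q.2).trans ?_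
      rw [integral_neumann hτ, mul_one, ← integral_add_right_eq_self _ q.1]
      simp only [add_sub_cancel_right]
    simp only [e2, ← integral_smul_const]
    rw [integral_integral_swap (hsw j)]
    exact integral_congr_ae (.of_forall (hin j))
  have hji : ∀ j : Fin 2, Integrable fun w => G w •
      ∫ q in Ω, pd j (fun y => φ (w + y)) q.1 • a q j := fun j =>
    (hsw j).integral_prod_right.congr (.of_forall (hin j))
  rw [Finset.sum_congr rfl fun j _ => hj j, ← integral_finsetSum _ fun j _ => hji j]
  refine integral_eq_zero_of_ae (Eventually.of_forall fun w => ?_)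
  simp only [Pi.zero_apply]
  rw [← Finset.smul_sum, hd (fun y => φ (w + y)) (h1.comp (contDiff_const.add contDiff_id))
    (h2.comp_homeomorph (Homeomorph.addLeft w)), smul_zero]

end

section

variable {𝕜 : Type*} [RCLike 𝕜] [Layer] {C : ℝ} {v v' a : ℝ³ → Vel 𝕜} {Dv Dv' : ℝ³ → Grad 𝕜}

theorem IsField.sub (h : IsField v Dv) (h' : IsField v' Dv') : IsField (v - v') (Dv - Dv') where
  toIsPreField := h.toIsPreField.sub h'.toIsPreField
  div := by
    filter_upwards [h.div, h'.div, h.memLinf_hdiv.ae_integrable, h'.memLinf_hdiv.ae_integrable]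
      with x h1 h2 i1 i2
    have e : ∀ ζ, hdiv (Dv - Dv') (x, ζ) = hdiv Dv (x, ζ) - hdiv Dv' (x, ζ) := fun ζ => by
      simp only [hdiv, Pi.sub_apply, PiLp.sub_apply]; ring
    simp only [e]
    rw [integral_sub i1 i2, h1, h2, sub_zero]

theorem isField_zero : IsField (0 : ℝ³ → Vel 𝕜) 0 where
  toIsPreField := isPreField_zero
  div := Eventually.of_forall fun x => by simp [hdiv]

theorem IsField.divFree (h : IsField v Dv) : DivFree v := h.toIsPreField.divFree_iff.2 h.div

/-- The Duhamel integrand `S(τ)ℙ∇·(u ⊗ v)` and its gradient. -/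
theorem IsField.proj (hC : KernelBounds 𝕜 C) (h : IsField v Dv)
    {τ : ℝ} (hτ : 0 < τ) : IsField (projOp τ (flux v Dv)) (convGrad τ (conv v Dv)) where
  sm := hC.proj.stronglyMeasurable (h.memLinf_flux).1 τ
  sm' := hC.convGrad.stronglyMeasurable (h.memLinf_conv).1 τ
  mem := hC.proj.memLinf hτ (h.memLinf_flux)
  mem' := hC.convGrad.memLinf hτ (h.memLinf_conv)
  weak := fun i => by
    simp only [convGrad, gradOf_apply]
    exact (weakDeriv_projOp hτ (h.memLinf_flux) i).congr EventuallyEq.rfl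
      (ae_projGradOp_eq_convOp hτ (h.memLinf_flux) (h.memLinf_conv) (h.isFluxDiv) i)
  div := Eventually.of_forall fun x => integral_hdiv_convGrad hτ (h.memLinf_conv) x

theorem isField_stokes (hC : KernelBounds 𝕜 C) (ha : MemL a)
    (hd : DivFree a) {τ : ℝ} (hτ : 0 < τ) :
    IsField (heatOp 0 1 0 τ a) (stokesGrad τ a) :=
  have h : IsPreField (heatOp 0 1 0 τ a) (stokesGrad τ a) :=
    { sm := hC.stokes.stronglyMeasurable ha.1 τ
      sm' := hC.stokesGrad.stronglyMeasurable ha.1 τ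
      mem := hC.stokes.memLinf hτ ha
      mem' := hC.stokesGrad.memLinf hτ ha
      weak := fun i => by
        simp only [stokesGrad, gradOf_apply]
        exact weakDeriv_heatOp 0 (by simp) 0 hτ ha i }
  { h with div := h.divFree_iff.1 (hd.stokes hτ ha) }

theorem IsSmoothingOp.normInfOne_sub_le {E E' : Type*} [NormedAddCommGroup E] [NormedSpace ℝ E]
    [NormedAddCommGroup E'] [NormedSpace ℝ E'] {e : ℝ}
    {T : ℝ → (ℝ³ → E) → ℝ³ → E'} (h : IsSmoothingOp C e T) {τ : ℝ}
    (hτ : 0 < τ) {f g : ℝ³ → E} (hf : MemL f) (hg : MemL g) :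
    nrm (T τ f - T τ g) ≤ ofReal (C * τ ^ (-e)) * nrm (f - g) := by
  refine (le_of_eq (normInfOne_congr ?_)).trans (h.normInfOne_le hτ (hf.sub hg))
  filter_upwards [ae_restrict_mem measurableSet_layer] with p hp
  exact (h.sub hτ hf hg p hp).symm

/-- The gradient of the Duhamel integrand, estimated by the flux instead of its divergence. -/
theorem IsField.normInfOne_convGrad_sub_le (hC : KernelBounds 𝕜 C)
    (h : IsField v Dv) (h' : IsField v' Dv') {τ : ℝ} (hτ : 0 < τ) :
    nrm (convGrad τ (conv v Dv) - convGrad τ (conv v' Dv')) ≤ ofReal (C * τ ^ (-1 : ℝ)) *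
        nrm (flux v Dv - flux v' Dv') := by
  have key : ∀ {w : ℝ³ → Vel 𝕜} {Dw : ℝ³ → Grad 𝕜}, IsField w Dw → convGrad τ (conv w Dw) =ᵐ[μΩ]
        projGrad τ (flux w Dw) := fun hw => by
    filter_upwards [ae_all_iff.2 fun l => ae_projGradOp_eq_convOp hτ (hw.memLinf_flux)
      (hw.memLinf_conv) (hw.isFluxDiv) l] with p hp
    simp only [convGrad, projGrad, gradOf, hp]
  rw [normInfOne_congr ((key h).sub (key h'))]
  exact hC.projGrad.normInfOne_sub_le hτ (h.memLinf_flux) (h'.memLinf_flux)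

section
variable {S : Type*} [MeasurableSpace S] {ν : Measure S} [SFinite ν]

/-- An absolutely convergent integral of fields is a field. -/
theorem IsField.integral {U : S → ℝ³ → Vel 𝕜} {W : S → ℝ³ → Grad 𝕜}
    (hU : StronglyMeasurable fun r : S × ℝ³ => U r.1 r.2)
    (hW : StronglyMeasurable fun r : S × ℝ³ => W r.1 r.2)
    {γ γ' : S → ℝ≥0∞} (hγm : Measurable γ) (hγ : ∀ᵐ s ∂ν, nrm (U s) ≤ γ s)
    (hfin : ∫⁻ s, γ s ∂ν < ∞) (hγm' : Measurable γ')
    (hγ' : ∀ᵐ s ∂ν, nrm (W s) ≤ γ' s) (hfin' : ∫⁻ s, γ' s ∂ν < ∞)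
    (h : ∀ᵐ s ∂ν, IsField (U s) (W s)) :
    IsField (fun p => ∫ s, U s p ∂ν) (fun p => ∫ s, W s p ∂ν) where
  sm := stronglyMeasurable_integral_param hU
  sm' := stronglyMeasurable_integral_param hW
  mem := memLinf_integral hU hγm hγ hfin
  mem' := memLinf_integral hW hγm' hγ' hfin'
  weak := fun i => by
    refine (weakDeriv_integral (W := fun s p => W s p i) hU
      ((gradProj 𝕜 i).continuous.comp_stronglyMeasurable hW)
      hγm hγ hfin hγm' ?_ hfin' (h.mono fun s hs => hs.weak i)).congr EventuallyEq.rfl ?_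
    · filter_upwards [hγ'] with s hs
      exact (normInfOne_mono_ae (Eventually.of_forall fun p => enorm_grad_le i _)).trans hs
    · filter_upwards [ae_integrable_param hW hγm' hγ' hfin'] with p hp
      exact (gradProj 𝕜 i).integral_comp_comm hp
  div := by
    have hD : StronglyMeasurable fun r : (S × Plane) × ℝ => hdiv (W r.1.1) (r.1.2, r.2) :=
      stronglyMeasurable_hdiv (hW.comp_measurable (g := fun r : (S × Plane) × ℝ =>
        (r.1.1, (r.1.2, r.2))) (by fun_prop))
    have hI := (hD.integral_prod_right' (ν := volume.restrict (Ioo z₀ z₁))).measurable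
    have h1 : ∀ᵐ x : Plane, ∀ᵐ s ∂ν, ∫ ζ in Ioo z₀ z₁, hdiv (W s) (x, ζ) = 0 :=
      (Measure.ae_ae_comm (p := fun s (x : Plane) => ∫ ζ in Ioo z₀ z₁, hdiv (W s) (x, ζ) = 0)
        (measurableSet_eq_fun hI measurable_const)).1 (h.mono fun s hs => hs.div)
    filter_upwards [h1, ae_ae_sliceNorm_le hW hγm' hγ'] with x hx hsl
    have hlt : ∫⁻ s, sliceNorm (W s) x ∂ν < ∞ := (lintegral_mono_ae hsl).trans_lt hfin'
    have e : (fun ζ => hdiv (fun p => ∫ s, W s p ∂ν) (x, ζ)) =ᵐ[volume.restrict (Ioo z₀ z₁)]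
        fun ζ => ∫ s, hdiv (W s) (x, ζ) ∂ν := by
      filter_upwards [ae_integrable_slice_param hW hlt] with ζ hζ
      have e1 := (((velProj 𝕜 0).comp (gradProj 𝕜 0)) +
        ((velProj 𝕜 1).comp (gradProj 𝕜 1))).integral_comp_comm hζ
      exact e1.symm
    have hD' : StronglyMeasurable fun r : ℝ × S => hdiv (W r.2) (x, r.1) :=
      hD.comp_measurable (g := fun r : ℝ × S => ((r.2, x), r.1)) (by fun_prop)
    rw [integral_congr_ae e, integral_integral_swap (f := fun ζ s => hdiv (W s) (x, ζ))
      ⟨hD'.aestronglyMeasurable, ?_⟩]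
    · exact integral_eq_zero_of_ae hx
    · simp only [HasFiniteIntegral, Function.uncurry]
      rw [lintegral_prod _ hD'.aestronglyMeasurable.enorm]
      refine (lintegral_mono fun ζ => lintegral_mono fun s => enorm_hdiv_le (W s) (x, ζ)).trans_lt ?_
      simp only [lintegral_const_mul' _ _ ENNReal.coe_ne_top]
      rw [lintegral_slice_param hW x]
      exact mul_lt_top ENNReal.coe_lt_top hlt
end

end

section

theorem lintegral_rpow {β t : ℝ} (hβ : β < 1) (ht : 0 < t) :
    ∫⁻ s in Ioo 0 t, ofReal (s ^ (-β)) = ofReal (t ^ (1 - β) / (1 - β)) := by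
  have hi : IntervalIntegrable (fun s : ℝ => s ^ (-β)) volume 0 t :=
    intervalIntegral.intervalIntegrable_rpow' (by linarith)
  have hi' : IntegrableOn (fun s : ℝ => s ^ (-β)) (Ioo 0 t) :=
    ((intervalIntegrable_iff_integrableOn_Ioo_of_le ht.le).1 hi)
  rw [← ofReal_integral_eq_lintegral_ofReal hi'
    ((ae_restrict_mem measurableSet_Ioo).mono fun s hs => rpow_nonneg hs.1.le _),
    ← integral_Ioc_eq_integral_Ioo, ← intervalIntegral.integral_of_le ht.le,
    integral_rpow (Or.inl (by linarith)), show -β + 1 = 1 - β by ring,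
    Real.zero_rpow (by linarith), sub_zero]

theorem lintegral_sub_rpow {α t : ℝ} (hα : α < 1) (ht : 0 < t) :
    ∫⁻ s in Ioo 0 t, ofReal ((t - s) ^ (-α)) = ofReal (t ^ (1 - α) / (1 - α)) := by
  rw [← lintegral_rpow hα ht]
  have h := (Measure.measurePreserving_sub_left (volume : Measure ℝ) t).setLIntegral_comp_preimage
    (measurableSet_Ioo (a := 0) (b := t)) (f := fun s : ℝ => ofReal (s ^ (-α)))
    (by fun_prop)
  rw [← h, preimage_const_sub_Ioo, sub_self, sub_zero]

/-- The constant in the estimate of the beta integral. -/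
def betaConst (α β : ℝ) : ℝ := 2 ^ α / (1 - β) + 2 ^ β / (1 - α)

theorem betaConst_nonneg {α β : ℝ} (hα : α < 1) (hβ : β < 1) : 0 ≤ betaConst α β :=
  add_nonneg (div_nonneg (by positivity) (by linarith)) (div_nonneg (by positivity) (by linarith))

theorem lintegral_beta_le {α β t : ℝ} (hα : α ∈ Ico 0 1) (hβ : β ∈ Ico 0 1) (ht : 0 < t) {A : ℝ} (hA : 0 ≤ A) :
    ∫⁻ s in Ioo 0 t, ofReal (A * ((t - s) ^ (-α) * s ^ (-β))) ≤
      ofReal (A * betaConst α β * t ^ (1 - α - β)) := by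
  obtain ⟨hα₀, hα⟩ := hα
  obtain ⟨hβ₀, hβ⟩ := hβ
  have h2 : 0 < t / 2 := by positivity
  have hpt : ∀ s ∈ Ioo 0 t, (t - s) ^ (-α) * s ^ (-β) ≤
      (t / 2) ^ (-α) * s ^ (-β) + (t / 2) ^ (-β) * (t - s) ^ (-α) := fun s hs => by
    have a1 : 0 ≤ (t - s) ^ (-α) := rpow_nonneg (sub_nonneg.2 hs.2.le) _
    have a2 : 0 ≤ s ^ (-β) := rpow_nonneg hs.1.le _
    have a3 : 0 ≤ (t / 2) ^ (-α) := by positivity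
    have a4 : 0 ≤ (t / 2) ^ (-β) := by positivity
    rcases le_total s (t / 2) with h | h
    · have : (t - s) ^ (-α) ≤ (t / 2) ^ (-α) :=
        Real.rpow_le_rpow_of_nonpos h2 (by linarith) (by linarith)
      nlinarith [mul_le_mul_of_nonneg_right this a2, mul_nonneg a4 a1]
    · have : s ^ (-β) ≤ (t / 2) ^ (-β) := Real.rpow_le_rpow_of_nonpos h2 h (by linarith)
      nlinarith [mul_le_mul_of_nonneg_right this a1, mul_nonneg a3 a2]
  have hc : 0 ≤ (t / 2) ^ (-α) := by positivity
  have hc' : 0 ≤ (t / 2) ^ (-β) := by positivity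
  calc ∫⁻ s in Ioo 0 t, ofReal (A * ((t - s) ^ (-α) * s ^ (-β)))
      ≤ ∫⁻ s in Ioo 0 t, (ofReal (A * (t / 2) ^ (-α)) * ofReal (s ^ (-β)) +
        ofReal (A * (t / 2) ^ (-β)) * ofReal ((t - s) ^ (-α))) := by
        refine setLIntegral_mono' measurableSet_Ioo fun s hs => ?_
        have a1 : 0 ≤ (t - s) ^ (-α) := rpow_nonneg (sub_nonneg.2 hs.2.le) _
        have a2 : 0 ≤ s ^ (-β) := rpow_nonneg hs.1.le _
        rw [← ofReal_mul (by positivity), ← ofReal_mul (by positivity),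
          ← ofReal_add (by positivity) (by positivity), mul_assoc, mul_assoc, ← mul_add]
        gcongr
        exact hpt s hs
    _ = ofReal (A * (t / 2) ^ (-α) * (t ^ (1 - β) / (1 - β)) +
        A * (t / 2) ^ (-β) * (t ^ (1 - α) / (1 - α))) := by
        have b1 : 0 < 1 - β := by linarith
        have b2 : 0 < 1 - α := by linarith
        rw [lintegral_add_left (by fun_prop), lintegral_const_mul' _ _ ofReal_ne_top,
          lintegral_const_mul' _ _ ofReal_ne_top, lintegral_rpow hβ ht,
          lintegral_sub_rpow hα ht, ← ofReal_mul (by positivity),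
          ← ofReal_mul (by positivity), ofReal_add (by positivity) (by positivity)]
    _ = _ := by
        have e : ∀ a b : ℝ, (t / 2) ^ (-a) * t ^ (1 - b) = 2 ^ a * t ^ (1 - a - b) := fun a b => by
          rw [Real.div_rpow ht.le zero_le_two, Real.rpow_neg zero_le_two, div_inv_eq_mul,
            mul_right_comm, ← rpow_add ht, mul_comm]
          ring_nf
        congr 1
        rw [betaConst, ← mul_div_assoc, ← mul_div_assoc, mul_assoc, mul_assoc, e, e,
          show 1 - β - α = 1 - α - β by ring]
        ring

section
variable {E : Type*} [NormedAddCommGroup E] [Layer]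

/-- Completeness of `L^∞(L¹)`, with convergence almost everywhere. -/
theorem ae_tendsto_of_geometric [CompleteSpace E] {f : ℕ → ℝ³ → E} {g : ℝ³ → E}
    (hf : ∀ n, StronglyMeasurable (f n)) {c : ℝ} (hc : 0 ≤ c)
    (h : ∀ n, nrm (f (n + 1) - f n) ≤ ofReal (c / 2 ^ n))
    (hg : ∀ p, g p = limUnder atTop fun n => f n p) (n : ℕ) :
    nrm (g - f n) ≤ ofReal (2 * c / 2 ^ n) := by
  have hd : ∀ n, Measurable fun p => ‖f (n + 1) p - f n p‖ₑ := fun n =>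
    ((hf (n + 1)).sub (hf n)).enorm
  have hsum : ∀ n, ∑' m : ℕ, ofReal (c / 2 ^ (n + m)) = ofReal (2 * c / 2 ^ n) := by
    intro n
    have e : ∀ m : ℕ, c / 2 ^ (n + m) = c / 2 ^ n * (1 / 2) ^ m := fun m => by
      rw [pow_add, one_div, inv_pow]; field_simp
    simp only [e]
    rw [← ENNReal.ofReal_tsum_of_nonneg (fun m => by positivity)
      (summable_geometric_two.mul_left _), tsum_mul_left, tsum_geometric_two]
    congr 1; ring
  refine normInfOne_le ?_
  filter_upwards [ae_all_iff.2 fun n => sliceNorm_le_normInfOne (f (n + 1) - f n)] with x hx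
  have hle : ∀ n, ∫⁻ z in Ioo z₀ z₁, ∑' m : ℕ, ‖f (n + m + 1) (x, z) - f (n + m) (x, z)‖ₑ ≤
      ofReal (2 * c / 2 ^ n) := fun n => by
    rw [lintegral_tsum (f := fun m z => ‖f (n + m + 1) (x, z) - f (n + m) (x, z)‖ₑ)
      fun m => ((hd (n + m)).comp measurable_prodMk_left).aemeasurable, ← hsum]
    exact ENNReal.tsum_le_tsum fun m => (hx (n + m)).trans (h (n + m))
  have hfin : ∀ᵐ z ∂volume.restrict (Ioo z₀ z₁),
      ∑' m : ℕ, ‖f (m + 1) (x, z) - f m (x, z)‖ₑ < ∞ := by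
    refine ae_lt_top (Measurable.tsum fun m => (hd m).comp measurable_prodMk_left) ?_
    have := hle 0
    simp only [zero_add] at this
    exact (this.trans_lt ofReal_lt_top).ne
  refine (lintegral_mono_ae ?_).trans (hle n)
  filter_upwards [hfin] with z hz
  have hed : ∀ m, edist (f m (x, z)) (f (m + 1) (x, z)) ≤ ‖f (m + 1) (x, z) - f m (x, z)‖ₑ :=
    fun m => by rw [edist_comm, edist_eq_enorm_sub]
  have hC := cauchySeq_of_edist_le_of_tsum_ne_top _ hed hz.ne
  have hl := hC.tendsto_limUnder
  rw [← hg] at hl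
  have := edist_le_tsum_of_edist_le_of_tendsto _ hed hl n
  rwa [edist_comm, edist_eq_enorm_sub] at this

variable [NormedSpace ℝ E]

theorem tendsto_integral_smul {f : ℕ → ℝ³ → E} {g : ℝ³ → E} (hf : ∀ n, MemL (f n)) (hg : MemL g)
    (h : Tendsto (fun n => nrm (g - f n)) atTop (𝓝 0))
    {φ : ℝ³ → ℝ} (hφ : Continuous φ) (hφc : HasCompactSupport φ) :
    Tendsto (fun n => ∫ p in Ω, φ p • f n p) atTop (𝓝 (∫ p in Ω, φ p • g p)) := by
  obtain ⟨K, hK, hb⟩ := exists_isWeight hφ hφc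
  rw [tendsto_iff_edist_tendsto_0]
  refine tendsto_of_tendsto_of_tendsto_of_le_of_le tendsto_const_nhds
    (by simpa using ENNReal.Tendsto.const_mul h (Or.inr hK.lintegral_lt_top.ne))
    (fun _ => zero_le) fun n => ?_
  rw [edist_comm, edist_eq_enorm_sub, ← integral_sub (hg.integrable_test_smul hφ hφc)
    ((hf n).integrable_test_smul hφ hφc)]
  refine (enorm_integral_le_lintegral_enorm _).trans ((lintegral_mono fun p => ?_).trans
    (lintegral_weight_le (hg.sub (hf n)).1 hK.measurable hK.ne_top))
  rw [← smul_sub, enorm_smul]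
  exact mul_le_mul_left (hb p) _
end

/-- A limit of fields, together with their gradients, is a field. -/
theorem IsField.of_tendsto {𝕜 : Type*} [RCLike 𝕜] [Layer] {f : ℕ → ℝ³ → Vel 𝕜}
    {Df : ℕ → ℝ³ → Grad 𝕜} {v : ℝ³ → Vel 𝕜} {Dv : ℝ³ → Grad 𝕜}
    (hf : ∀ n, IsField (f n) (Df n)) (hv : StronglyMeasurable v)
    (hDv : StronglyMeasurable Dv) (hm : MemL v) (hm' : MemL Dv)
    (h : Tendsto (fun n => nrm (v - f n)) atTop (𝓝 0))
    (h' : Tendsto (fun n => nrm (Dv - Df n)) atTop (𝓝 0)) :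
    IsField v Dv where
  sm := hv
  sm' := hDv
  mem := hm
  mem' := hm'
  weak := fun i φ h1 h2 h3 => by
    have t1 := tendsto_integral_smul (fun n => (hf n).mem) hm h (continuous_dirDeriv h1 (dir i))
      (hasCompactSupport_dirDeriv h2 (dir i))
    have hi : Tendsto (fun n => nrm ((fun p => Dv p i) - fun p => Df n p i)) atTop
        (𝓝 0) := tendsto_of_tendsto_of_tendsto_of_le_of_le tendsto_const_nhds h'
      (fun _ => zero_le) fun n => normInfOne_mono_ae
        (Eventually.of_forall fun p => enorm_grad_le i (Dv p - Df n p))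
    have t2 := (tendsto_integral_smul (fun n => (hf n).memLinf_grad i)
      (memLinf_clm (gradProj 𝕜 i) hm').1 hi h1.continuous h2).neg
    exact tendsto_nhds_unique (t1.congr fun n => (hf n).weak i φ h1 h2 h3) t2
  div := by
    filter_upwards [ae_all_iff.2 fun n => (hf n).div, hm'.ae_integrable,
      ae_all_iff.2 fun n => (hf n).mem'.ae_integrable,
      ae_all_iff.2 fun n => sliceNorm_le_normInfOne (Dv - Df n)] with x h0 hi hin hs
    set L := ((velProj 𝕜 0).comp (gradProj 𝕜 0)) + ((velProj 𝕜 1).comp (gradProj 𝕜 1))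
    have e : ∀ n, ∫ ζ in Ioo z₀ z₁, hdiv Dv (x, ζ) = ∫ ζ in Ioo z₀ z₁, hdiv (Dv - Df n) (x, ζ) :=
      fun n => by
        have : ∀ ζ, hdiv (Dv - Df n) (x, ζ) = L (Dv (x, ζ)) - L (Df n (x, ζ)) := fun ζ => by
          rw [← map_sub]; rfl
        simp only [this]
        rw [integral_sub (L.integrable_comp hi) (L.integrable_comp (hin n))]
        exact (sub_eq_self.2 (h0 n)).symm
    rw [← enorm_eq_zero, ← nonpos_iff_eq_zero]
    refine ge_of_tendsto' (by simpa using ENNReal.Tendsto.const_mul h' (Or.inr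
      (ENNReal.coe_ne_top (r := 2)))) fun n => ?_
    rw [e n]
    refine (enorm_integral_le_lintegral_enorm _).trans ((lintegral_mono fun ζ =>
      enorm_hdiv_le (Dv - Df n) (x, ζ)).trans ?_)
    rw [lintegral_const_mul' _ _ ENNReal.coe_ne_top]
    exact mul_le_mul_right (hs n) _

end

section

section
variable {E : Type*} [NormedAddCommGroup E] [NormedSpace ℝ E] [Layer] {t A β : ℝ} {U : ℝ → ℝ³ → E}

theorem measurable_power (t A α β : ℝ) :
    Measurable fun s => ofReal (A * ((t - s) ^ (-α) * s ^ (-β))) := by fun_prop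

theorem lintegral_beta_lt_top {α : ℝ} (hα : α ∈ Ico 0 1) (hβ : β ∈ Ico 0 1) (hA : 0 ≤ A) (ht : 0 < t) : ∫⁻ s in Ioo 0 t, ofReal (A * ((t - s) ^ (-α) * s ^ (-β))) < ∞ :=
  (lintegral_beta_le hα hβ ht hA).trans_lt ofReal_lt_top

theorem ae_integrable_of_power (hU : StronglyMeasurable fun r : ℝ × ℝ³ => U r.1 r.2)
    (ht : 0 < t) (hA : 0 ≤ A) (hβ₀ : 0 ≤ β) (hβ : β < 1)
    (hb : ∀ s ∈ Ioo 0 t, nrm (U s) ≤ ofReal (A * ((t - s) ^ (-(1 / 2) : ℝ) * s ^ (-β)))) :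
    ∀ᵐ p ∂μΩ, IntegrableOn (fun s => U s p) (Ioo 0 t) :=
  ae_integrable_param hU (measurable_power t A (1 / 2) β)
    ((ae_restrict_mem measurableSet_Ioo).mono hb)
    (lintegral_beta_lt_top (by norm_num) ⟨hβ₀, hβ⟩ hA ht)

theorem normInfOne_integral_sub_le {S : Set ℝ} (hS : MeasurableSet S) {V : ℝ → ℝ³ → E}
    (hU : StronglyMeasurable fun r : ℝ × ℝ³ => U r.1 r.2)
    (hV : StronglyMeasurable fun r : ℝ × ℝ³ => V r.1 r.2) {β γ : ℝ → ℝ≥0∞}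
    (hβ : Measurable β) (hγ : Measurable γ) (hfin : ∫⁻ s in S, β s < ∞)
    (bU : ∀ s ∈ S, nrm (U s) ≤ β s) (bV : ∀ s ∈ S, nrm (V s) ≤ β s)
    (bd : ∀ s ∈ S, nrm (U s - V s) ≤ γ s) :
    nrm ((fun p => ∫ s in S, U s p) - fun p => ∫ s in S, V s p) ≤ ∫⁻ s in S, γ s := by
  have hm := ae_restrict_mem (μ := volume) hS
  rw [normInfOne_congr (g := fun p => ∫ s in S, (U s - V s) p)]
  · exact normInfOne_integral_le (W := fun s => U s - V s) (hU.sub hV) hγ (hm.mono bd)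
  · filter_upwards [ae_integrable_param hU hβ (hm.mono bU) hfin,
      ae_integrable_param hV hβ (hm.mono bV) hfin] with p h1 h2
    exact (integral_sub h1 h2).symm

theorem normInfOne_integral_le_of_power (hU : StronglyMeasurable fun r : ℝ × ℝ³ => U r.1 r.2)
    (ht : 0 < t) (hA : 0 ≤ A) (hβ₀ : 0 ≤ β) (hβ : β < 1)
    (hb : ∀ s ∈ Ioo 0 t, nrm (U s) ≤ ofReal (A * ((t - s) ^ (-(1 / 2) : ℝ) * s ^ (-β)))) :
    nrm (fun p => ∫ s in Ioo 0 t, U s p) ≤ ofReal (A * betaConst (1 / 2) β * t ^ (1 / 2 - β)) := by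
  refine (normInfOne_integral_le hU (measurable_power t A (1 / 2) β)
    ((ae_restrict_mem measurableSet_Ioo).mono hb)).trans
    ((lintegral_beta_le (by norm_num) ⟨hβ₀, hβ⟩ ht hA).trans (le_of_eq ?_))
  norm_num
end

variable {𝕜 : Type*} [RCLike 𝕜] [Layer] {C : ℝ}

/-- The estimates of the differences of the nonlinear terms, with real bounds. -/
theorem IsField.sub_le {v v' : ℝ³ → Vel 𝕜} {Dv Dv' : ℝ³ → Grad 𝕜}
    (h : IsField v Dv) (h' : IsField v' Dv') {A₀ A₁ d₀ d₁ : ℝ} (hA₀ : 0 ≤ A₀)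
    (hA₁ : 0 ≤ A₁) (hd₀ : 0 ≤ d₀) (hd₁ : 0 ≤ d₁)
    (b : nrm v ≤ ofReal A₀ ∧ nrm Dv ≤ ofReal A₁)
    (b' : nrm v' ≤ ofReal A₀ ∧ nrm Dv' ≤ ofReal A₁)
    (d : nrm (v - v') ≤ ofReal d₀ ∧ nrm (Dv - Dv') ≤ ofReal d₁) :
    nrm (flux v Dv - flux v' Dv') ≤ ofReal (3 * sobConst * ((d₀ + d₁) * A₀ + (A₀ + A₁) * d₀)) ∧
    nrm (conv v Dv - conv v' Dv') ≤ ofReal (3 * sobConst * ((d₀ + d₁) * A₁ + (A₀ + A₁) * d₁)) := by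
  have key : ∀ A₂ d₂ : ℝ, 0 ≤ A₂ → 0 ≤ d₂ →
      (sobConst : ℝ≥0∞) * (ofReal d₀ + ofReal d₁) * ofReal A₂ +
        sobConst * (ofReal A₀ + ofReal A₁) * ofReal d₂ =
      ofReal (sobConst * ((d₀ + d₁) * A₂ + (A₀ + A₁) * d₂)) := fun A₂ d₂ h2 h3 => by
    rw [ofReal_mul NNReal.zero_le_coe, ofReal_add (by positivity) (by positivity),
      ofReal_mul (by positivity), ofReal_mul (by positivity),
      ENNReal.ofReal_coe_nnreal, ofReal_add hd₀ hd₁, ofReal_add hA₀ hA₁]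
    ring
  have m : ∀ {a₁ a₂ a₃ a₄ : ℝ≥0∞} {A₂ d₂ : ℝ}, a₁ ≤ ofReal A₂ → a₂ ≤ ofReal d₂ →
      (sobConst : ℝ≥0∞) * (nrm (v - v') + nrm (Dv - Dv')) * a₁ +
        sobConst * (nrm v' + nrm Dv') * a₂ ≤
      (sobConst : ℝ≥0∞) * (ofReal d₀ + ofReal d₁) * ofReal A₂ +
        sobConst * (ofReal A₀ + ofReal A₁) * ofReal d₂ := by
    intro a₁ a₂ _ _ A₂ d₂ h1 h2
    exact add_le_add (mul_le_mul' (mul_le_mul_right (add_le_add d.1 d.2) _) h1)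
      (mul_le_mul' (mul_le_mul_right (add_le_add b'.1 b'.2) _) h2)
  constructor
  · refine (h.normInfOne_flux_sub_le h'.toIsPreField).trans
      ((m (a₃ := 0) (a₄ := 0) b.1 d.1).trans ?_)
    rw [key _ _ hA₀ hd₀, mul_assoc 3]
    refine ofReal_le_ofReal (le_mul_of_one_le_left (by positivity) (by norm_num))
  · refine (h.normInfOne_conv_sub_le h'.toIsPreField).trans
      ((mul_le_mul_right (m (a₃ := 0) (a₄ := 0) b.2 d.2) _).trans (le_of_eq ?_))
    rw [key _ _ hA₁ hd₁, mul_assoc 3, ofReal_mul zero_le_three, ENNReal.ofReal_ofNat]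

instance : AddCommGroup (Grad 𝕜) := NormedAddCommGroup.toAddCommGroup

/-- A time dependent field, together with its gradient. -/
abbrev Traj (𝕜 : Type*) [RCLike 𝕜] : Type _ := (ℝ → ℝ³ → Vel 𝕜) × (ℝ → ℝ³ → Grad 𝕜)

/-- The Duhamel integrand `S(t-s)ℙ∇·(u(s) ⊗ v(s))` and its gradient. -/
def duhInt (X : Traj 𝕜) (t : ℝ) : Traj 𝕜 := (fun s => projOp (t - s) (flux (X.1 s) (X.2 s)),
    fun s => convGrad (t - s) (conv (X.1 s) (X.2 s)))

/-- The Duhamel integral and its gradient. -/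
def duh (X : Traj 𝕜) : Traj 𝕜 := (fun t p => ∫ s in Ioo 0 t, (duhInt X t).1 s p,
    fun t p => ∫ s in Ioo 0 t, (duhInt X t).2 s p)

/-- Joint measurability in time and space. -/
def Traj.Meas (X : Traj 𝕜) : Prop := (StronglyMeasurable fun r : ℝ × ℝ³ => X.1 r.1 r.2) ∧
    StronglyMeasurable fun r : ℝ × ℝ³ => X.2 r.1 r.2

/-- `‖v(t)‖ ≤ d` and `t^μ ‖∇v(t)‖ ≤ d` on `(0, T]`. -/
def SizeLe (μ T d : ℝ) (X : Traj 𝕜) : Prop := ∀ t ∈ Ioc 0 T, nrm (X.1 t) ≤ ofReal d ∧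
    nrm (X.2 t) ≤ ofReal (d * t ^ (-μ))

/-- A measurable time dependent field on `(0, T]`. -/
structure IsTraj (T : ℝ) (X : Traj 𝕜) : Prop where
  meas : X.Meas
  field : ∀ t ∈ Ioc 0 T, IsField (X.1 t) (X.2 t)

theorem Traj.Meas.sub {X Y : Traj 𝕜} (hX : X.Meas) (hY : Y.Meas) : (X - Y).Meas :=
  ⟨hX.1.sub hY.1, hX.2.sub hY.2⟩

theorem IsTraj.sub {T : ℝ} {X Y : Traj 𝕜} (hX : IsTraj T X) (hY : IsTraj T Y) : IsTraj T (X - Y) :=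
  ⟨hX.meas.sub hY.meas, fun t ht => (hX.field t ht).sub (hY.field t ht)⟩

theorem stronglyMeasurable_duhInt (hC : KernelBounds 𝕜 C) {X : Traj 𝕜} (hX : X.Meas) :
    (StronglyMeasurable fun r : (ℝ × ℝ) × ℝ³ => (duhInt X r.1.1).1 r.1.2 r.2) ∧
    StronglyMeasurable fun r : (ℝ × ℝ) × ℝ³ => (duhInt X r.1.1).2 r.1.2 r.2 := by
  have hm : Measurable fun r : (ℝ × ℝ) × ℝ³ => (r.1.2, r.2) :=
    (measurable_snd.comp measurable_fst).prodMk measurable_snd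
  have hτ : Measurable fun r : ℝ × ℝ => r.1 - r.2 := measurable_fst.sub measurable_snd
  have h1 := (stronglyMeasurable_flux hX.1 hX.2).comp_measurable hm
  have h2 := (stronglyMeasurable_conv hX.1 hX.2).comp_measurable hm
  have h3 := hC.proj.measurable (f := fun r : ℝ × ℝ => flux (X.1 r.2) (X.2 r.2)) hτ h1
  have h4 := hC.convGrad.measurable (f := fun r : ℝ × ℝ => conv (X.1 r.2) (X.2 r.2)) hτ h2
  simp only [duhInt]
  exact ⟨h3, h4⟩

theorem Traj.Meas.duhInt (hC : KernelBounds 𝕜 C) {X : Traj 𝕜} (hX : X.Meas) (t : ℝ) :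
    (duhInt X t).Meas :=
  have hm : Measurable fun r : ℝ × ℝ³ => ((t, r.1), r.2) := by fun_prop
  ⟨StronglyMeasurable.comp_measurable (g := fun r : ℝ × ℝ³ => ((t, r.1), r.2))
    (stronglyMeasurable_duhInt hC hX).1 hm,
    StronglyMeasurable.comp_measurable (g := fun r : ℝ × ℝ³ => ((t, r.1), r.2))
    (stronglyMeasurable_duhInt hC hX).2 hm⟩

theorem Traj.Meas.duh (hC : KernelBounds 𝕜 C) {X : Traj 𝕜} (hX : X.Meas) : (duh X).Meas := by
  have hm : Measurable fun r : (ℝ × ℝ³) × ℝ => ((r.1.1, r.2), r.1.2) :=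
    ((measurable_fst.comp measurable_fst).prodMk measurable_snd).prodMk
      (measurable_snd.comp measurable_fst)
  have h := stronglyMeasurable_duhInt hC hX
  have h3 := stronglyMeasurable_setIntegral_Ioc (X := ℝ × ℝ³) (a := fun _ => 0)
    (b := fun x => x.1) measurable_const measurable_fst (h.1.comp_measurable hm)
  have h4 := stronglyMeasurable_setIntegral_Ioc (X := ℝ × ℝ³) (a := fun _ => 0)
    (b := fun x => x.1) measurable_const measurable_fst (h.2.comp_measurable hm)
  simp only [Traj.Meas, PrimEq.duh, ← integral_Ioc_eq_integral_Ioo]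
  exact ⟨h3, h4⟩

theorem duhInt_zero (t : ℝ) : duhInt (0 : Traj 𝕜) t = 0 := by
  refine Prod.ext ?_ ?_ <;> funext s p
  · simp [duhInt, projOp, heatOp, tailOp, layerOp, flux]
  · simp [duhInt, convGrad, gradOf, convOp, heatOp, tailOp, layerOp, conv]

theorem duh_zero : duh (0 : Traj 𝕜) = 0 := by
  refine Prod.ext ?_ ?_ <;> funext t p <;> simp [duh, duhInt_zero]

/-- The constant in the estimate of the Duhamel integrand. -/
def intConst (C : ℝ) : ℝ := 12 * (C * sobConst)

theorem KernelBounds.intConst_nonneg (hC : KernelBounds 𝕜 C) : 0 ≤ intConst C :=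
  mul_nonneg (by norm_num) (mul_nonneg hC.proj.const_nonneg (sobConst).coe_nonneg)

/-- A smoothing bound of a difference of nonlinear terms that are estimated by `IsField.sub_le`. -/
theorem KernelBounds.le_ofReal (hC : KernelBounds 𝕜 C) {y A B : ℝ} {N N' : ℝ≥0∞} (hy : 0 ≤ y)
    (h1 : N ≤ ofReal (C * y) * N') (h2 : N' ≤ ofReal (3 * sobConst * A)) (h3 : A ≤ 4 * B) :
    N ≤ ofReal (intConst C * (y * B)) := by
  have hC0 := hC.proj.const_nonneg
  have hk := (sobConst).coe_nonneg
  refine h1.trans ((mul_le_mul_right h2 _).trans ?_)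
  rw [← ofReal_mul (by positivity)]
  refine ofReal_le_ofReal ?_
  calc C * y * (3 * sobConst * A) ≤ C * y * (3 * sobConst * (4 * B)) := by gcongr
    _ = _ := by rw [intConst]; ring

theorem duhInt_sub_le (hC : KernelBounds 𝕜 C) {X Y : Traj 𝕜}
    {T μ M d : ℝ} (hX : IsTraj T X) (hY : IsTraj T Y) (hT : T ≤ 1) (hμ : 0 ≤ μ)
    (hM : 0 ≤ M) (hd : 0 ≤ d) (bX : SizeLe μ T M X) (bY : SizeLe μ T M Y)
    (bd : SizeLe μ T d (X - Y)) {t : ℝ} (ht : t ∈ Ioc 0 T) {s : ℝ} (hs : s ∈ Ioo 0 t) :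
    nrm ((duhInt X t - duhInt Y t).1 s) ≤
      ofReal (intConst C * (M * d) * ((t - s) ^ (-(1 / 2) : ℝ) * s ^ (-μ))) ∧
    nrm ((duhInt X t - duhInt Y t).2 s) ≤ ofReal (intConst C * (M * d) *
        ((t - s) ^ (-(1 / 2) : ℝ) * s ^ (-(2 * μ)))) := by
  have hs' : s ∈ Ioc 0 T := ⟨hs.1, hs.2.le.trans ht.2⟩
  have hτ : 0 < t - s := sub_pos.2 hs.2
  have fX := hX.field s hs'
  have fY := hY.field s hs'
  have h1 : 1 ≤ s ^ (-μ) := Real.one_le_rpow_of_pos_of_le_one_of_nonpos hs.1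
    (hs'.2.trans hT) (by linarith)
  have h2 : s ^ (-(2 * μ)) = s ^ (-μ) * s ^ (-μ) := by rw [← rpow_add hs.1]; ring_nf
  have hMd : 0 ≤ M * d := mul_nonneg hM hd
  obtain ⟨b1, b2⟩ := fX.sub_le fY hM (by positivity) hd (by positivity) (bX s hs') (bY s hs')
    (bd s hs')
  have hp := rpow_nonneg hτ.le (-(1 / 2))
  have h3 := mul_nonneg hMd (mul_nonneg (zero_le_one.trans h1) (sub_nonneg.2 h1))
  exact ⟨(hC.le_ofReal hp (hC.proj.normInfOne_sub_le hτ fX.memLinf_flux fY.memLinf_flux) b1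
    (B := M * d * s ^ (-μ)) (by nlinarith)).trans_eq (by ring_nf),
    (hC.le_ofReal hp (hC.convGrad.normInfOne_sub_le hτ fX.memLinf_conv fY.memLinf_conv) b2
    (B := M * d * (s ^ (-μ) * s ^ (-μ))) (by nlinarith)).trans_eq (by rw [h2]; ring_nf)⟩

theorem isTraj_zero {T : ℝ} : IsTraj T (0 : Traj 𝕜) :=
  ⟨⟨stronglyMeasurable_zero, stronglyMeasurable_zero⟩, fun _ _ => isField_zero⟩

theorem sizeLe_zero {μ T d : ℝ} : SizeLe μ T d (0 : Traj 𝕜) := fun t _ => by simp [normInfOne_zero]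

theorem duhInt_le (hC : KernelBounds 𝕜 C) {X : Traj 𝕜}
    {T μ M : ℝ} (hX : IsTraj T X) (hT : T ≤ 1) (hμ : 0 ≤ μ)
    (hM : 0 ≤ M) (bX : SizeLe μ T M X) {t : ℝ} (ht : t ∈ Ioc 0 T) {s : ℝ} (hs : s ∈ Ioo 0 t) :
    nrm ((duhInt X t).1 s) ≤ ofReal (intConst C * (M * M) * ((t - s) ^ (-(1 / 2) : ℝ) * s ^ (-μ))) ∧
    nrm ((duhInt X t).2 s) ≤ ofReal (intConst C * (M * M) *
        ((t - s) ^ (-(1 / 2) : ℝ) * s ^ (-(2 * μ)))) := by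
  have := duhInt_sub_le hC hX isTraj_zero hT hμ hM hM bX sizeLe_zero (by rwa [sub_zero]) ht hs
  rwa [duhInt_zero, sub_zero] at this

/-- The constant in the estimate of the Duhamel integral. -/
def duhConst (C μ : ℝ) : ℝ := intConst C * (betaConst (1 / 2) μ + betaConst (1 / 2) (2 * μ))

section
variable {T μ M d : ℝ} {X Y : Traj 𝕜}

theorem IsTraj.duh (hC : KernelBounds 𝕜 C) (hμ₀ : 0 ≤ μ) (hμ : μ < 1 / 2)
    (hX : IsTraj T X) (hT : T ≤ 1) (hM : 0 ≤ M) (bX : SizeLe μ T M X) :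
    IsTraj T (duh X) := by
  refine ⟨hX.meas.duh hC, fun t ht => ?_⟩
  have hI := hX.meas.duhInt hC t
  have hA : 0 ≤ intConst C * (M * M) := mul_nonneg hC.intConst_nonneg (mul_nonneg hM hM)
  refine IsField.integral hI.1 hI.2 (measurable_power t _ (1 / 2) μ) ?_
    (lintegral_beta_lt_top (by norm_num) ⟨hμ₀, by linarith⟩ hA ht.1) (measurable_power t _ (1 / 2) (2 * μ)) ?_
    (lintegral_beta_lt_top (by norm_num) ⟨by linarith, by linarith⟩ hA ht.1) ?_
  · filter_upwards [ae_restrict_mem measurableSet_Ioo] with s hs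
    exact (duhInt_le hC hX hT hμ₀ hM bX ht hs).1
  · filter_upwards [ae_restrict_mem measurableSet_Ioo] with s hs
    exact (duhInt_le hC hX hT hμ₀ hM bX ht hs).2
  · filter_upwards [ae_restrict_mem measurableSet_Ioo] with s hs
    exact (hX.field s ⟨hs.1, hs.2.le.trans ht.2⟩).proj hC (sub_pos.2 hs.2)

/-- The Duhamel integral is locally Lipschitz, with a small constant for small `T`. -/
theorem SizeLe.duh_sub (hC : KernelBounds 𝕜 C) (hμ₀ : 0 ≤ μ) (hμ : μ < 1 / 2)
    (hX : IsTraj T X) (hY : IsTraj T Y) (hT : T ≤ 1)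
    (hM : 0 ≤ M) (hd : 0 ≤ d) (bX : SizeLe μ T M X) (bY : SizeLe μ T M Y)
    (bd : SizeLe μ T d (X - Y)) :
    SizeLe μ T (duhConst C μ * T ^ (1 / 2 - μ) * M * d) (PrimEq.duh X - PrimEq.duh Y) := by
  intro t ht
  have hL := hC.intConst_nonneg
  have hA : 0 ≤ intConst C * (M * M) := mul_nonneg hL (mul_nonneg hM hM)
  have hB : 0 ≤ intConst C * (M * d) := mul_nonneg hL (mul_nonneg hM hd)
  have hIX := hX.meas.duhInt hC t
  have hIY := hY.meas.duhInt hC t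
  have b0 := betaConst_nonneg (α := 1 / 2) (β := μ) (by norm_num) (by linarith)
  have b1 := betaConst_nonneg (α := 1 / 2) (β := 2 * μ) (by norm_num) (by linarith)
  have hT' : t ^ (1 / 2 - μ) ≤ T ^ (1 / 2 - μ) := Real.rpow_le_rpow ht.1.le ht.2 (by linarith)
  have ht0 : 0 ≤ t ^ (1 / 2 - μ) := rpow_nonneg ht.1.le _
  have fin : ∀ b, 0 ≤ b → b ≤ betaConst (1 / 2) μ + betaConst (1 / 2) (2 * μ) →
      intConst C * (M * d) * b * t ^ (1 / 2 - μ) ≤ duhConst C μ * T ^ (1 / 2 - μ) * M * d :=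
    fun b hb0 hb => by
      calc _ ≤ intConst C * (M * d) * (betaConst (1 / 2) μ + betaConst (1 / 2) (2 * μ)) *
            T ^ (1 / 2 - μ) := by gcongr
        _ = _ := by rw [duhConst]; ring
  have B : ∀ Z, IsTraj T Z → SizeLe μ T M Z → ∀ s ∈ Ioo 0 t, _ := fun Z hZ bZ s hs =>
    duhInt_le hC hZ hT hμ₀ hM bZ ht hs
  have D := fun s hs => duhInt_sub_le hC hX hY hT hμ₀ hM hd bX bY bd (s := s) ht hs
  constructor
  · refine (normInfOne_integral_sub_le measurableSet_Ioo hIX.1 hIY.1 (measurable_power t _ (1 / 2) μ)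
      (measurable_power t _ (1 / 2) μ) (lintegral_beta_lt_top (by norm_num) ⟨hμ₀, by linarith⟩ hA ht.1) (fun s hs => (B X hX bX s hs).1) (fun s hs => (B Y hY bY s hs).1)
      fun s hs => (D s hs).1).trans ((lintegral_beta_le (by norm_num) ⟨hμ₀, by linarith⟩ ht.1 hB).trans (ofReal_le_ofReal ?_))
    convert fin _ b0 (by linarith) using 2
    norm_num
  · refine (normInfOne_integral_sub_le measurableSet_Ioo hIX.2 hIY.2
      (measurable_power t _ (1 / 2) (2 * μ)) (measurable_power t _ (1 / 2) (2 * μ))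
      (lintegral_beta_lt_top (by norm_num) ⟨by linarith, by linarith⟩ hA ht.1)
      (fun s hs => (B X hX bX s hs).2) (fun s hs => (B Y hY bY s hs).2)
      fun s hs => (D s hs).2).trans ((lintegral_beta_le (by norm_num) ⟨by linarith, by linarith⟩ ht.1 hB).trans (ofReal_le_ofReal ?_))
    rw [show 1 - 1 / 2 - 2 * μ = (1 / 2 - μ) + (-μ) by ring, rpow_add ht.1, ← mul_assoc]
    exact mul_le_mul_of_nonneg_right (fin _ b1 (by linarith)) (rpow_nonneg ht.1.le _)
end

end

section

variable {𝕜 : Type*} [RCLike 𝕜] [Layer] {C T μ m d e : ℝ} {X Y : Traj 𝕜}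

theorem SizeLe.add (hX : IsTraj T X) (hd : 0 ≤ d) (he : 0 ≤ e) (bX : SizeLe μ T d X)
    (bY : SizeLe μ T e Y) : SizeLe μ T (d + e) (X + Y) := fun t ht => by
  have := rpow_nonneg ht.1.le (-μ)
  rw [add_mul, ofReal_add hd he, ofReal_add (by positivity) (by positivity)]
  exact ⟨(normInfOne_add_le (hX.field t ht).mem.1).trans (add_le_add (bX t ht).1 (bY t ht).1),
    (normInfOne_add_le (hX.field t ht).mem'.1).trans (add_le_add (bX t ht).2 (bY t ht).2)⟩

theorem SizeLe.sub_comm (h : SizeLe μ T d (X - Y)) : SizeLe μ T d (Y - X) := fun t ht => by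
    rw [← neg_sub X Y]
    exact ⟨(normInfOne_neg _).trans_le (h t ht).1, (normInfOne_neg _).trans_le (h t ht).2⟩

theorem SizeLe.mono (h : SizeLe μ T d X) (hde : d ≤ e) : SizeLe μ T e X :=
  fun t ht => ⟨(h t ht).1.trans (by gcongr), (h t ht).2.trans (by
    have := rpow_nonneg ht.1.le (-μ); gcongr)⟩

theorem tendsto_ofReal_div_two_pow (c : ℝ) :
    Tendsto (fun n : ℕ => ofReal (c / 2 ^ n)) atTop (𝓝 0) := by
  have : Tendsto (fun n : ℕ => c / 2 ^ n) atTop (𝓝 0) :=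
    tendsto_const_nhds.div_atTop (tendsto_pow_atTop_atTop_of_one_lt one_lt_two)
  simpa using ENNReal.tendsto_ofReal this

/-- Completeness of the space of time dependent fields. -/
theorem exists_limit {P : ℕ → Traj 𝕜} (hm : 0 ≤ m) (hP : ∀ n, IsTraj T (P n))
    (b : SizeLe μ T d (P 0)) (hd : 0 ≤ d)
    (dif : ∀ n, SizeLe μ T (m / 2 ^ n) (P (n + 1) - P n)) :
    ∃ X : Traj 𝕜, IsTraj T X ∧ SizeLe μ T (d + 2 * m) X ∧
      ∀ n, SizeLe μ T (2 * m / 2 ^ n) (X - P n) := by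
  obtain ⟨X, h1, h2⟩ : ∃ X : Traj 𝕜, (∀ t p, X.1 t p = limUnder atTop fun n => (P n).1 t p) ∧
      ∀ t p, X.2 t p = limUnder atTop fun n => (P n).2 t p := ⟨(_, _), fun _ _ => rfl, fun _ _ => rfl⟩
  have hXm : X.Meas := by
    simp only [Traj.Meas, h1, h2]
    exact ⟨StronglyMeasurable.limUnder fun n => (hP n).meas.1,
      StronglyMeasurable.limUnder fun n => (hP n).meas.2⟩
  have near : ∀ n, SizeLe μ T (2 * m / 2 ^ n) (X - P n) := fun n t ht => by
    have ht0 := rpow_nonneg ht.1.le (-μ)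
    refine ⟨ae_tendsto_of_geometric (fun k => ((hP k).field t ht).sm) hm
      (fun k => (dif k t ht).1) (h1 t) n,
      (ae_tendsto_of_geometric (fun k => ((hP k).field t ht).sm') (mul_nonneg hm ht0)
      (fun k => (dif k t ht).2.trans_eq (by rw [div_mul_eq_mul_div])) (h2 t) n).trans_eq
      (by ring_nf)⟩
  have bX : SizeLe μ T (d + 2 * m) X := by
    have := SizeLe.add (hP 0) hd (by positivity) b (near 0)
    rwa [add_sub_cancel, pow_zero, div_one] at this
  refine ⟨X, ⟨hXm, fun t ht => ?_⟩, bX, near⟩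
  have s1 : StronglyMeasurable (X.1 t) := hXm.1.comp_measurable measurable_prodMk_left
  have s2 : StronglyMeasurable (X.2 t) := hXm.2.comp_measurable measurable_prodMk_left
  have l1 : Tendsto (fun n => nrm (X.1 t - (P n).1 t)) atTop (𝓝 0) :=
    tendsto_of_tendsto_of_tendsto_of_le_of_le tendsto_const_nhds (tendsto_ofReal_div_two_pow _)
      (fun _ => zero_le) fun n => (near n t ht).1
  have l2 : Tendsto (fun n => nrm (X.2 t - (P n).2 t)) atTop (𝓝 0) :=
    tendsto_of_tendsto_of_tendsto_of_le_of_le tendsto_const_nhds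
      (tendsto_ofReal_div_two_pow (2 * m * t ^ (-μ))) (fun _ => zero_le) fun n =>
        (near n t ht).2.trans_eq (by rw [div_mul_eq_mul_div])
  exact IsField.of_tendsto (fun n => (hP n).field t ht) s1 s2
    ⟨s1.aestronglyMeasurable, (bX t ht).1.trans_lt ofReal_lt_top⟩
    ⟨s2.aestronglyMeasurable, (bX t ht).2.trans_lt ofReal_lt_top⟩ l1 l2

/-- The Picard iterates of `X = A - duh X`. -/
def picard (A : Traj 𝕜) (n : ℕ) : Traj 𝕜 := (fun X => A - duh X)^[n] A

theorem picard_succ (A : Traj 𝕜) (n : ℕ) : picard A (n + 1) = A - duh (picard A n) :=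
  Function.iterate_succ_apply' _ _ _

theorem picard_bounds (hC : KernelBounds 𝕜 C) (hμ₀ : 0 ≤ μ)
    (hμ : μ < 1 / 2) {A : Traj 𝕜} (hA : IsTraj T A) (hT : T ≤ 1) (hm : 0 ≤ m)
    (bA : SizeLe μ T m A) (hq : duhConst C μ * T ^ (1 / 2 - μ) * (2 * m) ≤ 1 / 2)
    (n : ℕ) : (IsTraj T (picard A n) ∧ SizeLe μ T (2 * m) (picard A n)) ∧
      SizeLe μ T (m / 2 ^ n) (picard A (n + 1) - picard A n) := by
  have h2m : 0 ≤ 2 * m := by linarith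
  have small : ∀ X : Traj 𝕜, IsTraj T X → SizeLe μ T (2 * m) X →
      SizeLe μ T m (0 - duh X) := fun X hX bX => by
    have b := SizeLe.duh_sub hC hμ₀ hμ hX isTraj_zero hT h2m h2m bX sizeLe_zero
      (by rw [sub_zero]; exact bX)
    rw [duh_zero] at b
    exact b.sub_comm.mono (by nlinarith)
  have fld : ∀ n, IsTraj T (picard A n) ∧ SizeLe μ T (2 * m) (picard A n) := by
    intro n
    induction n with
    | zero => exact ⟨hA, bA.mono (by linarith)⟩
    | succ n ih =>
      rw [picard_succ]
      refine ⟨hA.sub (ih.1.duh hC hμ₀ hμ hT h2m ih.2), ?_⟩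
      rw [two_mul, sub_eq_add_neg, ← zero_sub]
      exact bA.add hA hm hm (small _ ih.1 ih.2)
  refine ⟨fld n, ?_⟩
  induction n with
  | zero =>
    have e : picard A (0 + 1) - picard A 0 = 0 - duh (picard A 0) := by
      rw [picard_succ]; show A - _ - A = _; abel
    rw [e, pow_zero, div_one]
    exact small _ (fld 0).1 (fld 0).2
  | succ n ih =>
    have b := SizeLe.duh_sub hC hμ₀ hμ (fld (n + 1)).1 (fld n).1 hT h2m
      (by positivity) (fld (n + 1)).2 (fld n).2 ih
    have e : picard A (n + 1 + 1) - picard A (n + 1) =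
        duh (picard A n) - duh (picard A (n + 1)) := by
      rw [picard_succ A (n + 1), picard_succ A n]; abel
    rw [e]
    refine b.sub_comm.mono ?_
    have : 0 ≤ m / 2 ^ n := by positivity
    rw [pow_succ, ← div_div]
    nlinarith

/-- The integral equation has a solution on `(0, T]` when `T` is small compared with the size of
the linear part. -/
theorem exists_fixedPoint (hC : KernelBounds 𝕜 C) (hμ₀ : 0 ≤ μ)
    (hμ : μ < 1 / 2) {A : Traj 𝕜} (hA : IsTraj T A) (hT : T ≤ 1) (hm : 0 ≤ m)
    (bA : SizeLe μ T m A) (hq : duhConst C μ * T ^ (1 / 2 - μ) * (2 * m) ≤ 1 / 2) :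
    ∃ X : Traj 𝕜, IsTraj T X ∧ SizeLe μ T (4 * m) X ∧
      ∀ t ∈ Ioc 0 T, X.1 t =ᵐ[μΩ] A.1 t - (duh X).1 t := by
  have hP := picard_bounds hC hμ₀ hμ hA hT hm bA hq
  obtain ⟨X, hX, bX, near⟩ := exists_limit hm (fun n => (hP n).1.1) (hP 0).1.2 (by linarith)
    fun n => (hP n).2
  rw [show 2 * m + 2 * m = 4 * m by ring] at bX
  refine ⟨X, hX, bX, fun t ht => ?_⟩
  have hs := (hX.sub (hA.sub (hX.duh hC hμ₀ hμ hT (by linarith) bX))).field t ht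
  have h0 : nrm ((X - (A - duh X)).1 t) = 0 := by
    refine le_antisymm (ge_of_tendsto' (tendsto_ofReal_div_two_pow (2 * m + 2 * m)) fun n => ?_)
      zero_le
    have b := SizeLe.duh_sub hC hμ₀ hμ hX (hP n).1.1 hT (by linarith : 0 ≤ 4 * m)
      (by positivity) bX ((hP n).1.2.mono (by linarith)) (near n)
    have hc : 0 ≤ 2 * m / 2 ^ n := by positivity
    have := SizeLe.add (hX.sub (hP (n + 1)).1.1) (by positivity) hc (near (n + 1))
      (b.mono (by nlinarith))
    rw [picard_succ, show X - (A - duh (picard A n)) +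
      (duh X - duh (picard A n)) = X - (A - duh X) by abel] at this
    refine (this t ht).1.trans (ofReal_le_ofReal ?_)
    rw [add_div]
    gcongr
    · norm_num
    · omega
  filter_upwards [ae_eq_zero_of_normInfOne hs.mem.1 h0] with p hp using sub_eq_zero.1 hp

/-- The linear part `S(t)a` with its gradient. -/
def linTraj (a : ℝ³ → Vel 𝕜) : Traj 𝕜 := (fun t => heatOp 0 1 0 t a, fun t => stokesGrad t a)

theorem isTraj_linTraj (hC : KernelBounds 𝕜 C) {a : ℝ³ → Vel 𝕜}
    (ha : MemL a) (hd : DivFree a) : IsTraj T (linTraj a) := by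
  refine ⟨?_, fun t ht => isField_stokes hC ha hd ht.1⟩
  have hm : StronglyMeasurable fun r : ℝ × ℝ³ => ha.1.mk a r.2 :=
    ha.1.stronglyMeasurable_mk.comp_measurable measurable_snd
  have h1 := hC.stokes.measurable (f := fun _ : ℝ => ha.1.mk a) measurable_id hm
  have h2 := hC.stokesGrad.measurable (f := fun _ : ℝ => ha.1.mk a) measurable_id hm
  simp only [Traj.Meas, linTraj, hC.stokes.congr ha.1.ae_eq_mk, hC.stokesGrad.congr ha.1.ae_eq_mk]
  exact ⟨h1, h2⟩

theorem IsPreField.ae_eq_grad {v v' : ℝ³ → Vel 𝕜} {Dv g : ℝ³ → Grad 𝕜}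
    (h : IsPreField v Dv) (hg : IsWeakGrad z₀ z₁ v' g)
    (hv : v' =ᵐ[μΩ] v) : Dv =ᵐ[μΩ] g := by
  have hi : ∀ i, WeakDeriv i v' fun p => g p i := fun i φ h1 h2 h3 => hg.2.2 φ h1 h2 h3 i
  filter_upwards [ae_all_iff.2 fun i => (h.weak i).ae_eq ((hi i).congr hv .rfl)
    (h.memLinf_grad i).locallyIntegrableOn ((gradProj 𝕜 i).locallyIntegrableOn_comp hg.2.1)]
    with p hp using PiLp.ext hp

theorem sizeLe_linTraj (hC : KernelBounds 𝕜 C) (hC1 : 1 ≤ C) {a : ℝ³ → Vel 𝕜}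
    (ha : MemL a) (hd : DivFree a) (hμ : seminormMu z₀ z₁ μ a < ∞) (hT : T ≤ 1) :
    SizeLe μ T (C * (tripleNorm z₀ z₁ μ a).toReal) (linTraj a) := by
  intro t ht
  have hn : tripleNorm z₀ z₁ μ a ≠ ∞ := (ENNReal.add_lt_top.2 ⟨hμ, ha.2⟩).ne
  have hC0 : 0 ≤ C := by linarith
  have h1 : 1 ≤ t ^ (-μ) * t ^ μ := by rw [← rpow_add ht.1]; simp
  have ht0 := rpow_nonneg ht.1.le (-μ)
  have e : ofReal (C * (tripleNorm z₀ z₁ μ a).toReal) = ofReal C * tripleNorm z₀ z₁ μ a := by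
    rw [ofReal_mul hC0, ofReal_toReal hn]
  have hf := isField_stokes hC ha hd ht.1
  constructor
  · refine (hC.stokes.normInfOne_le ht.1 ha).trans ?_
    rw [e, neg_zero, Real.rpow_zero, mul_one]
    exact mul_le_mul_right le_add_self _
  rw [mul_comm, ofReal_mul ht0, e]
  rcases (ht.2.trans hT).lt_or_eq with h | h
  · have g : gradNorm z₀ z₁ (stokes z₀ z₁ t a) = nrm (stokesGrad t a) := by
      have hs : stokes z₀ z₁ t a = heatOp 0 1 0 t a := stokes_eq ht.1 a
      rw [hs]
      refine le_antisymm (iInf₂_le (stokesGrad t a) ⟨hf.mem.locallyIntegrableOn,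
        hf.mem'.locallyIntegrableOn, fun φ h1 h2 h3 i => hf.weak i φ h1 h2 h3⟩) ?_
      exact le_iInf₂ fun g hg => (normInfOne_congr (hf.toIsPreField.ae_eq_grad hg .rfl)).le
    have : ofReal (t ^ μ) * nrm (stokesGrad t a) ≤ tripleNorm z₀ z₁ μ a := by
      rw [← g]
      exact (le_iSup₂ (f := fun t (_ : t ∈ Ioo (0 : ℝ) 1) => ofReal (t ^ μ) *
        gradNorm z₀ z₁ (stokes z₀ z₁ t a)) t ⟨ht.1, h⟩).trans le_self_add
    calc nrm (stokesGrad t a)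
        ≤ ofReal (t ^ (-μ) * t ^ μ) * nrm (stokesGrad t a) :=
          le_mul_of_one_le_left zero_le (ENNReal.one_le_ofReal.2 h1)
      _ ≤ ofReal (t ^ (-μ)) * tripleNorm z₀ z₁ μ a := by rw [ofReal_mul ht0, mul_assoc]; gcongr
      _ ≤ _ := by
          gcongr
          exact le_mul_of_one_le_left zero_le (ENNReal.one_le_ofReal.2 hC1)
  · refine (hC.stokesGrad.normInfOne_le ht.1 ha).trans ?_
    rw [h, Real.one_rpow, Real.one_rpow, ofReal_one, one_mul, mul_one]
    exact mul_le_mul_right le_add_self _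

end

section

variable {𝕜 : Type*} [RCLike 𝕜] [Layer] {C T : ℝ}

/-- The difference of two gradient terms of the Duhamel integrand is estimated in two ways, with
the weights `τ⁻¹ s^{-1/2}` and `τ^{-1/2} s⁻¹`; their geometric mean is integrable. -/
theorem IsField.rough_sub_le {v v' : ℝ³ → Vel 𝕜} {Dv Dv' : ℝ³ → Grad 𝕜}
    (hC : KernelBounds 𝕜 C) (h : IsField v Dv)
    (h' : IsField v' Dv') {K₀ K₁ d₀ d₁ r s τ : ℝ} (hK₀ : 0 ≤ K₀) (hK₁ : 0 ≤ K₁)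
    (hd₀ : 0 ≤ d₀) (hd₁ : 0 ≤ d₁) (hr : 0 ≤ r) (hs : 0 < s) (hsr : s ≤ r ^ 2) (hτ : 0 < τ)
    (b : nrm v ≤ ofReal K₀ ∧ nrm Dv ≤ ofReal (K₁ * s ^ (-(1 / 2) : ℝ)))
    (b' : nrm v' ≤ ofReal K₀ ∧ nrm Dv' ≤ ofReal (K₁ * s ^ (-(1 / 2) : ℝ)))
    (d : nrm (v - v') ≤ ofReal d₀ ∧ nrm (Dv - Dv') ≤ ofReal (d₁ * s ^ (-(1 / 2) : ℝ))) :
    nrm (projOp τ (flux v Dv) - projOp τ (flux v' Dv')) ≤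
      ofReal (intConst C * ((r * d₀ + d₁) * K₀ + (r * K₀ + K₁) * d₀) *
        (τ ^ (-(1 / 2) : ℝ) * s ^ (-(1 / 2) : ℝ))) ∧
    nrm (convGrad τ (conv v Dv) - convGrad τ (conv v' Dv')) ≤
      ofReal (intConst C * √(((r * d₀ + d₁) * K₀ + (r * K₀ + K₁) * d₀) *
        ((r * d₀ + d₁) * K₁ + (r * K₀ + K₁) * d₁)) *
        (τ ^ (-(3 / 4) : ℝ) * s ^ (-(3 / 4) : ℝ))) := by
  set x := s ^ (-(1 / 2) : ℝ) with hx
  have hx0 : 0 ≤ x := rpow_nonneg hs.le _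
  have hrx : 1 ≤ r * x := by
    rw [hx, Real.rpow_neg hs.le, ← Real.sqrt_eq_rpow, ← div_eq_mul_inv,
      one_le_div (Real.sqrt_pos.2 hs)]
    exact Real.sqrt_le_iff.2 ⟨hr, hsr⟩
  obtain ⟨b1, b2⟩ := h.sub_le h' hK₀ (by positivity) hd₀ (by positivity) b b' d
  set F := (r * d₀ + d₁) * K₀ + (r * K₀ + K₁) * d₀
  set Q := (r * d₀ + d₁) * K₁ + (r * K₀ + K₁) * d₁
  have hF : 0 ≤ F := by positivity
  have hQ : 0 ≤ Q := by positivity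
  have hL := hC.intConst_nonneg
  have e1 : d₀ + d₁ * x ≤ (r * d₀ + d₁) * x := by nlinarith
  have e2 : K₀ + K₁ * x ≤ (r * K₀ + K₁) * x := by nlinarith
  have f1 : (d₀ + d₁ * x) * K₀ + (K₀ + K₁ * x) * d₀ ≤ F * x := by
    linarith [mul_le_mul_of_nonneg_right e1 hK₀, mul_le_mul_of_nonneg_right e2 hd₀]
  have f2 : (d₀ + d₁ * x) * (K₁ * x) + (K₀ + K₁ * x) * (d₁ * x) ≤ Q * (x * x) := by
    linarith [mul_le_mul_of_nonneg_right e1 (mul_nonneg hK₁ hx0),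
      mul_le_mul_of_nonneg_right e2 (mul_nonneg hd₁ hx0)]
  refine ⟨(hC.le_ofReal (rpow_nonneg hτ.le _) (hC.proj.normInfOne_sub_le hτ h.memLinf_flux
    h'.memLinf_flux) b1 (B := F * x) (by nlinarith)).trans_eq (by ring_nf), ?_⟩
  have g1 := hC.le_ofReal (rpow_nonneg hτ.le _) (h.normInfOne_convGrad_sub_le hC h' hτ) b1
    (B := F * x) (by nlinarith)
  have g2 := hC.le_ofReal (rpow_nonneg hτ.le _) (hC.convGrad.normInfOne_sub_le hτ
    h.memLinf_conv h'.memLinf_conv) b2 (B := Q * (x * x)) (by nlinarith)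
  rw [mul_assoc (intConst C)]
  set y₁ := τ ^ (-1 : ℝ) * (F * x)
  set y₂ := τ ^ (-(1 / 2) : ℝ) * (Q * (x * x))
  have hm : min y₁ y₂ ≤ √(F * Q) * (τ ^ (-(3 / 4) : ℝ) * s ^ (-(3 / 4) : ℝ)) := by
    have hy₁ : 0 ≤ y₁ := mul_nonneg (rpow_nonneg hτ.le _) (by positivity)
    have hy₂ : 0 ≤ y₂ := mul_nonneg (rpow_nonneg hτ.le _) (by positivity)
    have p : ∀ {w : ℝ}, 0 < w → (w ^ (-(3 / 4) : ℝ)) ^ 2 = w ^ (-1 : ℝ) * w ^ (-(1 / 2) : ℝ) ∧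
        w ^ (-1 : ℝ) = w ^ (-(1 / 2) : ℝ) * w ^ (-(1 / 2) : ℝ) := fun hw => by
      rw [sq, ← rpow_add hw, ← rpow_add hw, ← rpow_add hw]; norm_num
    refine le_of_sq_le_sq ?_ (mul_nonneg (Real.sqrt_nonneg _) (mul_nonneg
      (rpow_nonneg hτ.le _) (rpow_nonneg hs.le _)))
    calc min y₁ y₂ ^ 2 ≤ y₁ * y₂ := by
          rw [sq]; exact mul_le_mul (min_le_left _ _) (min_le_right _ _) (le_min hy₁ hy₂) hy₁
      _ = _ := by
          rw [mul_pow, mul_pow, Real.sq_sqrt (by positivity), (p hτ).1, (p hs).1, (p hs).2]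
          simp only [y₁, y₂, hx]; ring
  refine le_trans ?_ (ofReal_le_ofReal (mul_le_mul_of_nonneg_left hm hL))
  rcases min_choice y₁ y₂ with e | e <;> rw [e]
  exacts [g1, g2]

/-- `‖v(t)‖ ≤ K₀` and `t^{1/2} ‖∇v(t)‖ ≤ K₁` on `(0, T]`. -/
def RoughLe (T K₀ K₁ : ℝ) (X : Traj 𝕜) : Prop := ∀ t ∈ Ioc 0 T, nrm (X.1 t) ≤ ofReal K₀ ∧
    nrm (X.2 t) ≤ ofReal (K₁ * t ^ (-(1 / 2) : ℝ))

theorem RoughLe.mono {K₀ K₁ L₀ L₁ : ℝ} {X : Traj 𝕜} (h : RoughLe T K₀ K₁ X) (h₀ : K₀ ≤ L₀)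
    (h₁ : K₁ ≤ L₁) : RoughLe T L₀ L₁ X := fun t ht =>
  ⟨(h t ht).1.trans (by gcongr), (h t ht).2.trans (by
    have := rpow_nonneg ht.1.le (-(1 / 2)); gcongr)⟩

/-- The weights of the two components in the rough estimates. -/
def roughConst (C : ℝ) : ℝ :=
  1 + intConst C * (betaConst (1 / 2) (1 / 2) + betaConst (3 / 4) (3 / 4))

section
variable {X Y : Traj 𝕜} {K₀ K₁ d₀ d₁ r : ℝ}

/-- A dominating function of the Duhamel integrand under the rough bounds. -/
theorem IsTraj.rough_bound (hC : KernelBounds 𝕜 C) (hT : T ≤ 1) {K : ℝ}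
    (hK : 0 ≤ K) {v : ℝ³ → Vel 𝕜} {Dv : ℝ³ → Grad 𝕜} {t s : ℝ} (ht : t ∈ Ioc 0 T)
    (hs : s ∈ Ioo 0 t) (h : IsField v Dv) (b : nrm v ≤ ofReal K ∧
      nrm Dv ≤ ofReal (K * s ^ (-(1 / 2) : ℝ))) :
    nrm (projOp (t - s) (flux v Dv)) ≤ ofReal (intConst C * (4 * (K * K)) *
        ((t - s) ^ (-(1 / 2) : ℝ) * s ^ (-(1 / 2) : ℝ))) ∧
    nrm (convGrad (t - s) (conv v Dv)) ≤ ofReal (intConst C * (4 * (K * K)) *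
        ((t - s) ^ (-(3 / 4) : ℝ) * s ^ (-(3 / 4) : ℝ))) := by
  have h0 : IsField (0 : ℝ³ → Vel 𝕜) 0 := isField_zero
  have := h.rough_sub_le hC h0 hK hK hK hK zero_le_one hs.1
    (by linarith [hs.2, ht.2] : s ≤ 1 ^ 2) (sub_pos.2 hs.2) b (by simp [normInfOne_zero])
    (by simpa using b)
  have e := duhInt_zero (𝕜 := 𝕜) t
  have e1 : projOp (t - s) (flux (0 : ℝ³ → Vel 𝕜) 0) = 0 := congrFun (congrArg Prod.fst e) s
  have e2 : convGrad (t - s) (conv (0 : ℝ³ → Vel 𝕜) 0) = 0 := congrFun (congrArg Prod.snd e) s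
  rw [e1, e2, sub_zero, sub_zero, show (1 * K + K) * K + (1 * K + K) * K = 4 * (K * K) by ring,
    Real.sqrt_mul_self (by positivity)] at this
  exact this

theorem IsTraj.duh_sub_le (hC : KernelBounds 𝕜 C) (hT : T ≤ 1)
    (hX : IsTraj T X) (hY : IsTraj T Y) {K : ℝ} (hK : 0 ≤ K)
    (bX : RoughLe T K K X) (bY : RoughLe T K K Y) {t : ℝ} (ht : t ∈ Ioc 0 T)
    {γ γ' : ℝ → ℝ≥0∞} (hγ : Measurable γ) (hγ' : Measurable γ')
    (bd : ∀ s ∈ Ioo 0 t, nrm ((duhInt X t).1 s - (duhInt Y t).1 s) ≤ γ s ∧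
      nrm ((duhInt X t).2 s - (duhInt Y t).2 s) ≤ γ' s) :
    nrm ((PrimEq.duh X).1 t - (PrimEq.duh Y).1 t) ≤ ∫⁻ s in Ioo 0 t, γ s ∧
    nrm ((PrimEq.duh X).2 t - (PrimEq.duh Y).2 t) ≤ ∫⁻ s in Ioo 0 t, γ' s := by
  have hA : 0 ≤ intConst C * (4 * (K * K)) := mul_nonneg hC.intConst_nonneg (by positivity)
  have B : ∀ Z : Traj 𝕜, IsTraj T Z → RoughLe T K K Z → ∀ s ∈ Ioo 0 t, _ :=
    fun Z hZ bZ s hs => IsTraj.rough_bound hC hT hK ht hs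
      (hZ.field s ⟨hs.1, hs.2.le.trans ht.2⟩) (bZ s ⟨hs.1, hs.2.le.trans ht.2⟩)
  have hIX := hX.meas.duhInt hC t
  have hIY := hY.meas.duhInt hC t
  exact ⟨normInfOne_integral_sub_le measurableSet_Ioo hIX.1 hIY.1 (measurable_power t _ (1 / 2) (1 / 2)) hγ
    (lintegral_beta_lt_top (by norm_num) (by norm_num) hA ht.1) (fun s hs => (B X hX bX s hs).1)
    (fun s hs => (B Y hY bY s hs).1) fun s hs => (bd s hs).1,
    normInfOne_integral_sub_le measurableSet_Ioo hIX.2 hIY.2 (measurable_power t _ (3 / 4) (3 / 4)) hγ'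
    (lintegral_beta_lt_top (by norm_num) (by norm_num) hA ht.1) (fun s hs => (B X hX bX s hs).2)
    (fun s hs => (B Y hY bY s hs).2) fun s hs => (bd s hs).2⟩

theorem RoughLe.duh_sub (hC : KernelBounds 𝕜 C) (hr : 0 ≤ r) (hTr : T ≤ r ^ 2)
    (hT : T ≤ 1) (hX : IsTraj T X) (hY : IsTraj T Y) (hK₀ : 0 ≤ K₀) (hK₁ : 0 ≤ K₁)
    (hd₀ : 0 ≤ d₀) (hd₁ : 0 ≤ d₁) (bX : RoughLe T K₀ K₁ X) (bY : RoughLe T K₀ K₁ Y)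
    (bd : RoughLe T d₀ d₁ (X - Y)) :
    RoughLe T (roughConst C * ((r * d₀ + d₁) * K₀ + (r * K₀ + K₁) * d₀))
      (roughConst C * √(((r * d₀ + d₁) * K₀ + (r * K₀ + K₁) * d₀) *
        ((r * d₀ + d₁) * K₁ + (r * K₀ + K₁) * d₁)))
      (PrimEq.duh X - PrimEq.duh Y) := by
  intro t ht
  have hL := hC.intConst_nonneg
  have b1 := betaConst_nonneg (α := 1 / 2) (β := 1 / 2) (by norm_num) (by norm_num)
  have b2 := betaConst_nonneg (α := 3 / 4) (β := 3 / 4) (by norm_num) (by norm_num)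
  have hF : 0 ≤ (r * d₀ + d₁) * K₀ + (r * K₀ + K₁) * d₀ := by positivity
  have hR := Real.sqrt_nonneg (((r * d₀ + d₁) * K₀ + (r * K₀ + K₁) * d₀) *
        ((r * d₀ + d₁) * K₁ + (r * K₀ + K₁) * d₁))
  obtain ⟨g1, g2⟩ := IsTraj.duh_sub_le hC hT hX hY (le_max_of_le_left hK₀)
    (bX.mono (le_max_left _ _) (le_max_right _ _)) (bY.mono (le_max_left _ _) (le_max_right _ _)) ht
    (measurable_power t _ (1 / 2) (1 / 2)) (measurable_power t _ (3 / 4) (3 / 4)) fun s hs =>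
      have hs' : s ∈ Ioc 0 T := ⟨hs.1, hs.2.le.trans ht.2⟩
      (hX.field s hs').rough_sub_le hC (hY.field s hs') hK₀ hK₁ hd₀ hd₁ hr hs.1
        (hs'.2.trans hTr) (sub_pos.2 hs.2) (bX s hs') (bY s hs') (bd s hs')
  have ht0 := rpow_nonneg ht.1.le (-(1 / 2))
  constructor
  · refine g1.trans ((lintegral_beta_le (by norm_num) (by norm_num)
      ht.1 (mul_nonneg hL hF)).trans (ofReal_le_ofReal ?_))
    rw [show (1 : ℝ) - 1 / 2 - 1 / 2 = 0 by norm_num, Real.rpow_zero, mul_one, roughConst]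
    nlinarith [mul_nonneg (mul_nonneg hL b2) hF]
  · refine g2.trans ((lintegral_beta_le (by norm_num) (by norm_num)
      ht.1 (mul_nonneg hL hR)).trans (ofReal_le_ofReal ?_))
    rw [show (1 : ℝ) - 3 / 4 - 3 / 4 = -(1 / 2) by norm_num, roughConst]
    refine mul_le_mul_of_nonneg_right ?_ ht0
    nlinarith [mul_nonneg (mul_nonneg hL b1) hR]
end

theorem eq_zero_of_halving {δ : Traj 𝕜} {S : Set ℝ} {w w' : ℝ → ℝ} {d : ℝ}
    (P : ℝ → Prop) (hP : ∀ d, P d ↔ ∀ t ∈ S, nrm (δ.1 t) ≤ ofReal (d * w t) ∧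
      nrm (δ.2 t) ≤ ofReal (d * w' t)) (hd : 0 ≤ d) (h0 : P d)
    (h : ∀ d, 0 ≤ d → P d → P (d / 2)) {t : ℝ} (ht : t ∈ S) :
    nrm (δ.1 t) = 0 ∧ nrm (δ.2 t) = 0 := by
  have hn : ∀ n : ℕ, P (d / 2 ^ n) := fun n => by
    induction n with
    | zero => simpa using h0
    | succ n ih => rw [pow_succ, ← div_div]; exact h _ (by positivity) ih
  have hn' := fun n => (hP _).1 (hn n) t ht
  exact ⟨le_antisymm (ge_of_tendsto' (tendsto_ofReal_div_two_pow (d * w t)) fun n =>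
    (hn' n).1.trans_eq (by rw [div_mul_eq_mul_div])) zero_le,
    le_antisymm (ge_of_tendsto' (tendsto_ofReal_div_two_pow (d * w' t)) fun n =>
    (hn' n).2.trans_eq (by rw [div_mul_eq_mul_div])) zero_le⟩

end

section

variable {𝕜 : Type*} [RCLike 𝕜] [Layer] {C T K : ℝ} {A X Y : Traj 𝕜}

/-- A solution of `X = A - duh X` on `(0, T]` in the class of the uniqueness theorem. -/
structure IsRoughSol (T K : ℝ) (A X : Traj 𝕜) : Prop where
  traj : IsTraj T X
  bound : RoughLe T K K X
  small : ∀ ε, 0 < ε → ∃ t₁, 0 < t₁ ∧ ∀ t ∈ Ioc 0 (min t₁ T),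
    nrm (X.2 t) ≤ ofReal (ε * t ^ (-(1 / 2) : ℝ))
  eqn : ∀ t ∈ Ioc 0 T, X.1 t = A.1 t - (duh X).1 t ∧ X.2 t = A.2 t - (duh X).2 t

theorem IsRoughSol.mono {T' K' : ℝ} (h : IsRoughSol T K A X) (hT : T' ≤ T) (hK : K ≤ K') :
    IsRoughSol T' K' A X where
  traj := ⟨h.traj.meas, fun t ht => h.traj.field t ⟨ht.1, ht.2.trans hT⟩⟩
  bound := fun t ht => h.bound.mono hK hK t ⟨ht.1, ht.2.trans hT⟩
  small := fun ε hε => (h.small ε hε).imp fun _ h1 => ⟨h1.1, fun t ht =>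
    h1.2 t ⟨ht.1, ht.2.trans (min_le_min_left _ hT)⟩⟩
  eqn := fun t ht => h.eqn t ⟨ht.1, ht.2.trans hT⟩

theorem IsRoughSol.sub_eq (hX : IsRoughSol T K A X) (hY : IsRoughSol T K A Y) {t : ℝ}
    (ht : t ∈ Ioc 0 T) : (X - Y).1 t = -((duh X).1 t - (duh Y).1 t) ∧
      (X - Y).2 t = -((duh X).2 t - (duh Y).2 t) := by
  refine ⟨?_, ?_⟩
  · show X.1 t - Y.1 t = _
    nth_rw 1 [(hX.eqn t ht).1, (hY.eqn t ht).1]; abel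
  · show X.2 t - Y.2 t = _
    nth_rw 1 [(hX.eqn t ht).2, (hY.eqn t ht).2]; abel

theorem RoughLe.sub {K₀ K₁ L₀ L₁ : ℝ} (hX : IsTraj T X) (bX : RoughLe T K₀ K₁ X)
    (bY : RoughLe T L₀ L₁ Y) (hK₀ : 0 ≤ K₀) (hK₁ : 0 ≤ K₁) (hL₀ : 0 ≤ L₀) (hL₁ : 0 ≤ L₁) :
    RoughLe T (K₀ + L₀) (K₁ + L₁) (X - Y) := fun t ht => by
  have := rpow_nonneg ht.1.le (-(1 / 2))
  rw [add_mul, ofReal_add hK₀ hL₀, ofReal_add (by positivity) (by positivity)]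
  exact ⟨(normInfOne_sub_le (hX.field t ht).mem.1).trans (add_le_add (bX t ht).1 (bY t ht).1),
    (normInfOne_sub_le (hX.field t ht).mem'.1).trans (add_le_add (bX t ht).2 (bY t ht).2)⟩

/-- Two solutions coincide for a short time. The gradients of both are small there, relative to
`t^{-1/2}`; measuring the difference of the gradients with a small weight `η` makes the Duhamel
integral a contraction. -/
theorem IsRoughSol.unique_small (hC : KernelBounds 𝕜 C) (hT : T ≤ 1)
    (hK : 1 ≤ K) (hX : IsRoughSol T K A X) (hY : IsRoughSol T K A Y) :
    ∃ t₁, 0 < t₁ ∧ ∀ t ∈ Ioc 0 (min t₁ T), nrm ((X - Y).1 t) = 0 ∧ nrm ((X - Y).2 t) = 0 := by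
  set b := roughConst C
  have hb : 1 ≤ b := le_add_of_nonneg_right (mul_nonneg hC.intConst_nonneg (add_nonneg
    (betaConst_nonneg (by norm_num) (by norm_num)) (betaConst_nonneg (by norm_num) (by norm_num))))
  have hbK : 1 ≤ b * K := one_le_mul_of_one_le_of_one_le hb hK
  obtain ⟨η, hη, hη0⟩ : ∃ η, η * (4 * (b * K)) = 1 ∧ 0 < η :=
    ⟨(4 * (b * K))⁻¹, inv_mul_cancel₀ (by positivity), by positivity⟩
  have hη1 : η ≤ 1 := by nlinarith
  obtain ⟨ε, hε, hε0⟩ : ∃ ε, ε * (32 * (b * b * K)) = η ∧ 0 < ε :=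
    ⟨η / (32 * (b * b * K)), div_mul_cancel₀ _ (by positivity), by positivity⟩
  have h32 : 32 ≤ 32 * (b * b * K) := by nlinarith
  have hε1 : 32 * ε ≤ η := by nlinarith
  obtain ⟨r, hr, hr0⟩ : ∃ r, r * K = ε ∧ 0 < r := ⟨ε / K, div_mul_cancel₀ _ (by positivity),
    by positivity⟩
  have hr1 : r ≤ ε := by nlinarith
  obtain ⟨t₁, h1, h1'⟩ := hX.small ε hε0
  obtain ⟨t₂, h2, h2'⟩ := hY.small ε hε0
  refine ⟨min (min t₁ t₂) (r ^ 2), by positivity, ?_⟩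
  set τ := min (min (min t₁ t₂) (r ^ 2)) T with hτ
  have hτT : τ ≤ T := min_le_right _ _
  have hτr : τ ≤ r ^ 2 := (min_le_left _ _).trans (min_le_right _ _)
  have l1 : τ ≤ min t₁ T := min_le_min_right _ ((min_le_left _ _).trans (min_le_left _ _))
  have l2 : τ ≤ min t₂ T := min_le_min_right _ ((min_le_left _ _).trans (min_le_right _ _))
  have sX := hX.mono hτT le_rfl
  have sY := hY.mono hτT le_rfl
  have bX : RoughLe τ K ε X := fun t ht => ⟨(sX.bound t ht).1, h1' t ⟨ht.1, ht.2.trans l1⟩⟩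
  have bY : RoughLe τ K ε Y := fun t ht => ⟨(sY.bound t ht).1, h2' t ⟨ht.1, ht.2.trans l2⟩⟩
  have hK0 : 0 ≤ K := by linarith
  intro t ht
  refine eq_zero_of_halving (d := (2 * K + 2 * ε) / η) (w := fun _ => 1)
    (w' := fun t => η * t ^ (-(1 / 2) : ℝ)) (fun d => RoughLe τ d (d * η) (X - Y))
    (fun d => by simp only [RoughLe, mul_one, mul_assoc]) (by positivity) ?_ (fun d hd h => ?_) ht
  · refine (RoughLe.sub sX.traj bX bY hK0 hε0.le hK0 hε0.le).mono ?_ ?_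
    · rw [le_div_iff₀ hη0]; nlinarith
    · rw [div_mul_cancel₀ _ hη0.ne']; linarith
  · have := RoughLe.duh_sub hC hr0.le hτr (hτT.trans hT) sX.traj sY.traj hK0 hε0.le hd
      (by positivity) bX bY h
    have hF : (r * d + d * η) * K + (r * K + ε) * d ≤ 2 * (η * K) * d := by
      nlinarith [mul_nonneg hη0.le hd, mul_nonneg (mul_nonneg hη0.le hd) (sub_nonneg.2 hK)]
    have hQ : (r * d + d * η) * ε + (r * K + ε) * (d * η) ≤ 4 * ε * d := by
      have := mul_nonneg hε0.le hd
      rw [hr]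
      nlinarith [mul_nonneg this (sub_nonneg.2 hη1)]
    intro s hs
    have hs' := RoughLe.mono this (L₀ := d / 2) (L₁ := d / 2 * η) ?_ ?_ s hs
    · rw [(sX.sub_eq sY hs).1, (sX.sub_eq sY hs).2, normInfOne_neg, normInfOne_neg]
      exact hs'
    · calc b * _ ≤ b * (2 * (η * K) * d) := by gcongr
        _ = η * (4 * (b * K)) * (d / 2) := by ring
        _ = d / 2 := by rw [hη, one_mul]
    · calc b * √_ ≤ b * √(2 * (η * K) * d * (4 * ε * d)) := by gcongr
        _ = b * √((η * d / (2 * b)) ^ 2) := by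
            congr 2
            nth_rw 2 [← hε]
            field_simp
            nlinarith [hε]
        _ = d / 2 * η := by
            rw [Real.sqrt_sq (by positivity)]
            field_simp

theorem exp_neg_le_rpow {x : ℝ} (hx : 0 < x) : exp (-x) ≤ x ^ (-(1 / 8) : ℝ) := by
  rw [Real.exp_neg, Real.rpow_neg hx.le]
  refine inv_anti₀ (by positivity) ?_
  rcases le_total x 1 with h | h
  · exact (Real.rpow_le_one hx.le h (by norm_num)).trans (Real.one_le_exp hx.le)
  · refine (Real.rpow_le_self_of_one_le h (by norm_num)).trans ?_
    linarith [Real.add_one_le_exp x]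

/-- Solutions that coincide for a short time coincide: away from `t = 0` the Duhamel integral is a
contraction with respect to a weight `e^{λt}`. -/
theorem IsRoughSol.unique (hC : KernelBounds 𝕜 C) (hT : T ≤ 1)
    (hT0 : 0 < T) (hK : 1 ≤ K) (hX : IsRoughSol T K A X) (hY : IsRoughSol T K A Y)
    {t : ℝ} (ht : t ∈ Ioc 0 T) : X.1 t =ᵐ[μΩ] Y.1 t := by
  obtain ⟨t₁, h1, h1'⟩ := hX.unique_small hC hT hK hY
  have hK0 : 0 ≤ K := by linarith
  set τ := min t₁ T
  have hτ : 0 < τ := lt_min h1 hT0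
  have hL := hC.intConst_nonneg
  set x := τ ^ (-(3 / 4) : ℝ)
  have hx1 : 1 ≤ x := Real.one_le_rpow_of_pos_of_le_one_of_nonpos hτ
    ((min_le_right _ _).trans hT) (by norm_num)
  set L := intConst C * (4 * K * x)
  have hL0 : 0 ≤ L := by positivity
  set l := 16 * L + 1
  have hl : 0 < l := by positivity
  have hsmall : ∀ s : ℝ, 0 < s → s ≤ 1 → 1 ≤ s ^ (-(1 / 2) : ℝ) := fun s hs hs1 =>
    Real.one_le_rpow_of_pos_of_le_one_of_nonpos hs hs1 (by norm_num)
  have key := eq_zero_of_halving (δ := X - Y) (S := Ioc 0 T) (d := 2 * K * x)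
    (w := fun t => exp (l ^ 8 * t)) (w' := fun t => exp (l ^ 8 * t))
    _ (fun d => Iff.rfl) (by positivity) ?_ ?_ ht
  · filter_upwards [ae_eq_zero_of_normInfOne ((hX.traj.sub hY.traj).field t ht).mem.1 key.1]
      with p hp using sub_eq_zero.1 hp
  · intro s hs
    have he : 1 ≤ exp (l ^ 8 * s) := Real.one_le_exp (mul_nonneg (by positivity) hs.1.le)
    rcases le_or_gt s τ with h | h
    · rw [(h1' s ⟨hs.1, h⟩).1, (h1' s ⟨hs.1, h⟩).2]; exact ⟨zero_le, zero_le⟩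
    · have hsx : s ^ (-(1 / 2) : ℝ) ≤ x := (Real.rpow_le_rpow_of_nonpos hτ h.le (by norm_num)).trans
        (Real.rpow_le_rpow_of_exponent_ge hτ ((min_le_right _ _).trans hT) (by norm_num))
      have := RoughLe.sub hX.traj hX.bound hY.bound hK0 hK0 hK0 hK0 s hs
      have hle : 2 * K * x ≤ 2 * K * x * exp (l ^ 8 * s) :=
        le_mul_of_one_le_right (by positivity) he
      exact ⟨this.1.trans (ofReal_le_ofReal (by nlinarith)),
        this.2.trans (ofReal_le_ofReal (by nlinarith))⟩
  · intro d hd h s hs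
    set c := L * d * exp (l ^ 8 * s) * l⁻¹
    have hl8 : (l ^ 8) ^ (-(1 / 8) : ℝ) = l⁻¹ := by
      rw [← Real.rpow_natCast, ← Real.rpow_mul hl.le]; norm_num [Real.rpow_neg_one]
    -- The integrand vanishes before `τ`, and afterwards the gradients are bounded.
    have hpt : ∀ ρ ∈ Ioo 0 s, nrm ((duhInt X s).1 ρ - (duhInt Y s).1 ρ) ≤
          ofReal (c * (s - ρ) ^ (-(7 / 8) : ℝ)) ∧
        nrm ((duhInt X s).2 ρ - (duhInt Y s).2 ρ) ≤ ofReal (c * (s - ρ) ^ (-(7 / 8) : ℝ)) := by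
      intro ρ hρ
      have hq : 0 < s - ρ := sub_pos.2 hρ.2
      have hρT : ρ ∈ Ioc 0 T := ⟨hρ.1, hρ.2.le.trans hs.2⟩
      have hρ1 := hρT.2.trans hT
      have est := fun {D : ℝ} (hD : 0 ≤ D) => (hX.traj.field ρ hρT).rough_sub_le hC
        (hY.traj.field ρ hρT) hK0 hK0 hD hD zero_le_one hρ.1 (by simpa using hρ1) hq
        (hX.bound ρ hρT) (hY.bound ρ hρT)
      rcases le_or_gt ρ τ with h' | h'
      · have := est le_rfl ⟨(h1' ρ ⟨hρ.1, h'⟩).1.trans_le zero_le,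
          (h1' ρ ⟨hρ.1, h'⟩).2.trans_le zero_le⟩
        simp only [mul_zero, zero_mul, add_zero, Real.sqrt_zero, ENNReal.ofReal_zero] at this
        exact ⟨this.1.trans zero_le, this.2.trans zero_le⟩
      set D := d * exp (l ^ 8 * ρ)
      have hD : 0 ≤ D := by positivity
      have := est hD ⟨(h ρ hρT).1, (h ρ hρT).2.trans
        (ofReal_le_ofReal (le_mul_of_one_le_right hD (hsmall ρ hρ.1 hρ1)))⟩
      rw [Real.sqrt_mul_self (by positivity)] at this
      have e2 := exp_neg_le_rpow (mul_pos (pow_pos hl 8) hq)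
      rw [Real.mul_rpow (by positivity) hq.le, hl8] at e2
      have fin : ∀ a ∈ Icc (1 / 2 : ℝ) (3 / 4), intConst C * ((1 * D + D) * K + (1 * K + K) * D) *
          ((s - ρ) ^ (-a) * ρ ^ (-a)) ≤ c * (s - ρ) ^ (-(7 / 8) : ℝ) := fun a ha => by
        have i1 : (s - ρ) ^ (-a) ≤ (s - ρ) ^ (-(3 / 4) : ℝ) := Real.rpow_le_rpow_of_exponent_ge hq
          (by linarith [hs.2, hρ.1]) (by linarith [ha.2])
        have i2 : ρ ^ (-a) ≤ x := (Real.rpow_le_rpow_of_nonpos hτ h'.le (by linarith [ha.1])).trans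
          (Real.rpow_le_rpow_of_exponent_ge hτ ((min_le_right _ _).trans hT) (by linarith [ha.2]))
        have j0 := rpow_nonneg hρ.1.le (-a)
        have j1 := rpow_nonneg hq.le (-(3 / 4))
        calc _ ≤ intConst C * ((1 * D + D) * K + (1 * K + K) * D) *
              ((s - ρ) ^ (-(3 / 4) : ℝ) * x) := by gcongr
          _ = L * d * exp (l ^ 8 * s) * (s - ρ) ^ (-(3 / 4) : ℝ) * exp (-(l ^ 8 * (s - ρ))) := by
              rw [show D = d * (exp (l ^ 8 * s) * exp (-(l ^ 8 * (s - ρ)))) by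
                rw [← Real.exp_add]; ring_nf; rfl]
              simp only [L]; ring
          _ ≤ L * d * exp (l ^ 8 * s) * (s - ρ) ^ (-(3 / 4) : ℝ) *
              (l⁻¹ * (s - ρ) ^ (-(1 / 8) : ℝ)) := by gcongr
          _ = c * ((s - ρ) ^ (-(3 / 4) : ℝ) * (s - ρ) ^ (-(1 / 8) : ℝ)) := by ring
          _ = _ := by rw [← rpow_add hq]; norm_num
      exact ⟨this.1.trans (ofReal_le_ofReal (fin _ (by norm_num))),
        this.2.trans (ofReal_le_ofReal (fin _ (by norm_num)))⟩
    have hle := IsTraj.duh_sub_le hC hT hX.traj hY.traj hK0 hX.bound hY.bound hs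
      (γ := fun ρ => ofReal (c * (s - ρ) ^ (-(7 / 8) : ℝ)))
      (γ' := fun ρ => ofReal (c * (s - ρ) ^ (-(7 / 8) : ℝ))) (by fun_prop) (by fun_prop) hpt
    rw [(hX.sub_eq hY hs).1, (hX.sub_eq hY hs).2, normInfOne_neg, normInfOne_neg]
    have hint : ∫⁻ ρ in Ioo 0 s, ofReal (c * (s - ρ) ^ (-(7 / 8) : ℝ)) ≤
        ofReal (d / 2 * exp (l ^ 8 * s)) := by
      have hc : 0 ≤ c := by positivity
      simp only [ofReal_mul hc]
      rw [lintegral_const_mul _ (by fun_prop), lintegral_sub_rpow (by norm_num) hs.1, ← ofReal_mul hc]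
      refine ofReal_le_ofReal ?_
      have hs1 : s ^ (1 - 7 / 8 : ℝ) ≤ 1 := Real.rpow_le_one hs.1.le (hs.2.trans hT) (by norm_num)
      have hLl : L * l⁻¹ * 8 ≤ 1 / 2 := by
        rw [← div_eq_mul_inv, div_mul_eq_mul_div, div_le_iff₀ hl]; linarith
      calc c * (s ^ (1 - 7 / 8 : ℝ) / (1 - 7 / 8)) ≤ c * (1 / (1 - 7 / 8)) := by
            have : (0 : ℝ) < 1 - 7 / 8 := by norm_num
            gcongr
        _ = (L * l⁻¹ * 8) * (d * exp (l ^ 8 * s)) := by simp only [c]; ring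
        _ ≤ 1 / 2 * (d * exp (l ^ 8 * s)) := by gcongr
        _ = _ := by ring
    exact ⟨hle.1.trans hint, hle.2.trans hint⟩

end

section

variable {𝕜 : Type*} [RCLike 𝕜] [Layer] {C T τ μ d : ℝ} {v V a : ℝ³ → Vel 𝕜}
  {Dv W : ℝ³ → Grad 𝕜} {X : Traj 𝕜}

theorem ae_fullVel_congr (h : v =ᵐ[μΩ] V)
    (h' : Dv =ᵐ[μΩ] W) :
    fullVel v Dv =ᵐ[μΩ] fullVel V W := by
  filter_upwards [h, ae_layer_of_ae (ae_slice h'), ae_restrict_mem measurableSet_layer]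
    with p h1 h2 hp
  have e : vertVel z₁ Dv p = vertVel z₁ W p := by
    rw [vertVel_eq hp, vertVel_eq hp, integral_Ioc_eq_integral_Ioo, integral_Ioc_eq_integral_Ioo]
    refine integral_congr_ae ?_
    filter_upwards [ae_restrict_of_ae_restrict_of_subset (Ioo_subset_Ioo_left hp.2.1.le) h2]
      with ζ hζ
    rw [hdiv, hdiv, hζ]
  rw [fullVel, fullVel, h1, e]

theorem ae_flux_congr (h : v =ᵐ[μΩ] V)
    (h' : Dv =ᵐ[μΩ] W) :
    flux v Dv =ᵐ[μΩ] flux V W := by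
  filter_upwards [h, ae_fullVel_congr h h'] with p h1 h2
  funext i
  simp only [flux, h1, h2]

theorem ae_conv_congr (h : v =ᵐ[μΩ] V)
    (h' : Dv =ᵐ[μΩ] W) :
    conv v Dv =ᵐ[μΩ] conv V W := by
  filter_upwards [h', ae_fullVel_congr h h'] with p h1 h2
  rw [conv, conv, h1, h2]

theorem DivFree.congr (hV : DivFree v) (h : v =ᵐ[μΩ] V) :
    DivFree V := fun φ h1 h2 => by
  rw [← hV φ h1 h2]
  refine Finset.sum_congr rfl fun j _ => integral_congr_ae ?_
  filter_upwards [h] with p hp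
  rw [hp]

theorem nonlin_eq (hC : KernelBounds 𝕜 C) (hτ : 0 < τ)
    (hV : IsField V W) (h : v =ᵐ[μΩ] V)
    (h' : Dv =ᵐ[μΩ] W) {p : ℝ³} (hp : p ∈ Ω) :
    nonlin z₀ z₁ τ v Dv p = projOp τ (flux V W) p := by
  have e := ae_flux_congr h h'
  rw [← hC.proj.congr e, ← stokesProjDiv_eq hτ ((hV.memLinf_flux).congr e.symm) hp, nonlin]
  simp only [flux, fullVel_castSucc]; rfl

theorem le_of_sqrt_mul_le {N : ℝ≥0∞} {t k : ℝ} (ht : 0 < t) (hk : 0 ≤ k)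
    (h : ofReal √t * N ≤ ofReal k) :
    N ≤ ofReal (k * t ^ (-(1 / 2) : ℝ)) := by
  have h0 := rpow_nonneg ht.le (-(1 / 2))
  have e : t ^ (-(1 / 2) : ℝ) * √t = 1 := by
    rw [Real.sqrt_eq_rpow, ← rpow_add ht]; norm_num
  calc N = ofReal (t ^ (-(1 / 2) : ℝ)) * (ofReal √t * N) := by
        rw [← mul_assoc, ← ofReal_mul h0, e, ofReal_one, one_mul]
    _ ≤ _ := by rw [ofReal_mul hk, mul_comm]; exact mul_le_mul_left h _

/-- A bounded mild solution has, up to null sets, a jointly measurable version that satisfies the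
integral equation together with its gradient. -/
theorem IsMildOn.exists_isRoughSol (hC : KernelBounds 𝕜 C)
    (ha : MemL a) (hd : DivFree a) (hT : T ≤ 1) {v : ℝ → ℝ³ → Vel 𝕜}
    (hv : IsMildOn z₀ z₁ a (Ioc 0 T) v) (hσ : ∀ t ∈ Ioc 0 T, MemLinfSigma z₀ z₁ (v t)) {K : ℝ≥0}
    (hK : ∀ t ∈ Ioc 0 T, nrm (v t) ≤ K) :
    ∃ K' : ℝ, 1 ≤ K' ∧ ∃ X : Traj 𝕜, IsRoughSol T K' (linTraj a) X ∧
      ∀ t ∈ Ioc 0 T, v t =ᵐ[μΩ] X.1 t := by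
  obtain ⟨Dv, m1, m2, wk, ⟨K₁, hK₁⟩, lim, eqn⟩ := hv
  set M : ℝ := max 1 (max K K₁)
  have hM1 : 1 ≤ M := le_max_left _ _
  have hM0 : 0 ≤ M := by linarith
  have bd : ∀ t ∈ Ioc 0 T, nrm (v t) ≤ ofReal M ∧
      nrm (Dv t) ≤ ofReal (M * t ^ (-(1 / 2) : ℝ)) := fun t ht =>
    ⟨(hK t ht).trans (by
      rw [← ENNReal.ofReal_coe_nnreal]
      exact ofReal_le_ofReal ((le_max_left _ _).trans (le_max_right _ _))),
    le_of_sqrt_mul_le ht.1 hM0 ((hK₁ t ht).trans (by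
      rw [← ENNReal.ofReal_coe_nnreal]
      exact ofReal_le_ofReal ((le_max_right _ _).trans (le_max_right _ _))))⟩
  let V : Traj 𝕜 := (fun s p => m1.mk _ (s, p), fun s p => m2.mk _ (s, p))
  have hVm : V.Meas := ⟨m1.stronglyMeasurable_mk, m2.stronglyMeasurable_mk⟩
  have hV : ∀ᵐ s ∂(volume.restrict (Ioc 0 T)), IsField (V.1 s) (V.2 s) ∧
      v s =ᵐ[μΩ] V.1 s ∧
      Dv s =ᵐ[μΩ] V.2 s := by
    filter_upwards [ae_restrict_mem measurableSet_Ioc, Measure.ae_ae_of_ae_prod m1.ae_eq_mk,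
      Measure.ae_ae_of_ae_prod m2.ae_eq_mk] with s hs e1 e2
    have s1 : StronglyMeasurable (V.1 s) := hVm.1.comp_measurable measurable_prodMk_left
    have s2 : StronglyMeasurable (V.2 s) := hVm.2.comp_measurable measurable_prodMk_left
    have e1' : v s =ᵐ[μΩ] V.1 s := e1
    have e2' : Dv s =ᵐ[μΩ] V.2 s := e2
    have hp : IsPreField (V.1 s) (V.2 s) :=
      ⟨s1, s2, (hσ s hs).1.congr e1', ⟨s2.aestronglyMeasurable, by
        rw [← normInfOne_congr e2']; exact (bd s hs).2.trans_lt ofReal_lt_top⟩, fun i =>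
        WeakDeriv.congr (fun φ h1 h2 h3 => (wk s hs).2.2 φ h1 h2 h3 i) e1'
          (e2'.mono fun p hp => congrArg (fun g : Grad 𝕜 => g i) hp)⟩
    exact ⟨⟨hp, hp.divFree_iff.1 (((memLinfSigma_iff).1 (hσ s hs)).2.congr e1')⟩, e1', e2'⟩
  have hVt : ∀ t ∈ Ioc 0 T, ∀ᵐ s ∂(volume.restrict (Ioo 0 t)), s ∈ Ioo 0 t ∧
      IsField (V.1 s) (V.2 s) ∧ v s =ᵐ[μΩ] V.1 s ∧
      Dv s =ᵐ[μΩ] V.2 s := fun t ht =>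
    (ae_restrict_mem measurableSet_Ioo).and (ae_restrict_of_ae_restrict_of_subset
      (Ioo_subset_Ioc_self.trans (Ioc_subset_Ioc_right ht.2)) hV)
  have fldV : ∀ t ∈ Ioc 0 T, IsField ((duh V).1 t) ((duh V).2 t) := by
    intro t ht
    have hA : 0 ≤ intConst C * (4 * (M * M)) := mul_nonneg hC.intConst_nonneg (by positivity)
    have B : ∀ᵐ s ∂(volume.restrict (Ioo 0 t)), _ := (hVt t ht).mono fun s hs =>
      have hs' : s ∈ Ioc 0 T := ⟨hs.1.1, hs.1.2.le.trans ht.2⟩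
      IsTraj.rough_bound hC hT hM0 ht hs.1 hs.2.1
        (by rw [← normInfOne_congr hs.2.2.1, ← normInfOne_congr hs.2.2.2]; exact bd s hs')
    exact IsField.integral (hVm.duhInt hC t).1 (hVm.duhInt hC t).2
      (measurable_power t _ (1 / 2) (1 / 2)) (B.mono fun s hs => hs.1)
      (lintegral_beta_lt_top (by norm_num) (by norm_num) hA ht.1)
      (measurable_power t _ (3 / 4) (3 / 4)) (B.mono fun s hs => hs.2)
      (lintegral_beta_lt_top (by norm_num) (by norm_num) hA ht.1)
      ((hVt t ht).mono fun s hs => hs.2.1.proj hC (sub_pos.2 hs.1.2))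
  have hA := isTraj_linTraj (T := T) hC ha hd
  obtain ⟨X, hX⟩ : ∃ X, X = linTraj a - duh V := ⟨_, rfl⟩
  have tX : IsTraj T X := hX ▸ hA.sub ⟨hVm.duh hC, fldV⟩
  have e1 : ∀ t ∈ Ioc 0 T, v t =ᵐ[μΩ] X.1 t := fun t ht => by
    filter_upwards [eqn t ht, ae_restrict_mem measurableSet_layer] with p hp hpl
    rw [hp.2, stokes_eq ht.1, hX]
    refine congrArg (heatOp 0 1 0 t a p - ·) (integral_congr_ae ?_)
    exact (hVt t ht).mono fun s hs =>
      nonlin_eq hC (sub_pos.2 hs.1.2) hs.2.1 hs.2.2.1 hs.2.2.2 hpl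
  have e2 : ∀ t ∈ Ioc 0 T, X.2 t =ᵐ[μΩ] Dv t := fun t ht =>
    (tX.field t ht).toIsPreField.ae_eq_grad (wk t ht) (e1 t ht)
  have eD : ∀ t ∈ Ioc 0 T, (duh V).1 t = (duh X).1 t ∧
      (duh V).2 t = (duh X).2 t := fun t ht => by
    have E : ∀ᵐ s ∂(volume.restrict (Ioo 0 t)),
        (duhInt V t).1 s = (duhInt X t).1 s ∧
        (duhInt V t).2 s = (duhInt X t).2 s := (hVt t ht).mono fun s hs => by
      have hs' : s ∈ Ioc 0 T := ⟨hs.1.1, hs.1.2.le.trans ht.2⟩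
      have g1 := hs.2.2.1.symm.trans (e1 s hs')
      have g2 := hs.2.2.2.symm.trans (e2 s hs').symm
      exact ⟨hC.proj.congr (ae_flux_congr g1 g2), hC.convGrad.congr (ae_conv_congr g1 g2)⟩
    exact ⟨funext fun p => integral_congr_ae (E.mono fun s hs => congrFun hs.1 p),
      funext fun p => integral_congr_ae (E.mono fun s hs => congrFun hs.2 p)⟩
  refine ⟨M, hM1, X, ⟨tX, fun t ht => ?_, fun ε hε => ?_, fun t ht => ?_⟩, e1⟩
  · rw [← normInfOne_congr (e1 t ht), normInfOne_congr (e2 t ht)]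
    exact bd t ht
  · obtain ⟨t₁, h1, h2⟩ := (mem_nhdsGT_iff_exists_Ioc_subset (a := (0 : ℝ))).1
      (lim.eventually (Iic_mem_nhds (ENNReal.ofReal_pos.2 hε)))
    refine ⟨t₁, h1, fun t ht => ?_⟩
    rw [normInfOne_congr (e2 t ⟨ht.1, ht.2.trans (min_le_right _ _)⟩)]
    exact le_of_sqrt_mul_le ht.1 hε.le (h2 ⟨ht.1, ht.2.trans (min_le_left _ _)⟩)
  · rw [← (eD t ht).1, ← (eD t ht).2, hX]
    exact ⟨rfl, rfl⟩

/-- Uniqueness of bounded mild solutions. -/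
theorem IsMildOn.ae_eq (hC : KernelBounds 𝕜 C) (ha : MemLinfSigma z₀ z₁ a)
    {t : ℝ} (ht : 0 < t) (ht1 : t ≤ 1) {v v' : ℝ → ℝ³ → Vel 𝕜}
    (h : IsMildOn z₀ z₁ a (Ioc 0 t) v) (hσ : ∀ s ∈ Ioc 0 t, MemLinfSigma z₀ z₁ (v s)) {K : ℝ≥0}
    (hK : ∀ s ∈ Ioc 0 t, nrm (v s) ≤ K)
    (h' : IsMildOn z₀ z₁ a (Ioc 0 t) v') (hσ' : ∀ s ∈ Ioc 0 t, MemLinfSigma z₀ z₁ (v' s)) {K' : ℝ≥0}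
    (hK' : ∀ s ∈ Ioc 0 t, nrm (v' s) ≤ K') :
    v t =ᵐ[μΩ] v' t := by
  have had := (memLinfSigma_iff).1 ha
  obtain ⟨L, hL, X, sX, eX⟩ := h.exists_isRoughSol hC had.1 had.2 ht1 hσ hK
  obtain ⟨L', hL', Y, sY, eY⟩ := h'.exists_isRoughSol hC had.1 had.2 ht1 hσ' hK'
  exact ((eX t ⟨ht, le_rfl⟩).trans (IsRoughSol.unique hC ht1 ht (le_max_of_le_left hL)
    (sX.mono le_rfl (le_max_left L L')) (sY.mono le_rfl (le_max_right L L')) ⟨ht, le_rfl⟩)).trans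
    (eY t ⟨ht, le_rfl⟩).symm

theorem IsMildOn.mono {I I' : Set ℝ} {v : ℝ → ℝ³ → Vel 𝕜} (h : IsMildOn z₀ z₁ a I v)
    (hI : I' ⊆ I) : IsMildOn z₀ z₁ a I' v := by
  obtain ⟨Dv, m1, m2, wk, ⟨K, hK⟩, lim, eqn⟩ := h
  have hac : (volume.restrict I').prod μΩ ≪
      (volume.restrict I).prod μΩ :=
    (Measure.restrict_mono hI le_rfl).absolutelyContinuous.prod .rfl
  exact ⟨Dv, m1.mono_ac hac, m2.mono_ac hac, fun t ht => wk t (hI ht),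
    ⟨K, fun t ht => hK t (hI ht)⟩, lim, fun t ht => eqn t (hI ht)⟩

theorem isMildOn_of_traj (hC : KernelBounds 𝕜 C) (hμ₀ : 0 ≤ μ)
    (hμ : μ < 1 / 2) (hT0 : 0 < T) (hT : T ≤ 1) (hd : 0 ≤ d) (hX : IsTraj T X)
    (bX : SizeLe μ T d X) {v : ℝ → ℝ³ → Vel 𝕜} (hv : ∀ t ∈ Ioc 0 T, v t = X.1 t)
    (eqn : ∀ t ∈ Ioc 0 T, X.1 t =ᵐ[μΩ]
      (linTraj a).1 t - (duh X).1 t) : IsMildOn z₀ z₁ a (Ioc 0 T) v := by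
  have key : ∀ t ∈ Ioc 0 T, ofReal √t * nrm (X.2 t) ≤
      ofReal (d * t ^ (1 / 2 - μ)) := fun t ht => by
    refine (mul_le_mul_right (bX t ht).2 _).trans_eq ?_
    rw [← ofReal_mul (Real.sqrt_nonneg _), Real.sqrt_eq_rpow, mul_left_comm,
      ← rpow_add ht.1, sub_eq_add_neg]
  refine ⟨X.2, ?_, hX.meas.2.aestronglyMeasurable, fun t ht => ?_, ⟨d.toNNReal, fun t ht => ?_⟩,
    ?_, fun t ht => ?_⟩
  · refine hX.meas.1.aestronglyMeasurable.congr ?_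
    filter_upwards [Measure.quasiMeasurePreserving_fst.ae (ae_restrict_mem measurableSet_Ioc)]
      with r hr
    rw [hv _ hr]
  · have hf := hX.field t ht
    rw [hv t ht]
    exact ⟨hf.mem.locallyIntegrableOn, hf.mem'.locallyIntegrableOn,
      fun φ h1 h2 h3 i => hf.weak i φ h1 h2 h3⟩
  · exact (key t ht).trans (ofReal_le_ofReal (mul_le_of_le_one_right hd
      (Real.rpow_le_one ht.1.le (ht.2.trans hT) (by linarith))))
  · have h0 : Tendsto (fun t : ℝ => d * t ^ (1 / 2 - μ)) (𝓝 0) (𝓝 0) := by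
      have := (Real.continuousAt_rpow_const 0 (1 / 2 - μ) (Or.inr (by linarith))).tendsto.const_mul d
      rwa [Real.zero_rpow (by linarith), mul_zero] at this
    have h1 := (ENNReal.tendsto_ofReal h0).mono_left (nhdsWithin_le_nhds (s := Ioi 0))
    rw [ENNReal.ofReal_zero] at h1
    refine tendsto_of_tendsto_of_tendsto_of_le_of_le' tendsto_const_nhds h1
      (Eventually.of_forall fun _ => zero_le) ?_
    filter_upwards [Ioc_mem_nhdsGT hT0] with t ht using key t ht
  · have hI := ae_integrable_of_power (hX.meas.duhInt hC t).1 ht.1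
      (mul_nonneg hC.intConst_nonneg (mul_nonneg hd hd)) hμ₀ (by linarith)
      fun s hs => (duhInt_le hC hX hT hμ₀ hd bX ht hs).1
    filter_upwards [hI, eqn t ht, ae_restrict_mem measurableSet_layer] with p h1 h2 hp
    have e : ∀ s ∈ Ioo 0 t, nonlin z₀ z₁ (t - s) (v s) (X.2 s) p = (duhInt X t).1 s p :=
      fun s hs => by
        have hs' : s ∈ Ioc 0 T := ⟨hs.1, hs.2.le.trans ht.2⟩
        rw [hv s hs']
        exact nonlin_eq hC (sub_pos.2 hs.2) (hX.field s hs') .rfl .rfl hp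
    refine ⟨h1.congr_fun (fun s hs => (e s hs).symm) measurableSet_Ioo, ?_⟩
    rw [hv t ht, h2, stokes_eq ht.1, setIntegral_congr_fun measurableSet_Ioo e]
    rfl

/-- Existence on a time interval of the asserted length. -/
theorem exists_solution (hC : KernelBounds 𝕜 C) (hC1 : 1 ≤ C) (hμ₀ : 0 ≤ μ)
    (hμ : μ < 1 / 2) (ha : MemL a) (hd : DivFree a)
    (hs : seminormMu z₀ z₁ μ a < ∞) :
    ∃ T : ℝ, 0 < T ∧ T ≤ 1 ∧ 1 / T ≤ max ((4 * duhConst C μ * C + 1) *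
      (tripleNorm z₀ z₁ μ a).toReal) 1 ^ (2 / (1 / 2 - μ)) ∧ ∃ (X : Traj 𝕜) (d : ℝ), 0 ≤ d ∧
        IsTraj T X ∧ SizeLe μ T d X ∧ ∀ t ∈ Ioc 0 T,
          X.1 t =ᵐ[μΩ] (linTraj a).1 t - (duh X).1 t := by
  set N := (tripleNorm z₀ z₁ μ a).toReal
  have hN : 0 ≤ N := ENNReal.toReal_nonneg
  have hD : 0 ≤ duhConst C μ := mul_nonneg hC.intConst_nonneg (add_nonneg
    (betaConst_nonneg (by norm_num) (by linarith)) (betaConst_nonneg (by norm_num) (by linarith)))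
  set m := max ((4 * duhConst C μ * C + 1) * N) 1
  have hm1 : 1 ≤ m := le_max_right _ _
  have hm : 0 < m := by linarith
  have hθ : 0 < 1 / 2 - μ := by linarith
  set T := m ^ (-(2 / (1 / 2 - μ)))
  have hT : T ≤ 1 := Real.rpow_le_one_of_one_le_of_nonpos hm1 (neg_nonpos.2 (by positivity))
  refine ⟨T, Real.rpow_pos_of_pos hm _, hT, ?_, ?_⟩
  · rw [one_div, ← Real.rpow_neg hm.le, neg_neg]
  · have hq : duhConst C μ * T ^ (1 / 2 - μ) * (2 * (C * N)) ≤ 1 / 2 := by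
      have e : T ^ (1 / 2 - μ) = (m ^ 2)⁻¹ := by
        rw [← Real.rpow_mul hm.le, neg_mul, div_mul_cancel₀ _ hθ.ne', Real.rpow_neg hm.le]
        norm_cast
      have h1 : (4 * duhConst C μ * C + 1) * N ≤ m := le_max_left _ _
      rw [e, mul_right_comm, ← div_eq_mul_inv, div_le_iff₀ (by positivity)]
      nlinarith
    obtain ⟨X, h1, h2, h3⟩ := exists_fixedPoint hC hμ₀ hμ (isTraj_linTraj (T := T) hC ha hd)
      hT (by positivity) (sizeLe_linTraj hC hC1 ha hd hs hT) hq
    exact ⟨X, _, by positivity, h1, h2, h3⟩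

end

section

variable {𝕜 : Type*} [RCLike 𝕜] [Layer]

/-- A field whose slices in `L¹(J)` depend on `x` with a uniform modulus of continuity. -/
theorem memBUC_of_modulus {f : ℝ³ → Vel 𝕜} (hf : StronglyMeasurable f) {M : ℝ≥0}
    (hM : ∀ x, sliceNorm f x ≤ M) {ω : ℝ → ℝ} (hω : Tendsto ω (𝓝 0) (𝓝 0))
    (h : ∀ x ξ : Plane, sliceNorm (fun p => f (p.1 + ξ, p.2) - f p) x ≤
      ofReal (ω ‖ξ‖)) : MemBUC z₀ z₁ f := by
  have hm : ∀ x, MemLp (fun z => f (x, z)) 1 (volume.restrict (Ioo z₀ z₁)) := fun x =>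
    ⟨(hf.comp_measurable measurable_prodMk_left).aestronglyMeasurable, by
      rw [eLpNorm_one_eq_lintegral_enorm]; exact (hM x).trans_lt ENNReal.coe_lt_top⟩
  have hn : ∀ x, ‖(hm x).toLp _‖ ≤ M := fun x => by
    rw [Lp.norm_toLp, eLpNorm_one_eq_lintegral_enorm]
    exact ENNReal.toReal_le_coe_of_le_coe (hM x)
  have huc : UniformContinuous fun x => (hm x).toLp _ := by
    refine EMetric.uniformContinuous_iff.2 fun ε hε => ?_
    have h0 : Tendsto (fun r => ofReal (ω r)) (𝓝 0) (𝓝 0) := by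
      simpa using ENNReal.tendsto_ofReal hω
    obtain ⟨δ, hδ, hb⟩ := Metric.eventually_nhds_iff.1 (h0.eventually (gt_mem_nhds hε))
    refine ⟨ofReal δ, ENNReal.ofReal_pos.2 hδ, fun {x y} hxy => ?_⟩
    rw [Lp.edist_toLp_toLp, eLpNorm_one_eq_lintegral_enorm]
    have hd : ‖x - y‖ < δ := by
      rwa [edist_dist, dist_eq_norm, ENNReal.ofReal_lt_ofReal_iff hδ] at hxy
    refine lt_of_le_of_lt ?_ (hb (y := ‖x - y‖) (by simpa using hd))
    have := h y (x - y)
    simpa [sliceNorm] using this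
  refine ⟨⟨hf.aestronglyMeasurable, (normInfOne_le (Eventually.of_forall hM)).trans_lt
    ENNReal.coe_lt_top⟩, .ofNormedAddCommGroup _ huc.continuous M hn, huc,
    Eventually.of_forall fun x => (hm x).coeFn_toLp.symm⟩

theorem MemBUC.sub {f g : ℝ³ → Vel 𝕜} (hf : MemBUC z₀ z₁ f) (hg : MemBUC z₀ z₁ g) :
    MemBUC z₀ z₁ (f - g) := by
  obtain ⟨f1, U, hU, hU'⟩ := hf
  obtain ⟨g1, V, hV, hV'⟩ := hg
  refine ⟨f1.sub g1, U - V, hU.sub hV, ?_⟩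
  filter_upwards [hU', hV'] with x h1 h2
  filter_upwards [h1, h2, Lp.coeFn_sub (U x) (V x)] with z e1 e2 e3
  rw [BoundedContinuousFunction.sub_apply, e3]
  simp only [Pi.sub_apply, e1, e2]

theorem MemBUC.congr {f g : ℝ³ → Vel 𝕜} (hf : MemBUC z₀ z₁ f)
    (h : f =ᵐ[μΩ] g) : MemBUC z₀ z₁ g := by
  obtain ⟨f1, U, hU, hU'⟩ := hf
  refine ⟨f1.congr h, U, hU, ?_⟩
  filter_upwards [hU', ae_slice h] with x h1 h2
  exact EventuallyEq.trans (EventuallyEq.symm h2) h1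

theorem IsSmoothingOp.memBUC {E : Type*} [NormedAddCommGroup E] [NormedSpace ℝ E] {C e : ℝ}
    {T : ℝ → (ℝ³ → E) → ℝ³ → Vel 𝕜} (hT : IsSmoothingOp C e T)
    {f : ℝ³ → E} (hf : MemL f) {τ : ℝ} (hτ : 0 < τ) : MemBUC z₀ z₁ (T τ f) := by
  have hN := ofReal_toReal hf.2.ne
  have hC := hT.const_nonneg
  refine memBUC_of_modulus (M := (C * τ ^ (-e) * (nrm f).toReal).toNNReal)
    (ω := fun r => C * (r * τ ^ (-e - 1 / 2)) * (nrm f).toReal)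
    (hT.stronglyMeasurable hf.1 τ) (fun x => ?_) ?_ fun x ξ => ?_
  · refine (hT.bound hτ hf x).trans_eq ?_
    change _ = ofReal _
    conv_lhs => rw [← hN, ← ofReal_mul (by positivity)]
  · have : Continuous fun r => C * (r * τ ^ (-e - 1 / 2)) * (nrm f).toReal := by fun_prop
    simpa using this.tendsto 0
  · refine (hT.space hτ hf x ξ).trans_eq ?_
    conv_lhs => rw [← hN, ← ofReal_mul (by positivity)]

theorem le_interpolation {N : ℝ≥0∞} {B q θ : ℝ} (hB : 0 ≤ B) (hq : 0 ≤ q) (hθ : 0 < θ)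
    (hθ1 : θ ≤ 1) (h₁ : N ≤ ofReal (2 * B)) (h₂ : N ≤ ofReal (B * q)) :
    N ≤ ofReal (2 * (B * q ^ θ)) := by
  have hqθ := rpow_nonneg hq θ
  rcases le_total q 1 with h | h
  · have : q ≤ q ^ θ := by
      rcases hq.eq_or_lt with h0 | h0
      · rw [← h0, Real.zero_rpow hθ.ne']
      · simpa using Real.rpow_le_rpow_of_exponent_ge h0 h hθ1
    exact h₂.trans (ofReal_le_ofReal (by nlinarith [mul_le_mul_of_nonneg_left this hB]))
  · exact h₁.trans (ofReal_le_ofReal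
      (by nlinarith [mul_le_mul_of_nonneg_left (Real.one_le_rpow h hθ.le) hB]))

section smoothing

variable {E : Type*} [NormedAddCommGroup E] [NormedSpace ℝ E] {C : ℝ}
  {T : ℝ → (ℝ³ → E) → ℝ³ → Vel 𝕜}

theorem sliceNorm_sub_le {f g : ℝ³ → Vel 𝕜} (hf : StronglyMeasurable f) (x : Plane) :
    sliceNorm (fun p => f p - g p) x ≤ sliceNorm f x + sliceNorm g x := by
  refine (lintegral_mono fun z => enorm_sub_le (a := f (x, z)) (b := g (x, z))).trans (le_of_eq ?_)
  exact lintegral_add_left (hf.comp_measurable measurable_prodMk_left).enorm _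

theorem IsSmoothingOp.space_interp (hT : IsSmoothingOp C (1 / 2) T) {f : ℝ³ → E}
    (hf : MemL f) {N τ : ℝ} (hN : 0 ≤ N) (hb : nrm f ≤ ofReal N)
    (hτ : 0 < τ) (x ξ : Plane) :
    sliceNorm (fun p => T τ f (p.1 + ξ, p.2) - T τ f p) x ≤
      ofReal (2 * (C * N) * ‖ξ‖ ^ (1 / 2 : ℝ) * τ ^ (-(3 / 4) : ℝ)) := by
  have hC := hT.const_nonneg
  have hm : StronglyMeasurable (T τ f) := hT.stronglyMeasurable hf.1 τ
  have hp := rpow_nonneg hτ.le (-(1 / 2))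
  have b1 : ∀ y, sliceNorm (T τ f) y ≤ ofReal (C * N * τ ^ (-(1 / 2) : ℝ)) :=
    fun y => (hT.bound hτ hf y).trans <| (mul_le_mul_right hb _).trans_eq <| by
      rw [← ofReal_mul (by positivity), mul_right_comm]
  refine (le_interpolation (B := C * N * τ ^ (-(1 / 2) : ℝ)) (q := ‖ξ‖ * τ ^ (-(1 / 2) : ℝ))
    (θ := 1 / 2) (by positivity) (by positivity) (by norm_num) (by norm_num) ?_ ?_).trans_eq ?_
  · rw [two_mul, ofReal_add (by positivity) (by positivity)]
    exact (sliceNorm_sub_le (f := fun p => T τ f (p.1 + ξ, p.2)) (hm.comp_measurable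
      ((measurable_fst.add_const ξ).prodMk measurable_snd)) x).trans (add_le_add (b1 (x + ξ)) (b1 x))
  · refine (hT.space hτ hf x ξ).trans ((mul_le_mul_right hb _).trans_eq ?_)
    rw [← ofReal_mul (by positivity), sub_eq_add_neg, rpow_add hτ]
    ring_nf
  · congr 1
    rw [Real.mul_rpow (norm_nonneg _) hp, ← Real.rpow_mul hτ.le, show (-(3 / 4) : ℝ) =
      -(1 / 2) + -(1 / 2) * (1 / 2) by norm_num, rpow_add hτ]
    ring

theorem IsSmoothingOp.time_interp (hT : IsSmoothingOp C (1 / 2) T) {f : ℝ³ → E}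
    (hf : MemL f) {N τ τ' : ℝ} (hN : 0 ≤ N) (hb : nrm f ≤ ofReal N)
    (hτ : 0 < τ) (hτ' : τ ≤ τ') :
    nrm (T τ' f - T τ f) ≤ ofReal (2 * (C * N) * (τ' - τ) ^ (1 / 4 : ℝ) * τ ^ (-(3 / 4) : ℝ)) := by
  have hC := hT.const_nonneg
  have hm : ∀ τ, StronglyMeasurable (T τ f) := hT.stronglyMeasurable hf.1
  have hp := rpow_nonneg hτ.le (-(1 / 2))
  have hp1 := rpow_nonneg hτ.le (-1)
  have hσ : 0 ≤ τ' - τ := sub_nonneg.2 hτ'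
  have b1 : ∀ r, τ ≤ r → nrm (T r f) ≤ ofReal (C * N * τ ^ (-(1 / 2) : ℝ)) :=
    fun r hr => (hT.normInfOne_le (hτ.trans_le hr) hf).trans <| (mul_le_mul_right hb _).trans <| by
        have h1 := Real.rpow_le_rpow_of_nonpos hτ hr (z := -(1 / 2)) (by norm_num)
        rw [← ofReal_mul (mul_nonneg hC (rpow_nonneg (hτ.trans_le hr).le _)), mul_right_comm]
        gcongr
  refine (le_interpolation (B := C * N * τ ^ (-(1 / 2) : ℝ)) (q := (τ' - τ) * τ ^ (-1 : ℝ))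
    (θ := 1 / 4) (by positivity) (by positivity) (by norm_num) (by norm_num) ?_ ?_).trans_eq ?_
  · rw [two_mul, ofReal_add (by positivity) (by positivity)]
    exact (PrimEq.normInfOne_sub_le (hm τ').aestronglyMeasurable).trans (add_le_add (b1 τ' hτ') (b1 τ le_rfl))
  · refine (PrimEq.normInfOne_le (Eventually.of_forall (hT.time hτ hτ' hf))).trans
      ((mul_le_mul_right hb _).trans_eq ?_)
    rw [← ofReal_mul (by positivity), sub_eq_add_neg _ (1 : ℝ), rpow_add hτ]
    ring_nf
  · congr 1
    rw [Real.mul_rpow hσ hp1, ← Real.rpow_mul hτ.le, show (-(3 / 4) : ℝ) =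
      -(1 / 2) + -1 * (1 / 4) by norm_num, rpow_add hτ]
    ring

variable {μ F : ℝ} {f : ℝ → ℝ³ → E}

/-- Spatial regularity of a Duhamel integral. -/
theorem IsSmoothingOp.memBUC_integral (hT : IsSmoothingOp C (1 / 2) T)
    (hf : StronglyMeasurable fun r : ℝ × ℝ³ => f r.1 r.2) (hF : 0 ≤ F) (hμ₀ : 0 ≤ μ)
    (hμ : μ < 1) {t : ℝ} (ht : 0 < t) (hm : ∀ s ∈ Ioo 0 t, MemL (f s))
    (hb : ∀ s ∈ Ioo 0 t, nrm (f s) ≤ ofReal (F * s ^ (-μ))) :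
    MemBUC z₀ z₁ fun p => ∫ s in Ioo 0 t, T (t - s) (f s) p := by
  have hC := hT.const_nonneg
  have hU : StronglyMeasurable fun r : ℝ × ℝ³ => T (t - r.1) (f r.1) r.2 :=
    hT.measurable (measurable_const.sub measurable_id) hf
  have b1 : ∀ x, ∫⁻ s in Ioo 0 t, sliceNorm (T (t - s) (f s)) x ≤
      ofReal (C * F * betaConst (1 / 2) μ * t ^ (1 - 1 / 2 - μ)) := fun x => by
    refine (setLIntegral_mono (measurable_power t (C * F) (1 / 2) μ) fun s hs => ?_).trans
      (lintegral_beta_le (by norm_num) ⟨hμ₀, hμ⟩ ht (by positivity))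
    have hτ : 0 < t - s := sub_pos.2 hs.2
    refine (hT.bound hτ (hm s hs) x).trans ((mul_le_mul_right (hb s hs) _).trans_eq ?_)
    rw [← ofReal_mul (by positivity)]
    ring_nf
  have hI : ∀ x, ∀ᵐ z ∂(volume.restrict (Ioo z₀ z₁)),
      IntegrableOn (fun s => T (t - s) (f s) (x, z)) (Ioo 0 t) := fun x =>
    ae_integrable_slice_param hU ((b1 x).trans_lt ofReal_lt_top)
  refine memBUC_of_modulus (M := (C * F * betaConst (1 / 2) μ * t ^ (1 - 1 / 2 - μ)).toNNReal)
    (ω := fun r => 2 * (C * F) * r ^ (1 / 2 : ℝ) * betaConst (3 / 4) μ * t ^ (1 - 3 / 4 - μ))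
    (stronglyMeasurable_integral_param hU)
    (fun x => (sliceNorm_integral_le hU x).trans (b1 x)) ?_ fun x ξ => ?_
  · have : Continuous fun r : ℝ => 2 * (C * F) * r ^ (1 / 2 : ℝ) * betaConst (3 / 4) μ *
        t ^ (1 - 3 / 4 - μ) := by
      have := Real.continuous_rpow_const (q := 1 / 2) (by norm_num)
      fun_prop
    have h0 := this.tendsto 0
    rwa [Real.zero_rpow (by norm_num), mul_zero, zero_mul, zero_mul] at h0
  · have e : sliceNorm (fun p => (∫ s in Ioo 0 t, T (t - s) (f s) (p.1 + ξ, p.2)) -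
        ∫ s in Ioo 0 t, T (t - s) (f s) p) x = sliceNorm (fun p => ∫ s in Ioo 0 t,
          (T (t - s) (f s) (p.1 + ξ, p.2) - T (t - s) (f s) p)) x := by
      refine lintegral_congr_ae ?_
      filter_upwards [hI x, hI (x + ξ)] with z h1 h2
      rw [integral_sub h2 h1]
    rw [e]
    have hU' : StronglyMeasurable fun r : ℝ × ℝ³ => T (t - r.1) (f r.1) (r.2.1 + ξ, r.2.2) :=
      hU.comp_measurable (g := fun r : ℝ × ℝ³ => (r.1, (r.2.1 + ξ, r.2.2))) (by fun_prop)
    refine (sliceNorm_integral_le (hU'.sub hU) x).trans ?_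
    refine (setLIntegral_mono (measurable_power t (2 * (C * F) * ‖ξ‖ ^ (1 / 2 : ℝ)) (3 / 4) μ)
      fun s hs => ?_).trans (lintegral_beta_le (by norm_num) ⟨hμ₀, hμ⟩ ht (by positivity))
    have hs1 : (0 : ℝ) < s := hs.1
    refine (hT.space_interp (hm s hs) (by positivity) (hb s hs) (sub_pos.2 hs.2) x ξ).trans_eq ?_
    ring_nf

/-- Regularity in time of a Duhamel integral. -/
theorem IsSmoothingOp.integral_time_le (hT : IsSmoothingOp C (1 / 2) T)
    (hf : StronglyMeasurable fun r : ℝ × ℝ³ => f r.1 r.2) (hF : 0 ≤ F) (hμ₀ : 0 ≤ μ)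
    (hμ : μ < 1) {t t' : ℝ} (ht : 0 < t) (ht' : t ≤ t') (hm : ∀ s ∈ Ioo 0 t', MemL (f s))
    (hb : ∀ s ∈ Ioo 0 t', nrm (f s) ≤ ofReal (F * s ^ (-μ))) :
    nrm ((fun p => ∫ s in Ioo 0 t', T (t' - s) (f s) p) -
      fun p => ∫ s in Ioo 0 t, T (t - s) (f s) p) ≤ ofReal (2 * (C * F) *
        (t' - t) ^ (1 / 4 : ℝ) * betaConst (3 / 4) μ * (t ^ (1 / 4 - μ) + t' ^ (1 / 4 - μ))) := by
  have hC := hT.const_nonneg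
  have hσ : 0 ≤ t' - t := sub_nonneg.2 ht'
  have ht0 : 0 < t' := ht.trans_le ht'
  have hU : ∀ t, StronglyMeasurable fun r : ℝ × ℝ³ => T (t - r.1) (f r.1) r.2 := fun t =>
    hT.measurable (measurable_const.sub measurable_id) hf
  have hI : ∀ t₂ ≤ t', 0 < t₂ → ∀ᵐ p ∂μΩ,
      IntegrableOn (fun s => T (t₂ - s) (f s) p) (Ioo 0 t₂) := fun t₂ h₂ h₂' => by
    refine ae_integrable_of_power (A := C * F) (β := μ) (hU t₂) h₂' (by positivity) hμ₀ hμ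
      fun s hs => ?_
    have hs' : s ∈ Ioo 0 t' := ⟨hs.1, hs.2.trans_le h₂⟩
    have hτ : 0 < t₂ - s := sub_pos.2 hs.2
    refine (hT.normInfOne_le hτ (hm s hs')).trans ((mul_le_mul_right (hb s hs') _).trans_eq ?_)
    rw [← ofReal_mul (by positivity)]
    ring_nf
  set V : ℝ → ℝ³ → Vel 𝕜 := fun s p => T (t' - s) (f s) p - T (t - s) (f s) p
  have hB : 0 ≤ betaConst (3 / 4) μ := betaConst_nonneg (by norm_num) hμ
  have e : (fun p => ∫ s in Ioo 0 t', T (t' - s) (f s) p) - (fun p => ∫ s in Ioo 0 t,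
      T (t - s) (f s) p) =ᵐ[μΩ]
      (fun p => ∫ s in Ioo 0 t, V s p) + fun p => ∫ s in Ico t t', T (t' - s) (f s) p := by
    filter_upwards [hI t ht' ht, hI t' le_rfl ht0] with p h1 h2
    have h3 := h2.mono_set (Ioo_subset_Ioo_right ht')
    have h4 := h2.mono_set (fun s hs => ⟨ht.trans_le hs.1, hs.2⟩ : Ico t t' ⊆ Ioo 0 t')
    simp only [Pi.sub_apply, Pi.add_apply, V]
    rw [integral_sub h3 h1, ← Ioo_union_Ico_eq_Ioo ht ht', setIntegral_union (by
        rw [Set.disjoint_left]; exact fun s h h' => h.2.not_ge h'.1) measurableSet_Ico h3 h4]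
    abel
  rw [normInfOne_congr e, mul_add, ofReal_add (by positivity) (by positivity)]
  refine (normInfOne_add_le (stronglyMeasurable_integral_param
    (W := V) ((hU t').sub (hU t))).aestronglyMeasurable).trans (add_le_add ?_ ?_)
  · refine (normInfOne_integral_le (W := V) ((hU t').sub (hU t)) (measurable_power t
      (2 * (C * F) * (t' - t) ^ (1 / 4 : ℝ)) (3 / 4) μ) ?_).trans
      ((lintegral_beta_le (by norm_num) ⟨hμ₀, hμ⟩ ht (by positivity)).trans_eq ?_)
    · filter_upwards [ae_restrict_mem measurableSet_Ioo] with s hs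
      have hs' : s ∈ Ioo 0 t' := ⟨hs.1, hs.2.trans_le ht'⟩
      have hs1 : (0 : ℝ) < s := hs.1
      refine (hT.time_interp (hm s hs') (by positivity) (hb s hs') (sub_pos.2 hs.2)
        (sub_le_sub_right ht' s)).trans_eq ?_
      rw [sub_sub_sub_cancel_right]
      ring_nf
    · norm_num
  · refine (normInfOne_integral_le (hU t') (measurable_power t'
      (2 * (C * F) * (t' - t) ^ (1 / 4 : ℝ)) (3 / 4) μ) ?_).trans
      ((lintegral_mono_set (fun s hs => ⟨ht.trans_le hs.1, hs.2⟩ : Ico t t' ⊆ Ioo 0 t')).trans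
      ((lintegral_beta_le (by norm_num) ⟨hμ₀, hμ⟩ ht0 (by positivity)).trans_eq ?_))
    · filter_upwards [ae_restrict_mem measurableSet_Ico] with s hs
      have hs' : s ∈ Ioo 0 t' := ⟨ht.trans_le hs.1, hs.2⟩
      have hs1 : (0 : ℝ) < s := hs'.1
      have hτ : 0 < t' - s := sub_pos.2 hs.2
      refine (hT.normInfOne_le hτ (hm s hs')).trans ((mul_le_mul_right (hb s hs') _).trans ?_)
      rw [← ofReal_mul (by positivity)]
      refine ofReal_le_ofReal ?_
      -- the integrand is compared with the one of the first part, as `t' - s ≤ t' - t`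
      have h1 : (t' - s) ^ (-(1 / 2) : ℝ) ≤ 2 * (t' - t) ^ (1 / 4 : ℝ) * (t' - s) ^ (-(3 / 4) : ℝ) := by
        rw [show (-(1 / 2) : ℝ) = 1 / 4 + -(3 / 4) by norm_num, rpow_add hτ]
        have := Real.rpow_le_rpow hτ.le (sub_le_sub_left hs.1 t') (z := 1 / 4) (by norm_num)
        have := rpow_nonneg hσ (1 / 4)
        gcongr
        linarith
      calc _ = C * F * s ^ (-μ) * (t' - s) ^ (-(1 / 2) : ℝ) := by ring
        _ ≤ C * F * s ^ (-μ) * (2 * (t' - t) ^ (1 / 4 : ℝ) * (t' - s) ^ (-(3 / 4) : ℝ)) := by gcongr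
        _ = _ := by ring
    · norm_num

end smoothing

end

section

section trajectory

variable {𝕜 : Type*} [RCLike 𝕜] [Layer] {C T μ d : ℝ} {X : Traj 𝕜} {a : ℝ³ → Vel 𝕜}

theorem IsTraj.flux_le (hX : IsTraj T X) (hT : T ≤ 1) (hμ : 0 ≤ μ)
    (hd : 0 ≤ d) (bX : SizeLe μ T d X) {s : ℝ} (hs : s ∈ Ioc 0 T) :
    nrm (flux (X.1 s) (X.2 s)) ≤ ofReal (12 * sobConst * (d * d) * s ^ (-μ)) := by
  have h1 : 1 ≤ s ^ (-μ) := Real.one_le_rpow_of_pos_of_le_one_of_nonpos hs.1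
    (hs.2.trans hT) (by linarith)
  have e : flux (0 : ℝ³ → Vel 𝕜) 0 = 0 := by funext q i; simp [flux]
  have h := ((hX.field s hs).sub_le isField_zero hd (by positivity) (d₀ := d) (d₁ := d * s ^ (-μ)) hd
    (by positivity) (bX s hs) (by simp [normInfOne_zero]) (by simpa only [sub_zero] using bX s hs)).1
  rw [e, sub_zero] at h
  refine h.trans (ofReal_le_ofReal ?_)
  calc _ = sobConst * (d * d) * (6 * (1 + s ^ (-μ))) := by ring
    _ ≤ sobConst * (d * d) * (12 * s ^ (-μ)) :=
        mul_le_mul_of_nonneg_left (by linarith) (by positivity)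
    _ = _ := by ring

theorem IsTraj.memBUC (hC : KernelBounds 𝕜 C) (hμ₀ : 0 ≤ μ) (hμ : μ < 1 / 2)
    (hX : IsTraj T X) (hT : T ≤ 1) (hd : 0 ≤ d) (bX : SizeLe μ T d X)
    (ha : MemL a) {t : ℝ} (ht : t ∈ Ioc 0 T)
    (e : X.1 t =ᵐ[μΩ] (linTraj a).1 t - (PrimEq.duh X).1 t) :
    MemBUC z₀ z₁ (X.1 t) := by
  have hs : ∀ s ∈ Ioo 0 t, s ∈ Ioc 0 T := fun s hs => ⟨hs.1, hs.2.le.trans ht.2⟩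
  have h1 : MemBUC z₀ z₁ ((linTraj a).1 t) := hC.stokes.memBUC ha ht.1
  have h2 : MemBUC z₀ z₁ ((PrimEq.duh X).1 t) :=
    hC.proj.memBUC_integral (f := fun s => flux (X.1 s) (X.2 s))
      (stronglyMeasurable_flux hX.meas.1 hX.meas.2) (by positivity) hμ₀ (by linarith) ht.1
      (fun s h => (hX.field s (hs s h)).memLinf_flux)
      fun s h => hX.flux_le hT hμ₀ hd bX (hs s h)
  exact (h1.sub h2).congr e.symm

/-- Hölder continuity in time away from the initial time. -/
theorem IsTraj.exists_time_le (hC : KernelBounds 𝕜 C) (hμ₀ : 0 ≤ μ)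
    (hμ : μ < 1 / 2) (hX : IsTraj T X) (hT : T ≤ 1) (hd : 0 ≤ d) (bX : SizeLe μ T d X)
    (ha : MemL a) (e : ∀ t ∈ Ioc 0 T, X.1 t =ᵐ[μΩ]
      (linTraj a).1 t - (PrimEq.duh X).1 t) {δ : ℝ} (hδ : 0 < δ) :
    ∃ K : ℝ, ∀ t t' : ℝ, δ ≤ t → t ≤ t' → t' ≤ T →
      nrm (X.1 t' - X.1 t) ≤ ofReal (K * (t' - t) ^ (1 / 4 : ℝ)) := by
  set N := (nrm a).toReal
  set F := 12 * sobConst * (d * d)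
  have hC0 := hC.stokes.const_nonneg
  have hB : 0 ≤ betaConst (3 / 4) μ := betaConst_nonneg (by norm_num) (by linarith)
  have hN : ofReal N = nrm a := ofReal_toReal ha.2.ne
  have hF : 0 ≤ F := by positivity
  refine ⟨C * N * δ⁻¹ + 2 * (C * F) * betaConst (3 / 4) μ * (2 * δ⁻¹), fun t t' h1 h2 h3 => ?_⟩
  have ht : 0 < t := hδ.trans_le h1
  have ht' : 0 < t' := ht.trans_le h2
  have hσ : 0 ≤ t' - t := sub_nonneg.2 h2
  have hs : ∀ s ∈ Ioo 0 t', s ∈ Ioc 0 T := fun s hs => ⟨hs.1, hs.2.le.trans h3⟩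
  have E : X.1 t' - X.1 t =ᵐ[μΩ] (heatOp 0 1 0 t' a - heatOp 0 1 0 t a) -
        ((PrimEq.duh X).1 t' - (PrimEq.duh X).1 t) :=
    ((e t' ⟨ht', h3⟩).sub (e t ⟨ht, h2.trans h3⟩)).trans (Eventually.of_forall fun p =>
      sub_sub_sub_comm _ _ _ _)
  have hm := fun t => hC.stokes.stronglyMeasurable ha.1 t
  have b1 : nrm (heatOp 0 1 0 t' a - heatOp 0 1 0 t a) ≤
      ofReal (C * N * δ⁻¹ * (t' - t) ^ (1 / 4 : ℝ)) := by
    refine (normInfOne_le (Eventually.of_forall (hC.stokes.time ht h2 ha))).trans ?_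
    rw [← hN, ← ofReal_mul (by positivity)]
    refine ofReal_le_ofReal ?_
    have i1 : t' - t ≤ (t' - t) ^ (1 / 4 : ℝ) := by
      rcases hσ.eq_or_lt with h0 | h0
      · rw [← h0, Real.zero_rpow (by norm_num)]
      · simpa using Real.rpow_le_rpow_of_exponent_ge h0 (by linarith) (show (1 / 4 : ℝ) ≤ 1 by norm_num)
    have i2 : t ^ (-0 - 1 : ℝ) ≤ δ⁻¹ := by
      rw [show (-0 - 1 : ℝ) = -1 by norm_num, Real.rpow_neg_one]
      exact inv_anti₀ hδ h1
    calc _ ≤ C * ((t' - t) ^ (1 / 4 : ℝ) * δ⁻¹) * N := by gcongr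
      _ = _ := by ring
  have b2 : nrm ((PrimEq.duh X).1 t' - (PrimEq.duh X).1 t) ≤ ofReal
      (2 * (C * F) * betaConst (3 / 4) μ * (2 * δ⁻¹) * (t' - t) ^ (1 / 4 : ℝ)) := by
    refine (hC.proj.integral_time_le (f := fun s => flux (X.1 s) (X.2 s))
      (stronglyMeasurable_flux hX.meas.1 hX.meas.2) hF hμ₀ (by linarith) ht h2
      (fun s h => (hX.field s (hs s h)).memLinf_flux)
      fun s h => hX.flux_le hT hμ₀ hd bX (hs s h)).trans (ofReal_le_ofReal ?_)
    have i : ∀ r, δ ≤ r → r ≤ T → r ^ (1 / 4 - μ) ≤ δ⁻¹ := fun r i1 i2 => by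
      have hr : 0 < r := hδ.trans_le i1
      calc r ^ (1 / 4 - μ) ≤ r ^ (-1 : ℝ) :=
            Real.rpow_le_rpow_of_exponent_ge hr (i2.trans hT) (by linarith)
        _ ≤ δ⁻¹ := by rw [Real.rpow_neg_one]; exact inv_anti₀ hδ i1
    have i3 : t ^ (1 / 4 - μ) + t' ^ (1 / 4 - μ) ≤ 2 * δ⁻¹ := by
      linarith [i t h1 (h2.trans h3), i t' (h1.trans h2) h3]
    calc _ ≤ 2 * (C * F) * (t' - t) ^ (1 / 4 : ℝ) * betaConst (3 / 4) μ * (2 * δ⁻¹) := by gcongr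
      _ = _ := by ring
  rw [normInfOne_congr E, add_mul, ofReal_add (by positivity) (by positivity)]
  exact (normInfOne_sub_le ((hm t').sub (hm t)).aestronglyMeasurable).trans (add_le_add b1 b2)

end trajectory

/-! ### The semigroup law -/

section semigroup

variable [Layer] {s t : ℝ}

/-- Completion of the square in a product of two Gaussians. -/
theorem heatKernelOne_mul (hs : 0 < s) (ht : 0 < t) (x y w : ℝ) :
    heatKernelOne s (x - y) * heatKernelOne t (y - w) = heatKernelOne (s + t) (x - w) *
      heatKernelOne (s * t / (s + t)) (y - (t * x + s * w) / (s + t)) := by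
  have hst : 0 < s + t := by positivity
  simp only [heatKernelOne]
  rw [mul_mul_mul_comm, mul_mul_mul_comm (√(4 * π * (s + t)))⁻¹, ← mul_inv, ← mul_inv, ← Real.sqrt_mul (by positivity),
    ← Real.sqrt_mul (by positivity), ← Real.exp_add, ← Real.exp_add]
  refine congr_arg₂ _ (congr_arg (fun r => (√r)⁻¹) ?_) (congr_arg _ ?_)
  · field_simp
  · field_simp
    ring

theorem heatKernel_mul (hs : 0 < s) (ht : 0 < t) (x y w : Plane) :
    heatKernel s (x - y) * heatKernel t (y - w) = heatKernel (s + t) (x - w) *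
      heatKernel (s * t / (s + t)) (y - (s + t)⁻¹ • (t • x + s • w)) := by
  have hst : 0 < s + t := by positivity
  have e : ∀ i, (s + t)⁻¹ * (t * x i + s * w i) = (t * x i + s * w i) / (s + t) := fun i => by
    rw [div_eq_inv_mul]
  rw [heatKernel_eq_mul hs, heatKernel_eq_mul ht, heatKernel_eq_mul hst,
    heatKernel_eq_mul (by positivity)]
  simp only [PiLp.sub_apply, PiLp.smul_apply, PiLp.add_apply, smul_eq_mul, e]
  rw [mul_mul_mul_comm, heatKernelOne_mul hs ht, heatKernelOne_mul hs ht]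
  ring

theorem integral_heatKernel_mul (hs : 0 < s) (ht : 0 < t) (x w : Plane) :
    ∫ y, heatKernel s (x - y) * heatKernel t (y - w) = heatKernel (s + t) (x - w) := by
  simp only [heatKernel_mul hs ht]
  rw [integral_const_mul, integral_sub_right_eq_self (heatKernel (s * t / (s + t))),
    integral_heatKernel (by positivity), mul_one]

theorem lintegral_heatKernelOne_mul (hs : 0 < s) (ht : 0 < t) (x w : ℝ) :
    ∫⁻ y, ofReal (heatKernelOne s (x - y)) * ofReal (heatKernelOne t (y - w)) =
      ofReal (heatKernelOne (s + t) (x - w)) := by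
  simp only [← ofReal_mul (heatKernelOne_nonneg _ _), heatKernelOne_mul hs ht]
  simp only [ofReal_mul (heatKernelOne_nonneg _ _)]
  rw [lintegral_const_mul _ (by have := measurable_heatKernelOne (s * t / (s + t)); fun_prop),
    lintegral_sub_right_eq_self fun y => ofReal (heatKernelOne (s * t / (s + t)) y)]
  have := lintegral_ofReal_heatKernelOne (t := s * t / (s + t)) (by positivity) 0
  simp only [zero_sub, heatKernelOne_neg] at this
  rw [this, mul_one]

theorem neumann_reflect (t z ζ : ℝ) :
    reflKernel 1 (gaussDeriv 0 t) (2 * z₀ - z) ζ = reflKernel 1 (gaussDeriv 0 t) z ζ := by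
  rw [reflKernel_eq_add, reflKernel_eq_add, one_mul, one_mul, add_comm]
  congr 1 <;> rw [← (Equiv.neg ℤ).tsum_eq] <;> refine tsum_congr fun k => ?_ <;>
    rw [gaussDeriv_zero, gaussDeriv_zero, ← heatKernelOne_neg] <;> congr 1 <;>
    simp only [Equiv.neg_apply, Int.cast_neg] <;> ring

theorem neumann_periodic (t z ζ : ℝ) (k : ℤ) :
    reflKernel 1 (gaussDeriv 0 t) (z + 2 * k * (z₁ - z₀)) ζ =
      reflKernel 1 (gaussDeriv 0 t) z ζ := by
  rw [reflKernel_eq_add, reflKernel_eq_add, one_mul, one_mul]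
  congr 1 <;> rw [← (Equiv.addRight k).tsum_eq] <;> refine tsum_congr fun k => ?_ <;>
    congr 1 <;> simp only [Equiv.coe_addRight, Int.cast_add] <;> ring

theorem integral_neumann_mul (hs : 0 < s) (ht : 0 < t) (z ζ : ℝ) :
    ∫ η in Ioo z₀ z₁, reflKernel 1 (gaussDeriv 0 s) z η *
      reflKernel 1 (gaussDeriv 0 t) η ζ = reflKernel 1 (gaussDeriv 0 (s + t)) z ζ := by
  have hg := fun t => measurable_heatKernelOne t
  have hm : ∀ t ζ, Measurable fun η => reflKernel 1 (gaussDeriv 0 t) η ζ := fun t ζ =>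
    (measurable_reflKernel 1 0).comp (measurable_const.prodMk
      (measurable_id.prodMk measurable_const))
  have hm' : ∀ t z, Measurable fun η => reflKernel 1 (gaussDeriv 0 t) z η := fun t ζ =>
    (measurable_reflKernel 1 0).comp (measurable_const.prodMk
      (measurable_const.prodMk measurable_id))
  have e : ∫⁻ η in Ioo z₀ z₁, ‖reflKernel 1 (gaussDeriv 0 s) z η *
      reflKernel 1 (gaussDeriv 0 t) η ζ‖ₑ = ‖reflKernel 1 (gaussDeriv 0 (s + t)) z ζ‖ₑ := by
    simp only [enorm_mul]
    rw [show (∫⁻ η in Ioo z₀ z₁, ‖reflKernel 1 (gaussDeriv 0 s) z η‖ₑ *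
      ‖reflKernel 1 (gaussDeriv 0 t) η ζ‖ₑ) = _ from by simp only [enorm_neumann s]; rfl,
      lintegral_unfold (u := fun y => ofReal (heatKernelOne s y))
      (φ := fun η => ‖reflKernel 1 (gaussDeriv 0 t) η ζ‖ₑ) (hg s).ennreal_ofReal
      (hm t ζ).enorm (fun η => by rw [neumann_reflect]) (fun η k => by rw [neumann_periodic])]
    simp only [enorm_neumann]
    simp only [← ENNReal.tsum_mul_left]
    rw [lintegral_tsum fun k => by fun_prop]
    refine tsum_congr fun k => ?_
    simp only [mul_add]
    rw [lintegral_add_left (by fun_prop)]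
    congr 1
    · refine (lintegral_congr fun η => ?_).trans ((lintegral_heatKernelOne_mul hs ht z
        (ζ + 2 * k * (z₁ - z₀))).trans ?_) <;> ring_nf
    · refine (lintegral_congr fun η => ?_).trans ((lintegral_heatKernelOne_mul hs ht z
        (2 * z₀ + 2 * k * (z₁ - z₀) - ζ)).trans ?_) <;> ring_nf
  have h0 : ∀ η, 0 ≤ reflKernel 1 (gaussDeriv 0 s) z η *
      reflKernel 1 (gaussDeriv 0 t) η ζ := fun η =>
    mul_nonneg (neumann_nonneg _ _ _) (neumann_nonneg _ _ _)
  rw [integral_eq_lintegral_of_nonneg_ae (Eventually.of_forall h0)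
    ((hm' s z).mul (hm t ζ)).aestronglyMeasurable]
  simp only [← Real.enorm_eq_ofReal (h0 _)]
  rw [e, Real.enorm_eq_ofReal (neumann_nonneg _ _ _), ENNReal.toReal_ofReal (neumann_nonneg _ _ _)]

/-- The semigroup law `S(s) S(t) = S(s + t)`. -/
theorem heatOp_heatOp {E : Type*} [NormedAddCommGroup E] [NormedSpace ℝ E] [CompleteSpace E]
    (hs : 0 < s) (ht : 0 < t) {f : ℝ³ → E} (hf : MemL f)
    {p : ℝ³} (hp : p ∈ Ω) :
    heatOp 0 1 0 s (heatOp 0 1 0 t f) p = heatOp 0 1 0 (s + t) f p := by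
  have hA := admissible_heat 0 (σ := 1) (by simp) 0 hs
  obtain ⟨M, hM⟩ := hA.bounded_right
  have hst : 0 < s + t := by positivity
  set φ : ℝ³ → ℝ := (Ω).indicator fun q =>
    planeDeriv 0 s (p.1 - q.1) * reflKernel 1 (gaussDeriv 0 s) p.2 q.2
  have hk : Measurable fun y => planeDeriv 0 s (p.1 - y) :=
    hA.measurable_left.comp (measurable_const.sub measurable_id)
  have hm : Measurable fun ζ => reflKernel 1 (gaussDeriv 0 s) p.2 ζ :=
    (measurable_reflKernel 1 0).comp
      (measurable_const.prodMk (measurable_const.prodMk measurable_id))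
  have hφ : Measurable φ := Measurable.indicator ((hk.comp measurable_fst).mul
    (hm.comp measurable_snd)) measurableSet_layer
  have hK : IsWeight fun y => ‖planeDeriv 0 s (p.1 - y)‖ₑ * ofReal M := by
    refine ⟨hk.enorm.mul_const _, fun y => ENNReal.mul_ne_top enorm_ne_top ofReal_ne_top, ?_⟩
    rw [lintegral_mul_const _ hk.enorm]
    exact mul_lt_top (hA.integrable_left.comp_sub_left p.1).2 ofReal_lt_top
  have hb : ∀ q, ‖φ q‖ₑ ≤ ‖planeDeriv 0 s (p.1 - q.1)‖ₑ * ofReal M := fun q => by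
    by_cases hq : q ∈ Ω
    · simp only [φ, indicator_of_mem hq, enorm_mul]
      gcongr
      rw [Real.enorm_eq_ofReal_abs]
      exact ofReal_le_ofReal (hM _ hp.2 _ hq.2)
    · simp [φ, hq]
  have h := (integral_smul_layerOp (admissible_heat 0 (σ := 1) (by simp) 0 ht) hf hφ hK hb).2
  have e1 : heatOp 0 1 0 s (heatOp 0 1 0 t f) p = ∫ q in Ω, φ q • heatOp 0 1 0 t f q := by
    rw [heatOp, layerOp]
    exact setIntegral_congr_fun measurableSet_layer fun q hq => by
      simp only [φ, indicator_of_mem hq]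
  rw [e1, heatOp, h, heatOp, layerOp]
  refine setIntegral_congr_fun measurableSet_layer fun q hq => ?_
  have e2 : ∫ q' in Ω, φ q' * (planeDeriv 0 t (q'.1 - q.1) *
      reflKernel 1 (gaussDeriv 0 t) q'.2 q.2) = ∫ q' in Ω,
        (planeDeriv 0 s (p.1 - q'.1) * planeDeriv 0 t (q'.1 - q.1)) *
        (reflKernel 1 (gaussDeriv 0 s) p.2 q'.2 * reflKernel 1 (gaussDeriv 0 t) q'.2 q.2) :=
    setIntegral_congr_fun measurableSet_layer fun q' hq' => by
      simp only [φ, indicator_of_mem hq']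
      ring
  have e3 := integral_prod_mul (μ := (volume : Measure Plane)) (ν := volume.restrict (Ioo z₀ z₁))
    (fun y => planeDeriv 0 s (p.1 - y) * planeDeriv 0 t (y - q.1))
    (fun η => reflKernel 1 (gaussDeriv 0 s) p.2 η * reflKernel 1 (gaussDeriv 0 t) η q.2)
  rw [integral_neumann_mul hs ht, ← heatKernel_eq hs, ← heatKernel_eq ht,
    integral_heatKernel_mul hs ht, ← volume_restrict_layer, heatKernel_eq hs, heatKernel_eq ht,
    heatKernel_eq hst] at e3
  simp only [e2, e3]

end semigroup

end

section

variable [Layer]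

/-- The heat equation `∂_r S(r)f = Δ S(r)f`, pointwise, with the derivatives on the kernel. -/
theorem hasDerivAt_heatOp_time {E : Type*} [NormedAddCommGroup E] [NormedSpace ℝ E]
    {f : ℝ³ → E} (hf : MemL f) {p : ℝ³} (hp : p ∈ Ω) {r : ℝ}
    (hr : 0 < r) : HasDerivAt (fun r => heatOp 0 1 0 r f p)
      ((∑ j : Fin 2, heatOp (0 + Pi.single j 2) 1 0 r f p) + heatOp 0 1 2 r f p) r := by
  have hr2 : r / 2 ≤ 2 * r := by linarith
  choose A a hA ha bA using fun j : Fin 2 =>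
    exists_planeDeriv_local_bound (0 + Pi.single j 2) (half_pos hr) hr2 0
  obtain ⟨B, b, hB, hb, bB⟩ := exists_planeDeriv_local_bound 0 (half_pos hr) hr2 0
  obtain ⟨M, hM, bM⟩ := exists_reflKernel_bound 1 0 (half_pos hr) hr2
  obtain ⟨N, hN, bN⟩ := exists_reflKernel_bound 1 2 (half_pos hr) hr2
  have adm : ∀ (α : Fin 2 → ℕ) (n : ℕ) {τ : ℝ}, 0 < τ →
      Integrable (fun q => (planeDeriv α τ (p.1 - q.1) *
        reflKernel 1 (gaussDeriv n τ) p.2 q.2) • f q) μΩ :=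
    fun α n τ hτ => (admissible_heat α (σ := 1) (by simp) n hτ).integrable hf hp
  set d : Plane → ℝ := fun y => (∑ j, A j * exp (-a j * ‖y‖ ^ 2)) * M + B * exp (-b * ‖y‖ ^ 2) * N
  have hd : Integrable d := ((integrable_finsetSum _ fun j _ =>
    (integrable_exp_neg_mul_sq_norm (ha j)).const_mul (A j)).mul_const M).add
    (((integrable_exp_neg_mul_sq_norm hb).const_mul B).mul_const N)
  have hd0 : ∀ y, 0 ≤ d y := fun y => add_nonneg (mul_nonneg (Finset.sum_nonneg fun j _ =>
    mul_nonneg (hA j) (Real.exp_nonneg _)) hM) (by positivity)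
  have h := (hasDerivAt_integral_of_dominated_loc_of_deriv_le (μ := μΩ) (s := Icc (r / 2) (2 * r))
    (F := fun r q => (planeDeriv 0 r (p.1 - q.1) * reflKernel 1 (gaussDeriv 0 r) p.2 q.2) • f q)
    (F' := fun r q => ((∑ j : Fin 2, planeDeriv (0 + Pi.single j 2) r (p.1 - q.1)) *
      reflKernel 1 (gaussDeriv 0 r) p.2 q.2 +
      planeDeriv 0 r (p.1 - q.1) * reflKernel 1 (gaussDeriv 2 r) p.2 q.2) • f q)
    (bound := fun q => d (p.1 - q.1) * ‖f q‖)
    (Icc_mem_nhds (by linarith) (by linarith)) ?_ (adm 0 0 hr) ?_ ?_ ?_ ?_).2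
  · refine h.congr_deriv ?_
    simp only [add_smul, Finset.sum_mul, Finset.sum_smul]
    rw [integral_add (integrable_finsetSum _ fun j _ => adm _ 0 hr) (adm 0 2 hr),
      integral_finsetSum _ fun j _ => adm _ 0 hr]
    rfl
  · filter_upwards [Ioi_mem_nhds hr] with r hr using (adm 0 0 hr).aestronglyMeasurable
  · simp only [add_smul, Finset.sum_mul, Finset.sum_smul]
    exact ((integrable_finsetSum _ fun j _ => adm _ 0 hr).add (adm 0 2 hr)).aestronglyMeasurable
  · filter_upwards [ae_restrict_mem measurableSet_layer] with q hq s hs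
    rw [norm_smul]
    gcongr
    have e : ∀ y : Plane, y + 0 = y := add_zero
    refine (norm_add_le _ _).trans (add_le_add ?_ ?_)
    · rw [norm_mul]
      refine mul_le_mul ((norm_sum_le _ _).trans (Finset.sum_le_sum fun j _ => ?_))
        (bM s hs _ (Ioo_subset_Icc_self hp.2) _ (Ioo_subset_Icc_self hq.2)) (norm_nonneg _)
        (Finset.sum_nonneg fun j _ => mul_nonneg (hA j) (Real.exp_nonneg _))
      have := bA j s hs 0 (by simp) (p.1 - q.1)
      rwa [e] at this
    · rw [norm_mul]
      refine mul_le_mul ?_ (bN s hs _ (Ioo_subset_Icc_self hp.2) _ (Ioo_subset_Icc_self hq.2))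
        (norm_nonneg _) (by positivity)
      have := bB s hs 0 (by simp) (p.1 - q.1)
      rwa [e] at this
  · have hdm : Measurable d := by fun_prop
    refine (hf.integrable_kernel_smul hdm hd p.1).norm.congr (Eventually.of_forall fun q => ?_)
    simp only [norm_smul, Real.norm_of_nonneg (hd0 _)]
  · refine Eventually.of_forall fun q s hs => ?_
    have hs0 : 0 < s := (half_pos hr).trans_le hs.1
    exact ((hasDerivAt_planeDeriv_time 0 hs0 _).mul
      (hasDerivAt_reflKernel_time 1 0 hs0 _ _)).smul_const (f q)

theorem reflKernel_right_end (n : ℕ) (t z : ℝ) : reflKernel (-1) (gaussDeriv n t) z z₀ = 0 ∧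
      reflKernel (-1) (gaussDeriv n t) z z₁ = 0 := by
  rw [reflKernel_eq_add, reflKernel_eq_add, neg_one_mul, neg_one_mul, ← sub_eq_add_neg,
    ← sub_eq_add_neg, sub_eq_zero, sub_eq_zero]
  constructor
  · exact tsum_congr fun k => by ring_nf
  · rw [← (Equiv.addRight (1 : ℤ)).tsum_eq fun k : ℤ =>
      gaussDeriv n t (z + z₁ - 2 * z₀ - 2 * k * (z₁ - z₀))]
    refine tsum_congr fun k => ?_
    simp only [Equiv.coe_addRight, Int.cast_add, Int.cast_one]
    ring_nf

variable {𝕜 : Type*} [RCLike 𝕜] {C μ d : ℝ} {a : ℝ³ → Vel 𝕜}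

/-- `S(τ) ∇·g`, with the derivatives on the kernel. -/
def heatDiv (τ : ℝ) (g : ℝ³ → Grad 𝕜) (p : ℝ³) : Vel 𝕜 :=
  (∑ j : Fin 2, heatOp (0 + Pi.single j 1) 1 0 τ (fun q => gradProj 𝕜 j.castSucc (g q)) p) +
    heatOp 0 (-1) 1 τ (fun q => gradProj 𝕜 2 (g q)) p

theorem exists_isSmoothingOp_heatDiv (𝕜 : Type*) [RCLike 𝕜] :
    ∃ C, IsSmoothingOp C (1 / 2) (heatDiv (𝕜 := 𝕜)) := by
  choose A hA using fun j : Fin 2 => exists_isSmoothingOp_heatOp (0 + Pi.single j 1) 0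
    (gradProj 𝕜 j.castSucc) (a := 1 / 2) (by rw [order_single]; norm_num)
  obtain ⟨B, hB⟩ := exists_isSmoothingOp_heatOp 0 1 (gradProj 𝕜 2) (a := 1 / 2) (by norm_num)
  exact ⟨_, (IsSmoothingOp.sum _ fun j _ => hA j (by simp)).add (hB (by simp))⟩

/-- `Δ S(r)f = S(r)∇·∇f`; no boundary terms appear, as `∂_ζ` of the Neumann kernel vanishes at the
walls. -/
theorem IsPreField.heatOp_laplacian {f : ℝ³ → Vel 𝕜} {g : ℝ³ → Grad 𝕜}
    (h : IsPreField f g) {r : ℝ} (hr : 0 < r) (p : ℝ³) :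
    (∑ j : Fin 2, heatOp (0 + Pi.single j 2) 1 0 r f p) + heatOp 0 1 2 r f p = heatDiv r g p := by
  have h2 : ∀ j : Fin 2, (0 + Pi.single j 2 : Fin 2 → ℕ) = 0 + Pi.single j 1 + Pi.single j 1 :=
    fun j => by rw [add_assoc, ← Pi.single_add]
  rw [heatDiv]
  congr 1
  · refine Finset.sum_congr rfl fun j _ => ?_
    have := (h.horizDeriv j).integral_kernel_smul h.mem (h.memLinf_grad _) h.sm (h.sm_grad _)
      ((c1Kernel_planeDeriv (0 + Pi.single j 1) hr).reflect p.1)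
      (continuous_reflKernel_right 1 0 hr p.2)
    simp only [neg_mul, neg_smul, integral_neg, neg_inj] at this
    rw [h2]
    exact this
  · have := (h.weak 2).integral_kernel_smul h.mem (h.memLinf_grad 2) h.sm (h.sm_grad 2)
      ((c1Kernel_planeDeriv 0 hr).reflect p.1)
      (fun ζ => hasDerivAt_reflKernel_right (-1) 1 hr p.2 ζ)
      (by rw [neg_neg]; exact (continuous_reflKernel_right 1 2 hr p.2).neg)
      (reflKernel_right_end 1 r p.2).1 (reflKernel_right_end 1 r p.2).2
    simp only [neg_neg, mul_neg, neg_smul, integral_neg, neg_inj] at this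
    exact this

/-- The increments of `S(·)a` are controlled by the gradient of `S(·)a`. -/
theorem normInfOne_heatOp_dilate_le (hC : KernelBounds 𝕜 C)
    {D : ℝ} (hD : IsSmoothingOp D (1 / 2) (heatDiv (𝕜 := 𝕜)))
    (ha : MemL a) (hd : DivFree a) {t : ℝ} (ht : 0 < t) {l : ℝ} (hl : 2 ≤ l) {M : ℝ} (hM : 0 ≤ M)
    (b : nrm (stokesGrad t a) ≤ ofReal M) :
    nrm (heatOp 0 1 0 (l * t) a - heatOp 0 1 0 (2 * t) a) ≤
      ofReal (l * D * M * t ^ (1 / 2 : ℝ)) := by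
  have hf := isField_stokes hC ha hd ht
  set f := heatOp 0 1 0 t a
  set g := stokesGrad t a
  have hD0 := hD.const_nonneg
  have hm := hD.measurable (τ := fun r : ℝ => r) (f := fun _ => g) measurable_id
    (hf.sm'.comp_measurable measurable_snd)
  have bd : ∀ r ∈ Ioc t ((l - 1) * t), nrm (heatDiv r g) ≤
      ofReal (D * M * t ^ (-(1 / 2) : ℝ)) := fun r hr => by
    have h1 := Real.rpow_le_rpow_of_nonpos ht hr.1.le (z := -(1 / 2)) (by norm_num)
    refine (hD.normInfOne_le (ht.trans hr.1) hf.mem').trans ((mul_le_mul_right b _).trans ?_)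
    rw [← ofReal_mul (mul_nonneg hD0 (rpow_nonneg (ht.trans hr.1).le _)), mul_right_comm]
    gcongr
  have hγ : ∀ᵐ r ∂(volume.restrict (Ioc t ((l - 1) * t))), nrm (heatDiv r g) ≤
      ofReal (D * M * t ^ (-(1 / 2) : ℝ)) :=
    (ae_restrict_mem measurableSet_Ioc).mono bd
  have hint : ∫⁻ _ in Ioc t ((l - 1) * t), ofReal (D * M * t ^ (-(1 / 2) : ℝ)) =
      ofReal ((l - 2) * D * M * t ^ (1 / 2 : ℝ)) := by
    rw [setLIntegral_const, Real.volume_Ioc, ← ofReal_mul (by positivity),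
      show (1 / 2 : ℝ) = -(1 / 2) + 1 by norm_num, rpow_add ht, Real.rpow_one]
    ring_nf
  have e : heatOp 0 1 0 (l * t) a - heatOp 0 1 0 (2 * t) a
      =ᵐ[μΩ] fun p => ∫ r in Ioc t ((l - 1) * t), heatDiv r g p := by
    filter_upwards [ae_restrict_mem measurableSet_layer, ae_integrable_param hm
      measurable_const hγ (hint ▸ ofReal_lt_top)] with p hp hi
    have h3 : t ≤ (l - 1) * t := le_mul_of_one_le_left ht.le (by linarith)
    rw [Pi.sub_apply, show l * t = (l - 1) * t + t by ring, show 2 * t = t + t by ring,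
      ← heatOp_heatOp (ht.trans_le h3) ht ha hp, ← heatOp_heatOp ht ht ha hp,
      ← intervalIntegral.integral_of_le h3]
    refine (intervalIntegral.integral_eq_sub_of_hasDerivAt
      (f := fun r => heatOp 0 1 0 r f p) (fun r hr => ?_)
      ((intervalIntegrable_iff_integrableOn_Ioc_of_le h3).2 hi)).symm
    rw [uIcc_of_le h3] at hr
    have hr0 := ht.trans_le hr.1
    exact (hasDerivAt_heatOp_time hf.mem hp hr0).congr_deriv
      (hf.toIsPreField.heatOp_laplacian hr0 p)
  rw [normInfOne_congr e]
  refine (normInfOne_integral_le hm measurable_const hγ).trans (hint.le.trans ?_)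
  gcongr
  linarith

end

section

variable [Layer] {t : ℝ}

/-! ### The initial value -/

theorem enorm_mul_heatKernelOne (ht : 0 < t) (y : ℝ) :
    ‖y‖ₑ * ofReal (heatKernelOne t y) = ofReal (2 * t) * ‖gaussDeriv 1 t y‖ₑ := by
  rw [← Real.enorm_of_nonneg (heatKernelOne_nonneg t y), ← Real.enorm_of_nonneg (r := 2 * t)
    (by positivity), ← enorm_mul, ← enorm_mul, gaussDeriv_one, ← enorm_neg]
  congr 1
  field_simp

theorem mul_rpow_neg_half (ht : 0 < t) (c : ℝ) : ofReal (2 * t) * ofReal (c * t ^ (-(1 / 2) : ℝ)) =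
      ofReal (2 * c * t ^ (1 / 2 : ℝ)) := by
  rw [← ofReal_mul (by positivity), show (1 / 2 : ℝ) = 1 + -(1 / 2) by norm_num,
    rpow_add ht, Real.rpow_one]
  ring_nf

/-- The first moment of the Neumann kernel. -/
theorem lintegral_neumann_moment (ht : 0 < t) {ζ : ℝ} (hζ : ζ ∈ Ioo z₀ z₁) :
    ∫⁻ z in Ioo z₀ z₁, ‖z - ζ‖ₑ * ‖reflKernel 1 (gaussDeriv 0 t) z ζ‖ₑ ≤
      ofReal (2 * gaussConst 1 * t ^ (1 / 2 : ℝ)) := by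
  set u : ℝ → ℝ≥0∞ := fun y => ‖y‖ₑ * ofReal (heatKernelOne t y)
  have hu : Measurable u := measurable_enorm.mul (measurable_heatKernelOne t).ennreal_ofReal
  have h1 := lintegral_unfold hu (φ := fun _ => 1) measurable_const (fun _ => rfl)
    (fun _ _ => rfl) ζ
  simp only [mul_one] at h1
  rw [lintegral_sub_left_eq_self u ζ] at h1
  -- the distance to each reflected image is at least the distance in the layer
  have h2 : ∀ z ∈ Ioo z₀ z₁, ∀ k : ℤ, |z - ζ| ≤ |ζ - z - 2 * k * (z₁ - z₀)| ∧
      |z - ζ| ≤ |ζ + z - 2 * z₀ - 2 * k * (z₁ - z₀)| := fun z hz' k => by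
    obtain ⟨a1, a2⟩ := hζ
    obtain ⟨b1, b2⟩ := hz'
    have h0 := sub_nonneg.2 (le_of_lt (hz : z₀ < z₁))
    rcases lt_trichotomy k 0 with hk | rfl | hk
    · have : (k : ℝ) ≤ -1 := by exact_mod_cast Int.le_sub_one_of_lt hk
      have : k * (z₁ - z₀) ≤ -1 * (z₁ - z₀) := by gcongr
      constructor <;> refine le_trans ?_ (le_abs_self _) <;>
        refine abs_le.2 ⟨by linarith, by linarith⟩
    · constructor
      · simp [abs_sub_comm]
      · refine le_trans ?_ (le_abs_self _)
        refine abs_le.2 ⟨?_, ?_⟩ <;> push_cast <;> linarith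
    · have : (1 : ℝ) ≤ k := by exact_mod_cast hk
      have : 1 * (z₁ - z₀) ≤ k * (z₁ - z₀) := by gcongr
      constructor <;> refine le_trans ?_ (neg_le_abs _) <;>
        refine abs_le.2 ⟨by linarith, by linarith⟩
  have h3 : ∫⁻ y, u y ≤ ofReal (2 * gaussConst 1 * t ^ (1 / 2 : ℝ)) := by
    simp only [u, enorm_mul_heatKernelOne ht]
    have hm : Measurable fun y => ‖gaussDeriv 1 t y‖ₑ :=
      ((measurable_gaussDeriv 1).comp measurable_prodMk_left).enorm
    rw [lintegral_const_mul _ hm, ← mul_rpow_neg_half ht]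
    gcongr
    refine (lintegral_gaussDeriv_le 1 ht).trans_eq ?_
    norm_num
  refine le_trans (setLIntegral_mono' measurableSet_Ioo fun z hz' => ?_) (h1.trans_le h3)
  rw [neumann_symm, enorm_neumann, ← ENNReal.tsum_mul_left]
  refine ENNReal.tsum_le_tsum fun k => ?_
  rw [mul_add]
  have h4 := h2 z hz' k
  simp only [u, Real.enorm_eq_ofReal_abs]
  exact add_le_add (mul_le_mul' (ofReal_le_ofReal h4.1) le_rfl)
    (mul_le_mul' (ofReal_le_ofReal h4.2) le_rfl)

/-- The first moment of the heat kernel of the plane. -/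
theorem lintegral_heatKernel_moment (ht : 0 < t) : ∫⁻ x : Plane, ‖x‖ₑ * ‖heatKernel t x‖ₑ ≤
      ofReal (2 * (∑ j : Fin 2, planeConst (Pi.single j 1)) * t ^ (1 / 2 : ℝ)) := by
  have h1 : ∀ x : Plane, ‖x‖ₑ * ‖heatKernel t x‖ₑ ≤
      ofReal (2 * t) * ∑ j : Fin 2, ‖planeDeriv (Pi.single j 1) t x‖ₑ := fun x => by
    have e : ∀ j : Fin 2, ‖x j‖ₑ * ‖heatKernel t x‖ₑ =
        ofReal (2 * t) * ‖planeDeriv (Pi.single j 1) t x‖ₑ := fun j => by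
      rw [← Real.enorm_of_nonneg (r := 2 * t) (by positivity), ← enorm_mul, ← enorm_mul,
        ← enorm_neg, heatKernel_eq_mul ht]
      congr 1
      fin_cases j <;> simp [planeDeriv, gaussDeriv_one, gaussDeriv_zero] <;> field_simp
    rw [Finset.mul_sum, ← Finset.sum_congr rfl fun j _ => e j, ← Finset.sum_mul]
    gcongr
    have : x = ∑ j : Fin 2, EuclideanSpace.single j (x j) := by ext i; fin_cases i <;> simp
    conv_lhs => rw [this]
    refine (enorm_sum_le _ _).trans (Finset.sum_le_sum fun j _ => ?_)
    simp [enorm_eq_nnnorm]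
  have hm : ∀ j : Fin 2, Measurable fun x => ‖planeDeriv (Pi.single j 1) t x‖ₑ := fun j =>
    ((measurable_planeDeriv _).comp measurable_prodMk_left).enorm
  refine (lintegral_mono h1).trans ?_
  rw [lintegral_const_mul _ (Finset.measurable_sum _ fun j _ => hm j),
    lintegral_finsetSum _ fun j _ => hm j, ← mul_rpow_neg_half ht, Finset.sum_mul,
    ENNReal.ofReal_sum_of_nonneg fun j _ => mul_nonneg (planeConst_nonneg _) (rpow_nonneg ht.le _)]
  gcongr with j
  refine (lintegral_planeDeriv_le _ ht).trans_eq ?_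
  rw [show (Pi.single j 1 : Fin 2 → ℕ) 0 + (Pi.single j 1 : Fin 2 → ℕ) 1 = 1 by fin_cases j <;> rfl]
  norm_num

variable {E : Type*} [NormedAddCommGroup E] [NormedSpace ℝ E] [CompleteSpace E]

/-- `‖∫ φ (S(t)a - a)‖` is controlled by the modulus of continuity of `φ`, averaged by the kernel. -/
theorem enorm_integral_heatOp_sub_le (ht : 0 < t) {a : ℝ³ → E}
    (ha : MemL a) {φ : ℝ³ → ℝ} (hφ : Continuous φ) (hc : HasCompactSupport φ) :
    ‖(∫ p in Ω, φ p • heatOp 0 1 0 t a p) - ∫ p in Ω, φ p • a p‖ₑ ≤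
      ∫⁻ q in Ω, (∫⁻ p in Ω, ‖φ p - φ q‖ₑ * (‖heatKernel t (p.1 - q.1)‖ₑ *
        ‖reflKernel 1 (gaussDeriv 0 t) p.2 q.2‖ₑ)) * ‖a q‖ₑ := by
  obtain ⟨W, hW, hb⟩ := exists_isWeight hφ hc
  have hA := admissible_heat 0 (σ := 1) (by simp) 0 ht
  obtain ⟨hi, h0⟩ := integral_smul_layerOp hA ha hφ.measurable hW hb
  rw [heatOp, h0]
  rw [← heatKernel_eq ht] at hi ⊢
  set N := reflKernel 1 (gaussDeriv 0 t)
  obtain ⟨B, hB⟩ := hc.exists_bound_of_continuous hφ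
  have hN : ∀ ζ, Integrable (fun z => N z ζ) (volume.restrict (Ioo z₀ z₁)) := fun ζ =>
    integrable_of_integral_eq_one (integral_neumann ht ζ)
  have hK : ∀ q : ℝ³, Integrable (fun p : ℝ³ => heatKernel t (p.1 - q.1) * N p.2 q.2)
      μΩ := fun q => by
    rw [volume_restrict_layer]
    exact ((integrable_heatKernel ht).comp_sub_right q.1).mul_prod (hN q.2)
  have hφK : ∀ q : ℝ³, Integrable (fun p : ℝ³ => φ p * (heatKernel t (p.1 - q.1) *
      N p.2 q.2)) μΩ := fun q =>
    (hK q).bdd_mul hφ.aestronglyMeasurable (Eventually.of_forall hB)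
  have h1 : ∀ q : ℝ³, ∫ p in Ω, heatKernel t (p.1 - q.1) * N p.2 q.2 = 1 := fun q => by
      rw [volume_restrict_layer, integral_prod_mul (fun y => heatKernel t (y - q.1))
        (fun z => N z q.2), integral_sub_right_eq_self (heatKernel t), integral_heatKernel ht,
        integral_neumann ht, one_mul]
  have e : ∀ q, (∫ p in Ω, φ p * (heatKernel t (p.1 - q.1) * N p.2 q.2)) - φ q =
      ∫ p in Ω, (φ p - φ q) * (heatKernel t (p.1 - q.1) * N p.2 q.2) := fun q => by
    simp only [sub_mul]
    rw [integral_sub (hφK q) ((hK q).const_mul _), integral_const_mul, h1, mul_one]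
  rw [← integral_sub hi (ha.integrable_test_smul hφ hc)]
  refine (enorm_integral_le_lintegral_enorm _).trans (lintegral_mono fun q => ?_)
  rw [← sub_smul, e, enorm_smul]
  gcongr
  refine (enorm_integral_le_lintegral_enorm _).trans (lintegral_mono fun p => ?_)
  rw [enorm_mul, enorm_mul]

end

section

variable [Layer]

theorem tendsto_ofReal_mul_rpow (c : ℝ) {θ : ℝ} (hθ : 0 < θ) :
    Tendsto (fun t : ℝ => ofReal (c * t ^ θ)) (𝓝[>] 0) (𝓝 0) := by
  have : Tendsto (fun t : ℝ => c * t ^ θ) (𝓝 0) (𝓝 (c * 0 ^ θ)) :=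
    ((Real.continuous_rpow_const hθ.le).const_mul c).tendsto 0
  rw [Real.zero_rpow hθ.ne', mul_zero] at this
  simpa using (ENNReal.tendsto_ofReal this).mono_left nhdsWithin_le_nhds

/-- `S(t)a → a` in the sense of distributions as `t ↓ 0`. -/
theorem tendsto_integral_heatOp {E : Type*} [NormedAddCommGroup E] [NormedSpace ℝ E]
    [CompleteSpace E] {a : ℝ³ → E} (ha : MemL a)
    {φ : ℝ³ → ℝ} (hφ : ContDiff ℝ (⊤ : ℕ∞) φ) (hc : HasCompactSupport φ) :
    Tendsto (fun t => ∫ p in Ω, φ p • heatOp 0 1 0 t a p) (𝓝[>] 0) (𝓝 (∫ p in Ω, φ p • a p)) := by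
  obtain ⟨L, hL⟩ := ContDiff.lipschitzWith_of_hasCompactSupport hc hφ (by simp)
  set B : Set Plane := Prod.fst '' tsupport φ
  have hB : IsCompact B := hc.isCompact.image continuous_fst
  set χ : Plane → ℝ≥0∞ := B.indicator 1
  have hχ : Measurable χ := measurable_one.indicator hB.measurableSet
  have hχ1 : ∀ x, χ x ≤ 1 := fun x => indicator_le_self' (fun _ _ => zero_le) x
  have hχi : ∫⁻ x, χ x = volume B := by simp only [χ, lintegral_indicator_one hB.measurableSet]
  have modulus : ∀ p q : ℝ³, ‖φ p - φ q‖ₑ ≤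
      L * (χ p.1 + χ q.1) * (‖p.1 - q.1‖ₑ + ‖p.2 - q.2‖ₑ) := fun p q => by
    have h0 : ∀ p : ℝ³, p.1 ∉ B → φ p = 0 := fun p hp =>
      image_eq_zero_of_notMem_tsupport fun h => hp (mem_image_of_mem _ h)
    have h1 : ‖φ p - φ q‖ₑ ≤ L * (‖p.1 - q.1‖ₑ + ‖p.2 - q.2‖ₑ) := by
      have := hL p q
      rw [edist_eq_enorm_sub] at this
      rw [Prod.edist_eq, edist_eq_enorm_sub, edist_eq_enorm_sub] at this
      exact this.trans (mul_le_mul_right (max_le le_self_add le_add_self) _)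
    by_cases hp : p.1 ∈ B ∨ q.1 ∈ B
    · refine h1.trans ?_
      rw [mul_assoc]
      refine mul_le_mul_right (le_mul_of_one_le_left' ?_) _
      rcases hp with hp | hp <;> simp [χ, hp]
    · rw [not_or] at hp
      simp [h0 p hp.1, h0 q hp.2]
  set c := 2 * (∑ j : Fin 2, planeConst (Pi.single j 1))
  set c' := 2 * gaussConst 1
  have key : ∀ t, 0 < t → ‖(∫ p in Ω, φ p • heatOp 0 1 0 t a p) -
      ∫ p in Ω, φ p • a p‖ₑ ≤ 2 * (L * volume B * nrm a) *
        (ofReal (c * t ^ (1 / 2 : ℝ)) + ofReal (c' * t ^ (1 / 2 : ℝ))) :=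
      fun t ht => by
    set m := ofReal (c' * t ^ (1 / 2 : ℝ))
    set N := reflKernel 1 (gaussDeriv 0 t)
    have hG : Measurable (heatKernel t) := by
      rw [heatKernel_eq ht]
      exact (measurable_planeDeriv 0).comp measurable_prodMk_left
    have hN : ∀ ζ, Measurable fun z => N z ζ := fun ζ =>
      (measurable_reflKernel 1 0).comp (measurable_const.prodMk
        (measurable_id.prodMk measurable_const))
    set κ : Plane → ℝ≥0∞ := fun y => ‖y‖ₑ * ‖heatKernel t y‖ₑ + m * ‖heatKernel t y‖ₑ
    have hκ : Measurable κ := (measurable_enorm.mul hG.enorm).add (hG.enorm.const_mul m)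
    have hκi : ∫⁻ y, κ y ≤ ofReal (c * t ^ (1 / 2 : ℝ)) + m := by
      simp only [κ]
      rw [lintegral_add_right _ (hG.enorm.const_mul m), lintegral_const_mul _ hG.enorm,
        lintegral_heatKernel ht, mul_one]
      exact add_le_add (lintegral_heatKernel_moment ht) le_rfl
    have hF : Measurable fun r : Plane × Plane => (χ r.2 + χ r.1) * κ (r.2 - r.1) := by fun_prop
    set W : Plane → ℝ≥0∞ := fun y => L * ∫⁻ x, (χ x + χ y) * κ (x - y)
    have hW : Measurable W := hF.lintegral_prod_right'.const_mul _
    have hWi : ∫⁻ y, W y = L * (2 * (volume B * ∫⁻ y, κ y)) := by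
      simp only [W]
      rw [lintegral_const_mul _ hF.lintegral_prod_right']
      congr 1
      have e : ∀ y, ∫⁻ x, (χ x + χ y) * κ (x - y) =
          (∫⁻ x, χ x * κ (x - y)) + χ y * ∫⁻ x, κ x := fun y => by
        simp only [add_mul]
        rw [lintegral_add_left, lintegral_const_mul, lintegral_sub_right_eq_self κ] <;> fun_prop
      have hF' : Measurable fun r : Plane × Plane => χ r.2 * κ (r.2 - r.1) := by fun_prop
      simp only [e]
      rw [lintegral_add_left hF'.lintegral_prod_right', lintegral_mul_const _ hχ, hχi,
        lintegral_lintegral_swap hF'.aemeasurable]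
      have e' : ∀ x, ∫⁻ y, χ x * κ (x - y) = χ x * ∫⁻ y, κ y := fun x => by
        rw [lintegral_const_mul, lintegral_sub_left_eq_self κ]
        fun_prop
      simp only [e', lintegral_mul_const _ hχ, hχi, two_mul]
    have hWt : ∀ y, W y ≠ ∞ := fun y => by
      refine ENNReal.mul_ne_top ENNReal.coe_ne_top (ne_top_of_le_ne_top (b := 2 * ∫⁻ x, κ x)
        (ENNReal.mul_ne_top (by simp) (hκi.trans_lt (by simp [m])).ne) ?_)
      rw [← lintegral_sub_right_eq_self κ y, ← lintegral_const_mul _ (by fun_prop)]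
      exact lintegral_mono fun x => mul_le_mul_left ((add_le_add (hχ1 x) (hχ1 y)).trans_eq one_add_one_eq_two) _
    have inner : ∀ q ∈ Ω, (∫⁻ p in Ω, ‖φ p - φ q‖ₑ *
        (‖heatKernel t (p.1 - q.1)‖ₑ * ‖N p.2 q.2‖ₑ)) ≤ W q.1 := fun q hq => by
      have hφm := hφ.continuous.measurable
      have hNm := hN q.2
      rw [lintegral_layer (Measurable.aemeasurable (by fun_prop))]
      simp only [W]
      rw [← lintegral_const_mul _ (by fun_prop)]
      refine lintegral_mono fun x => ?_
      have e : ∀ z, ‖φ (x, z) - φ q‖ₑ * (‖heatKernel t (x - q.1)‖ₑ * ‖N z q.2‖ₑ) ≤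
          L * (χ x + χ q.1) * ‖heatKernel t (x - q.1)‖ₑ *
            (‖x - q.1‖ₑ * ‖N z q.2‖ₑ + ‖z - q.2‖ₑ * ‖N z q.2‖ₑ) := fun z =>
        (mul_le_mul_left (modulus (x, z) q) _).trans_eq (by ring)
      refine (lintegral_mono e).trans ?_
      rw [lintegral_const_mul _ (by fun_prop), lintegral_add_left (by fun_prop), lintegral_const_mul _ (hN q.2).enorm, lintegral_neumann ht, mul_one]
      refine (mul_le_mul_right (add_le_add le_rfl (lintegral_neumann_moment ht hq.2)) _).trans_eq ?_
      simp only [κ, m, c']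
      ring
    refine (enorm_integral_heatOp_sub_le ht ha hφ.continuous hc).trans ?_
    refine (setLIntegral_mono' measurableSet_layer fun q hq =>
      mul_le_mul_left (inner q hq) _).trans ((lintegral_weight_le ha.1 hW hWt).trans ?_)
    rw [hWi]
    calc _ = 2 * (L * volume B * nrm a) * ∫⁻ y, κ y := by ring
      _ ≤ _ := mul_le_mul_right hκi _
  simp only [tendsto_iff_edist_tendsto_0, edist_eq_enorm_sub]
  have h0 := ENNReal.Tendsto.const_mul (a := 2 * (L * volume B * nrm a))
    ((tendsto_ofReal_mul_rpow c one_half_pos).add (tendsto_ofReal_mul_rpow c' one_half_pos)) (Or.inr (ENNReal.mul_ne_top (by simp) (ENNReal.mul_ne_top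
      (ENNReal.mul_ne_top ENNReal.coe_ne_top hB.measure_lt_top.ne) ha.2.ne)))
  rw [add_zero, mul_zero] at h0
  refine tendsto_of_tendsto_of_tendsto_of_le_of_le' tendsto_const_nhds h0
    (.of_forall fun _ => zero_le) (eventually_mem_nhdsWithin.mono key)

theorem MemLinf.ae_eq_of_integral_eq {E : Type*} [NormedAddCommGroup E] [NormedSpace ℝ E]
    [CompleteSpace E] {f g : ℝ³ → E} (hf : MemL f) (hg : MemL g)
    (h : ∀ φ : ℝ³ → ℝ, ContDiff ℝ (⊤ : ℕ∞) φ → HasCompactSupport φ →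
      ∫ p in Ω, φ p • f p = ∫ p in Ω, φ p • g p) :
    f =ᵐ[μΩ] g := by
  have key := isOpen_layer.ae_eq_zero_of_integral_contDiff_smul_eq_zero
    (f := f - g) (μ := volume) (hf.sub hg).locallyIntegrableOn fun φ h1 h2 h3 => ?_
  · rw [EventuallyEq, ae_restrict_iff' measurableSet_layer]
    filter_upwards [key] with p hp hpl using sub_eq_zero.1 (hp hpl)
  · rw [← setIntegral_eq_integral_of_forall_compl_eq_zero (s := Ω) fun p hp => by
      rw [image_eq_zero_of_notMem_tsupport fun hp' => hp (h3 hp'), zero_smul]]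
    simp only [Pi.sub_apply, smul_sub]
    rw [integral_sub (hf.integrable_test_smul h1.continuous h2)
      (hg.integrable_test_smul h1.continuous h2), h φ h1 h2, sub_self]

end

section

variable {𝕜 : Type*} [RCLike 𝕜] [Layer] {C T μ m d : ℝ} {X : Traj 𝕜} {a : ℝ³ → Vel 𝕜}

/-- Strong continuity at time zero, at a rate, when `‖∇S(t)a‖ ≤ m t^{-μ}`: the increments of
`S(·)a` along a geometric sequence of times are summable, so that `S(·)a` converges in the norm,
and the limit is the weak limit `a`. -/
theorem tendsto_heatOp_zero (hC : KernelBounds 𝕜 C) (hμ : μ < 1 / 2)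
    (ha : MemL a) (hd : DivFree a) (hm : 0 ≤ m)
    (b : SizeLe μ 1 m (linTraj a)) :
    Tendsto (fun t => nrm (heatOp 0 1 0 t a - a)) (𝓝[>] 0) (𝓝 0) := by
  obtain ⟨D, hD⟩ := exists_isSmoothingOp_heatDiv 𝕜
  have hD0 := hD.const_nonneg
  set θ := 1 / 2 - μ
  have hθ : 0 < θ := by simp only [θ]; linarith
  obtain ⟨k, hk⟩ := exists_nat_ge (1 / θ)
  -- the ratio of the times is chosen such that the increments halve in each step
  set ρ : ℝ := (2 ^ k)⁻¹
  have hρ0 : 0 < ρ := by positivity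
  have hρ1 : ρ ≤ 1 := inv_le_one_of_one_le₀ (one_le_pow₀ one_le_two)
  have hρ : ρ ^ θ ≤ 1 / 2 := by
    rw [div_le_iff₀ hθ] at hk
    rw [Real.inv_rpow (by positivity), ← Real.rpow_natCast, ← Real.rpow_mul zero_le_two, one_div]
    refine inv_anti₀ two_pos ?_
    simpa using Real.rpow_le_rpow_of_exponent_le one_le_two hk
  have key : ∀ t ∈ Ioc (0 : ℝ) 1, nrm (heatOp 0 1 0 (2 * t) a - a) ≤
      ofReal (2 * (2 * ρ⁻¹ * D * m) * t ^ θ) := fun t ht => by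
    set f : ℕ → ℝ³ → Vel 𝕜 := fun n => heatOp 0 1 0 (2 * (t * ρ ^ n)) a
    have pos : ∀ n, 0 < t * ρ ^ n := fun n => mul_pos ht.1 (pow_pos hρ0 n)
    have hf : ∀ n, StronglyMeasurable (f n) := fun n => hC.stokes.stronglyMeasurable ha.1 _
    have hfm : ∀ n, MemL (f n) := fun n => hC.stokes.memLinf (mul_pos two_pos (pos n)) ha
    set c := 2 * ρ⁻¹ * D * m * t ^ θ
    have hc : 0 ≤ c := mul_nonneg (by positivity) (rpow_nonneg ht.1.le _)
    have inc : ∀ n, nrm (f (n + 1) - f n) ≤ ofReal (c / 2 ^ n) := fun n => by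
      have p1 := pos (n + 1)
      have h1 : t * ρ ^ (n + 1) ≤ 1 := mul_le_one₀ ht.2 (by positivity) (pow_le_one₀ hρ0.le hρ1)
      have h := normInfOne_heatOp_dilate_le hC hD ha hd p1 (l := 2 * ρ⁻¹)
        (le_mul_of_one_le_right zero_le_two ((one_le_inv₀ hρ0).2 hρ1))
        (mul_nonneg hm (rpow_nonneg p1.le _)) (b _ ⟨p1, h1⟩).2
      rw [show 2 * ρ⁻¹ * (t * ρ ^ (n + 1)) = 2 * (t * ρ ^ n) by rw [pow_succ]; field_simp] at h
      rw [normInfOne_sub_comm]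
      refine h.trans (ofReal_le_ofReal ?_)
      have e : (t * ρ ^ (n + 1)) ^ (-μ) * (t * ρ ^ (n + 1)) ^ (1 / 2 : ℝ) =
          t ^ θ * (ρ ^ θ) ^ (n + 1) := by
        rw [← rpow_add p1, neg_add_eq_sub, Real.mul_rpow ht.1.le (by positivity),
          ← Real.rpow_natCast, ← Real.rpow_mul hρ0.le, mul_comm _ θ, Real.rpow_mul hρ0.le,
          Real.rpow_natCast]
      have h2 : (ρ ^ θ) ^ (n + 1) ≤ (2 ^ n)⁻¹ := by
        rw [← inv_pow, inv_eq_one_div]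
        exact (pow_le_pow_of_le_one (by positivity) (hρ.trans (by norm_num)) n.le_succ).trans
          (pow_le_pow_left₀ (by positivity) hρ n)
      calc _ = 2 * ρ⁻¹ * D * m * (t ^ θ * (ρ ^ θ) ^ (n + 1)) := by rw [← e]; ring
        _ ≤ 2 * ρ⁻¹ * D * m * (t ^ θ * (2 ^ n)⁻¹) := by
          have := rpow_nonneg ht.1.le θ
          gcongr
        _ = _ := by simp only [c]; ring
    obtain ⟨g, hg⟩ : ∃ g : ℝ³ → Vel 𝕜, ∀ p, g p = limUnder atTop fun n => f n p := ⟨_, fun _ => rfl⟩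
    have hgs : StronglyMeasurable g := by rw [funext hg]; exact StronglyMeasurable.limUnder hf
    have near := ae_tendsto_of_geometric hf hc inc hg
    have hgm : MemL g := by
      have : MemL (g - f 0) :=
        ⟨(hgs.sub (hf 0)).aestronglyMeasurable, (near 0).trans_lt ofReal_lt_top⟩
      simpa using this.add (hfm 0)
    have hlim : Tendsto (fun n => nrm (g - f n)) atTop (𝓝 0) :=
      tendsto_of_tendsto_of_tendsto_of_le_of_le tendsto_const_nhds
        (tendsto_ofReal_div_two_pow _) (fun _ => zero_le) near
    have htime : Tendsto (fun n : ℕ => 2 * (t * ρ ^ n)) atTop (𝓝[>] 0) := by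
      refine tendsto_nhdsWithin_iff.2 ⟨?_, Eventually.of_forall fun n => mul_pos two_pos (pos n)⟩
      have : ρ < 1 := by
        by_contra! h
        rw [le_antisymm hρ1 h, Real.one_rpow] at hρ
        norm_num at hρ
      simpa using ((tendsto_pow_atTop_nhds_zero_of_lt_one hρ0.le this).const_mul t).const_mul 2
    have hga : g =ᵐ[μΩ] a := hgm.ae_eq_of_integral_eq ha fun φ h1 h2 => tendsto_nhds_unique
        (tendsto_integral_smul hfm hgm hlim h1.continuous h2)
        ((tendsto_integral_heatOp ha h1 h2).comp htime)
    have h0 := near 0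
    rw [normInfOne_sub_comm, normInfOne_congr ((EventuallyEq.refl _ (f 0)).sub hga)] at h0
    simpa [f, c, mul_assoc] using h0
  refine tendsto_of_tendsto_of_tendsto_of_le_of_le' tendsto_const_nhds
    (tendsto_ofReal_mul_rpow (2 * (2 * ρ⁻¹ * D * m) * (1 / 2) ^ θ) hθ)
    (Eventually.of_forall fun _ => zero_le) ?_
  filter_upwards [Ioc_mem_nhdsGT one_pos] with t ht
  have := key (1 / 2 * t) ⟨mul_pos (by norm_num) ht.1, by linarith [ht.2]⟩
  rwa [Real.mul_rpow (by norm_num) ht.1.le, ← mul_assoc, ← mul_assoc,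
    mul_one_div_cancel two_ne_zero, one_mul] at this

end

section

variable {𝕜 : Type*} [RCLike 𝕜] [Layer] {C T μ m d : ℝ} {X : Traj 𝕜} {a : ℝ³ → Vel 𝕜}

theorem IsTraj.memLinfSigma (hX : IsTraj T X) {t : ℝ} (ht : t ∈ Ioc 0 T) :
    MemLinfSigma z₀ z₁ (X.1 t) :=
  memLinfSigma_iff.2 ⟨(hX.field t ht).mem, (hX.field t ht).divFree⟩

theorem IsTraj.tendsto_zero (hC : KernelBounds 𝕜 C) (hμ₀ : 0 ≤ μ)
    (hμ : μ < 1 / 2) (hX : IsTraj T X) (hT0 : 0 < T) (hT : T ≤ 1) (hd : 0 ≤ d)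
    (bX : SizeLe μ T d X) (ha : MemL a) (hdiv : DivFree a) (hm : 0 ≤ m)
    (b : SizeLe μ 1 m (linTraj a))
    (e : ∀ t ∈ Ioc 0 T, X.1 t =ᵐ[μΩ] (linTraj a).1 t - (PrimEq.duh X).1 t) :
    Tendsto (fun t => nrm (X.1 t - a)) (𝓝[>] 0) (𝓝 0) := by
  have h0 := (tendsto_heatOp_zero hC hμ ha hdiv hm b).add (tendsto_ofReal_mul_rpow
    (intConst C * (d * d) * betaConst (1 / 2) μ) (show 0 < 1 / 2 - μ by linarith))
  rw [add_zero] at h0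
  refine tendsto_of_tendsto_of_tendsto_of_le_of_le' tendsto_const_nhds h0
    (.of_forall fun _ => zero_le) ?_
  filter_upwards [Ioc_mem_nhdsGT hT0] with t ht
  have E :=
    ((e t ht).sub (EventuallyEq.refl _ a)).trans (.of_forall fun p =>
      sub_right_comm _ _ _)
  rw [normInfOne_congr E]
  exact (normInfOne_sub_le ((hC.stokes.memLinf ht.1 ha).sub ha).1).trans (add_le_add le_rfl
    (normInfOne_integral_le_of_power (hX.meas.duhInt hC t).1 ht.1 (mul_nonneg hC.intConst_nonneg
    (mul_self_nonneg d)) hμ₀ (by linarith) fun s hs => (duhInt_le hC hX hT hμ₀ hd bX ht hs).1))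

theorem IsTraj.tendsto_of_pos (hC : KernelBounds 𝕜 C) (hμ₀ : 0 ≤ μ)
    (hμ : μ < 1 / 2) (hX : IsTraj T X) (hT : T ≤ 1) (hd : 0 ≤ d) (bX : SizeLe μ T d X)
    (ha : MemL a) (e : ∀ t ∈ Ioc 0 T, X.1 t =ᵐ[μΩ]
      (linTraj a).1 t - (PrimEq.duh X).1 t) {t : ℝ} (ht : t ∈ Ioc 0 T) :
    Tendsto (fun s => nrm (X.1 s - X.1 t)) (𝓝[Icc 0 T] t) (𝓝 0) := by
  obtain ⟨K, hK⟩ := hX.exists_time_le hC hμ₀ hμ hT hd bX ha e (half_pos ht.1)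
  have h0 : Tendsto (fun s => ofReal (K * |s - t| ^ (1 / 4 : ℝ))) (𝓝 t) (𝓝 0) := by
    have : Continuous fun s => K * |s - t| ^ (1 / 4 : ℝ) :=
      ((continuous_id.sub continuous_const).abs.rpow_const fun _ => Or.inr (by norm_num)).const_mul
        K
    simpa using ENNReal.tendsto_ofReal (this.tendsto t)
  refine tendsto_of_tendsto_of_tendsto_of_le_of_le' tendsto_const_nhds
    (h0.mono_left nhdsWithin_le_nhds) (.of_forall fun _ => zero_le) ?_
  filter_upwards [self_mem_nhdsWithin, mem_nhdsWithin_of_mem_nhds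
    (Ioi_mem_nhds (half_lt_self ht.1))] with s hs hs'
  rcases le_total s t with h | h
  · rw [normInfOne_sub_comm, abs_sub_comm, abs_of_nonneg (sub_nonneg.2 h)]
    exact hK s t (le_of_lt hs') h ht.2
  · rw [abs_of_nonneg (sub_nonneg.2 h)]
    exact hK t s (half_le_self ht.1.le) h hs.2

/-- A field that is continuous in time on a compact interval is bounded there. -/
theorem exists_normInfOne_le {v : ℝ → ℝ³ → Vel 𝕜} (h : ∀ t ∈ Icc 0 T, MemL (v t))
    (hc : ∀ t ∈ Icc 0 T, Tendsto (fun s => nrm (v s - v t)) (𝓝[Icc 0 T] t) (𝓝 0)) :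
    ∃ K : ℝ≥0, ∀ t ∈ Icc 0 T, nrm (v t) ≤ K := by
  refine isCompact_Icc.induction_on
    ⟨0, by simp⟩ (fun S S' hS ⟨K, hK⟩ => ⟨K, fun t ht => hK t (hS ht)⟩) ?_ fun t ht => ?_
  · rintro S S' ⟨K, hK⟩ ⟨K', hK'⟩
    exact ⟨max K K', fun t ht => ht.elim (fun h => (hK t h).trans (by simp))
      fun h => (hK' t h).trans (by simp)⟩
  · refine ⟨_, inter_mem self_mem_nhdsWithin ((hc t ht).eventually (gt_mem_nhds one_pos)),
      (nrm (v t)).toNNReal + 1, fun s hs => ?_⟩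
    rw [ENNReal.coe_add, ENNReal.coe_toNNReal (h t ht).2.ne, ENNReal.coe_one, add_comm]
    calc _ = nrm ((v s - v t) + v t) := by rw [sub_add_cancel]
      _ ≤ _ := (normInfOne_add_le ((h s hs.1).sub (h t ht)).1).trans
        (add_le_add (le_of_lt hs.2) le_rfl)

end

end PrimEq

end

theorem proposition2p2 {𝕜 : Type*} [RCLike 𝕜] (h : ℝ) (hh : 0 < h)
    (μ : ℝ) (hμ₀ : 0 ≤ μ) (hμ : μ < 1 / 2) :
    ∃ c : ℝ, 0 < c ∧
      ∀ (z₀ : ℝ) (a : PrimEq.Plane × ℝ → PrimEq.Vel 𝕜),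
        PrimEq.seminormMu z₀ (z₀ + h) μ a < ⊤ →
        (PrimEq.MemBUCSigma z₀ (z₀ + h) a →
          ∃ T : ℝ, 0 < T ∧
            1 / T ≤ max (c * (PrimEq.tripleNorm z₀ (z₀ + h) μ a).toReal) 1 ^ (2 / (1 / 2 - μ)) ∧
            ∃ v : ℝ → PrimEq.Plane × ℝ → PrimEq.Vel 𝕜,
              PrimEq.IsMildSolutionBUC z₀ (z₀ + h) a T v ∧
              ∀ (T' : ℝ) (v' : ℝ → PrimEq.Plane × ℝ → PrimEq.Vel 𝕜), 0 < T' →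
                PrimEq.IsMildSolutionBUC z₀ (z₀ + h) a T' v' →
                ∀ t ∈ Set.Icc 0 (min T T'),
                  v' t =ᵐ[MeasureTheory.volume.restrict (PrimEq.layer z₀ (z₀ + h))] v t) ∧
        (PrimEq.MemLinfSigma z₀ (z₀ + h) a →
          ∃ T : ℝ, 0 < T ∧
            1 / T ≤ max (c * (PrimEq.tripleNorm z₀ (z₀ + h) μ a).toReal) 1 ^ (2 / (1 / 2 - μ)) ∧
            ∃ v : ℝ → PrimEq.Plane × ℝ → PrimEq.Vel 𝕜,
              PrimEq.IsMildSolutionLinf z₀ (z₀ + h) a T v ∧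
              ∀ (T' : ℝ) (v' : ℝ → PrimEq.Plane × ℝ → PrimEq.Vel 𝕜), 0 < T' →
                PrimEq.IsMildSolutionLinf z₀ (z₀ + h) a T' v' →
                ∀ t ∈ Set.Ioo 0 (min T T'),
                  v' t =ᵐ[MeasureTheory.volume.restrict (PrimEq.layer z₀ (z₀ + h))] v t) := by
  open PrimEq MeasureTheory Set Filter Topology in
  obtain ⟨C, hC1, hC⟩ := exists_kernelBounds 𝕜
  let J₀ : Layer := ⟨0, h, hh⟩
  have hD : 0 ≤ duhConst C μ := mul_nonneg (hC J₀).intConst_nonneg (add_nonneg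
    (betaConst_nonneg (by norm_num) (by linarith)) (betaConst_nonneg (by norm_num) (by linarith)))
  refine ⟨4 * @duhConst J₀ C μ * C + 1, by positivity, fun z₀ a hs => ?_⟩
  let J : Layer := ⟨z₀, z₀ + h, by linarith⟩
  have hc : @duhConst J₀ C μ = @duhConst J C μ := by
    have e : @Layer.z₁ J₀ - @Layer.z₀ J₀ = @Layer.z₁ J - @Layer.z₀ J := by
      change h - 0 = z₀ + h - z₀; ring
    simp only [duhConst, intConst, sobConst, e]
  clear_value J₀
  rw [hc]
  have hC : @KernelBounds J 𝕜 _ C := hC J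
  constructor
  · rintro ⟨haB, haσ⟩
    have hdiv := (memLinfSigma_iff.1 haσ).2
    obtain ⟨T, hT0, hT1, hTb, X, d, hd, hX, bX, eqn⟩ :=
      exists_solution hC hC1 hμ₀ hμ haσ.1 hdiv hs
    set v : ℝ → Plane × ℝ → Vel 𝕜 := fun t => if t ≤ 0 then a else X.1 t
    have hv : ∀ t, 0 < t → v t = X.1 t := fun t ht => if_neg ht.not_ge
    have hv0 : v 0 = a := if_pos le_rfl
    have hmem : ∀ t ∈ Icc 0 T, MemBUCSigma z₀ (z₀ + h) (v t) := fun t ht => by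
      rcases ht.1.eq_or_lt with rfl | h0
      · rw [hv0]; exact ⟨haB, haσ⟩
      · rw [hv t h0]
        exact ⟨hX.memBUC hC hμ₀ hμ hT1 hd bX haσ.1 ⟨h0, ht.2⟩ (eqn t ⟨h0, ht.2⟩),
          hX.memLinfSigma ⟨h0, ht.2⟩⟩
    have hcont : ∀ t ∈ Icc 0 T,
        Tendsto (fun s => normInfOne z₀ (z₀ + h) (v s - v t)) (𝓝[Icc 0 T] t) (𝓝 0) := fun t ht => by
      rcases ht.1.eq_or_lt with rfl | h0
      · rw [hv0, ← Ioc_insert_left hT0.le, nhdsWithin_insert, tendsto_sup]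
        refine ⟨tendsto_pure_left.2 fun S hS => ?_, ?_⟩
        · have e : normInfOne z₀ (z₀ + h) (0 : ℝ³ → Vel 𝕜) = 0 := normInfOne_zero
          rw [hv0, sub_self, e]
          exact mem_of_mem_nhds hS
        · refine ((hX.tendsto_zero hC hμ₀ hμ hT0 hT1 hd bX haσ.1 hdiv (by positivity)
            (sizeLe_linTraj hC hC1 haσ.1 hdiv hs le_rfl) eqn).mono_left
            (nhdsWithin_mono _ Ioc_subset_Ioi_self)).congr' ?_
          filter_upwards [self_mem_nhdsWithin] with s hs
          rw [hv s hs.1]; rfl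
      · rw [hv t h0]
        refine (hX.tendsto_of_pos hC hμ₀ hμ hT1 hd bX haσ.1 eqn ⟨h0, ht.2⟩).congr' ?_
        filter_upwards [mem_nhdsWithin_of_mem_nhds (Ioi_mem_nhds h0)] with s hs
        rw [hv s hs]; rfl
    have hmild : IsMildOn z₀ (z₀ + h) a (Ioc 0 T) v :=
      isMildOn_of_traj hC hμ₀ hμ hT0 hT1 hd hX bX (fun t ht => hv t ht.1) eqn
    refine ⟨T, hT0, hTb, v, ⟨hmem, hcont, by rw [hv0], hmild⟩, fun T' v' hT' h' t ht => ?_⟩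
    rcases ht.1.eq_or_lt with rfl | h0
    · rw [hv0]; exact h'.2.2.1
    · obtain ⟨K, hK⟩ := exists_normInfOne_le (fun t ht => (hmem t ht).2.1) hcont
      obtain ⟨K', hK'⟩ := exists_normInfOne_le (fun t ht => (h'.1 t ht).2.1) h'.2.1
      have i : ∀ s ∈ Ioc 0 t, s ∈ Icc 0 T := fun s hs =>
        ⟨hs.1.le, hs.2.trans (ht.2.trans (min_le_left _ _))⟩
      have i' : ∀ s ∈ Ioc 0 t, s ∈ Icc 0 T' := fun s hs =>
        ⟨hs.1.le, hs.2.trans (ht.2.trans (min_le_right _ _))⟩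
      exact (IsMildOn.ae_eq hC haσ h0 ((ht.2.trans (min_le_left _ _)).trans hT1)
        (hmild.mono fun s hs => ⟨hs.1, (i s hs).2⟩) (fun s hs => (hmem s (i s hs)).2)
        (fun s hs => hK s (i s hs)) (h'.2.2.2.mono fun s hs => ⟨hs.1, (i' s hs).2⟩)
        (fun s hs => (h'.1 s (i' s hs)).2) fun s hs => hK' s (i' s hs)).symm
  · intro haσ
    obtain ⟨T, hT0, hT1, hTb, X, d, hd, hX, bX, eqn⟩ :=
      exists_solution hC hC1 hμ₀ hμ haσ.1 (memLinfSigma_iff.1 haσ).2 hs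
    have hmild : IsMildOn z₀ (z₀ + h) a (Ioc 0 T) X.1 :=
      isMildOn_of_traj hC hμ₀ hμ hT0 hT1 hd hX bX (fun _ _ => rfl) eqn
    refine ⟨T, hT0, hTb, X.1, ⟨fun t ht => hX.memLinfSigma ⟨ht.1, ht.2.le⟩, ⟨d.toNNReal,
      fun t ht => (bX t ⟨ht.1, ht.2.le⟩).1⟩, hmild.mono Ioo_subset_Ioc_self⟩,
      fun T' v' hT' ⟨h1, ⟨K', hK'⟩, h2⟩ t ht => ?_⟩
    have i : ∀ s ∈ Ioc 0 t, s ∈ Ioc 0 T := fun s hs =>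
      ⟨hs.1, hs.2.trans (ht.2.le.trans (min_le_left _ _))⟩
    have i' : ∀ s ∈ Ioc 0 t, s ∈ Ioo 0 T' := fun s hs =>
      ⟨hs.1, hs.2.trans_lt (ht.2.trans_le (min_le_right _ _))⟩
    exact (IsMildOn.ae_eq hC haσ ht.1 ((i t ⟨ht.1, le_rfl⟩).2.trans hT1) (hmild.mono i)
      (fun s hs => hX.memLinfSigma (i s hs)) (K := d.toNNReal) (fun s hs => (bX s (i s hs)).1)
      (h2.mono i') (fun s hs => h1 s (i' s hs)) fun s hs => hK' s (i' s hs)).symm
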